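/- Conventions. Manifolds are smooth, finite-dimensional, Hausdorff, second countable and without boundary. A Lie groupoid $\mathscr{G}\rightrightarrows P$ has source $\alpha$ and target $\beta$, both surjective submersions, identities $m\mapsto 1_m$, and a smooth multiplication $(h,g)\mapsto hg$ defined for $\alpha(h)=\beta(g)$. A Poisson structure $\pi$ has anchor $\pi^\#\colon T^*\mathscr{G}\to T\mathscr{G}$ determined by $\langle df_2,\pi^\#(df_1)\rangle=\{f_1,f_2\}$. A closed submanifold $C$ of a Poisson manifold is coisotropic if $\pi^\#$ maps the annihilator $(TC)^\circ$ into $TC$. The tangent groupoid $T\mathscr{G}\rightrightarrows TP$ is obtained by applying the tangent functor to $\mathscr{G}\rightrightarrows P$; its multiplication is written $\eta\bullet\xi$. The Lie algebroid of $\mathscr{G}$ has fibres $A_m\mathscr{G}=\ker(T_{1_m}\alpha)$ and anchor $a=T(\beta)|_{A\mathscr{G}}$. The cotangent groupoid $T^*\mathscr{G}\rightrightarrows A^*\mathscr{G}$ has target and source, for $\Phi\in T_g^*\mathscr{G}$, $$\langle\widetilde\beta(\Phi),Y\rangle=\langle\Phi,T(R_g)(Y)\rangle,\qquad \langle\widetilde\alpha(\Phi),X\rangle=\langle\Phi,T(L_g)(X-T(1)(aX))\rangle\qquad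 (Y\in A_{\beta g}\mathscr{G},\ X\in A_{\alpha g}\mathscr{G}),$$ identities $\langle\widetilde 1_\phi,T(1)(x)+X\rangle=\langle\phi,X\rangle$ for $\phi\in A_m^*\mathscr{G}$, $x\in T_mP$, $X\in A_m\mathscr{G}$, multiplication $\langle\Psi\bullet\Phi,\eta\bullet\xi\rangle=\langle\Psi,\eta\rangle+\langle\Phi,\xi\rangle$, and inverses $\langle\Phi^{-1},\xi^{-1}\rangle=-\langle\Phi,\xi\rangle$. Theorem. Let $\mathscr{G}\rightrightarrows P$ be a Poisson groupoid, that is, a Lie groupoid with a Poisson structure $\pi$ on $\mathscr{G}$ such that the graph of multiplication $\{(hg,h,g)\mid\alpha(h)=\beta(g)\}$ is coisotropic in $\overline{\mathscr{G}}\times\mathscr{G}\times\mathscr{G}$, where $\overline{\mathscr{G}}$ carries the opposite Poisson structure. Then: (i) The Poisson anchor $\pi^\#\colon T^*\mathscr{G}\to T\mathscr{G}$ is a morphism of Lie groupoids from $T^*\mathscr{G}\rightrightarrows A^*\mathscr{G}$ to $T\mathscr{G}\rightrightarrows TP$, over a base map $a_*\colon A^*\mathscr{G}\to TP$. (ii)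 The submanifold $1_P=\{1_m\mid m\in P\}$ is coisotropic in $\mathscr{G}$. (iii) The Lie algebroid structure on $T^*\mathscr{G}$, with anchor $\pi^\#$ and bracket $[\Phi,\Psi]=\mathfrak{L}_{\pi^\#\Phi}\Psi-\mathfrak{L}_{\pi^\#\Psi}\Phi-d(\pi(\Phi,\Psi))$ of 1-forms, where $\pi(\Phi,\Psi)=\langle\Psi,\pi^\#\Phi\rangle$, induces a Lie algebroid structure on the dual bundle $A^*\mathscr{G}$ with anchor $a_*$: there is a unique Lie algebroid structure on $A^*\mathscr{G}$ with anchor $a_*$ such that, for all smooth sections $\phi,\psi$ of $A^*\mathscr{G}$ and all 1-forms $\Phi,\Psi$ on $\mathscr{G}$ with $\Phi(1_m)=\widetilde 1_{\phi(m)}$ and $\Psi(1_m)=\widetilde 1_{\psi(m)}$ for all $m\in P$, one has $[\Phi,\Psi](1_m)=\widetilde 1_{[\phi,\psi](m)}$ for all $m\in P$. (iv) Inversion $g\mapsto g^{-1}$ is an anti-Poisson map $\mathscr{G}\to\mathscr{G}$. (v) There is a unique Poisson structure on $P$ for which $\beta\colon\mathscr{G}\to P$ is a Poisson map. -/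

import Mathlib

open Set Filter Topology
open Bundle (TotalSpace Pretrivialization)
open scoped Manifold ContDiff

set_option linter.unusedSectionVars false

noncomputable section

namespace PoissonGeometry

section Poisson

variable {E : Type*} [NormedAddCommGroup E] [NormedSpace ℝ E]
  {H : Type*} [TopologicalSpace H] (I : ModelWithCorners ℝ E H)
  {M : Type*} [TopologicalSpace M] [ChartedSpace H M]
  {E' : Type*} [NormedAddCommGroup E'] [NormedSpace ℝ E']
  {H' : Type*} [TopologicalSpace H'] (I' : ModelWithCorners ℝ E' H')
  {M' : Type*} [TopologicalSpace M'] [ChartedSpace H' M']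

/-- The cotangent space `T*_x M`. -/
abbrev CotangentSpace (x : M) : Type _ := TangentSpace I x →L[ℝ] ℝ

/-- The cotangent bundle `T*M`, a smooth vector bundle (the bundle of homomorphisms from `TM` to the
trivial line bundle), hence a manifold modelled on `I.prod 𝓘(ℝ, E →L[ℝ] ℝ)`. -/
abbrev CotangentBundle (M : Type*) [TopologicalSpace M] [ChartedSpace H M] : Type _ :=
  TotalSpace (E →L[ℝ] ℝ) (fun x : M => CotangentSpace I x)

/-- Smooth vector fields on `M`. -/
abbrev VectorFields (M : Type*) [TopologicalSpace M] [ChartedSpace H M] [IsManifold I ∞ M] :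
    Type _ :=
  Cₛ^∞⟮I; E, fun x : M => TangentSpace I x⟯

/-- Smooth 1-forms on `M`. -/
abbrev OneForms (M : Type*) [TopologicalSpace M] [ChartedSpace H M] [IsManifold I ∞ M] : Type _ :=
  Cₛ^∞⟮I; E →L[ℝ] ℝ, fun x : M => CotangentSpace I x⟯

variable {I} in
/-- Transport of tangent vectors along an equality of base points. -/
def tcast {x y : M} (h : x = y) : TangentSpace I x →L[ℝ] TangentSpace I y :=
  h ▸ ContinuousLinearMap.id ℝ (TangentSpace I x)

/-- A Poisson structure: a Lie bracket on the smooth functions that is a derivation in each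
argument. -/
@[ext] structure PoissonStructure (M : Type*) [TopologicalSpace M] [ChartedSpace H M] where
  bracket : C^∞⟮I, M; 𝓘(ℝ), ℝ⟯ →ₗ[ℝ] C^∞⟮I, M; 𝓘(ℝ), ℝ⟯ →ₗ[ℝ] C^∞⟮I, M; 𝓘(ℝ), ℝ⟯
  bracket_self : ∀ f, bracket f f = 0
  jacobi : ∀ f g h,
    bracket f (bracket g h) + bracket g (bracket h f) + bracket h (bracket f g) = 0
  leibniz : ∀ f g h, bracket f (g * h) = g * bracket f h + bracket f g * h

variable {I I'}

/-- The Poisson anchor `π^# : T*_x M → T_x M`. The Poisson tensor is `π(df₁, df₂) = {f₁, f₂}` and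
`⟨φ, π^# ψ⟩ = π(ψ, φ)`; thus `π^# ψ` is the tangent vector with `⟨df₂, π^# ψ⟩ = {f₁, f₂}(x)` whenever
`df₁ = ψ` at `x`. -/
def PoissonStructure.sharp (π : PoissonStructure I M) (x : M) (ψ : CotangentSpace I x) :
    TangentSpace I x :=
  Classical.epsilon fun v : TangentSpace I x =>
    ∀ f₁ f₂ : C^∞⟮I, M; 𝓘(ℝ), ℝ⟯, mvfderiv I f₁ x = ψ → mvfderiv I f₂ x v = π.bracket f₁ f₂ x

/-- The Poisson anchor as a map `T*M → TM`. -/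
def PoissonStructure.anchor (π : PoissonStructure I M) (Φ : CotangentBundle I M) :
    TangentBundle I M :=
  ⟨Φ.1, π.sharp Φ.1 Φ.2⟩

/-- A Poisson map: a smooth map `μ` with `{f₁ ∘ μ, f₂ ∘ μ} = {f₁, f₂} ∘ μ`. -/
def IsPoissonMap (π : PoissonStructure I M) (π' : PoissonStructure I' M') (μ : M → M') : Prop :=
  ∃ h : ContMDiff I I' ∞ μ, ∀ f₁ f₂ : C^∞⟮I', M'; 𝓘(ℝ), ℝ⟯,
    π.bracket (f₁.comp ⟨μ, h⟩) (f₂.comp ⟨μ, h⟩) = (π'.bracket f₁ f₂).comp ⟨μ, h⟩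

/-- An anti-Poisson map: a smooth map `μ` with `{f₁ ∘ μ, f₂ ∘ μ} = -{f₁, f₂} ∘ μ`. -/
def IsAntiPoissonMap (π : PoissonStructure I M) (π' : PoissonStructure I' M') (μ : M → M') :
    Prop :=
  ∃ h : ContMDiff I I' ∞ μ, ∀ f₁ f₂ : C^∞⟮I', M'; 𝓘(ℝ), ℝ⟯,
    π.bracket (f₁.comp ⟨μ, h⟩) (f₂.comp ⟨μ, h⟩) = -(π'.bracket f₁ f₂).comp ⟨μ, h⟩

variable (I)

/-- `C` is a closed (embedded) submanifold: it is closed, and near each of its points it is the zero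
set of a smooth map to some `ℝ^k` whose derivative at that point is onto. -/
def IsClosedSubmanifold (C : Set M) : Prop :=
  IsClosed C ∧ ∀ x ∈ C, ∃ (k : ℕ) (U : Set M) (f : M → EuclideanSpace ℝ (Fin k)),
    IsOpen U ∧ x ∈ U ∧ ContMDiffOn I 𝓘(ℝ, EuclideanSpace ℝ (Fin k)) ∞ f U ∧
      Function.Surjective (mvfderiv I f x) ∧ C ∩ U = {y ∈ U | f y = 0}

/-- `TC` as a subset of `TM`: the velocities at time `0` of smooth curves lying in `C`. -/
def tangentSet (C : Set M) : Set (TangentBundle I M) :=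
  {V | ∃ γ : ℝ → M, ContMDiffAt 𝓘(ℝ) I ∞ γ 0 ∧ (∀ᶠ t in 𝓝 0, γ t ∈ C) ∧
    V = ⟨γ 0, mfderiv 𝓘(ℝ) I γ 0 (1 : ℝ)⟩}

/-- The annihilator `(TC)°` of `TC` in `T*M`. -/
def annihilator (C : Set M) : Set (CotangentBundle I M) :=
  {Φ | Φ.1 ∈ C ∧ ∀ v : TangentSpace I Φ.1,
    (⟨Φ.1, v⟩ : TangentBundle I M) ∈ tangentSet I C → Φ.2 v = 0}

/-- `C` is coisotropic for the Poisson structure with anchor `s`: it is a closed submanifold, and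
the anchor maps `(TC)°` into `TC`. -/
def IsCoisotropic (s : ∀ x : M, CotangentSpace I x → TangentSpace I x) (C : Set M) : Prop :=
  IsClosedSubmanifold I C ∧
    ∀ Φ ∈ annihilator I C, (⟨Φ.1, s Φ.1 Φ.2⟩ : TangentBundle I M) ∈ tangentSet I C

variable {I}

/-- The anchor of a product of Poisson manifolds with anchors `s` and `s'`:
`(φ, φ') ↦ (s φ, s' φ')`. -/
def prodAnchor (s : ∀ x : M, CotangentSpace I x → TangentSpace I x)
    (s' : ∀ x : M', CotangentSpace I' x → TangentSpace I' x) (x : M × M')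
    (φ : CotangentSpace (I.prod I') x) : TangentSpace (I.prod I') x :=
  (s x.1 (φ ∘L ContinuousLinearMap.inl ℝ E E'), s' x.2 (φ ∘L ContinuousLinearMap.inr ℝ E E'))

/-- The Lie derivative of a 1-form along a vector field, characterized by
`⟨L_X ψ, Y⟩ = X⟨ψ, Y⟩ - ⟨ψ, [X, Y]⟩` for all vector fields `Y`. -/
def lieDerivOneForm [IsManifold I ∞ M] (X : ∀ x : M, TangentSpace I x)
    (ψ : ∀ x : M, CotangentSpace I x) (x : M) : CotangentSpace I x :=
  Classical.epsilon fun θ : CotangentSpace I x => ∀ Y : VectorFields I M,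
    θ (Y x) = mvfderiv I (fun y => ψ y (Y y)) x (X x) - ψ x (VectorField.mlieBracket I X Y x)

/-- The bracket of 1-forms on a Poisson manifold,
`[φ, ψ] = L_{π^# φ} ψ - L_{π^# ψ} φ - d(π(φ, ψ))`, where `π(φ, ψ) = ⟨ψ, π^# φ⟩`. -/
def PoissonStructure.oneFormBracket [IsManifold I ∞ M] (π : PoissonStructure I M)
    (φ ψ : ∀ x : M, CotangentSpace I x) (x : M) : CotangentSpace I x :=
  lieDerivOneForm (fun y => π.sharp y (φ y)) ψ x - lieDerivOneForm (fun y => π.sharp y (ψ y)) φ x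
    - mvfderiv I (fun y => ψ y (π.sharp y (φ y))) x

end Poisson

section LieAlgebroid

variable {E : Type*} [NormedAddCommGroup E] [NormedSpace ℝ E]
  {H : Type*} [TopologicalSpace H] (I : ModelWithCorners ℝ E H)
  {M : Type*} [TopologicalSpace M] [ChartedSpace H M] [IsManifold I ∞ M]
  (K : Type*) [NormedAddCommGroup K] [NormedSpace ℝ K]
  (V : M → Type*) [TopologicalSpace (TotalSpace K V)] [∀ x, TopologicalSpace (V x)]
  [∀ x, AddCommGroup (V x)] [∀ x, Module ℝ (V x)] [FiberBundle K V] [VectorBundle ℝ K V]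
  [ContMDiffVectorBundle ∞ K V I]

/-- A Lie algebroid structure on the smooth vector bundle `V` over `M`. -/
@[ext] structure LieAlgebroid where
  bracket : Cₛ^∞⟮I; K, V⟯ →ₗ[ℝ] Cₛ^∞⟮I; K, V⟯ →ₗ[ℝ] Cₛ^∞⟮I; K, V⟯
  anchor : ∀ x : M, V x →L[ℝ] TangentSpace I x
  contMDiff_anchor : ContMDiff (I.prod 𝓘(ℝ, K)) I.tangent ∞
    (fun v : TotalSpace K V => (⟨v.1, anchor v.1 v.2⟩ : TangentBundle I M))
  bracket_self : ∀ X, bracket X X = 0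
  jacobi : ∀ X Y Z,
    bracket X (bracket Y Z) + bracket Y (bracket Z X) + bracket Z (bracket X Y) = 0
  leibniz : ∀ (X Y : Cₛ^∞⟮I; K, V⟯) (f : C^∞⟮I, M; 𝓘(ℝ), ℝ⟯) (x : M),
    bracket X ⟨fun y => f y • Y y, f.contMDiff.smul_section Y.contMDiff⟩ x =
      f x • bracket X Y x + mvfderiv I f x (anchor x (X x)) • Y x
  anchor_bracket : ∀ (X Y : Cₛ^∞⟮I; K, V⟯) (x : M),
    anchor x (bracket X Y x) =
      VectorField.mlieBracket I (fun y => anchor y (X y)) (fun y => anchor y (Y y)) x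

end LieAlgebroid

section Groupoids

/-- The structure maps of a groupoid `G ⇉ P`: source `α`, target `β`, identities `m ↦ 1_m`,
inversion, and the multiplication `(h, g) ↦ hg`. Only the values of `mul h g` with
`src h = tgt g` are meaningful. -/
structure GroupoidMaps (G P : Type*) where
  src : G → P
  tgt : G → P
  one : P → G
  inv : G → G
  mul : G → G → G

/-- The set `G ×_P G` of composable pairs. -/
def GroupoidMaps.composable {G P : Type*} (𝒢 : GroupoidMaps G P) : Set (G × G) :=
  {p | 𝒢.src p.1 = 𝒢.tgt p.2}

/-- The graph `{(hg, h, g)}` of the multiplication. -/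
def GroupoidMaps.graph {G P : Type*} (𝒢 : GroupoidMaps G P) : Set (G × (G × G)) :=
  {p | 𝒢.src p.2.1 = 𝒢.tgt p.2.2 ∧ p.1 = 𝒢.mul p.2.1 p.2.2}

variable {E : Type*} [NormedAddCommGroup E] [NormedSpace ℝ E]
  {H : Type*} [TopologicalSpace H] (I : ModelWithCorners ℝ E H)
  {G : Type*} [TopologicalSpace G] [ChartedSpace H G]
  {F : Type*} [NormedAddCommGroup F] [NormedSpace ℝ F]
  {N : Type*} [TopologicalSpace N] (J : ModelWithCorners ℝ F N)
  {P : Type*} [TopologicalSpace P] [ChartedSpace N P]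

/-- The structure maps `𝒢` make `G ⇉ P` a Lie groupoid. Smoothness of the multiplication is
smoothness on the submanifold of composable pairs. -/
structure IsLieGroupoid (𝒢 : GroupoidMaps G P) : Prop where
  contMDiff_src : ContMDiff I J ∞ 𝒢.src
  contMDiff_tgt : ContMDiff I J ∞ 𝒢.tgt
  src_surjective : Function.Surjective 𝒢.src
  tgt_surjective : Function.Surjective 𝒢.tgt
  src_submersion : ∀ g, Function.Surjective (mfderiv I J 𝒢.src g)
  tgt_submersion : ∀ g, Function.Surjective (mfderiv I J 𝒢.tgt g)
  contMDiff_one : ContMDiff J I ∞ 𝒢.one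
  one_injective : Function.Injective 𝒢.one
  one_immersion : ∀ m, Function.Injective (mfderiv J I 𝒢.one m)
  contMDiffOn_mul :
    ContMDiffOn (I.prod I) I ∞ (fun p : G × G => 𝒢.mul p.1 p.2) 𝒢.composable
  src_one : ∀ m, 𝒢.src (𝒢.one m) = m
  tgt_one : ∀ m, 𝒢.tgt (𝒢.one m) = m
  src_mul : ∀ h g, 𝒢.src h = 𝒢.tgt g → 𝒢.src (𝒢.mul h g) = 𝒢.src g
  tgt_mul : ∀ h g, 𝒢.src h = 𝒢.tgt g → 𝒢.tgt (𝒢.mul h g) = 𝒢.tgt h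
  mul_assoc : ∀ h g f, 𝒢.src h = 𝒢.tgt g → 𝒢.src g = 𝒢.tgt f →
    𝒢.mul h (𝒢.mul g f) = 𝒢.mul (𝒢.mul h g) f
  one_mul : ∀ g, 𝒢.mul (𝒢.one (𝒢.tgt g)) g = g
  mul_one : ∀ g, 𝒢.mul g (𝒢.one (𝒢.src g)) = g
  src_inv : ∀ g, 𝒢.src (𝒢.inv g) = 𝒢.tgt g
  tgt_inv : ∀ g, 𝒢.tgt (𝒢.inv g) = 𝒢.src g
  inv_mul : ∀ g, 𝒢.mul (𝒢.inv g) g = 𝒢.one (𝒢.src g)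
  mul_inv : ∀ g, 𝒢.mul g (𝒢.inv g) = 𝒢.one (𝒢.tgt g)

variable (G P) in
/-- A Lie groupoid `G ⇉ P`. -/
structure LieGroupoid extends GroupoidMaps G P where
  isLieGroupoid : IsLieGroupoid I J toGroupoidMaps

variable {E₂ : Type*} [NormedAddCommGroup E₂] [NormedSpace ℝ E₂]
  {H₂ : Type*} [TopologicalSpace H₂] (I₂ : ModelWithCorners ℝ E₂ H₂)
  {G₂ : Type*} [TopologicalSpace G₂] [ChartedSpace H₂ G₂]
  {F₂ : Type*} [NormedAddCommGroup F₂] [NormedSpace ℝ F₂]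
  {N₂ : Type*} [TopologicalSpace N₂] (J₂ : ModelWithCorners ℝ F₂ N₂)
  {P₂ : Type*} [TopologicalSpace P₂] [ChartedSpace N₂ P₂]

/-- `Φ : G → G₂` is a morphism of Lie groupoids from `G ⇉ P` to `G₂ ⇉ P₂` with base map
`f : P → P₂`. -/
structure IsLieGroupoidMorphism (𝒢 : GroupoidMaps G P) (𝒢₂ : GroupoidMaps G₂ P₂)
    (Φ : G → G₂) (f : P → P₂) : Prop where
  dom : IsLieGroupoid I J 𝒢
  cod : IsLieGroupoid I₂ J₂ 𝒢₂
  contMDiff : ContMDiff I I₂ ∞ Φ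
  contMDiff_base : ContMDiff J J₂ ∞ f
  map_src : ∀ g, 𝒢₂.src (Φ g) = f (𝒢.src g)
  map_tgt : ∀ g, 𝒢₂.tgt (Φ g) = f (𝒢.tgt g)
  map_one : ∀ m, Φ (𝒢.one m) = 𝒢₂.one (f m)
  map_mul : ∀ h g, 𝒢.src h = 𝒢.tgt g → Φ (𝒢.mul h g) = 𝒢₂.mul (Φ h) (Φ g)

/-- The structure maps of the tangent groupoid `TG ⇉ TP`, obtained by applying the tangent functor.
The multiplication is `T(κ)` for the multiplication `κ : G ×_P G → G`: the derivative of `κ` within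
the submanifold `G ×_P G` of `G × G`, which is determined on the vectors tangent to `G ×_P G`, that
is, on the composable pairs of `TG ⇉ TP`. -/
def GroupoidMaps.tangent (𝒢 : GroupoidMaps G P) :
    GroupoidMaps (TangentBundle I G) (TangentBundle J P) where
  src := tangentMap I J 𝒢.src
  tgt := tangentMap I J 𝒢.tgt
  one := tangentMap J I 𝒢.one
  inv := tangentMap I I 𝒢.inv
  mul η ξ := ⟨𝒢.mul η.1 ξ.1, mfderivWithin (I.prod I) I (fun p : G × G => 𝒢.mul p.1 p.2)
    𝒢.composable (η.1, ξ.1) (η.2, ξ.2)⟩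

end Groupoids

/-! ### The Lie algebroid of a Lie groupoid as a vector bundle, and its dual -/

section AlgebroidBundle

variable {E : Type*} [NormedAddCommGroup E] [NormedSpace ℝ E] [FiniteDimensional ℝ E]
  {G : Type*} [TopologicalSpace G] [ChartedSpace E G] [IsManifold 𝓘(ℝ, E) ∞ G]
  {F : Type*} [NormedAddCommGroup F] [NormedSpace ℝ F] [FiniteDimensional ℝ F]
  {P : Type*} [TopologicalSpace P] [ChartedSpace F P] [IsManifold 𝓘(ℝ, F) ∞ P]

namespace LieGroupoid

variable (𝒢 : LieGroupoid 𝓘(ℝ, E) G 𝓘(ℝ, F) P)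

/-- `ker (T(α) : T_{1_m} G → T_m P)` as a subspace of `T_{1_m} G`. -/
def algSubmodule (m : P) : Submodule ℝ (TangentSpace 𝓘(ℝ, E) (𝒢.one m)) :=
  LinearMap.ker (mfderiv 𝓘(ℝ, E) 𝓘(ℝ, F) 𝒢.src (𝒢.one m)).toLinearMap

/-- The fibre `A_m G = ker (T(α) : T_{1_m} G → T_m P)` of the Lie algebroid of `G ⇉ P`. -/
def AlgFiber (m : P) : Type _ := 𝒢.algSubmodule m

instance (m : P) : AddCommGroup (𝒢.AlgFiber m) :=
  inferInstanceAs (AddCommGroup (𝒢.algSubmodule m))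

instance (m : P) : Module ℝ (𝒢.AlgFiber m) :=
  inferInstanceAs (Module ℝ (𝒢.algSubmodule m))

instance (m : P) : TopologicalSpace (𝒢.AlgFiber m) :=
  inferInstanceAs (TopologicalSpace (𝒢.algSubmodule m))

/-- The inclusion `A_m G → T_{1_m} G`. -/
def incl (m : P) : 𝒢.AlgFiber m →L[ℝ] TangentSpace 𝓘(ℝ, E) (𝒢.one m) :=
  (𝒢.algSubmodule m).subtypeL

/-- The endomorphism `T(1) ∘ T(α)` of `T_{1_m} G`. -/
def oneSrc (m : P) : TangentSpace 𝓘(ℝ, E) (𝒢.one m) →L[ℝ] TangentSpace 𝓘(ℝ, E) (𝒢.one m) :=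
  mfderiv 𝓘(ℝ, F) 𝓘(ℝ, E) 𝒢.one m ∘L tcast (𝒢.isLieGroupoid.src_one m) ∘L
    mfderiv 𝓘(ℝ, E) 𝓘(ℝ, F) 𝒢.src (𝒢.one m)

theorem tcast_eq {x y : P} (h : x = y) (v : TangentSpace 𝓘(ℝ, F) x) :
    (tcast h v : TangentSpace 𝓘(ℝ, F) y) = (show F from v) := by
  subst h; rfl

theorem tcast_injective {x y : P} (h : x = y) :
    Function.Injective (tcast h : TangentSpace 𝓘(ℝ, F) x →L[ℝ] TangentSpace 𝓘(ℝ, F) y) := by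
  subst h; exact fun _ _ hab => hab

theorem mfderiv_src_one (m : P) (v : TangentSpace 𝓘(ℝ, F) m) :
    tcast (𝒢.isLieGroupoid.src_one m) (mfderiv 𝓘(ℝ, E) 𝓘(ℝ, F) 𝒢.src (𝒢.one m)
      (mfderiv 𝓘(ℝ, F) 𝓘(ℝ, E) 𝒢.one m v)) = v := by
  have h1 := (𝒢.isLieGroupoid.contMDiff_src.mdifferentiableAt (x := 𝒢.one m) (by simp)).hasMFDerivAt
  have h2 := (𝒢.isLieGroupoid.contMDiff_one.mdifferentiableAt (x := m) (by simp)).hasMFDerivAt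
  have h3 := h1.comp m h2
  have h4 : (𝒢.src ∘ 𝒢.one) = id := funext 𝒢.isLieGroupoid.src_one
  rw [h4] at h3
  have h5 := hasMFDerivAt_unique h3 (hasMFDerivAt_id (I := 𝓘(ℝ, F)) m)
  rw [tcast_eq]
  exact DFunLike.congr_fun h5 v

theorem mfderiv_src_oneSrc (m : P) (v : TangentSpace 𝓘(ℝ, E) (𝒢.one m)) :
    mfderiv 𝓘(ℝ, E) 𝓘(ℝ, F) 𝒢.src (𝒢.one m) (𝒢.oneSrc m v) =
      mfderiv 𝓘(ℝ, E) 𝓘(ℝ, F) 𝒢.src (𝒢.one m) v := by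
  have h := 𝒢.mfderiv_src_one m (tcast (𝒢.isLieGroupoid.src_one m)
    (mfderiv 𝓘(ℝ, E) 𝓘(ℝ, F) 𝒢.src (𝒢.one m) v))
  exact tcast_injective (𝒢.isLieGroupoid.src_one m) h

/-- The projection `T_{1_m} G = T(1)(T_m P) ⊕ A_m G → A_m G`, that is `ξ ↦ ξ - T(1)(T(α)(ξ))`. -/
def algProj (m : P) : TangentSpace 𝓘(ℝ, E) (𝒢.one m) →L[ℝ] 𝒢.AlgFiber m :=
  (ContinuousLinearMap.id ℝ _ - 𝒢.oneSrc m).codRestrict (𝒢.algSubmodule m) fun v => by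
    change mfderiv 𝓘(ℝ, E) 𝓘(ℝ, F) 𝒢.src (𝒢.one m) (v - 𝒢.oneSrc m v) = 0
    rw [map_sub, mfderiv_src_oneSrc, sub_self]

theorem incl_algProj (m : P) (v : TangentSpace 𝓘(ℝ, E) (𝒢.one m)) :
    𝒢.incl m (𝒢.algProj m v) = v - 𝒢.oneSrc m v := rfl

theorem algProj_incl (m : P) (v : 𝒢.AlgFiber m) : 𝒢.algProj m (𝒢.incl m v) = v := by
  have hv : mfderiv 𝓘(ℝ, E) 𝓘(ℝ, F) 𝒢.src (𝒢.one m) (𝒢.incl m v) = 0 := v.2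
  refine Subtype.ext ?_
  change 𝒢.incl m v - 𝒢.oneSrc m (𝒢.incl m v) = 𝒢.incl m v
  simp [oneSrc, hv]

variable (E F) in
/-- The model fibre of `AG`, of dimension `dim G - dim P`. -/
abbrev AlgModel : Type := EuclideanSpace ℝ (Fin (Module.finrank ℝ E - Module.finrank ℝ F))

instance (m : P) : FiniteDimensional ℝ (𝒢.AlgFiber m) :=
  haveI : FiniteDimensional ℝ (TangentSpace 𝓘(ℝ, E) (𝒢.one m)) :=
    inferInstanceAs (FiniteDimensional ℝ E)
  inferInstanceAs (FiniteDimensional ℝ (𝒢.algSubmodule m))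

theorem finrank_algFiber (m : P) :
    Module.finrank ℝ (𝒢.AlgFiber m) = Module.finrank ℝ (AlgModel E F) := by
  have : FiniteDimensional ℝ (TangentSpace 𝓘(ℝ, E) (𝒢.one m)) :=
    inferInstanceAs (FiniteDimensional ℝ E)
  have h := LinearMap.finrank_range_add_finrank_ker
    (mfderiv 𝓘(ℝ, E) 𝓘(ℝ, F) 𝒢.src (𝒢.one m)).toLinearMap
  rw [LinearMap.range_eq_top.2 (𝒢.isLieGroupoid.src_submersion (𝒢.one m)), finrank_top] at h
  have h1 : Module.finrank ℝ (TangentSpace 𝓘(ℝ, F) (𝒢.src (𝒢.one m))) = Module.finrank ℝ F := rfl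
  have h2 : Module.finrank ℝ (TangentSpace 𝓘(ℝ, E) (𝒢.one m)) = Module.finrank ℝ E := rfl
  have h3 : Module.finrank ℝ (𝒢.AlgFiber m) = Module.finrank ℝ
    (LinearMap.ker (mfderiv 𝓘(ℝ, E) 𝓘(ℝ, F) 𝒢.src (𝒢.one m)).toLinearMap) := rfl
  rw [finrank_euclideanSpace_fin]
  omega

/-- A linear isomorphism of the fibre with the model fibre. -/
def fiberEquiv (i : P) : 𝒢.AlgFiber i ≃ₗ[ℝ] AlgModel E F :=
  LinearEquiv.ofFinrankEq _ _ (𝒢.finrank_algFiber i)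

/-- The preferred trivialization of `TG` at `1_i`. -/
abbrev tTriv (i : P) := trivializationAt E (TangentSpace 𝓘(ℝ, E) : G → Type _) (𝒢.one i)

/-- The coordinates `T_{1_m} G → E` near `1_i`. -/
def toCoord (i m : P) : TangentSpace 𝓘(ℝ, E) (𝒢.one m) →L[ℝ] E :=
  (𝒢.tTriv i).continuousLinearMapAt ℝ (𝒢.one m)

/-- The inverse of the coordinates `T_{1_m} G → E` near `1_i`. -/
def ofCoord (i m : P) : E →L[ℝ] TangentSpace 𝓘(ℝ, E) (𝒢.one m) :=
  (𝒢.tTriv i).symmL ℝ (𝒢.one m)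

/-- The model fibre as a subspace of `E`: the coordinates of `A_i G`. -/
def modelIncl (i : P) : AlgModel E F →L[ℝ] E :=
  ((𝒢.toCoord i i).toLinearMap ∘ₗ (𝒢.incl i).toLinearMap ∘ₗ
    (𝒢.fiberEquiv i).symm.toLinearMap).toContinuousLinearMap

/-- A projection of `E` onto the model fibre. -/
def modelProj (i : P) : E →L[ℝ] AlgModel E F :=
  ((𝒢.fiberEquiv i).toLinearMap ∘ₗ (𝒢.algProj i).toLinearMap ∘ₗ
    (𝒢.ofCoord i i).toLinearMap).toContinuousLinearMap

/-- The fibre coordinate `A_m G → ℝ^r` for `m` near `i`: the coordinates of `T_{1_m} G`, followed by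
a fixed projection. -/
def algCoord (i m : P) : 𝒢.AlgFiber m →L[ℝ] AlgModel E F :=
  𝒢.modelProj i ∘L 𝒢.toCoord i m ∘L 𝒢.incl m

/-- The map `ℝ^r → E → T_{1_m} G → A_m G`. -/
def algLift (i m : P) : AlgModel E F →L[ℝ] 𝒢.AlgFiber m :=
  𝒢.algProj m ∘L 𝒢.ofCoord i m ∘L 𝒢.modelIncl i

/-- The composite `ℝ^r → A_m G → ℝ^r`, invertible for `m` near `i`. -/
def algTrans (i m : P) : AlgModel E F →L[ℝ] AlgModel E F :=
  𝒢.algCoord i m ∘L 𝒢.algLift i m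

/-- The inverse of the fibre coordinate. -/
def algCoordInv (i m : P) : AlgModel E F →L[ℝ] 𝒢.AlgFiber m :=
  𝒢.algLift i m ∘L (𝒢.algTrans i m).inverse

/-- The domain of the local trivialization of `AG` at `i`. -/
def algBase (i : P) : Set P :=
  {m | 𝒢.one m ∈ (𝒢.tTriv i).baseSet ∧ (𝒢.algTrans i m).IsInvertible}

theorem ofCoord_toCoord {i m : P} (h : 𝒢.one m ∈ (𝒢.tTriv i).baseSet)
    (v : TangentSpace 𝓘(ℝ, E) (𝒢.one m)) : 𝒢.ofCoord i m (𝒢.toCoord i m v) = v :=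
  (𝒢.tTriv i).symmL_continuousLinearMapAt h v

theorem toCoord_ofCoord {i m : P} (h : 𝒢.one m ∈ (𝒢.tTriv i).baseSet) (v : E) :
    𝒢.toCoord i m (𝒢.ofCoord i m v) = v :=
  (𝒢.tTriv i).continuousLinearMapAt_symmL h v

theorem one_mem_baseSet (i : P) : 𝒢.one i ∈ (𝒢.tTriv i).baseSet :=
  FiberBundle.mem_baseSet_trivializationAt' _

theorem algTrans_self (i : P) : 𝒢.algTrans i i = ContinuousLinearMap.id ℝ _ := by
  ext1 w
  have h := 𝒢.one_mem_baseSet i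
  have h1 : 𝒢.algLift i i w = (𝒢.fiberEquiv i).symm w := by
    change 𝒢.algProj i (𝒢.ofCoord i i (𝒢.toCoord i i (𝒢.incl i ((𝒢.fiberEquiv i).symm w)))) = _
    rw [ofCoord_toCoord _ h, algProj_incl]
  change 𝒢.algCoord i i (𝒢.algLift i i w) = w
  rw [h1]
  change 𝒢.fiberEquiv i (𝒢.algProj i (𝒢.ofCoord i i (𝒢.toCoord i i (𝒢.incl i
    ((𝒢.fiberEquiv i).symm w))))) = w
  rw [ofCoord_toCoord _ h, algProj_incl, LinearEquiv.apply_symm_apply]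

theorem mem_algBase (i : P) : i ∈ 𝒢.algBase i := by
  refine ⟨𝒢.one_mem_baseSet i, ?_⟩
  rw [algTrans_self]
  exact ⟨ContinuousLinearEquiv.refl ℝ _, rfl⟩

theorem algCoord_algCoordInv {i m : P} (h : m ∈ 𝒢.algBase i) (w : AlgModel E F) :
    𝒢.algCoord i m (𝒢.algCoordInv i m w) = w :=
  h.2.self_apply_inverse w

theorem algCoordInv_algCoord {i m : P} (h : m ∈ 𝒢.algBase i) (v : 𝒢.AlgFiber m) :
    𝒢.algCoordInv i m (𝒢.algCoord i m v) = v := by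
  have hs : Function.Surjective (𝒢.algCoord i m).toLinearMap :=
    fun w => ⟨_, 𝒢.algCoord_algCoordInv h w⟩
  have hi := (LinearMap.injective_iff_surjective_of_finrank_eq_finrank
    (𝒢.finrank_algFiber m)).2 hs
  exact hi (𝒢.algCoord_algCoordInv h _)

/-- The endomorphism `T(1) ∘ T(α)` in coordinates near `1_i`. -/
def oneSrcCoord (i m : P) : E →L[ℝ] E := 𝒢.toCoord i m ∘L 𝒢.oneSrc m ∘L 𝒢.ofCoord i m

theorem mfderiv_one_src (m : P) (v : E) :
    (mfderiv 𝓘(ℝ, E) 𝓘(ℝ, E) (fun g => 𝒢.one (𝒢.src g)) (𝒢.one m) v : E) = 𝒢.oneSrc m v := by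
  have h1 := (𝒢.isLieGroupoid.contMDiff_src.mdifferentiableAt (x := 𝒢.one m) (by simp)).hasMFDerivAt
  have h2 := (𝒢.isLieGroupoid.contMDiff_one.mdifferentiableAt
    (x := 𝒢.src (𝒢.one m)) (by simp)).hasMFDerivAt
  have h3 := (h2.comp (𝒢.one m) h1).mfderiv
  change mfderiv 𝓘(ℝ, E) 𝓘(ℝ, E) (𝒢.one ∘ 𝒢.src) (𝒢.one m) v = _
  rw [h3]
  change mfderiv 𝓘(ℝ, F) 𝓘(ℝ, E) 𝒢.one (𝒢.src (𝒢.one m))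
    (mfderiv 𝓘(ℝ, E) 𝓘(ℝ, F) 𝒢.src (𝒢.one m) v) = mfderiv 𝓘(ℝ, F) 𝓘(ℝ, E) 𝒢.one m
      (tcast (𝒢.isLieGroupoid.src_one m) (mfderiv 𝓘(ℝ, E) 𝓘(ℝ, F) 𝒢.src (𝒢.one m) v))
  generalize mfderiv 𝓘(ℝ, E) 𝓘(ℝ, F) 𝒢.src (𝒢.one m) v = u
  revert u
  generalize_proofs hp
  revert hp
  generalize 𝒢.src (𝒢.one m) = x
  rintro rfl u
  rfl

theorem contMDiffAt_oneSrcCoord_self (m : P) :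
    ContMDiffAt 𝓘(ℝ, F) 𝓘(ℝ, E →L[ℝ] E) ∞ (𝒢.oneSrcCoord m) m := by
  have hf : ContMDiff 𝓘(ℝ, E) 𝓘(ℝ, E) ∞ (fun g => 𝒢.one (𝒢.src g)) :=
    𝒢.isLieGroupoid.contMDiff_one.comp 𝒢.isLieGroupoid.contMDiff_src
  have h := ContMDiffAt.mfderiv (x₀ := m) (m := ∞) (n := ∞) (I := 𝓘(ℝ, E)) (I' := 𝓘(ℝ, E))
    (J := 𝓘(ℝ, F)) (fun (_ : P) g => 𝒢.one (𝒢.src g)) 𝒢.one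
    ((hf.comp contMDiff_snd).contMDiffAt) 𝒢.isLieGroupoid.contMDiff_one.contMDiffAt (by simp)
  have he : (fun m => 𝒢.one (𝒢.src (𝒢.one m))) = 𝒢.one := by
    funext m; rw [𝒢.isLieGroupoid.src_one]
  rw [he] at h
  refine h.congr_of_eventuallyEq (Eventually.of_forall fun m' => ?_)
  ext v
  change 𝒢.toCoord m m' (𝒢.oneSrc m' (𝒢.ofCoord m m' v)) =
    𝒢.toCoord m m' (mfderiv 𝓘(ℝ, E) 𝓘(ℝ, E) (fun g => 𝒢.one (𝒢.src g)) (𝒢.one m')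
      (𝒢.ofCoord m m' v))
  congr 1
  exact (𝒢.mfderiv_one_src m' _).symm

/-- The coordinate change of `TG` along the identities. -/
def tChange (i j m : P) : E →L[ℝ] E := 𝒢.toCoord j m ∘L 𝒢.ofCoord i m

theorem contMDiffAt_tChange {i j m : P} (hi : 𝒢.one m ∈ (𝒢.tTriv i).baseSet)
    (hj : 𝒢.one m ∈ (𝒢.tTriv j).baseSet) :
    ContMDiffAt 𝓘(ℝ, F) 𝓘(ℝ, E →L[ℝ] E) ∞ (𝒢.tChange i j) m := by
  have h := ContMDiffAt.coordChangeL (IM := 𝓘(ℝ, F)) (IB := 𝓘(ℝ, E)) (n := ∞)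
    (e := 𝒢.tTriv i) (e' := 𝒢.tTriv j)
    (𝒢.isLieGroupoid.contMDiff_one.contMDiffAt (x := m)) hi hj
  refine h.congr_of_eventuallyEq ?_
  have ho : IsOpen (𝒢.one ⁻¹' ((𝒢.tTriv i).baseSet ∩ (𝒢.tTriv j).baseSet)) :=
    ((𝒢.tTriv i).open_baseSet.inter (𝒢.tTriv j).open_baseSet).preimage
      𝒢.isLieGroupoid.contMDiff_one.continuous
  filter_upwards [ho.mem_nhds ⟨hi, hj⟩] with m' hm'
  ext v
  change (𝒢.tTriv j).continuousLinearMapAt ℝ (𝒢.one m') ((𝒢.tTriv i).symmL ℝ (𝒢.one m') v) = _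
  rw [ContinuousLinearEquiv.coe_coe, Bundle.Trivialization.coordChangeL_apply _ _ hm',
    Bundle.Trivialization.continuousLinearMapAt_apply,
    Bundle.Trivialization.coe_linearMapAt_of_mem _ hm'.2, Bundle.Trivialization.symmL_apply _ hm'.1]

theorem contMDiffAt_oneSrcCoord {i m : P} (hi : 𝒢.one m ∈ (𝒢.tTriv i).baseSet) :
    ContMDiffAt 𝓘(ℝ, F) 𝓘(ℝ, E →L[ℝ] E) ∞ (𝒢.oneSrcCoord i) m := by
  have hm := 𝒢.one_mem_baseSet m
  have h := (𝒢.contMDiffAt_tChange hm hi).clm_comp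
    ((𝒢.contMDiffAt_oneSrcCoord_self m).clm_comp (𝒢.contMDiffAt_tChange hi hm))
  refine h.congr_of_eventuallyEq ?_
  have ho : IsOpen (𝒢.one ⁻¹' ((𝒢.tTriv i).baseSet ∩ (𝒢.tTriv m).baseSet)) :=
    ((𝒢.tTriv i).open_baseSet.inter (𝒢.tTriv m).open_baseSet).preimage
      𝒢.isLieGroupoid.contMDiff_one.continuous
  filter_upwards [ho.mem_nhds ⟨hi, hm⟩] with m' hm'
  ext v
  change 𝒢.toCoord i m' (𝒢.oneSrc m' (𝒢.ofCoord i m' v)) =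
    𝒢.toCoord i m' (𝒢.ofCoord m m' (𝒢.toCoord m m' (𝒢.oneSrc m' (𝒢.ofCoord m m' (𝒢.toCoord m m'
      (𝒢.ofCoord i m' v))))))
  rw [ofCoord_toCoord _ hm'.2, ofCoord_toCoord _ hm'.2]

theorem contMDiffAt_algTrans {i m : P} (hi : 𝒢.one m ∈ (𝒢.tTriv i).baseSet) :
    ContMDiffAt 𝓘(ℝ, F) 𝓘(ℝ, AlgModel E F →L[ℝ] AlgModel E F) ∞ (𝒢.algTrans i) m := by
  have h : ContMDiffAt 𝓘(ℝ, F) 𝓘(ℝ, AlgModel E F →L[ℝ] AlgModel E F) ∞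
      (fun m' => 𝒢.modelProj i ∘L (ContinuousLinearMap.id ℝ E - 𝒢.oneSrcCoord i m') ∘L
        𝒢.modelIncl i) m :=
    contMDiffAt_const.clm_comp
      ((contMDiffAt_const.sub (𝒢.contMDiffAt_oneSrcCoord hi)).clm_comp contMDiffAt_const)
  refine h.congr_of_eventuallyEq ?_
  have ho : IsOpen (𝒢.one ⁻¹' (𝒢.tTriv i).baseSet) :=
    (𝒢.tTriv i).open_baseSet.preimage 𝒢.isLieGroupoid.contMDiff_one.continuous
  filter_upwards [ho.mem_nhds hi] with m' hm'
  ext1 v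
  change 𝒢.modelProj i (𝒢.toCoord i m' (𝒢.ofCoord i m' (𝒢.modelIncl i v) -
    𝒢.oneSrc m' (𝒢.ofCoord i m' (𝒢.modelIncl i v)))) = 𝒢.modelProj i (𝒢.modelIncl i v -
      𝒢.toCoord i m' (𝒢.oneSrc m' (𝒢.ofCoord i m' (𝒢.modelIncl i v))))
  rw [map_sub (𝒢.toCoord i m'), toCoord_ofCoord _ hm']

theorem isOpen_algBase (i : P) : IsOpen (𝒢.algBase i) := by
  rw [isOpen_iff_mem_nhds]
  intro m hm
  have ho : IsOpen (𝒢.one ⁻¹' (𝒢.tTriv i).baseSet) :=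
    (𝒢.tTriv i).open_baseSet.preimage 𝒢.isLieGroupoid.contMDiff_one.continuous
  filter_upwards [ho.mem_nhds hm.1, (𝒢.contMDiffAt_algTrans hm.1).continuousAt
    (ContinuousLinearEquiv.isOpen.mem_nhds hm.2)] with m' h1 h2
  exact ⟨h1, h2⟩

/-- The coordinate changes of `AG`. -/
def algChange (i j m : P) : AlgModel E F →L[ℝ] AlgModel E F :=
  𝒢.algCoord j m ∘L 𝒢.algCoordInv i m

theorem contMDiffOn_algChange (i j : P) :
    ContMDiffOn 𝓘(ℝ, F) 𝓘(ℝ, AlgModel E F →L[ℝ] AlgModel E F) ∞ (𝒢.algChange i j)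
      (𝒢.algBase i ∩ 𝒢.algBase j) := by
  intro m hm
  refine ContMDiffAt.contMDiffWithinAt ?_
  have hinv : ContMDiffAt 𝓘(ℝ, F) 𝓘(ℝ, AlgModel E F →L[ℝ] AlgModel E F) ∞
      (fun m' => (𝒢.algTrans i m').inverse) m :=
    ContMDiffAt.comp (I' := 𝓘(ℝ, AlgModel E F →L[ℝ] AlgModel E F)) m
      (hm.1.2.contDiffAt_map_inverse).contMDiffAt (𝒢.contMDiffAt_algTrans hm.1.1)
  have h : ContMDiffAt 𝓘(ℝ, F) 𝓘(ℝ, AlgModel E F →L[ℝ] AlgModel E F) ∞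
      (fun m' => 𝒢.modelProj j ∘L 𝒢.tChange i j m' ∘L
        (ContinuousLinearMap.id ℝ E - 𝒢.oneSrcCoord i m') ∘L
        𝒢.modelIncl i ∘L (𝒢.algTrans i m').inverse) m :=
    contMDiffAt_const.clm_comp ((𝒢.contMDiffAt_tChange hm.1.1 hm.2.1).clm_comp
      ((contMDiffAt_const.sub (𝒢.contMDiffAt_oneSrcCoord hm.1.1)).clm_comp
        (contMDiffAt_const.clm_comp hinv)))
  refine h.congr_of_eventuallyEq ?_
  filter_upwards [(𝒢.isOpen_algBase i).mem_nhds hm.1] with m' hm'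
  ext1 w
  change 𝒢.modelProj j (𝒢.toCoord j m' (𝒢.ofCoord i m' (𝒢.modelIncl i _) -
    𝒢.oneSrc m' (𝒢.ofCoord i m' (𝒢.modelIncl i _)))) =
    𝒢.modelProj j (𝒢.toCoord j m' (𝒢.ofCoord i m' (𝒢.modelIncl i _ -
      𝒢.toCoord i m' (𝒢.oneSrc m' (𝒢.ofCoord i m' (𝒢.modelIncl i _))))))
  rw [map_sub (𝒢.ofCoord i m'), ofCoord_toCoord _ hm'.1]

/-- The local trivialization of `AG` near `i`. -/
def algPretriv (i : P) :
    Pretrivialization (AlgModel E F) (TotalSpace.proj : TotalSpace (AlgModel E F) 𝒢.AlgFiber → P) where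
  toFun v := (v.1, 𝒢.algCoord i v.1 v.2)
  invFun p := ⟨p.1, 𝒢.algCoordInv i p.1 p.2⟩
  source := TotalSpace.proj ⁻¹' 𝒢.algBase i
  target := 𝒢.algBase i ×ˢ univ
  map_source' _ hv := ⟨hv, mem_univ _⟩
  map_target' _ hp := hp.1
  left_inv' := by
    rintro ⟨m, v⟩ hv
    exact congrArg (TotalSpace.mk m) (𝒢.algCoordInv_algCoord hv v)
  right_inv' := by
    rintro ⟨m, w⟩ hw
    exact congrArg (Prod.mk m) (𝒢.algCoord_algCoordInv hw.1 w)
  open_target := (𝒢.isOpen_algBase i).prod isOpen_univ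
  baseSet := 𝒢.algBase i
  open_baseSet := 𝒢.isOpen_algBase i
  source_eq := rfl
  target_eq := rfl
  proj_toFun _ _ := rfl

theorem algPretriv_isLinear (i : P) : (𝒢.algPretriv i).IsLinear ℝ :=
  ⟨fun m _ => (𝒢.algCoord i m).isLinear⟩

theorem algChange_apply (i j : P) {m : P} (hm : m ∈ 𝒢.algBase i ∩ 𝒢.algBase j)
    (w : AlgModel E F) :
    𝒢.algChange i j m w = (𝒢.algPretriv j ⟨m, (𝒢.algPretriv i).symm m w⟩).2 := by
  have h : (𝒢.algPretriv i).symm m w = 𝒢.algCoordInv i m w := by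
    have := (𝒢.algPretriv i).mk_symm hm.1 w
    exact eq_of_heq (TotalSpace.mk.inj this).2
  rw [h]
  rfl

/-- The vector bundle structure of `AG`. -/
def algPrebundle : VectorPrebundle ℝ (AlgModel E F) 𝒢.AlgFiber where
  pretrivializationAtlas := range 𝒢.algPretriv
  pretrivialization_linear' := by
    rintro _ ⟨i, rfl⟩
    exact 𝒢.algPretriv_isLinear i
  pretrivializationAt := 𝒢.algPretriv
  mem_base_pretrivializationAt := 𝒢.mem_algBase
  pretrivialization_mem_atlas i := ⟨i, rfl⟩
  exists_coordChange := by
    rintro _ ⟨i, rfl⟩ _ ⟨j, rfl⟩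
    exact ⟨𝒢.algChange i j, (𝒢.contMDiffOn_algChange i j).continuousOn,
      fun m hm w => 𝒢.algChange_apply i j hm w⟩
  totalSpaceMk_isInducing i := by
    have h : Function.LeftInverse (fun p : P × AlgModel E F => 𝒢.algCoordInv i i p.2)
        (𝒢.algPretriv i ∘ TotalSpace.mk i) :=
      fun v => 𝒢.algCoordInv_algCoord (𝒢.mem_algBase i) v
    refine (h.isEmbedding ?_ ?_).isInducing
    · exact (𝒢.algCoordInv i i).continuous.comp continuous_snd
    · exact continuous_const.prodMk (𝒢.algCoord i i).continuous

instance : 𝒢.algPrebundle.IsContMDiff 𝓘(ℝ, F) ∞ where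
  exists_contMDiffCoordChange := by
    rintro _ ⟨i, rfl⟩ _ ⟨j, rfl⟩
    exact ⟨𝒢.algChange i j, 𝒢.contMDiffOn_algChange i j,
      fun m hm w => 𝒢.algChange_apply i j hm w⟩

instance : TopologicalSpace (TotalSpace (AlgModel E F) 𝒢.AlgFiber) :=
  𝒢.algPrebundle.totalSpaceTopology

instance : FiberBundle (AlgModel E F) 𝒢.AlgFiber := 𝒢.algPrebundle.toFiberBundle

instance : VectorBundle ℝ (AlgModel E F) 𝒢.AlgFiber := 𝒢.algPrebundle.toVectorBundle

instance : ContMDiffVectorBundle ∞ (AlgModel E F) 𝒢.AlgFiber 𝓘(ℝ, F) :=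
  𝒢.algPrebundle.contMDiffVectorBundle 𝓘(ℝ, F)

/-- The fibre `A_m^* G` of the dual bundle. -/
abbrev DualAlgFiber (m : P) : Type _ := 𝒢.AlgFiber m →L[ℝ] ℝ

/-- The dual bundle `A^*G` of `AG`, a manifold with its bundle structure. -/
abbrev DualAlg : Type _ := TotalSpace (AlgModel E F →L[ℝ] ℝ) 𝒢.DualAlgFiber

/-- Smooth sections of `A^*G`. -/
abbrev DualAlgSections : Type _ := Cₛ^∞⟮𝓘(ℝ, F); AlgModel E F →L[ℝ] ℝ, 𝒢.DualAlgFiber⟯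

/-- The conormal covector `\tilde 1_φ ∈ T^*_{1_m} G` of `φ ∈ A_m^* G`:
`⟨\tilde 1_φ, T(1)(x) + X⟩ = ⟨φ, X⟩` for `x ∈ T_m P`, `X ∈ A_m G`. -/
def conormal (m : P) (φ : 𝒢.DualAlgFiber m) : CotangentSpace 𝓘(ℝ, E) (𝒢.one m) :=
  φ ∘L 𝒢.algProj m

/-- The structure maps of the cotangent groupoid `T^*G ⇉ A^*G`. With `R_g : α⁻¹(βg) → α⁻¹(αg)` and
`L_g : β⁻¹(αg) → β⁻¹(βg)` the translations by `g` (whose derivatives are taken within the fibres),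
* `⟨β(Φ), Y⟩ = ⟨Φ, T(R_g)(Y)⟩` for `Φ ∈ T^*_g G`, `Y ∈ A_{βg} G`;
* `⟨α(Φ), X⟩ = ⟨Φ, T(L_g)(X - T(1)(aX))⟩` for `X ∈ A_{αg} G`, where `aX = T(β)(X)`;
* the identity over `φ ∈ A^*_m G` is `\tilde 1_φ`;
* `⟨Φ⁻¹, ξ⁻¹⟩ = -⟨Φ, ξ⟩`;
* `⟨Ψ • Φ, η • ξ⟩ = ⟨Ψ, η⟩ + ⟨Φ, ξ⟩` for all composable `η ∈ T_h G`, `ξ ∈ T_g G`. -/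
def cotangent : GroupoidMaps (CotangentBundle 𝓘(ℝ, E) G) 𝒢.DualAlg where
  src Φ := ⟨𝒢.src Φ.1, Φ.2 ∘L tcast (𝒢.isLieGroupoid.mul_one Φ.1) ∘L
    mfderivWithin 𝓘(ℝ, E) 𝓘(ℝ, E) (fun h => 𝒢.mul Φ.1 h) {h | 𝒢.tgt h = 𝒢.src Φ.1}
      (𝒢.one (𝒢.src Φ.1)) ∘L
    (ContinuousLinearMap.id ℝ _ - mfderiv 𝓘(ℝ, F) 𝓘(ℝ, E) 𝒢.one (𝒢.src Φ.1) ∘L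
      tcast (𝒢.isLieGroupoid.tgt_one (𝒢.src Φ.1)) ∘L
      mfderiv 𝓘(ℝ, E) 𝓘(ℝ, F) 𝒢.tgt (𝒢.one (𝒢.src Φ.1))) ∘L
    𝒢.incl (𝒢.src Φ.1)⟩
  tgt Φ := ⟨𝒢.tgt Φ.1, Φ.2 ∘L tcast (𝒢.isLieGroupoid.one_mul Φ.1) ∘L
    mfderivWithin 𝓘(ℝ, E) 𝓘(ℝ, E) (fun h => 𝒢.mul h Φ.1) {h | 𝒢.src h = 𝒢.tgt Φ.1}
      (𝒢.one (𝒢.tgt Φ.1)) ∘L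
    𝒢.incl (𝒢.tgt Φ.1)⟩
  one φ := ⟨𝒢.one φ.1, 𝒢.conormal φ.1 φ.2⟩
  inv Φ := ⟨𝒢.inv Φ.1, Classical.epsilon fun Θ : CotangentSpace 𝓘(ℝ, E) (𝒢.inv Φ.1) =>
    ∀ ξ : TangentSpace 𝓘(ℝ, E) Φ.1, Θ (mfderiv 𝓘(ℝ, E) 𝓘(ℝ, E) 𝒢.inv Φ.1 ξ) = -Φ.2 ξ⟩
  mul Ψ Φ := ⟨𝒢.mul Ψ.1 Φ.1,
    Classical.epsilon fun Θ : CotangentSpace 𝓘(ℝ, E) (𝒢.mul Ψ.1 Φ.1) =>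
      ∀ (η : TangentSpace 𝓘(ℝ, E) Ψ.1) (ξ : TangentSpace 𝓘(ℝ, E) Φ.1),
        (𝒢.tangent 𝓘(ℝ, E) 𝓘(ℝ, F)).src ⟨Ψ.1, η⟩ = (𝒢.tangent 𝓘(ℝ, E) 𝓘(ℝ, F)).tgt ⟨Φ.1, ξ⟩ →
        Θ ((𝒢.tangent 𝓘(ℝ, E) 𝓘(ℝ, F)).mul ⟨Ψ.1, η⟩ ⟨Φ.1, ξ⟩).2 = Ψ.2 η + Φ.2 ξ⟩

/-- A Poisson structure on `G` makes `G ⇉ P` a Poisson groupoid if the graph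
`{(hg, h, g)}` of the multiplication is coisotropic in `Ḡ × G × G`, where `Ḡ` has the opposite
Poisson structure. -/
def IsPoissonGroupoid (π : PoissonStructure 𝓘(ℝ, E) G) : Prop :=
  IsCoisotropic (𝓘(ℝ, E).prod (𝓘(ℝ, E).prod 𝓘(ℝ, E)))
    (prodAnchor (fun x φ => -π.sharp x φ) (prodAnchor π.sharp π.sharp)) 𝒢.graph

end LieGroupoid

end AlgebroidBundle

end PoissonGeometry

end

open PoissonGeometry

/-!
The structures on `T𝒢` and `T^*𝒢` are handled through curves and pairings. Every tangent vector is
the velocity of a curve, and composable tangent vectors of `𝒢` are the velocities of composable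
curves because the target is a submersion (`exists_composable_curves`). So `η • ξ` is the velocity
of `t ↦ h(t) g(t)` (`velocity_mul`), and the groupoid axioms pass from `𝒢` to `T𝒢`. The smoothness
of the inversion is not an axiom of Lie groupoids; it follows from the inverse function theorem
(`contMDiff_inv`). Covectors `Ψ`, `Φ` are composable exactly when `⟨Ψ, η⟩ + ⟨Φ, ξ⟩` depends only on
`η • ξ` (the implication used is `pair_add_pair_eq_zero`), and every vector at `hg` is a product
(`exists_tan_mul_eq`); hence `Ψ • Φ` is well defined, and identities between covectors are proved
by pairing them with products of vectors (`pair_cotangent_mul`, `pair_cotangent_inv`). This gives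
`isLieGroupoid_cotangent`.

Now let `𝒢` be a Poisson groupoid. If `Ψ` and `Φ` are composable, the covector `(-Ψ • Φ, Ψ, Φ)`
annihilates the graph of the multiplication. Its image `(π^#(Ψ • Φ), π^#Ψ, π^#Φ)` under the anchor
of the product is then tangent to the graph, which says that `π^#Ψ` and `π^#Φ` are composable with
product `π^#(Ψ • Φ)` (`anchor_composable_and_mul`). The identity `\tilde 1_φ` is idempotent, so its
image is, and idempotents in a groupoid are identities (`anchor_one`). Composability with the
identities shows that `π^#` covers `a_* = T(β) ∘ π^# ∘ \tilde 1` on sources and targets, and `π^#`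
is a morphism of Lie groupoids (`isLieGroupoidMorphism_anchor`).

Three of the other assertions are short consequences. The covectors which annihilate `1_P` are the
`\tilde 1_φ`, and `π^#` maps these into `T(1)(TP)`, so `1_P` is coisotropic
(`isCoisotropic_range_one`). A morphism preserves inverses (`anchor_inv`) and
`d(f ∘ ι)_g = -(df_{g⁻¹})⁻¹` for the inversion `ι`, so inversion is anti-Poisson
(`isAntiPoissonMap_inv`). The target of `d(f ∘ β)_g` depends only on `β(g)`, so `T(β)` of its image
under `π^#` does too: the bracket of functions `f₁ ∘ β` and `f₂ ∘ β` is constant on the fibres of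
`β` and descends to `P` (`bracket_comp_tgt`, `existsUnique_base`).

The Lie algebroid of a Poisson manifold needs the Jacobi identity for 1-forms and the fact that
`π^#` preserves brackets. Both are statements that a tensor vanishes, and they hold for exact forms
by the Jacobi identity of functions; since exact forms span all 1-forms over the smooth functions
near a point (`eq_zero_of_formDiff`), they hold in general (`sharpField_formBracket`,
`formBracket_jacobi`). For a Poisson groupoid, call a 1-form conormal if it is some `\tilde 1_φ`
along the identities. Its image under `π^#` is tangent to `1_P`. It follows that the bracket of
conormal 1-forms is conormal (`isConormal_formBracket`), and that it vanishes along `1_P` if one of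
them does (`formBracket_eq_zero`). Every section of `A^*𝒢` extends to a conormal 1-form
(`exists_isConormal`), so the bracket descends to sections of `A^*𝒢` and inherits all its
properties from the bracket of 1-forms (`existsUnique_dualAlgebroid`).
-/

noncomputable section

namespace PoissonGeometry

/-! ### The inverse function theorem and submersions -/

section InverseFunction

variable {E : Type*} [NormedAddCommGroup E] [NormedSpace ℝ E] [CompleteSpace E]
  {H : Type*} [TopologicalSpace H] {I : ModelWithCorners ℝ E H} [I.Boundaryless]
  {M : Type*} [TopologicalSpace M] [ChartedSpace H M] [IsManifold I ∞ M]
  {E' : Type*} [NormedAddCommGroup E'] [NormedSpace ℝ E'] [CompleteSpace E']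
  {H' : Type*} [TopologicalSpace H'] {I' : ModelWithCorners ℝ E' H'} [I'.Boundaryless]
  {M' : Type*} [TopologicalSpace M'] [ChartedSpace H' M'] [IsManifold I' ∞ M']

/-- The inverse function theorem on manifolds, with a local inverse that is smooth on an open
set. -/
theorem exists_local_inverse {f : M → M'} {U : Set M} (hU : IsOpen U)
    (hf : ContMDiffOn I I' ∞ f U) {x : M} (hx : x ∈ U)
    (hd : Function.Bijective (mfderiv I I' f x)) :
    ∃ (V : Set M') (g : M' → M), IsOpen V ∧ f x ∈ V ∧ ContMDiffOn I' I ∞ g V ∧ g (f x) = x ∧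
      (∀ y ∈ V, g y ∈ U ∧ f (g y) = y) ∧
      ∃ W : Set M, IsOpen W ∧ x ∈ W ∧ W ⊆ U ∧ ∀ z ∈ W, f z ∈ V ∧ g (f z) = z := by
  set φ := extChartAt I x with hφ
  set ψ := extChartAt I' (f x) with hψ
  have hφs : IsOpen φ.source := isOpen_extChartAt_source x
  have hφt : IsOpen φ.target := isOpen_extChartAt_target x
  have hψs : IsOpen ψ.source := isOpen_extChartAt_source (f x)
  have hψt : IsOpen ψ.target := isOpen_extChartAt_target (f x)
  have hxφ : x ∈ φ.source := mem_extChartAt_source x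
  have hxψ : f x ∈ ψ.source := mem_extChartAt_source (f x)
  set U₁ : Set M := U ∩ φ.source ∩ f ⁻¹' ψ.source with hU₁
  have hU₁o : IsOpen U₁ := by
    have h1 : IsOpen (U ∩ f ⁻¹' ψ.source) := hf.continuousOn.isOpen_inter_preimage hU hψs
    have : U₁ = (U ∩ f ⁻¹' ψ.source) ∩ φ.source := by ext; simp [hU₁]; tauto
    rw [this]; exact h1.inter hφs
  set D : Set E := φ.target ∩ φ.symm ⁻¹' U₁ with hD
  have hDo : IsOpen D := (continuousOn_extChartAt_symm x).isOpen_inter_preimage hφt hU₁o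
  set F : E → E' := fun y => ψ (f (φ.symm y)) with hF
  have hFD : ContDiffOn ℝ ∞ F D := by
    rw [← contMDiffOn_iff_contDiffOn]
    refine (contMDiffOn_extChartAt (I := I') (x := f x)).comp
      ((hf.mono fun y (hy : y ∈ U₁) => hy.1.1).comp
        ((contMDiffOn_extChartAt_symm (I := I) x).mono inter_subset_left) fun y hy => hy.2) ?_
    intro y hy
    rw [← extChartAt_source I']; exact hy.2.2
  set a : E := φ x with ha
  have hφa : φ.symm a = x := φ.left_inv hxφ
  have haD : a ∈ D := ⟨φ.map_source hxφ, by simp only [mem_preimage, hφa]; exact ⟨⟨hx, hxφ⟩, hxψ⟩⟩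
  have hfx : MDifferentiableAt I I' f x :=
    ((hf x hx).contMDiffAt (hU.mem_nhds hx)).mdifferentiableAt (by simp)
  have hder : (fderiv ℝ F a : E →L[ℝ] E') = mfderiv I I' f x := by
    rw [hfx.mfderiv]
    simp only [I.range_eq_univ, fderivWithin_univ]
    rfl
  have hb : Function.Bijective (fderiv ℝ F a) := by rw [hder]; exact hd
  have hcd : ∀ y ∈ D, ContDiffAt ℝ ∞ F y := fun y hy => (hFD y hy).contDiffAt (hDo.mem_nhds hy)
  have hFa := hcd a haD
  obtain ⟨L, hL⟩ : ∃ L : E ≃L[ℝ] E', (L : E →L[ℝ] E') = fderiv ℝ F a :=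
    ⟨ContinuousLinearEquiv.ofBijective _ (LinearMap.ker_eq_bot.2 hb.1) (LinearMap.range_eq_top.2 hb.2), by ext; rfl⟩
  have hFL : HasFDerivAt F (L : E →L[ℝ] E') a := by
    rw [hL]; exact (hFa.differentiableAt (by simp)).hasFDerivAt
  set e := hFa.toOpenPartialHomeomorph F hFL (by simp) with he
  have hea : a ∈ e.source := hFa.mem_toOpenPartialHomeomorph_source hFL (by simp)
  have hecoe : (e : E → E') = F := hFa.toOpenPartialHomeomorph_coe hFL (by simp)
  -- The points where the derivative is invertible form an open set. The local inverse is smooth at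
  -- their images, hence on an open set and not only at the image of `a`.
  set D₁ : Set E := D ∩ fderiv ℝ F ⁻¹' range ((↑) : (E ≃L[ℝ] E') → E →L[ℝ] E') with hD₁
  have hD₁o : IsOpen D₁ := by
    refine ContinuousOn.isOpen_inter_preimage ?_ hDo ContinuousLinearEquiv.isOpen
    exact hFD.continuousOn_fderiv_of_isOpen hDo (by simp)
  set N : Set E' := e.target ∩ e.symm ⁻¹' D₁ with hN
  have hNo : IsOpen N := e.isOpen_inter_preimage_symm hD₁o
  have hFe : ∀ z ∈ N, F (e.symm z) = z := fun z hz => by rw [← hecoe]; exact e.right_inv hz.1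
  refine ⟨ψ.source ∩ ψ ⁻¹' N, fun y => φ.symm (e.symm (ψ y)),
    (continuousOn_extChartAt _).isOpen_inter_preimage hψs hNo, ⟨hxψ, ?_⟩, ?_, ?_, ?_, ?_⟩
  · have h1 : ψ (f x) = e a := by rw [hecoe]; simp [hF, hφa]
    have h2 : e.symm (e a) = a := e.left_inv hea
    rw [mem_preimage, h1]
    refine ⟨e.map_source hea, ?_⟩
    rw [mem_preimage, h2]
    exact ⟨haD, L, hL⟩
  · have h1 : ContDiffOn ℝ ∞ e.symm N := by
      intro z hz
      obtain ⟨L', hL'⟩ := hz.2.2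
      refine (e.contDiffAt_symm (f₀' := L') hz.1 ?_ ?_).contDiffWithinAt
      · rw [hL', hecoe]; exact ((hcd _ hz.2.1).differentiableAt (by simp)).hasFDerivAt
      · rw [hecoe]; exact hcd _ hz.2.1
    refine (contMDiffOn_extChartAt_symm (I := I) x).comp
      ((contMDiffOn_iff_contDiffOn.2 h1).comp
      ((contMDiffOn_extChartAt (I := I') (x := f x)).mono ?_) fun y hy => hy.2) ?_
    · intro y hy; rw [← extChartAt_source I']; exact hy.1
    · intro y hy; exact hy.2.2.1.1
  · have h1 : ψ (f x) = e a := by rw [hecoe]; simp [hF, hφa]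
    have h2 : e.symm (e a) = a := e.left_inv hea
    simp only [h1, h2, hφa]
  · intro y hy
    have h1 := hFe _ hy.2
    have h2 : φ.symm (e.symm (ψ y)) ∈ U₁ := hy.2.2.1.2
    exact ⟨h2.1.1, ψ.injOn h2.2 hy.1 h1⟩
  · refine ⟨U₁ ∩ φ ⁻¹' (e.source ∩ D₁), ?_, ⟨⟨⟨hx, hxφ⟩, hxψ⟩, hea, haD, L, hL⟩,
      fun y hy => hy.1.1.1, ?_⟩
    · exact ((continuousOn_extChartAt x).mono fun y hy => hy.1.2).isOpen_inter_preimage hU₁o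
        (e.open_source.inter hD₁o)
    · intro z hz
      have h0 : φ.symm (φ z) = z := φ.left_inv hz.1.1.2
      have h1 : ψ (f z) = e (φ z) := by rw [hecoe]; simp [hF, h0]
      have h2 : e.symm (e (φ z)) = φ z := e.left_inv hz.2.1
      refine ⟨⟨hz.1.2, ?_⟩, ?_⟩
      · rw [mem_preimage, h1]
        refine ⟨e.map_source hz.2.1, ?_⟩
        rw [mem_preimage, h2]; exact hz.2.2
      · simp only [h1, h2, h0]

end InverseFunction

section Submersion

variable {E : Type*} [NormedAddCommGroup E] [NormedSpace ℝ E] [FiniteDimensional ℝ E]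
  {M : Type*} [TopologicalSpace M] [ChartedSpace E M] [IsManifold 𝓘(ℝ, E) ∞ M]
  {F : Type*} [NormedAddCommGroup F] [NormedSpace ℝ F] [FiniteDimensional ℝ F]
  {N : Type*} [TopologicalSpace N] [ChartedSpace F N] [IsManifold 𝓘(ℝ, F) ∞ N]

/-- Near a point where `f` is a submersion, `f` has a complementary coordinate `b` with values in
the kernel of its derivative, vanishing at that point: `(f, b)` is a local diffeomorphism, with
local inverse `θ`. -/
theorem exists_complementary_coordinate {f : M → N} (hf : ContMDiff 𝓘(ℝ, E) 𝓘(ℝ, F) ∞ f) (x₀ : M)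
    (hs : Function.Surjective (mfderiv 𝓘(ℝ, E) 𝓘(ℝ, F) f x₀)) :
    ∃ (K : Submodule ℝ E) (b : M → K) (θ : N × K → M) (U : Set M) (V : Set (N × K)),
      Module.finrank ℝ K + Module.finrank ℝ F = Module.finrank ℝ E ∧
      IsOpen U ∧ x₀ ∈ U ∧ IsOpen V ∧ ContMDiffOn 𝓘(ℝ, E) 𝓘(ℝ, K) ∞ b U ∧
      ContMDiffOn (𝓘(ℝ, F).prod 𝓘(ℝ, K)) 𝓘(ℝ, E) ∞ θ V ∧
      (∀ x ∈ U, (f x, b x) ∈ V ∧ θ (f x, b x) = x) ∧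
      (∀ p ∈ V, f (θ p) = p.1) ∧ b x₀ = 0 ∧
      (∀ v : TangentSpace 𝓘(ℝ, E) x₀, mfderiv 𝓘(ℝ, E) 𝓘(ℝ, F) f x₀ v = 0 →
        mfderiv 𝓘(ℝ, E) 𝓘(ℝ, K) b x₀ v = 0 → v = 0) := by
  set A : E →L[ℝ] F := mfderiv 𝓘(ℝ, E) 𝓘(ℝ, F) f x₀ with hA
  set K : Submodule ℝ E := LinearMap.ker A.toLinearMap with hK
  obtain ⟨q₀, hq₀⟩ := LinearMap.exists_leftInverse_of_injective K.subtype K.ker_subtype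
  set q : E →L[ℝ] K := q₀.toContinuousLinearMap with hq
  have hqK : ∀ v : K, q v = v := fun v => LinearMap.congr_fun hq₀ v
  set φ := extChartAt 𝓘(ℝ, E) x₀ with hφ
  -- The kernel component of the chart.
  set b : M → K := fun x => q (φ x - φ x₀) with hb
  have hφs : IsOpen φ.source := isOpen_extChartAt_source x₀
  have hbU : ContMDiffOn 𝓘(ℝ, E) 𝓘(ℝ, K) ∞ b φ.source := by
    have h1 : ContMDiffOn 𝓘(ℝ, E) 𝓘(ℝ, E) ∞ φ φ.source := by
      rw [hφ, extChartAt_source]; exact contMDiffOn_extChartAt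
    exact q.contDiff.contMDiff.comp_contMDiffOn (h1.sub contMDiffOn_const)
  have hx₀ : x₀ ∈ φ.source := mem_extChartAt_source x₀
  have hbd : HasMFDerivAt 𝓘(ℝ, E) 𝓘(ℝ, K) b x₀ q := by
    have h1 : HasMFDerivAt 𝓘(ℝ, E) 𝓘(ℝ, E) φ x₀ (ContinuousLinearMap.id ℝ E) := by
      have h := (mdifferentiableAt_extChartAt (I := 𝓘(ℝ, E)) (mem_chart_source E x₀)).hasMFDerivAt
      rw [mfderiv_extChartAt_self] at h
      exact h
    have h2 : HasMFDerivAt 𝓘(ℝ, E) 𝓘(ℝ, K) (fun y : E => q (y - φ x₀)) (φ x₀) q := by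
      refine HasFDerivAt.hasMFDerivAt ?_
      have h := q.hasFDerivAt.comp (φ x₀) ((hasFDerivAt_id (φ x₀)).sub_const (φ x₀))
      rwa [ContinuousLinearMap.comp_id] at h
    exact h2.comp x₀ h1
  have hfd : HasMFDerivAt 𝓘(ℝ, E) 𝓘(ℝ, F) f x₀ A :=
    (hf.mdifferentiableAt (by simp)).hasMFDerivAt
  have hinj : ∀ v : E, A v = 0 → q v = 0 → v = 0 := by
    intro v hv hqv
    have h1 : v ∈ K := hv
    have h2 := hqK ⟨v, h1⟩
    rw [hqv] at h2
    exact congrArg Subtype.val h2.symm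
  have hdim : Module.finrank ℝ K + Module.finrank ℝ F = Module.finrank ℝ E := by
    have h := LinearMap.finrank_range_add_finrank_ker A.toLinearMap
    have hr : LinearMap.range A.toLinearMap = ⊤ := LinearMap.range_eq_top.2 hs
    rw [hr, finrank_top] at h
    have h' : Module.finrank ℝ F + Module.finrank ℝ K = Module.finrank ℝ E := h
    omega
  have hbij : Function.Bijective (A.prod q : E →L[ℝ] F × K) := by
    have hi : Function.Injective (A.prod q).toLinearMap := by
      rw [← LinearMap.ker_eq_bot, LinearMap.ker_eq_bot']
      intro v hv
      exact hinj v (congrArg Prod.fst hv) (congrArg Prod.snd hv)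
    refine ⟨hi, ?_⟩
    refine (LinearMap.injective_iff_surjective_of_finrank_eq_finrank ?_).1 hi
    rw [Module.finrank_prod]; omega
  have hprod := (hfd.prodMk hbd).mfderiv
  obtain ⟨V, θ, hV, hxV, hθ, hθx, hVU, W, hW, hxW, hWU, hWV⟩ := exists_local_inverse
    (I := 𝓘(ℝ, E)) (I' := 𝓘(ℝ, F).prod 𝓘(ℝ, K)) (f := fun x => (f x, b x)) hφs
    (hf.contMDiffOn.prodMk hbU) hx₀ (by rw [hprod]; exact hbij)
  refine ⟨K, b, θ, W, V, hdim, hW, hxW, hV, hbU.mono hWU, hθ, hWV,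
    fun p hp => congrArg Prod.fst (hVU p hp).2, by simp [hb], fun v hv hqv => ?_⟩
  rw [hbd.mfderiv] at hqv
  exact hinj v hv hqv

/-- A smooth family of local sections of a submersion `f`, one through every point `x` near `x₀`:
the section `p ↦ s (p, x)` satisfies `s (f x, x) = x`. -/
theorem exists_section_family {f : M → N} (hf : ContMDiff 𝓘(ℝ, E) 𝓘(ℝ, F) ∞ f) (x₀ : M)
    (hs : Function.Surjective (mfderiv 𝓘(ℝ, E) 𝓘(ℝ, F) f x₀)) :
    ∃ (W : Set (N × M)) (s : N × M → M), IsOpen W ∧ (f x₀, x₀) ∈ W ∧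
      ContMDiffOn (𝓘(ℝ, F).prod 𝓘(ℝ, E)) 𝓘(ℝ, E) ∞ s W ∧ (∀ p ∈ W, f (s p) = p.1) ∧
      ∀ x, (f x, x) ∈ W → s (f x, x) = x := by
  obtain ⟨K, b, θ, U, V, -, hU, hx₀, hV, hb, hθ, hUV, hfθ, -, -⟩ :=
    exists_complementary_coordinate hf x₀ hs
  have hc : ContMDiffOn (𝓘(ℝ, F).prod 𝓘(ℝ, E)) (𝓘(ℝ, F).prod 𝓘(ℝ, K)) ∞
      (fun p : N × M => (p.1, b p.2)) (univ ×ˢ U) :=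
    contMDiffOn_fst.prodMk (hb.comp contMDiffOn_snd fun p hp => hp.2)
  refine ⟨(univ ×ˢ U) ∩ (fun p : N × M => (p.1, b p.2)) ⁻¹' V, fun p => θ (p.1, b p.2),
    hc.continuousOn.isOpen_inter_preimage (isOpen_univ.prod hU) hV,
    ⟨⟨mem_univ _, hx₀⟩, (hUV x₀ hx₀).1⟩, hθ.comp (hc.mono inter_subset_left) fun p hp => hp.2,
    fun p hp => hfθ _ hp.2, fun x hx => (hUV x hx.1.2).2⟩

end Submersion

/-! ### Velocities of curves -/

section Velocity

variable {E : Type*} [NormedAddCommGroup E] [NormedSpace ℝ E]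
  {H : Type*} [TopologicalSpace H] {I : ModelWithCorners ℝ E H}
  {M : Type*} [TopologicalSpace M] [ChartedSpace H M]
  {E' : Type*} [NormedAddCommGroup E'] [NormedSpace ℝ E']
  {H' : Type*} [TopologicalSpace H'] {I' : ModelWithCorners ℝ E' H'}
  {M' : Type*} [TopologicalSpace M'] [ChartedSpace H' M']

variable (I) in
/-- The velocity at time `0` of a curve. -/
def velocity (γ : ℝ → M) : TangentBundle I M := ⟨γ 0, mfderiv 𝓘(ℝ) I γ 0 (1 : ℝ)⟩

/-- Vectors at base points that are only propositionally equal are compared in the model space,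
which every fibre is by definition. -/
theorem tangent_ext {V W : TangentBundle I M} (h : V.1 = W.1) (h' : (V.2 : E) = W.2) : V = W := by
  obtain ⟨x, v⟩ := V
  obtain ⟨y, w⟩ := W
  obtain rfl : x = y := h
  exact congrArg (TotalSpace.mk x) h'

theorem velocity_comp {f : M → M'} {γ : ℝ → M} (hf : MDifferentiableAt I I' f (γ 0))
    (hγ : MDifferentiableAt 𝓘(ℝ) I γ 0) :
    velocity I' (fun t => f (γ t)) = tangentMap I I' f (velocity I γ) := by
  exact tangent_ext rfl (mfderiv_comp_apply (0 : ℝ) hf hγ (1 : ℝ))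

theorem velocity_congr {γ δ : ℝ → M} (h : γ =ᶠ[𝓝 0] δ) : velocity I γ = velocity I δ := by
  refine tangent_ext h.self_of_nhds ?_
  exact DFunLike.congr_fun (h.mfderiv_eq (I := 𝓘(ℝ)) (I' := I)) (1 : ℝ)

theorem velocity_of_hasMFDerivAt {γ : ℝ → M} {A : TangentSpace 𝓘(ℝ) (0 : ℝ) →L[ℝ] TangentSpace I (γ 0)}
    (h : HasMFDerivAt 𝓘(ℝ) I γ 0 A) : velocity I γ = ⟨γ 0, A (1 : ℝ)⟩ := by
  rw [velocity, h.mfderiv]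

theorem velocity_const (x : M) : velocity I (fun _ => x) = ⟨x, 0⟩ :=
  velocity_of_hasMFDerivAt (hasMFDerivAt_const x (0 : ℝ))

/-- The identification of a pair of tangent vectors with a tangent vector to the product. -/
def tangentPair (V : TangentBundle I M) (W : TangentBundle I' M') :
    TangentBundle (I.prod I') (M × M') :=
  (equivTangentBundleProd I M I' M').symm (V, W)

theorem velocity_prodMk {γ : ℝ → M} {δ : ℝ → M'} (hγ : MDifferentiableAt 𝓘(ℝ) I γ 0)
    (hδ : MDifferentiableAt 𝓘(ℝ) I' δ 0) :
    velocity (I.prod I') (fun t => (γ t, δ t)) = tangentPair (velocity I γ) (velocity I' δ) :=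
  velocity_of_hasMFDerivAt (hγ.hasMFDerivAt.prodMk hδ.hasMFDerivAt)

theorem contMDiff_tangentPair [IsManifold I 1 M] [IsManifold I' 1 M'] :
    ContMDiff (I.tangent.prod I'.tangent) (I.prod I').tangent ∞
      (fun p : TangentBundle I M × TangentBundle I' M' => tangentPair p.1 p.2) :=
  contMDiff_equivTangentBundleProd_symm

theorem contMDiffOn_tangentMap [IsManifold I 1 M] [IsManifold I' 1 M'] {f : M → M'} {U : Set M}
    (hU : IsOpen U) (hf : ContMDiffOn I I' ∞ f U) :
    ContMDiffOn I.tangent I'.tangent ∞ (tangentMap I I' f) (TotalSpace.proj ⁻¹' U) := by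
  refine (hf.contMDiffOn_tangentMapWithin (m := ∞) (by simp) hU.uniqueMDiffOn).congr fun V hV => ?_
  exact (tangentMapWithin_eq_tangentMap (hU.uniqueMDiffOn _ hV)
    (((hf _ hV).contMDiffAt (hU.mem_nhds hV)).mdifferentiableAt (by simp))).symm

end Velocity

section Velocity

variable {E : Type*} [NormedAddCommGroup E] [NormedSpace ℝ E]
  {M : Type*} [TopologicalSpace M] [ChartedSpace E M] [IsManifold 𝓘(ℝ, E) ∞ M]

/-- Every tangent vector is the velocity of a curve, a straight line in a chart. -/
theorem exists_velocity_eq (V : TangentBundle 𝓘(ℝ, E) M) :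
    ∃ γ : ℝ → M, ContMDiffAt 𝓘(ℝ) 𝓘(ℝ, E) ∞ γ 0 ∧ velocity 𝓘(ℝ, E) γ = V := by
  obtain ⟨x, v⟩ := V
  suffices key : ∀ w : E, ∃ γ : ℝ → M, ContMDiffAt 𝓘(ℝ) 𝓘(ℝ, E) ∞ γ 0 ∧
      velocity 𝓘(ℝ, E) γ = ⟨x, w⟩ from key v
  intro w
  set φ := extChartAt 𝓘(ℝ, E) x with hφ
  set c : ℝ → E := fun t => φ x + t • w with hc
  have hc0 : c 0 = φ x := by simp [hc]
  have hcd : HasDerivAt c w 0 := by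
    simpa [hc] using ((hasDerivAt_id (0 : ℝ)).smul_const w).const_add (φ x)
  have hφx : φ.symm (φ x) = x := φ.left_inv (mem_extChartAt_source x)
  have hs : ContMDiffAt 𝓘(ℝ, E) 𝓘(ℝ, E) ∞ φ.symm (c 0) := by
    rw [hc0]
    exact (contMDiffOn_extChartAt_symm x _ (mem_extChartAt_target x)).contMDiffAt
      ((isOpen_extChartAt_target x).mem_nhds (mem_extChartAt_target x))
  have hcs : ContMDiffAt 𝓘(ℝ) 𝓘(ℝ, E) ∞ c 0 := by
    refine ContDiffAt.contMDiffAt ?_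
    simp only [hc]; fun_prop
  refine ⟨fun t => φ.symm (c t), hs.comp (0 : ℝ) hcs, ?_⟩
  rw [velocity_comp (hs.mdifferentiableAt (by simp)) (hcs.mdifferentiableAt (by simp)),
    velocity_of_hasMFDerivAt hcd.hasFDerivAt.hasMFDerivAt]
  refine tangent_ext (by simp [hc0, hφx]) ?_
  have h2 : mfderiv 𝓘(ℝ, E) 𝓘(ℝ, E) φ.symm (c 0) = ContinuousLinearMap.id ℝ E := by
    have h := mfderivWithin_range_extChartAt_symm (I := 𝓘(ℝ, E)) (x := x)
    rw [ModelWithCorners.range_eq_univ, mfderivWithin_univ] at h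
    rw [hc0]
    exact h
  exact (DFunLike.congr_fun h2 _).trans (one_smul ℝ w)

end Velocity

/-! ### Submersions of total spaces of vector bundles -/

section BundleMap

variable {E : Type*} [NormedAddCommGroup E] [NormedSpace ℝ E]
  {H : Type*} [TopologicalSpace H] {I : ModelWithCorners ℝ E H}
  {M : Type*} [TopologicalSpace M] [ChartedSpace H M] [IsManifold I ∞ M]
  {K : Type*} [NormedAddCommGroup K] [NormedSpace ℝ K]
  {V : M → Type*} [TopologicalSpace (TotalSpace K V)] [∀ x, TopologicalSpace (V x)]
  [∀ x, AddCommGroup (V x)] [∀ x, Module ℝ (V x)] [FiberBundle K V] [VectorBundle ℝ K V]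
  [ContMDiffVectorBundle ∞ K V I]
  {E' : Type*} [NormedAddCommGroup E'] [NormedSpace ℝ E']
  {H' : Type*} [TopologicalSpace H'] {I' : ModelWithCorners ℝ E' H'}
  {M' : Type*} [TopologicalSpace M'] [ChartedSpace H' M'] [IsManifold I' ∞ M']
  {K' : Type*} [NormedAddCommGroup K'] [NormedSpace ℝ K']
  {V' : M' → Type*} [TopologicalSpace (TotalSpace K' V')] [∀ x, TopologicalSpace (V' x)]
  [∀ x, AddCommGroup (V' x)] [∀ x, Module ℝ (V' x)] [FiberBundle K' V'] [VectorBundle ℝ K' V']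
  [ContMDiffVectorBundle ∞ K' V' I']

/-- A smooth bundle map over a submersion that is linear and onto on a fibre is a submersion at the
points of that fibre. -/
theorem mfderiv_bundleMap_surjective {T : TotalSpace K V → TotalSpace K' V'} {f : M → M'}
    (hTf : ∀ v, (T v).1 = f v.1) (x₀ : M) (w₀ : V x₀)
    (hT : MDifferentiableAt (I.prod 𝓘(ℝ, K)) (I'.prod 𝓘(ℝ, K')) T ⟨x₀, w₀⟩)
    (hf : MDifferentiableAt I I' f x₀) (hfs : Function.Surjective (mfderiv I I' f x₀))
    (A : V x₀ →L[ℝ] V' (f x₀)) (hA : ∀ w, T ⟨x₀, w⟩ = ⟨f x₀, A w⟩)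
    (hAs : Function.Surjective A) :
    Function.Surjective (mfderiv (I.prod 𝓘(ℝ, K)) (I'.prod 𝓘(ℝ, K')) T ⟨x₀, w₀⟩) := by
  set v₀ : TotalSpace K V := ⟨x₀, w₀⟩ with hv₀
  set e := trivializationAt K V x₀ with he
  set e' := trivializationAt K' V' (T v₀).1 with he'
  have hxe : x₀ ∈ e.baseSet := FiberBundle.mem_baseSet_trivializationAt' x₀
  have hve : v₀ ∈ e.source := e.mem_source.2 hxe
  have hxe' : (T v₀).1 ∈ e'.baseSet := FiberBundle.mem_baseSet_trivializationAt' _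
  have hve' : T v₀ ∈ e'.source := e'.mem_source.2 hxe'
  have hfe' : f x₀ ∈ e'.baseSet := (hTf v₀) ▸ hxe'
  -- the trivialization at the image is a local diffeomorphism
  have hde' : MDifferentiableAt (I'.prod 𝓘(ℝ, K')) (I'.prod 𝓘(ℝ, K')) e' (T v₀) :=
    ((e'.contMDiffOn (IB := I') (n := ∞) _ hve').contMDiffAt
      (e'.open_source.mem_nhds hve')).mdifferentiableAt (by simp)
  have hds' : MDifferentiableAt (I'.prod 𝓘(ℝ, K')) (I'.prod 𝓘(ℝ, K')) e'.toOpenPartialHomeomorph.symm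
      (e' (T v₀)) :=
    ((e'.contMDiffOn_symm (IB := I') (n := ∞) _ (e'.map_source hve')).contMDiffAt
      (e'.open_target.mem_nhds (e'.map_source hve'))).mdifferentiableAt (by simp)
  have hinj : Function.Injective (mfderiv (I'.prod 𝓘(ℝ, K')) (I'.prod 𝓘(ℝ, K')) e' (T v₀)) := by
    have h := hds'.hasMFDerivAt.comp (T v₀) hde'.hasMFDerivAt
    have h2 := h.congr_of_eventuallyEq (f₁ := id) (by
      filter_upwards [e'.open_source.mem_nhds hve'] with v hv
      exact (e'.toOpenPartialHomeomorph.left_inv hv).symm)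
    have h3 := hasMFDerivAt_unique h2 (hasMFDerivAt_id (I := I'.prod 𝓘(ℝ, K')) (T v₀))
    intro a b hab
    have ha := DFunLike.congr_fun h3 a
    have hb := DFunLike.congr_fun h3 b
    refine ha.symm.trans (Eq.trans ?_ hb)
    exact congrArg (mfderiv (I'.prod 𝓘(ℝ, K')) (I'.prod 𝓘(ℝ, K'))
      e'.toOpenPartialHomeomorph.symm (e' (T v₀))) hab
  -- a local section through `v₀`
  set k₀ : K := (e v₀).2 with hk₀
  have hev : e v₀ = (x₀, k₀) := Prod.ext (e.coe_fst hve) rfl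
  have hdes : MDifferentiableAt (I.prod 𝓘(ℝ, K)) (I.prod 𝓘(ℝ, K)) e.toOpenPartialHomeomorph.symm
      (x₀, k₀) := by
    rw [← hev]
    exact ((e.contMDiffOn_symm (IB := I) (n := ∞) _ (e.map_source hve)).contMDiffAt
      (e.open_target.mem_nhds (e.map_source hve))).mdifferentiableAt (by simp)
  have hsymm : e.toOpenPartialHomeomorph.symm (x₀, k₀) = v₀ := by
    rw [← hev]; exact e.toOpenPartialHomeomorph.left_inv hve
  set g : TotalSpace K V → M' × K' := fun v => e' (T v) with hg
  have hgd : HasMFDerivAt (I.prod 𝓘(ℝ, K)) (I'.prod 𝓘(ℝ, K')) g v₀ _ :=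
    hde'.hasMFDerivAt.comp v₀ hT.hasMFDerivAt
  set G := (mfderiv (I'.prod 𝓘(ℝ, K')) (I'.prod 𝓘(ℝ, K')) e' (T v₀)) ∘L
    (mfderiv (I.prod 𝓘(ℝ, K)) (I'.prod 𝓘(ℝ, K')) T v₀) with hG
  suffices hGs : Function.Surjective G by
    intro a
    obtain ⟨b, hb⟩ := hGs (mfderiv (I'.prod 𝓘(ℝ, K')) (I'.prod 𝓘(ℝ, K')) e' (T v₀) a)
    exact ⟨b, hinj hb⟩
  have hσ : HasMFDerivAt I (I.prod 𝓘(ℝ, K)) (fun y : M => e.toOpenPartialHomeomorph.symm (y, k₀)) x₀ _ :=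
    hdes.hasMFDerivAt.comp x₀ ((hasMFDerivAt_id x₀).prodMk (hasMFDerivAt_const k₀ x₀))
  have hι : HasMFDerivAt 𝓘(ℝ, K) (I.prod 𝓘(ℝ, K)) (fun k : K => e.toOpenPartialHomeomorph.symm (x₀, k)) k₀ _ :=
    hdes.hasMFDerivAt.comp k₀ ((hasMFDerivAt_const x₀ k₀).prodMk (hasMFDerivAt_id k₀))
  rw [← hsymm] at hgd
  have hgσ := hgd.comp x₀ hσ
  have hgι := hgd.comp k₀ hι
  set B : K →L[ℝ] K' := (e'.continuousLinearMapAt ℝ (f x₀)) ∘L A ∘L (e.symmL ℝ x₀) with hB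
  -- `B` is `A` in the trivializations: the derivative of `T` along the fibre.
  have hBs : Function.Surjective B := by
    intro w
    obtain ⟨u, hu⟩ := hAs (e'.symmL ℝ (f x₀) w)
    refine ⟨e.continuousLinearMapAt ℝ x₀ u, ?_⟩
    simp only [hB, ContinuousLinearMap.comp_apply]
    rw [e.symmL_continuousLinearMapAt hxe, hu, e'.continuousLinearMapAt_symmL hfe']
  have hgιB : ∀ k, g (e.toOpenPartialHomeomorph.symm (x₀, k)) = (f x₀, B k) := by
    intro k
    have h1 : e.toOpenPartialHomeomorph.symm (x₀, k) = ⟨x₀, e.symmL ℝ x₀ k⟩ :=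
      ((e.mk_symm hxe k).symm.trans (by rw [e.symmL_apply hxe]))
    change e' (T _) = _
    rw [h1, hA]
    refine Prod.ext (e'.coe_fst (e'.mem_source.2 hfe')) ?_
    simp only [hB, ContinuousLinearMap.comp_apply]
    rw [Bundle.Trivialization.continuousLinearMapAt_apply,
      Bundle.Trivialization.coe_linearMapAt_of_mem _ hfe']
  have hι2 := hasMFDerivAt_unique hgι (((hasMFDerivAt_const (I' := I') (f x₀) k₀).prodMk
    (B.hasMFDerivAt (x := k₀))).congr_of_eventuallyEq (Eventually.of_forall hgιB))
  have hσ2 : HasMFDerivAt I I' f x₀ _ :=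
    (((hasMFDerivAt_fst (I := I') (I' := 𝓘(ℝ, K'))
      (x := g (e.toOpenPartialHomeomorph.symm (x₀, k₀)))).comp x₀ hgσ)).congr_of_eventuallyEq (by
      filter_upwards [e.open_baseSet.mem_nhds hxe, hf.continuousAt.preimage_mem_nhds
        (e'.open_baseSet.mem_nhds hfe')] with y hy hy'
      have h1 : e.toOpenPartialHomeomorph.symm (y, k₀) = ⟨y, e.symm y k₀⟩ := (e.mk_symm hy k₀).symm
      have h2 : (T ⟨y, e.symm y k₀⟩).1 = f y := hTf _
      change f y = (e' (T (e.toOpenPartialHomeomorph.symm (y, k₀)))).1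
      rw [h1, e'.coe_fst (e'.mem_source.2 (h2 ▸ hy')), h2])
  have hσ3 := hasMFDerivAt_unique hσ2 hf.hasMFDerivAt
  -- Reach the component `u` along the section, then correct the fibre component.
  rintro ⟨u, w⟩
  obtain ⟨u₀, hu₀⟩ := hfs u
  set S := mfderiv (I.prod 𝓘(ℝ, K)) (I.prod 𝓘(ℝ, K)) e.toOpenPartialHomeomorph.symm (x₀, k₀)
  set a := S (u₀, 0) with ha
  have h1 : (G a : E' × K').1 = u := (DFunLike.congr_fun hσ3 u₀).trans hu₀
  obtain ⟨k, hk⟩ := hBs (w - (G a : E' × K').2)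
  have h2 : (G (S (0, k)) : E' × K') = (0, B k) := DFunLike.congr_fun hι2 k
  refine ⟨a + S (0, k), ?_⟩
  refine (map_add G a (S (0, k))).trans ?_
  have h3 : (G a + G (S (0, k)) : E' × K') = (u, w) := by
    refine Prod.ext ?_ ?_
    · change (G a : E' × K').1 + (G (S (0, k)) : E' × K').1 = u
      rw [h2, h1]; exact add_zero u
    · change (G a : E' × K').2 + (G (S (0, k)) : E' × K').2 = w
      rw [h2, hk]; exact add_sub_cancel _ _
  exact h3

end BundleMap

/-! ### Smooth maps into dual bundles -/

section DualBundle

variable {E : Type*} [NormedAddCommGroup E] [NormedSpace ℝ E]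
  {H : Type*} [TopologicalSpace H] {I : ModelWithCorners ℝ E H}
  {M : Type*} [TopologicalSpace M] [ChartedSpace H M] [IsManifold I ∞ M]
  {K : Type*} [NormedAddCommGroup K] [NormedSpace ℝ K]
  {V : M → Type*} [TopologicalSpace (TotalSpace K V)] [∀ x, TopologicalSpace (V x)]
  [∀ x, AddCommGroup (V x)] [∀ x, Module ℝ (V x)] [FiberBundle K V] [VectorBundle ℝ K V]
  [ContMDiffVectorBundle ∞ K V I]
  {EX : Type*} [NormedAddCommGroup EX] [NormedSpace ℝ EX]
  {HX : Type*} [TopologicalSpace HX] {IX : ModelWithCorners ℝ EX HX}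
  {X : Type*} [TopologicalSpace X] [ChartedSpace HX X]

/-- In finite dimensions a family of functionals is smooth if it is so on each vector. -/
theorem contMDiffWithinAt_of_forall_apply [FiniteDimensional ℝ K] {f : X → K →L[ℝ] ℝ} {s : Set X}
    {x₀ : X} (h : ∀ k, ContMDiffWithinAt IX 𝓘(ℝ) ∞ (fun x => f x k) s x₀) :
    ContMDiffWithinAt IX 𝓘(ℝ, K →L[ℝ] ℝ) ∞ f s x₀ := by
  set b := Module.finBasis ℝ K
  set L : (Fin (Module.finrank ℝ K) → ℝ) →ₗ[ℝ] (K →L[ℝ] ℝ) :=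
    LinearMap.toContinuousLinearMap.toLinearMap ∘ₗ (b.constr ℝ).toLinearMap
  have hL : ∀ x, f x = L.toContinuousLinearMap (fun i => f x (b i)) := by
    intro x
    refine ContinuousLinearMap.coe_injective (b.ext fun i => ?_)
    simp [L]
  refine ContMDiffWithinAt.congr ?_ (fun x _ => hL x) (hL x₀)
  exact L.toContinuousLinearMap.contDiff.contMDiff.contMDiffAt.comp_contMDiffWithinAt x₀
    (contMDiffWithinAt_pi_space.2 fun i => h (b i))

/-- In a trivialization near `b x₀`, the constant vector `k` defines a smooth lift of `b`. -/
theorem contMDiffWithinAt_symmL (e : Bundle.Trivialization K (TotalSpace.proj : TotalSpace K V → M))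
    [MemTrivializationAtlas e] {b : X → M} {s : Set X} {x₀ : X} (hb : ContMDiffWithinAt IX I ∞ b s x₀)
    (hx₀ : b x₀ ∈ e.baseSet) (k : K) :
    ContMDiffWithinAt IX (I.prod 𝓘(ℝ, K)) ∞
      (fun x => (⟨b x, e.symmL ℝ (b x) k⟩ : TotalSpace K V)) s x₀ := by
  have h1 : ContMDiffAt (I.prod 𝓘(ℝ, K)) (I.prod 𝓘(ℝ, K)) ∞ e.toOpenPartialHomeomorph.symm (b x₀, k) :=
    (e.contMDiffOn_symm (IB := I) (n := ∞) _ (e.mem_target.2 hx₀)).contMDiffAt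
      (e.open_target.mem_nhds (e.mem_target.2 hx₀))
  have h2 := h1.comp_contMDiffWithinAt x₀ (hb.prodMk (contMDiffWithinAt_const (c := k)))
  have he : ∀ x, b x ∈ e.baseSet → (⟨b x, e.symmL ℝ (b x) k⟩ : TotalSpace K V) =
      e.toOpenPartialHomeomorph.symm (b x, k) := fun x hx => by
    rw [e.symmL_apply hx]; exact e.mk_symm hx k
  refine h2.congr_of_eventuallyEq ?_ (he x₀ hx₀)
  filter_upwards [hb.continuousWithinAt (e.open_baseSet.mem_nhds hx₀)] with x hx
  exact he x hx

/-- A map into the dual of a vector bundle is smooth if its pairing with every smooth lift of its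
base map is. -/
theorem contMDiffWithinAt_dual [FiniteDimensional ℝ K]
    {F : X → TotalSpace (K →L[ℝ] ℝ) (fun x => V x →L[ℝ] ℝ)} {s : Set X} {x₀ : X}
    (hb : ContMDiffWithinAt IX I ∞ (fun x => (F x).1) s x₀)
    (h : ∀ v : ∀ x, V (F x).1,
      ContMDiffWithinAt IX (I.prod 𝓘(ℝ, K)) ∞ (fun x => (⟨(F x).1, v x⟩ : TotalSpace K V)) s x₀ →
      ContMDiffWithinAt IX 𝓘(ℝ) ∞ (fun x => (F x).2 (v x)) s x₀) :
    ContMDiffWithinAt IX (I.prod 𝓘(ℝ, K →L[ℝ] ℝ)) ∞ F s x₀ := by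
  refine (contMDiffWithinAt_hom_bundle (E₂ := Bundle.Trivial M ℝ) F).2 ⟨hb, ?_⟩
  refine contMDiffWithinAt_of_forall_apply fun k => ?_
  refine (h (fun x => (trivializationAt K V (F x₀).1).symmL ℝ (F x).1 k)
    (contMDiffWithinAt_symmL _ hb (FiberBundle.mem_baseSet_trivializationAt' _) k)).congr ?_ ?_
  · intro x _
    simp [ContinuousLinearMap.inCoordinates]
  · simp [ContinuousLinearMap.inCoordinates]

theorem contMDiffWithinAt_dual_apply
    {F : X → TotalSpace (K →L[ℝ] ℝ) (fun x => V x →L[ℝ] ℝ)} {s : Set X} {x₀ : X}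
    (hF : ContMDiffWithinAt IX (I.prod 𝓘(ℝ, K →L[ℝ] ℝ)) ∞ F s x₀) {v : ∀ x, V (F x).1}
    (hv : ContMDiffWithinAt IX (I.prod 𝓘(ℝ, K)) ∞
      (fun x => (⟨(F x).1, v x⟩ : TotalSpace K V)) s x₀) :
    ContMDiffWithinAt IX 𝓘(ℝ) ∞ (fun x => (F x).2 (v x)) s x₀ := by
  have h := ContMDiffWithinAt.clm_bundle_apply (E₂ := Bundle.Trivial M ℝ) (F₂ := ℝ) hF hv
  rw [Bundle.contMDiffWithinAt_totalSpace] at h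
  exact h.2

end DualBundle

section Pairing

variable {E : Type*} [NormedAddCommGroup E] [NormedSpace ℝ E]
  {H : Type*} [TopologicalSpace H] {I : ModelWithCorners ℝ E H}
  {M : Type*} [TopologicalSpace M] [ChartedSpace H M]
  {EX : Type*} [NormedAddCommGroup EX] [NormedSpace ℝ EX]
  {HX : Type*} [TopologicalSpace HX] {IX : ModelWithCorners ℝ EX HX}
  {X : Type*} [TopologicalSpace X] [ChartedSpace HX X]

/-- The pairing `⟨Φ, V⟩` of a covector and a tangent vector. It is meaningful when they have the
same base point; the definition reads both in the model space, so that no transport along an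
equality of base points is needed. -/
def pair (Φ : CotangentBundle I M) (V : TangentBundle I M) : ℝ :=
  (show E →L[ℝ] ℝ from Φ.2) (show E from V.2)

theorem cotangent_ext {Φ Ψ : CotangentBundle I M} (h : Φ.1 = Ψ.1)
    (h' : ∀ V : TangentBundle I M, V.1 = Φ.1 → pair Φ V = pair Ψ V) : Φ = Ψ := by
  obtain ⟨x, φ⟩ := Φ
  obtain ⟨y, ψ⟩ := Ψ
  obtain rfl : x = y := h
  exact congrArg (TotalSpace.mk x) (ContinuousLinearMap.ext fun v => h' ⟨x, v⟩ rfl)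

theorem contMDiffWithinAt_pair [IsManifold I ∞ M] {F : X → CotangentBundle I M}
    {v : X → TangentBundle I M} {s : Set X} {x₀ : X}
    (hF : ContMDiffWithinAt IX (I.prod 𝓘(ℝ, E →L[ℝ] ℝ)) ∞ F s x₀)
    (hv : ContMDiffWithinAt IX I.tangent ∞ v s x₀) (h : ∀ x, (F x).1 = (v x).1) :
    ContMDiffWithinAt IX 𝓘(ℝ) ∞ (fun x => pair (F x) (v x)) s x₀ := by
  have hv' : v = fun x => (⟨(F x).1, (show E from (v x).2)⟩ : TangentBundle I M) :=
    funext fun x => tangent_ext (h x).symm rfl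
  rw [hv'] at hv
  exact contMDiffWithinAt_dual_apply hF hv

end Pairing

/-! ### Functions and sections with prescribed germs -/

section Extension

variable {E : Type*} [NormedAddCommGroup E] [NormedSpace ℝ E] [FiniteDimensional ℝ E]
  {M : Type*} [TopologicalSpace M] [ChartedSpace E M] [IsManifold 𝓘(ℝ, E) ∞ M]
  [T2Space M] [SigmaCompactSpace M]
  {K : Type*} [NormedAddCommGroup K] [NormedSpace ℝ K]
  {V : M → Type*} [TopologicalSpace (TotalSpace K V)] [∀ x, TopologicalSpace (V x)]
  [∀ x, AddCommGroup (V x)] [∀ x, Module ℝ (V x)] [FiberBundle K V] [VectorBundle ℝ K V]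
  [ContMDiffVectorBundle ∞ K V 𝓘(ℝ, E)]

/-- A section defined near `x` agrees near `x` with a global one. -/
theorem exists_section_eventuallyEq {U : Set M} (hU : IsOpen U) {x : M} (hx : x ∈ U)
    {σ : ∀ x, V x} (hσ : ContMDiffOn 𝓘(ℝ, E) (𝓘(ℝ, E).prod 𝓘(ℝ, K)) ∞
      (fun y => (⟨y, σ y⟩ : TotalSpace K V)) U) :
    ∃ s : Cₛ^∞⟮𝓘(ℝ, E); K, V⟯, ∀ᶠ y in 𝓝 x, s y = σ y := by
  have := Manifold.locallyCompact_of_finiteDimensional (M := M) 𝓘(ℝ, E)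
  obtain ⟨C, hC, hCc, hCU⟩ := exists_mem_nhds_isClosed_subset (hU.mem_nhds hx)
  -- Global sections with prescribed values on a closed neighbourhood `C ⊆ U` exist by a partition
  -- of unity, the condition being convex on each fibre.
  obtain ⟨s, hs⟩ := exists_contMDiffSection_forall_mem_convex_of_local (I := 𝓘(ℝ, E)) (n := (⊤ : ℕ∞))
    (F_fiber := K) V (fun y => {v | y ∈ C → v = σ y}) (fun y => by
      by_cases hy : y ∈ C
      · simp only [hy, true_imp_iff]; exact convex_singleton _
      · simp only [hy, false_imp_iff]; exact convex_univ) (fun y => by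
      by_cases hy : y ∈ U
      · exact ⟨U, hU.mem_nhds hy, σ, hσ, fun _ _ _ => rfl⟩
      · refine ⟨Cᶜ, hCc.isOpen_compl.mem_nhds fun h => hy (hCU h), fun _ => 0,
          (Bundle.contMDiff_zeroSection ℝ V).contMDiffOn, fun z hz h => absurd h hz⟩)
  exact ⟨s, by filter_upwards [hC] with y hy using hs y hy⟩

theorem exists_function_eventuallyEq {U : Set M} (hU : IsOpen U) {x : M} (hx : x ∈ U)
    {f : M → ℝ} (hf : ContMDiffOn 𝓘(ℝ, E) 𝓘(ℝ) ∞ f U) :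
    ∃ g : C^∞⟮𝓘(ℝ, E), M; 𝓘(ℝ), ℝ⟯, ∀ᶠ y in 𝓝 x, g y = f y := by
  have := Manifold.locallyCompact_of_finiteDimensional (M := M) 𝓘(ℝ, E)
  obtain ⟨C, hC, hCc, hCU⟩ := exists_mem_nhds_isClosed_subset (hU.mem_nhds hx)
  obtain ⟨s, hs⟩ := exists_contMDiffMap_forall_mem_convex_of_local (I := 𝓘(ℝ, E)) (n := (⊤ : ℕ∞))
    (F := ℝ) (t := fun y => {v | y ∈ C → v = f y}) (fun y => by
      by_cases hy : y ∈ C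
      · simp only [hy, true_imp_iff]; exact convex_singleton _
      · simp only [hy, false_imp_iff]; exact convex_univ) (fun y => by
      by_cases hy : y ∈ U
      · exact ⟨U, hU.mem_nhds hy, f, hf, fun _ _ _ => rfl⟩
      · exact ⟨Cᶜ, hCc.isOpen_compl.mem_nhds fun h => hy (hCU h), fun _ => 0,
          contMDiffOn_const, fun z hz h => absurd h hz⟩)
  exact ⟨s, by filter_upwards [hC] with y hy using hs y hy⟩

theorem exists_section_eq (x : M) (v : V x) : ∃ s : Cₛ^∞⟮𝓘(ℝ, E); K, V⟯, s x = v := by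
  set e := trivializationAt K V x with he
  have hx : x ∈ e.baseSet := FiberBundle.mem_baseSet_trivializationAt' x
  obtain ⟨s, hs⟩ := exists_section_eventuallyEq (V := V) e.open_baseSet hx
    (σ := fun y => e.symmL ℝ y (e.continuousLinearMapAt ℝ x v)) (fun y hy =>
      contMDiffWithinAt_symmL (I := 𝓘(ℝ, E)) (IX := 𝓘(ℝ, E)) (b := id) e contMDiffWithinAt_id hy _)
  exact ⟨s, by rw [hs.self_of_nhds, e.symmL_continuousLinearMapAt hx]⟩

/-- Near `x`, the linear functional `ℓ` of the chart at `x` agrees with a global smooth function. -/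
theorem exists_function_eq_chart (x : M) (ℓ : E →L[ℝ] ℝ) :
    ∃ g : C^∞⟮𝓘(ℝ, E), M; 𝓘(ℝ), ℝ⟯, ∀ᶠ y in 𝓝 x, g y = ℓ (extChartAt 𝓘(ℝ, E) x y) := by
  refine exists_function_eventuallyEq (chartAt E x).open_source (mem_chart_source E x) ?_
  exact ℓ.contDiff.contMDiff.comp_contMDiffOn contMDiffOn_extChartAt

theorem mvfderiv_congr {f g : M → ℝ} {x : M} (h : f =ᶠ[𝓝 x] g) :
    mvfderiv 𝓘(ℝ, E) f x = mvfderiv 𝓘(ℝ, E) g x := by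
  ext v
  exact DFunLike.congr_fun (h.mfderiv_eq (I := 𝓘(ℝ, E)) (I' := 𝓘(ℝ))) v

theorem mvfderiv_clm_extChartAt {x y : M} (hy : y ∈ (chartAt E x).source) (ℓ : E →L[ℝ] ℝ)
    (v : TangentSpace 𝓘(ℝ, E) y) :
    mvfderiv 𝓘(ℝ, E) (fun z => ℓ (extChartAt 𝓘(ℝ, E) x z)) y v =
      ℓ (mfderiv 𝓘(ℝ, E) 𝓘(ℝ, E) (extChartAt 𝓘(ℝ, E) x) y v) := by
  have h1 : HasMFDerivAt 𝓘(ℝ, E) 𝓘(ℝ) ℓ (extChartAt 𝓘(ℝ, E) x y) ℓ :=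
    ℓ.hasFDerivAt.hasMFDerivAt
  have h2 := h1.comp y (mdifferentiableAt_extChartAt (I := 𝓘(ℝ, E)) hy).hasMFDerivAt
  exact DFunLike.congr_fun h2.mfderiv v

theorem exists_function_mvfderiv_eq (x : M) (ψ : CotangentSpace 𝓘(ℝ, E) x) :
    ∃ g : C^∞⟮𝓘(ℝ, E), M; 𝓘(ℝ), ℝ⟯, mvfderiv 𝓘(ℝ, E) g x = ψ := by
  obtain ⟨g, hg⟩ := exists_function_eq_chart x (show E →L[ℝ] ℝ from ψ)
  refine ⟨g, ?_⟩
  ext v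
  rw [mvfderiv_congr hg, mvfderiv_clm_extChartAt (mem_chart_source E x), mfderiv_extChartAt_self]
  rfl

/-- A tangent vector is determined by its action on global smooth functions. -/
theorem tangent_eq_of_forall_mvfderiv {x : M} {v w : TangentSpace 𝓘(ℝ, E) x}
    (h : ∀ f : C^∞⟮𝓘(ℝ, E), M; 𝓘(ℝ), ℝ⟯, mvfderiv 𝓘(ℝ, E) f x v = mvfderiv 𝓘(ℝ, E) f x w) :
    v = w := by
  have key : ∀ ℓ : E →L[ℝ] ℝ, ℓ v = ℓ w := fun ℓ => by
    obtain ⟨g, hg⟩ := exists_function_mvfderiv_eq x (show CotangentSpace 𝓘(ℝ, E) x from ℓ)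
    have h1 := h g
    rw [hg] at h1
    exact h1
  exact (Module.finBasis ℝ E).ext_elem fun i =>
    key ((Module.finBasis ℝ E).coord i).toContinuousLinearMap

variable {EX : Type*} [NormedAddCommGroup EX] [NormedSpace ℝ EX]
  {HX : Type*} [TopologicalSpace HX] {IX : ModelWithCorners ℝ EX HX}
  {X : Type*} [TopologicalSpace X] [ChartedSpace HX X]

theorem contMDiffWithinAt_of_forall_dual {f : X → E} {s : Set X} {x₀ : X}
    (h : ∀ ℓ : E →L[ℝ] ℝ, ContMDiffWithinAt IX 𝓘(ℝ) ∞ (fun x => ℓ (f x)) s x₀) :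
    ContMDiffWithinAt IX 𝓘(ℝ, E) ∞ f s x₀ := by
  set b := Module.finBasis ℝ E
  set L : (Fin (Module.finrank ℝ E) → ℝ) →L[ℝ] E := b.equivFun.symm.toLinearMap.toContinuousLinearMap
  have hL : ∀ x, f x = L (fun i => (b.coord i).toContinuousLinearMap (f x)) := fun x =>
    (b.equivFun.symm_apply_apply (f x)).symm
  refine ContMDiffWithinAt.congr ?_ (fun x _ => hL x) (hL x₀)
  exact L.contDiff.contMDiff.contMDiffAt.comp_contMDiffWithinAt x₀
    (contMDiffWithinAt_pi_space.2 fun i => h _)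

/-- A map into the tangent bundle is smooth if its base map is and the differentials of global
smooth functions evaluate smoothly along it. -/
theorem contMDiffWithinAt_tangent {F : X → TangentBundle 𝓘(ℝ, E) M} {s : Set X} {x₀ : X}
    (hb : ContMDiffWithinAt IX 𝓘(ℝ, E) ∞ (fun x => (F x).1) s x₀)
    (h : ∀ f : C^∞⟮𝓘(ℝ, E), M; 𝓘(ℝ), ℝ⟯,
      ContMDiffWithinAt IX 𝓘(ℝ) ∞ (fun x => mvfderiv 𝓘(ℝ, E) f (F x).1 (F x).2) s x₀) :
    ContMDiffWithinAt IX 𝓘(ℝ, E).tangent ∞ F s x₀ := by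
  refine (Bundle.contMDiffWithinAt_totalSpace).2 ⟨hb, ?_⟩
  refine contMDiffWithinAt_of_forall_dual fun ℓ => ?_
  obtain ⟨g, hg⟩ := exists_function_eq_chart (F x₀).1 ℓ
  have key : ∀ x, (∀ᶠ y in 𝓝 (F x).1, g y = ℓ (extChartAt 𝓘(ℝ, E) (F x₀).1 y)) →
      (F x).1 ∈ (chartAt E (F x₀).1).source →
      ℓ (trivializationAt E (TangentSpace 𝓘(ℝ, E)) (F x₀).1 (F x)).2 =
        mvfderiv 𝓘(ℝ, E) g (F x).1 (F x).2 := by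
    intro x h1 h2
    rw [mvfderiv_congr h1, mvfderiv_clm_extChartAt h2]
    refine congrArg ℓ (Eq.trans ?_ (DFunLike.congr_fun
      (TangentBundle.continuousLinearMapAt_trivializationAt (I := 𝓘(ℝ, E)) h2) (F x).2))
    rw [Bundle.Trivialization.continuousLinearMapAt_apply,
      Bundle.Trivialization.coe_linearMapAt_of_mem _ (by simpa using h2)]
  refine (h g).congr_of_eventuallyEq ?_ (key x₀ hg (mem_chart_source E _))
  filter_upwards [hb.continuousWithinAt hg.eventually_nhds,
    hb.continuousWithinAt ((chartAt E (F x₀).1).open_source.mem_nhds (mem_chart_source E _))]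
    with x h1 h2
  exact key x h1 h2

end Extension

/-! ### Point derivations and the Poisson anchor -/

section Hadamard

open MeasureTheory in
open scoped Convolution in
/-- Hadamard's lemma: `g y = g a + H y (y - a)` with `H y = ∫₀¹ Dg(a + t(y - a)) dt` smooth. -/
theorem exists_hadamard {E : Type*} [NormedAddCommGroup E] [NormedSpace ℝ E]
    {g : E → ℝ} (hg : ContDiff ℝ ∞ g) (a : E) :
    ∃ H : E → E →L[ℝ] ℝ, ContDiff ℝ ∞ H ∧ H a = fderiv ℝ g a ∧ ∀ y, g y = g a + H y (y - a) := by
  have hDg : ContDiff ℝ ∞ (fderiv ℝ g) := hg.fderiv_right (m := ∞) (by simp)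
  have hpath : ∀ y : E, Continuous fun t : ℝ => fderiv ℝ g (a + t • (y - a)) := fun y =>
    hDg.continuous.comp (by fun_prop)
  refine ⟨fun y => ∫ t in (0 : ℝ)..1, fderiv ℝ g (a + t • (y - a)), ?_, ?_, fun y => ?_⟩
  · -- The integral is the convolution at `0` of the indicator of `[0, 1]` with a cut-off integrand.
    obtain ⟨χ, hχ1, hχ2⟩ : ∃ χ : ℝ → ℝ, ContDiff ℝ ∞ χ ∧ HasCompactSupport χ ∧
        ∀ t ∈ Icc (-1 : ℝ) 0, χ t = 1 := by
      let b : ContDiffBump (0 : ℝ) := ⟨2, 3, by norm_num, by norm_num⟩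
      refine ⟨b, b.contDiff, b.hasCompactSupport, fun t ht => b.one_of_mem_closedBall ?_⟩
      rw [mem_closedBall_zero_iff, Real.norm_eq_abs, abs_le]
      change -2 ≤ t ∧ t ≤ 2
      exact ⟨by linarith [ht.1], by linarith [ht.2]⟩
    have hloc : LocallyIntegrable (indicator (Icc (0 : ℝ) 1) fun _ => (1 : ℝ)) volume :=
      ((integrable_indicator_iff measurableSet_Icc).2 (by simp)).locallyIntegrable
    have key := contDiffOn_convolution_right_with_param_comp (𝕜 := ℝ) (n := (⊤ : ℕ∞)) (μ := volume)
      (P := E) (ContinuousLinearMap.lsmul ℝ ℝ : ℝ →L[ℝ] (E →L[ℝ] ℝ) →L[ℝ] (E →L[ℝ] ℝ))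
      (s := univ) (v := fun _ => (0 : ℝ)) contDiffOn_const
      (g := fun y t => χ t • fderiv ℝ g (a - t • (y - a))) (k := tsupport χ) isOpen_univ hχ2.1
      (fun p t _ ht => by rw [image_eq_zero_of_notMem_tsupport ht, zero_smul]) hloc
      (ContDiff.contDiffOn (by
        change ContDiff ℝ ∞ fun p : E × ℝ => χ p.2 • fderiv ℝ g (a - p.2 • (p.1 - a))
        exact (hχ1.comp contDiff_snd).smul (hDg.comp (by fun_prop))))
    refine contDiffOn_univ.1 (ContDiffOn.congr (n := ∞) key fun y _ => ?_)
    rw [convolution_def, intervalIntegral.integral_of_le zero_le_one,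
      ← integral_Icc_eq_integral_Ioc, ← integral_indicator measurableSet_Icc]
    congr 1
    ext1 t
    by_cases ht : t ∈ Icc (0 : ℝ) 1
    · have h1 : χ (0 - t) = 1 := hχ2.2 _ ⟨by linarith [ht.2], by linarith [ht.1]⟩
      rw [zero_sub] at h1
      simp [indicator_of_mem ht, h1]
    · simp [indicator_of_notMem ht]
  · simp
  · have h1 : ∀ t ∈ uIcc (0 : ℝ) 1, HasDerivAt (fun t : ℝ => g (a + t • (y - a)))
        (fderiv ℝ g (a + t • (y - a)) (y - a)) t := fun t _ => by
      have h2 : HasDerivAt (fun t : ℝ => a + t • (y - a)) (y - a) t := by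
        simpa using ((hasDerivAt_id t).smul_const (y - a)).const_add a
      exact ((hg.differentiable (by simp)).differentiableAt.hasFDerivAt).comp_hasDerivAt t h2
    have h3 := intervalIntegral.integral_eq_sub_of_hasDerivAt h1
      (((hpath y).clm_apply continuous_const).intervalIntegrable 0 1)
    rw [ContinuousLinearMap.intervalIntegral_apply ((hpath y).intervalIntegrable 0 1), h3]
    simp

end Hadamard

section Derivation

variable {E : Type*} [NormedAddCommGroup E] [NormedSpace ℝ E] [FiniteDimensional ℝ E]
  {M : Type*} [TopologicalSpace M] [ChartedSpace E M] [IsManifold 𝓘(ℝ, E) ∞ M]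
  [T2Space M] [SigmaCompactSpace M]

theorem sum_apply_contMDiffMap {ι : Type*} (s : Finset ι) (f : ι → C^∞⟮𝓘(ℝ, E), M; 𝓘(ℝ), ℝ⟯)
    (x : M) : (∑ i ∈ s, f i : C^∞⟮𝓘(ℝ, E), M; 𝓘(ℝ), ℝ⟯) x = ∑ i ∈ s, f i x := by
  classical
  induction s using Finset.induction_on with
  | empty => rfl
  | insert a s ha ih =>
    rw [Finset.sum_insert ha, Finset.sum_insert ha, ← ih]
    rfl

theorem exists_bump {x : M} {s : Set M} (hs : s ∈ 𝓝 x) :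
    ∃ χ : C^∞⟮𝓘(ℝ, E), M; 𝓘(ℝ), ℝ⟯, χ x = 1 ∧ ∀ y ∉ s, χ y = 0 := by
  obtain ⟨f, -, hf⟩ := (SmoothBumpFunction.nhds_basis_tsupport (I := 𝓘(ℝ, E)) x).mem_iff.1 hs
  exact ⟨⟨f, f.contMDiff⟩, f.eq_one, fun y hy =>
    image_eq_zero_of_notMem_tsupport fun h => hy (hf h)⟩

variable {x : M} {D : C^∞⟮𝓘(ℝ, E), M; 𝓘(ℝ), ℝ⟯ →ₗ[ℝ] ℝ}

/-- A derivation at `x` is local: it depends only on the germ of the function at `x`. -/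
theorem derivation_congr (hD : ∀ f g, D (f * g) = f x * D g + D f * g x)
    {f g : C^∞⟮𝓘(ℝ, E), M; 𝓘(ℝ), ℝ⟯} (h : ∀ᶠ y in 𝓝 x, f y = g y) : D f = D g := by
  obtain ⟨χ, h1, h2⟩ := exists_bump (E := E) h
  -- A bump function `χ` at `x` kills `f - g`, and `0 = D (χ (f - g)) = D (f - g)`.
  have h3 : χ * (f - g) = 0 := by
    ext y
    by_cases hy : f y = g y
    · simp [hy]
    · simp [h2 y hy]
  have h4 := hD χ (f - g)
  have h5 : (f - g) x = 0 := sub_eq_zero.2 h.self_of_nhds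
  rw [h3, map_zero, h1, h5, map_sub] at h4
  linarith

theorem derivation_const (hD : ∀ f g, D (f * g) = f x * D g + D f * g x) (c : ℝ) :
    D (algebraMap ℝ _ c) = 0 := by
  have h1 := hD 1 1
  have h2 : (1 : C^∞⟮𝓘(ℝ, E), M; 𝓘(ℝ), ℝ⟯) x = 1 := rfl
  rw [h2, mul_one] at h1
  rw [Algebra.algebraMap_eq_smul_one, map_smul]
  have : D 1 = 0 := by linarith
  rw [this, smul_zero]

/-- By Hadamard's lemma a derivation at `x` kills the functions whose differential vanishes at
`x`. -/
theorem derivation_eq_zero (hD : ∀ f g, D (f * g) = f x * D g + D f * g x)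
    {f : C^∞⟮𝓘(ℝ, E), M; 𝓘(ℝ), ℝ⟯} (hf : mvfderiv 𝓘(ℝ, E) f x = 0) : D f = 0 := by
  set φ := extChartAt 𝓘(ℝ, E) x with hφ
  have hxs : x ∈ φ.source := mem_extChartAt_source x
  have hopen : IsOpen φ.target := isOpen_extChartAt_target x
  obtain ⟨g, hg⟩ := exists_function_eventuallyEq (E := E) (M := E) hopen (φ.map_source hxs)
    (f := f ∘ φ.symm) (f.contMDiff.comp_contMDiffOn (contMDiffOn_extChartAt_symm x))
  have hgs : ContDiff ℝ ∞ g := g.contMDiff.contDiff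
  obtain ⟨H, hH, hHa, hHy⟩ := exists_hadamard hgs (φ x)
  have hfg : ∀ᶠ y in 𝓝 x, f y = g (φ y) := by
    filter_upwards [(continuousAt_extChartAt (I := 𝓘(ℝ, E)) x).eventually hg,
      extChartAt_source_mem_nhds (I := 𝓘(ℝ, E)) x] with y h1 h2
    change g (φ y) = f (φ.symm (φ y)) at h1
    rw [h1, φ.left_inv h2]
  have hDg : fderiv ℝ g (φ x) = 0 := by
    have h1 : HasMFDerivAt 𝓘(ℝ, E) 𝓘(ℝ) g (φ x) (fderiv ℝ g (φ x)) :=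
      (hgs.differentiable (by simp)).differentiableAt.hasFDerivAt.hasMFDerivAt
    have h2 := h1.comp x
      (mdifferentiableAt_extChartAt (I := 𝓘(ℝ, E)) (mem_chart_source E x)).hasMFDerivAt
    ext v
    have h3 := DFunLike.congr_fun hf v
    rw [mvfderiv_congr hfg] at h3
    have h4 := (DFunLike.congr_fun h2.mfderiv v).symm.trans h3
    change fderiv ℝ g (φ x) (mfderiv 𝓘(ℝ, E) 𝓘(ℝ, E) (extChartAt 𝓘(ℝ, E) x) x v) = 0 at h4
    rw [mfderiv_extChartAt_self] at h4
    exact h4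
  set b := Module.finBasis ℝ E
  have hu : ∀ i, ∃ u : C^∞⟮𝓘(ℝ, E), M; 𝓘(ℝ), ℝ⟯, ∀ᶠ y in 𝓝 x, u y = b.coord i (φ y - φ x) := by
    intro i
    refine exists_function_eventuallyEq (chartAt E x).open_source (mem_chart_source E x) ?_
    have : ContDiff ℝ ∞ fun z : E => (b.coord i).toContinuousLinearMap (z - φ x) := by fun_prop
    exact this.contMDiff.comp_contMDiffOn contMDiffOn_extChartAt
  have hh : ∀ i, ∃ h : C^∞⟮𝓘(ℝ, E), M; 𝓘(ℝ), ℝ⟯, ∀ᶠ y in 𝓝 x, h y = H (φ y) (b i) := by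
    intro i
    refine exists_function_eventuallyEq (chartAt E x).open_source (mem_chart_source E x) ?_
    exact (hH.clm_apply contDiff_const).contMDiff.comp_contMDiffOn contMDiffOn_extChartAt
  choose u hu using hu
  choose h hh using hh
  -- Near `x`, `f = f x + ∑ hᵢ uᵢ` where `uᵢ` are the coordinates centred at `x` and `hᵢ` vanishes
  -- at `x` as the differential of `f` does.
  have hsum : ∀ᶠ y in 𝓝 x, f y = (algebraMap ℝ C^∞⟮𝓘(ℝ, E), M; 𝓘(ℝ), ℝ⟯ (f x) +
      ∑ i, h i * u i) y := by
    filter_upwards [hfg, eventually_all.2 hu, eventually_all.2 hh] with y h1 h2 h3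
    have h4 : (algebraMap ℝ C^∞⟮𝓘(ℝ, E), M; 𝓘(ℝ), ℝ⟯ (f x) + ∑ i, h i * u i) y =
        f x + ∑ i, h i y * u i y := by
      change f x + (∑ i, h i * u i : C^∞⟮𝓘(ℝ, E), M; 𝓘(ℝ), ℝ⟯) y = _
      rw [sum_apply_contMDiffMap]
      rfl
    rw [h4, h1, hHy, hfg.self_of_nhds]
    congr 1
    conv_lhs => rw [← b.sum_repr (φ y - φ x), map_sum]
    refine Finset.sum_congr rfl fun i _ => ?_
    rw [h2, h3, map_smul, smul_eq_mul, mul_comm]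
    rfl
  rw [derivation_congr hD hsum, map_add, derivation_const hD, map_sum, zero_add]
  refine Finset.sum_eq_zero fun i _ => ?_
  rw [hD, (hh i).self_of_nhds, (hu i).self_of_nhds, hHa, hDg]
  simp

end Derivation

section Anchor

variable {E : Type*} [NormedAddCommGroup E] [NormedSpace ℝ E] [FiniteDimensional ℝ E]
  {M : Type*} [TopologicalSpace M] [ChartedSpace E M] [IsManifold 𝓘(ℝ, E) ∞ M]
  [T2Space M] [SigmaCompactSpace M]

theorem mvfderiv_add_apply (f g : C^∞⟮𝓘(ℝ, E), M; 𝓘(ℝ), ℝ⟯) (x : M) :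
    mvfderiv 𝓘(ℝ, E) (f + g : C^∞⟮𝓘(ℝ, E), M; 𝓘(ℝ), ℝ⟯) x =
      mvfderiv 𝓘(ℝ, E) f x + mvfderiv 𝓘(ℝ, E) g x := by
  have h1 := (f.contMDiff.mdifferentiableAt (x := x) (by simp)).hasMFDerivAt
  have h2 := (g.contMDiff.mdifferentiableAt (x := x) (by simp)).hasMFDerivAt
  exact (h1.add h2).mfderiv

theorem mvfderiv_smul_apply (c : ℝ) (f : C^∞⟮𝓘(ℝ, E), M; 𝓘(ℝ), ℝ⟯) (x : M) :
    mvfderiv 𝓘(ℝ, E) (c • f : C^∞⟮𝓘(ℝ, E), M; 𝓘(ℝ), ℝ⟯) x = c • mvfderiv 𝓘(ℝ, E) f x := by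
  have h1 := (f.contMDiff.mdifferentiableAt (x := x) (by simp)).hasMFDerivAt
  exact (h1.const_smul c).mfderiv

theorem mvfderiv_mul_apply (f g : C^∞⟮𝓘(ℝ, E), M; 𝓘(ℝ), ℝ⟯) (x : M) :
    mvfderiv 𝓘(ℝ, E) (f * g : C^∞⟮𝓘(ℝ, E), M; 𝓘(ℝ), ℝ⟯) x =
      f x • mvfderiv 𝓘(ℝ, E) g x + g x • mvfderiv 𝓘(ℝ, E) f x := by
  have h1 := (f.contMDiff.mdifferentiableAt (x := x) (by simp)).hasMFDerivAt
  have h2 := (g.contMDiff.mdifferentiableAt (x := x) (by simp)).hasMFDerivAt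
  exact (h1.mul h2).mfderiv

namespace PoissonStructure

variable (π : PoissonStructure 𝓘(ℝ, E) M)

theorem bracket_swap (f g : C^∞⟮𝓘(ℝ, E), M; 𝓘(ℝ), ℝ⟯) : π.bracket f g = -π.bracket g f := by
  have h := π.bracket_self (f + g)
  simp only [map_add, LinearMap.add_apply, π.bracket_self, zero_add, add_zero] at h
  exact eq_neg_of_add_eq_zero_right h

/-- `g ↦ {f, g}(x)`. -/
def bracketAt (x : M) (f : C^∞⟮𝓘(ℝ, E), M; 𝓘(ℝ), ℝ⟯) :
    C^∞⟮𝓘(ℝ, E), M; 𝓘(ℝ), ℝ⟯ →ₗ[ℝ] ℝ where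
  toFun g := π.bracket f g x
  map_add' g h := by rw [map_add]; rfl
  map_smul' c g := by rw [map_smul]; rfl

theorem bracket_eq_zero_right (f : C^∞⟮𝓘(ℝ, E), M; 𝓘(ℝ), ℝ⟯) {g : C^∞⟮𝓘(ℝ, E), M; 𝓘(ℝ), ℝ⟯} {x : M}
    (hg : mvfderiv 𝓘(ℝ, E) g x = 0) : π.bracket f g x = 0 := by
  refine derivation_eq_zero (D := π.bracketAt x f) (fun g h => ?_) hg
  change π.bracket f (g * h) x = _
  rw [π.leibniz]
  rfl

/-- The bracket of functions at `x` depends only on their differentials at `x`. -/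
theorem bracket_congr {f f' g g' : C^∞⟮𝓘(ℝ, E), M; 𝓘(ℝ), ℝ⟯} {x : M}
    (hf : mvfderiv 𝓘(ℝ, E) f x = mvfderiv 𝓘(ℝ, E) f' x)
    (hg : mvfderiv 𝓘(ℝ, E) g x = mvfderiv 𝓘(ℝ, E) g' x) :
    π.bracket f g x = π.bracket f' g' x := by
  have key : ∀ {f g g' : C^∞⟮𝓘(ℝ, E), M; 𝓘(ℝ), ℝ⟯}, mvfderiv 𝓘(ℝ, E) g x = mvfderiv 𝓘(ℝ, E) g' x →
      π.bracket f g x = π.bracket f g' x := by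
    intro f g g' h
    have h0 : mvfderiv 𝓘(ℝ, E) (g + (-1 : ℝ) • g' : C^∞⟮𝓘(ℝ, E), M; 𝓘(ℝ), ℝ⟯) x = 0 := by
      rw [mvfderiv_add_apply, mvfderiv_smul_apply, h]
      simp
    have h1 := π.bracket_eq_zero_right f h0
    rw [map_add, map_smul] at h1
    change π.bracket f g x + (-1) * π.bracket f g' x = 0 at h1
    linarith
  rw [key hg, π.bracket_swap, π.bracket_swap f' g']
  exact congrArg Neg.neg (key hf)

/-- The property that defines `sharp` by choice can be satisfied: the coordinates of `v` in a basis
are the brackets with functions whose differentials are the dual basis. -/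
theorem exists_sharp (x : M) (ψ : CotangentSpace 𝓘(ℝ, E) x) :
    ∃ v : TangentSpace 𝓘(ℝ, E) x, ∀ f₁ f₂ : C^∞⟮𝓘(ℝ, E), M; 𝓘(ℝ), ℝ⟯,
      mvfderiv 𝓘(ℝ, E) f₁ x = ψ → mvfderiv 𝓘(ℝ, E) f₂ x v = π.bracket f₁ f₂ x := by
  obtain ⟨f, hf⟩ := exists_function_mvfderiv_eq x ψ
  let b := Module.finBasis ℝ E
  choose u hu using fun i => exists_function_mvfderiv_eq x
    (show CotangentSpace 𝓘(ℝ, E) x from (b.coord i).toContinuousLinearMap)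
  refine ⟨show E from ∑ i, π.bracket f (u i) x • b i, fun f₁ f₂ h₁ => ?_⟩
  rw [π.bracket_congr (h₁.trans hf.symm) (rfl : mvfderiv 𝓘(ℝ, E) f₂ x = _)]
  set θ : E →L[ℝ] ℝ := mvfderiv 𝓘(ℝ, E) f₂ x with hθ
  have h2 : mvfderiv 𝓘(ℝ, E) f₂ x =
      mvfderiv 𝓘(ℝ, E) (∑ i, θ (b i) • u i : C^∞⟮𝓘(ℝ, E), M; 𝓘(ℝ), ℝ⟯) x := by
    let L : C^∞⟮𝓘(ℝ, E), M; 𝓘(ℝ), ℝ⟯ →ₗ[ℝ] CotangentSpace 𝓘(ℝ, E) x :=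
      { toFun := fun f => mvfderiv 𝓘(ℝ, E) f x
        map_add' := fun f g => mvfderiv_add_apply f g x
        map_smul' := fun c f => mvfderiv_smul_apply c f x }
    have h3 : L (∑ i, θ (b i) • u i) = ∑ i, θ (b i) • L (u i) := by
      rw [map_sum]; simp only [map_smul]
    refine Eq.trans ?_ h3.symm
    have h4 : ∀ i, L (u i) = (show E →L[ℝ] ℝ from (b.coord i).toContinuousLinearMap) := hu
    simp only [h4]
    change θ = ∑ i, θ (b i) • (b.coord i).toContinuousLinearMap
    ext v
    conv_lhs => rw [← b.sum_repr v, map_sum]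
    simp [mul_comm]
  rw [π.bracket_congr (rfl : mvfderiv 𝓘(ℝ, E) f x = _) h2, map_sum]
  change θ (∑ i, π.bracket f (u i) x • b i) = _
  have h5 : (∑ i, π.bracket f (θ (b i) • u i) : C^∞⟮𝓘(ℝ, E), M; 𝓘(ℝ), ℝ⟯) x =
      ∑ i, θ (b i) * π.bracket f (u i) x := by
    rw [sum_apply_contMDiffMap]
    refine Finset.sum_congr rfl fun i _ => ?_
    rw [map_smul]; rfl
  rw [h5, map_sum]
  exact Finset.sum_congr rfl fun i _ => by rw [map_smul, smul_eq_mul, mul_comm]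

theorem mvfderiv_sharp_of_eq {x : M} {ψ : CotangentSpace 𝓘(ℝ, E) x}
    {f₁ : C^∞⟮𝓘(ℝ, E), M; 𝓘(ℝ), ℝ⟯} (h : mvfderiv 𝓘(ℝ, E) f₁ x = ψ)
    (f₂ : C^∞⟮𝓘(ℝ, E), M; 𝓘(ℝ), ℝ⟯) :
    mvfderiv 𝓘(ℝ, E) f₂ x (π.sharp x ψ) = π.bracket f₁ f₂ x :=
  Classical.epsilon_spec (π.exists_sharp x ψ) f₁ f₂ h

theorem mvfderiv_sharp (f₁ f₂ : C^∞⟮𝓘(ℝ, E), M; 𝓘(ℝ), ℝ⟯) (x : M) :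
    mvfderiv 𝓘(ℝ, E) f₂ x (π.sharp x (mvfderiv 𝓘(ℝ, E) f₁ x)) = π.bracket f₁ f₂ x :=
  π.mvfderiv_sharp_of_eq rfl f₂

theorem apply_sharp_swap {x : M} (φ ψ : CotangentSpace 𝓘(ℝ, E) x) :
    φ (π.sharp x ψ) = -ψ (π.sharp x φ) := by
  obtain ⟨f, rfl⟩ := exists_function_mvfderiv_eq x φ
  obtain ⟨g, rfl⟩ := exists_function_mvfderiv_eq x ψ
  rw [mvfderiv_sharp, mvfderiv_sharp, π.bracket_swap]
  rfl

theorem apply_sharp_self {x : M} (φ : CotangentSpace 𝓘(ℝ, E) x) : φ (π.sharp x φ) = 0 := by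
  linarith [π.apply_sharp_swap φ φ]

theorem sharp_add {x : M} (φ ψ : CotangentSpace 𝓘(ℝ, E) x) :
    π.sharp x (φ + ψ) = π.sharp x φ + π.sharp x ψ :=
  tangent_eq_of_forall_mvfderiv fun f => by
    rw [map_add, π.apply_sharp_swap, π.apply_sharp_swap _ φ, π.apply_sharp_swap _ ψ,
      add_apply, neg_add]

theorem sharp_smul {x : M} (c : ℝ) (φ : CotangentSpace 𝓘(ℝ, E) x) :
    π.sharp x (c • φ) = c • π.sharp x φ :=
  tangent_eq_of_forall_mvfderiv fun f => by
    rw [map_smul, π.apply_sharp_swap, π.apply_sharp_swap _ φ, smul_apply,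
      smul_neg]

/-- The Poisson anchor on a fibre as a continuous linear map. -/
def sharpL (x : M) : CotangentSpace 𝓘(ℝ, E) x →L[ℝ] TangentSpace 𝓘(ℝ, E) x where
  toFun := π.sharp x
  map_add' := π.sharp_add
  map_smul' := π.sharp_smul
  cont :=
    LinearMap.continuous_of_finiteDimensional (E := E →L[ℝ] ℝ) (F' := E)
      { toFun := π.sharp x, map_add' := π.sharp_add, map_smul' := π.sharp_smul }

/-- Smoothness is tested on differentials of functions: `⟨df, π^#Φ⟩ = -⟨Φ, π^#(df)⟩`, where the
Hamiltonian field `π^#(df)` is smooth since `⟨dg, π^#(df)⟩ = {f, g}`. -/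
theorem contMDiff_anchor :
    ContMDiff (𝓘(ℝ, E).prod 𝓘(ℝ, E →L[ℝ] ℝ)) 𝓘(ℝ, E).tangent ∞ π.anchor := by
  have hX : ∀ f : C^∞⟮𝓘(ℝ, E), M; 𝓘(ℝ), ℝ⟯, ContMDiff 𝓘(ℝ, E) 𝓘(ℝ, E).tangent ∞
      (fun x => (⟨x, π.sharp x (mvfderiv 𝓘(ℝ, E) f x)⟩ : TangentBundle 𝓘(ℝ, E) M)) := fun f x => by
    refine contMDiffWithinAt_tangent contMDiffAt_id fun g => ?_
    refine ((π.bracket f g).contMDiff.contMDiffAt (x := x)).congr_of_eventuallyEq ?_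
    exact Eventually.of_forall fun y => π.mvfderiv_sharp f g y
  intro Φ
  have hproj : ContMDiffAt (𝓘(ℝ, E).prod 𝓘(ℝ, E →L[ℝ] ℝ)) 𝓘(ℝ, E) ∞
      (fun Φ : CotangentBundle 𝓘(ℝ, E) M => Φ.1) Φ :=
    Bundle.contMDiff_proj (n := ∞) (fun x : M => CotangentSpace 𝓘(ℝ, E) x) Φ
  refine contMDiffWithinAt_tangent hproj fun f => ?_
  have h := contMDiffWithinAt_pair contMDiffAt_id ((hX f).contMDiffAt.comp Φ hproj) fun _ => rfl
  exact h.neg.congr (fun Ψ _ => π.apply_sharp_swap _ _) (π.apply_sharp_swap _ _)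

end PoissonStructure

end Anchor

/-! ### The Lie bracket of vector fields as a commutator -/

section LieBracket

variable {E : Type*} [NormedAddCommGroup E] [NormedSpace ℝ E] [FiniteDimensional ℝ E]
  {M : Type*} [TopologicalSpace M] [ChartedSpace E M] [IsManifold 𝓘(ℝ, E) ∞ M]

theorem two_le_infty : (2 : WithTop ℕ∞) ≤ ∞ :=
  (WithTop.coe_le_coe.2 le_top : ((2 : ℕ∞) : WithTop ℕ∞) ≤ ((⊤ : ℕ∞) : WithTop ℕ∞))

/-- The expression of a vector field in the chart at `x`. -/
def chartField (x : M) (Z : ∀ x : M, TangentSpace 𝓘(ℝ, E) x) (y : E) : E :=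
  (mfderivWithin 𝓘(ℝ, E) 𝓘(ℝ, E) (extChartAt 𝓘(ℝ, E) x).symm (range 𝓘(ℝ, E)) y).inverse
    (Z ((extChartAt 𝓘(ℝ, E) x).symm y))

/-- The derivative of a function along a vector field, computed in a chart. -/
theorem fderiv_chartField {f : M → ℝ} {x : M} {y : E} (hy : y ∈ (extChartAt 𝓘(ℝ, E) x).target)
    (hf : MDifferentiableAt 𝓘(ℝ, E) 𝓘(ℝ) f ((extChartAt 𝓘(ℝ, E) x).symm y))
    (Z : ∀ x : M, TangentSpace 𝓘(ℝ, E) x) :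
    fderiv ℝ (f ∘ (extChartAt 𝓘(ℝ, E) x).symm) y (chartField x Z y) =
      mvfderiv 𝓘(ℝ, E) f ((extChartAt 𝓘(ℝ, E) x).symm y) (Z ((extChartAt 𝓘(ℝ, E) x).symm y)) := by
  have h1 : HasMFDerivAt 𝓘(ℝ, E) 𝓘(ℝ, E) (extChartAt 𝓘(ℝ, E) x).symm y
      (mfderivWithin 𝓘(ℝ, E) 𝓘(ℝ, E) (extChartAt 𝓘(ℝ, E) x).symm (range 𝓘(ℝ, E)) y) := by
    exact (mdifferentiableWithinAt_extChartAt_symm (I := 𝓘(ℝ, E)) hy).hasMFDerivWithinAt.hasMFDerivAt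
      (by simp)
  have h2 := hf.hasMFDerivAt.comp y h1
  unfold chartField
  obtain ⟨e, he⟩ := isInvertible_mfderivWithin_extChartAt_symm (I := 𝓘(ℝ, E)) hy
  rw [← he] at h2 ⊢
  rw [ContinuousLinearMap.inverse_equiv]
  have h3 : HasFDerivAt (f ∘ (extChartAt 𝓘(ℝ, E) x).symm) (show E →L[ℝ] ℝ from
      mfderiv 𝓘(ℝ, E) 𝓘(ℝ) f ((extChartAt 𝓘(ℝ, E) x).symm y) ∘L e.toContinuousLinearMap) y :=
    hasMFDerivAt_iff_hasFDerivAt.1 h2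
  rw [h3.fderiv]
  exact congrArg (mvfderiv 𝓘(ℝ, E) f _) (e.apply_symm_apply _)

/-- `[X, Y] f = X (Y f) - Y (X f)`. -/
theorem mvfderiv_mlieBracket {f : M → ℝ} (hf : ContMDiff 𝓘(ℝ, E) 𝓘(ℝ) ∞ f)
    {X Y : ∀ x : M, TangentSpace 𝓘(ℝ, E) x} {x : M}
    (hX : ContMDiffAt 𝓘(ℝ, E) 𝓘(ℝ, E).tangent ∞ (fun y => (⟨y, X y⟩ : TangentBundle 𝓘(ℝ, E) M)) x)
    (hY : ContMDiffAt 𝓘(ℝ, E) 𝓘(ℝ, E).tangent ∞ (fun y => (⟨y, Y y⟩ : TangentBundle 𝓘(ℝ, E) M)) x)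
    (hXf : MDifferentiableAt 𝓘(ℝ, E) 𝓘(ℝ) (fun y => mvfderiv 𝓘(ℝ, E) f y (X y)) x)
    (hYf : MDifferentiableAt 𝓘(ℝ, E) 𝓘(ℝ) (fun y => mvfderiv 𝓘(ℝ, E) f y (Y y)) x) :
    mvfderiv 𝓘(ℝ, E) f x (VectorField.mlieBracket 𝓘(ℝ, E) X Y x) =
      mvfderiv 𝓘(ℝ, E) (fun y => mvfderiv 𝓘(ℝ, E) f y (Y y)) x (X x) -
      mvfderiv 𝓘(ℝ, E) (fun y => mvfderiv 𝓘(ℝ, E) f y (X y)) x (Y x) := by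
  have : IsManifold 𝓘(ℝ, E) 2 M := IsManifold.of_le (n := ∞) two_le_infty
  set φ := extChartAt 𝓘(ℝ, E) x with hφ
  have hx : φ x ∈ φ.target := mem_extChartAt_target x
  have hxx : φ.symm (φ x) = x := extChartAt_to_inv x
  have hdiff : ∀ {Z : ∀ x : M, TangentSpace 𝓘(ℝ, E) x}, ContMDiffAt 𝓘(ℝ, E) 𝓘(ℝ, E).tangent ∞
      (fun y => (⟨y, Z y⟩ : TangentBundle 𝓘(ℝ, E) M)) x →
      DifferentiableAt ℝ (chartField x Z) (φ x) := by
    intro Z hZ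
    have h : DifferentiableWithinAt ℝ (chartField x Z) (φ.symm ⁻¹' univ ∩ range 𝓘(ℝ, E)) (φ x) :=
      (hZ.mdifferentiableAt
      (by simp)).mdifferentiableWithinAt.differentiableWithinAt_mpullbackWithin_vectorField (s := univ)
    rwa [preimage_univ, univ_inter, modelWithCornersSelf_coe, range_id,
      differentiableWithinAt_univ] at h
  have hf' : ContDiffAt ℝ ∞ (f ∘ φ.symm) (φ x) :=
    ((hf.comp_contMDiffOn (contMDiffOn_extChartAt_symm x)).contMDiffAt
      ((isOpen_extChartAt_target x).mem_nhds hx)).contDiffAt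
  have hsymm : IsSymmSndFDerivAt ℝ (f ∘ φ.symm) (φ x) := hf'.isSymmSndFDerivAt (by
    simpa using two_le_infty)
  have hval : ∀ Z : ∀ x : M, TangentSpace 𝓘(ℝ, E) x,
      (fun y => fderiv ℝ (f ∘ φ.symm) y (chartField x Z y)) =ᶠ[𝓝 (φ x)]
        (fun z => mvfderiv 𝓘(ℝ, E) f z (Z z)) ∘ φ.symm := by
    intro Z
    filter_upwards [(isOpen_extChartAt_target x).mem_nhds hx] with y hy
    exact fderiv_chartField hy (hf.mdifferentiableAt (by simp)) _
  have hat : ∀ (Z : ∀ x : M, TangentSpace 𝓘(ℝ, E) x) (h : M → ℝ),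
      MDifferentiableAt 𝓘(ℝ, E) 𝓘(ℝ) h x → fderiv ℝ (h ∘ φ.symm) (φ x) (chartField x Z (φ x)) =
      mvfderiv 𝓘(ℝ, E) h x (Z x) := by
    intro Z h hh
    refine (fderiv_chartField hx (hxx.symm ▸ hh) Z).trans ?_
    rw [hxx]
  have hcx : ∀ Z : ∀ x : M, TangentSpace 𝓘(ℝ, E) x, chartField x Z (φ x) = Z x := by
    intro Z
    refine (mfderivWithin_extChartAt_symm_inverse_apply (I := 𝓘(ℝ, E)) (x := x)
      (Z (φ.symm (φ x)))).trans ?_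
    rw [hxx]
  -- In a chart the formula is the symmetry of second derivatives.
  have key := VectorField.fderiv_apply_lieBracket_of_isSymmSndFDerivAt
    (hf'.of_le two_le_infty) hsymm (hdiff hY) (hdiff hX)
  have hbr : VectorField.mlieBracket 𝓘(ℝ, E) X Y x =
      VectorField.lieBracket ℝ (chartField x X) (chartField x Y) (φ x) := by
    have h1 : VectorField.lieBracketWithin ℝ (chartField x X) (chartField x Y)
        (φ.symm ⁻¹' univ ∩ range 𝓘(ℝ, E)) =
        VectorField.lieBracket ℝ (chartField x X) (chartField x Y) := by
      rw [preimage_univ, univ_inter, modelWithCornersSelf_coe, range_id,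
        VectorField.lieBracketWithin_univ]
    rw [← h1]
    have h2 : (mfderiv 𝓘(ℝ, E) 𝓘(ℝ, E) (extChartAt 𝓘(ℝ, E) x) x).inverse =
        ContinuousLinearMap.id ℝ (TangentSpace 𝓘(ℝ, E) x) := by
      rw [mfderiv_extChartAt_self]
      exact ContinuousLinearMap.inverse_id
    exact DFunLike.congr_fun h2 _
  have hfx : ∀ v : E, fderiv ℝ (f ∘ φ.symm) (φ x) v = mvfderiv 𝓘(ℝ, E) f x v := by
    classical
    intro v
    let v' : TangentSpace 𝓘(ℝ, E) x := v
    have h := hat (Function.update 0 x v') f (hf.mdifferentiableAt (by simp))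
    have h1 : Function.update (0 : ∀ x : M, TangentSpace 𝓘(ℝ, E) x) x v' x = v' :=
      Function.update_self ..
    rw [hcx] at h
    rw [h1] at h
    exact h
  rw [hbr, ← hfx]
  refine key.trans ?_
  rw [← hat X _ hYf, ← hat Y _ hXf, (hval Y).fderiv_eq, (hval X).fderiv_eq]

end LieBracket

/-! ### The calculus of vector fields and 1-forms -/

section DualSections

variable {E : Type*} [NormedAddCommGroup E] [NormedSpace ℝ E] [FiniteDimensional ℝ E]
  {M : Type*} [TopologicalSpace M] [ChartedSpace E M] [IsManifold 𝓘(ℝ, E) ∞ M]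
  [T2Space M] [SigmaCompactSpace M]
  {K : Type*} [NormedAddCommGroup K] [NormedSpace ℝ K] [FiniteDimensional ℝ K]
  {V : M → Type*} [TopologicalSpace (TotalSpace K V)] [∀ x, TopologicalSpace (V x)]
  [∀ x, AddCommGroup (V x)] [∀ x, Module ℝ (V x)] [FiberBundle K V] [VectorBundle ℝ K V]
  [ContMDiffVectorBundle ∞ K V 𝓘(ℝ, E)]

/-- A section of the dual of a vector bundle is smooth if its pairings with smooth sections are. -/
theorem contMDiff_dual_section {θ : ∀ x, V x →L[ℝ] ℝ}
    (h : ∀ Y : Cₛ^∞⟮𝓘(ℝ, E); K, V⟯, ContMDiff 𝓘(ℝ, E) 𝓘(ℝ) ∞ fun x => θ x (Y x)) :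
    ContMDiff 𝓘(ℝ, E) (𝓘(ℝ, E).prod 𝓘(ℝ, K →L[ℝ] ℝ)) ∞
      (fun x => (⟨x, θ x⟩ : TotalSpace (K →L[ℝ] ℝ) (fun x => V x →L[ℝ] ℝ))) := by
  intro x₀
  refine (contMDiffAt_hom_bundle (E₂ := Bundle.Trivial M ℝ) _).2 ⟨contMDiffAt_id, ?_⟩
  refine contMDiffWithinAt_of_forall_apply fun k => ?_
  set e := trivializationAt K V x₀
  have hx₀ : x₀ ∈ e.baseSet := FiberBundle.mem_baseSet_trivializationAt' x₀
  obtain ⟨Y, hY⟩ := exists_section_eventuallyEq (V := V) e.open_baseSet hx₀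
    (σ := fun y => e.symmL ℝ y k) (fun y hy =>
      contMDiffWithinAt_symmL (I := 𝓘(ℝ, E)) (IX := 𝓘(ℝ, E)) (b := id) e contMDiffWithinAt_id hy _)
  refine ((h Y).contMDiffAt (x := x₀)).congr_of_eventuallyEq ?_
  filter_upwards [hY] with y hy
  rw [hy]
  simp [ContinuousLinearMap.inCoordinates, e]

end DualSections

section Calculus

variable {E : Type*} [NormedAddCommGroup E] [NormedSpace ℝ E] [FiniteDimensional ℝ E]
  {M : Type*} [TopologicalSpace M] [ChartedSpace E M] [IsManifold 𝓘(ℝ, E) ∞ M]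

/-- The product of a smooth function and a smooth section. -/
def smulSection {K : Type*} [NormedAddCommGroup K] [NormedSpace ℝ K]
    {V : M → Type*} [TopologicalSpace (TotalSpace K V)] [∀ x, TopologicalSpace (V x)]
    [∀ x, AddCommGroup (V x)] [∀ x, Module ℝ (V x)] [FiberBundle K V] [VectorBundle ℝ K V]
    [ContMDiffVectorBundle ∞ K V 𝓘(ℝ, E)] (f : C^∞⟮𝓘(ℝ, E), M; 𝓘(ℝ), ℝ⟯)
    (s : Cₛ^∞⟮𝓘(ℝ, E); K, V⟯) : Cₛ^∞⟮𝓘(ℝ, E); K, V⟯ :=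
  ⟨fun y => f y • s y, f.contMDiff.smul_section s.contMDiff⟩

/-- The derivative `X f` of a function along a vector field. -/
def fieldDeriv (X : VectorFields 𝓘(ℝ, E) M) (f : C^∞⟮𝓘(ℝ, E), M; 𝓘(ℝ), ℝ⟯) :
    C^∞⟮𝓘(ℝ, E), M; 𝓘(ℝ), ℝ⟯ :=
  ⟨fun x => mvfderiv 𝓘(ℝ, E) f x (X x), by
    have h1 : ContMDiff 𝓘(ℝ, E) 𝓘(ℝ).tangent ∞ fun x =>
        tangentMap 𝓘(ℝ, E) 𝓘(ℝ) f (⟨x, X x⟩ : TangentBundle 𝓘(ℝ, E) M) :=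
      (f.contMDiff.contMDiff_tangentMap (m := ∞) (by simp)).comp X.contMDiff
    exact (contMDiff_snd_tangentBundle_modelSpace ℝ 𝓘(ℝ)).comp h1⟩

/-- The Lie bracket of smooth vector fields. -/
def fieldBracket (X Y : VectorFields 𝓘(ℝ, E) M) : VectorFields 𝓘(ℝ, E) M :=
  ⟨VectorField.mlieBracket 𝓘(ℝ, E) X Y, fun x => by
    have : IsManifold 𝓘(ℝ, E) (minSmoothness ℝ 2) M := by
      rw [minSmoothness_of_isRCLikeNormedField]
      exact IsManifold.of_le (n := ∞) two_le_infty
    have : IsManifold 𝓘(ℝ, E) (((⊤ : ℕ∞) : WithTop ℕ∞) + 1) M := by simpa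
    exact ContMDiffAt.mlieBracket_vectorField (m := ⊤) (n := ⊤) X.contMDiff.contMDiffAt
      Y.contMDiff.contMDiffAt (by simp)⟩

/-- The pairing of a 1-form and a vector field. -/
def formPair (Φ : OneForms 𝓘(ℝ, E) M) (X : VectorFields 𝓘(ℝ, E) M) :
    C^∞⟮𝓘(ℝ, E), M; 𝓘(ℝ), ℝ⟯ :=
  ⟨fun x => Φ x (X x), fun _ => contMDiffWithinAt_dual_apply (V := fun x : M => TangentSpace 𝓘(ℝ, E) x)
    (F := fun x => ⟨x, Φ x⟩) (v := fun x => X x) Φ.contMDiff.contMDiffAt X.contMDiff.contMDiffAt⟩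

variable [T2Space M] [SigmaCompactSpace M]

/-- The differential of a smooth function as a 1-form. -/
def formDiff (f : C^∞⟮𝓘(ℝ, E), M; 𝓘(ℝ), ℝ⟯) : OneForms 𝓘(ℝ, E) M :=
  ⟨fun x => mvfderiv 𝓘(ℝ, E) f x, contMDiff_dual_section fun X => (fieldDeriv X f).contMDiff⟩

variable (X Y Z : VectorFields 𝓘(ℝ, E) M) (Φ Ψ Θ : OneForms 𝓘(ℝ, E) M)
  (f g : C^∞⟮𝓘(ℝ, E), M; 𝓘(ℝ), ℝ⟯)

theorem fieldDeriv_add_left : fieldDeriv (X + Y) f = fieldDeriv X f + fieldDeriv Y f := by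
  ext x; exact map_add (mvfderiv 𝓘(ℝ, E) f x) (X x) (Y x)

theorem fieldDeriv_smul_left : fieldDeriv (smulSection g X) f = g * fieldDeriv X f := by
  ext x; exact map_smul (mvfderiv 𝓘(ℝ, E) f x) (g x) (X x)

theorem fieldDeriv_add : fieldDeriv X (f + g) = fieldDeriv X f + fieldDeriv X g := by
  ext x; exact DFunLike.congr_fun (mvfderiv_add_apply f g x) (X x)

theorem fieldDeriv_smul (c : ℝ) : fieldDeriv X (c • f) = c • fieldDeriv X f := by
  ext x; exact DFunLike.congr_fun (mvfderiv_smul_apply c f x) (X x)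

theorem fieldDeriv_neg : fieldDeriv X (-f) = -fieldDeriv X f := by
  have := fieldDeriv_smul X f (-1)
  rwa [neg_one_smul, neg_one_smul] at this

theorem fieldDeriv_mul : fieldDeriv X (f * g) = f * fieldDeriv X g + g * fieldDeriv X f := by
  ext x; exact DFunLike.congr_fun (mvfderiv_mul_apply f g x) (X x)

theorem formPair_add_left : formPair (Φ + Ψ) X = formPair Φ X + formPair Ψ X := by
  ext x; rfl

theorem formPair_smul_left : formPair (smulSection f Φ) X = f * formPair Φ X := by
  ext x; rfl

theorem formPair_add_right : formPair Φ (X + Y) = formPair Φ X + formPair Φ Y := by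
  ext x; exact map_add (Φ x) (X x) (Y x)

theorem formPair_sub_right : formPair Φ (X - Y) = formPair Φ X - formPair Φ Y := by
  ext x; exact map_sub (Φ x) (X x) (Y x)

theorem formPair_smul_right : formPair Φ (smulSection f X) = f * formPair Φ X := by
  ext x; exact map_smul (Φ x) (f x) (X x)

theorem formPair_formDiff : formPair (formDiff f) X = fieldDeriv X f := by
  ext x; rfl

theorem mdifferentiableAt_section {K : Type*} [NormedAddCommGroup K] [NormedSpace ℝ K]
    {V : M → Type*} [TopologicalSpace (TotalSpace K V)] [∀ x, TopologicalSpace (V x)]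
    [∀ x, AddCommGroup (V x)] [∀ x, Module ℝ (V x)] [FiberBundle K V] [VectorBundle ℝ K V]
    [ContMDiffVectorBundle ∞ K V 𝓘(ℝ, E)] (s : Cₛ^∞⟮𝓘(ℝ, E); K, V⟯) (x : M) :
    MDifferentiableAt 𝓘(ℝ, E) (𝓘(ℝ, E).prod 𝓘(ℝ, K)) (fun y => (⟨y, s y⟩ : TotalSpace K V)) x :=
  s.contMDiff.mdifferentiableAt (by simp)

theorem isManifold_two : IsManifold 𝓘(ℝ, E) 2 M :=
  IsManifold.of_le (n := ∞) two_le_infty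

theorem fieldBracket_add_right :
    fieldBracket X (Y + Z) = fieldBracket X Y + fieldBracket X Z := by
  have := isManifold_two (E := E) (M := M)
  ext x; exact VectorField.mlieBracket_add_right (mdifferentiableAt_section Y x)
    (mdifferentiableAt_section Z x)

theorem fieldBracket_swap : fieldBracket X Y = -fieldBracket Y X := by
  ext x; exact VectorField.mlieBracket_swap_apply

theorem fieldBracket_add_left :
    fieldBracket (X + Y) Z = fieldBracket X Z + fieldBracket Y Z := by
  rw [fieldBracket_swap, fieldBracket_add_right, fieldBracket_swap X, fieldBracket_swap Y, neg_add]

theorem fieldBracket_smul_right : fieldBracket X (smulSection f Y) =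
    smulSection (fieldDeriv X f) Y + smulSection f (fieldBracket X Y) := by
  have := isManifold_two (E := E) (M := M)
  ext x; exact VectorField.mlieBracket_smul_right (f.contMDiff.mdifferentiableAt (by simp))
    (mdifferentiableAt_section Y x)

theorem fieldBracket_smul_left : fieldBracket (smulSection f X) Y =
    smulSection f (fieldBracket X Y) - smulSection (fieldDeriv Y f) X := by
  rw [fieldBracket_swap, fieldBracket_smul_right, fieldBracket_swap X Y]
  ext x
  change -(fieldDeriv Y f x • X x + f x • fieldBracket Y X x) =
    f x • -fieldBracket Y X x - fieldDeriv Y f x • X x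
  module

theorem fieldDeriv_fieldBracket : fieldDeriv (fieldBracket X Y) f =
    fieldDeriv X (fieldDeriv Y f) - fieldDeriv Y (fieldDeriv X f) := by
  ext x
  exact mvfderiv_mlieBracket f.contMDiff X.contMDiff.contMDiffAt Y.contMDiff.contMDiffAt
    ((fieldDeriv X f).contMDiff.mdifferentiableAt (by simp))
    ((fieldDeriv Y f).contMDiff.mdifferentiableAt (by simp))

variable {X Y Φ Ψ}

theorem field_ext_of_fieldDeriv (h : ∀ f, fieldDeriv X f = fieldDeriv Y f) : X = Y := by
  ext x
  exact tangent_eq_of_forall_mvfderiv fun f => DFunLike.congr_fun (h f) x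

theorem form_ext_of_formPair (h : ∀ X, formPair Φ X = formPair Ψ X) : Φ = Ψ := by
  ext x v
  obtain ⟨X, rfl⟩ := exists_section_eq (E := E) (K := E) (V := fun x : M => TangentSpace 𝓘(ℝ, E) x) x v
  exact DFunLike.congr_fun (h X) x

/-- An additive functional on 1-forms which is tensorial at `x` vanishes if it vanishes on exact
forms: near `x` every form is a combination of differentials of coordinates. -/
theorem eq_zero_of_formDiff {x : M} {A : OneForms 𝓘(ℝ, E) M → ℝ}
    (hadd : ∀ Φ Ψ, A (Φ + Ψ) = A Φ + A Ψ) (hsmul : ∀ f Φ, A (smulSection f Φ) = f x * A Φ)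
    (hA : ∀ f, A (formDiff f) = 0) (Φ : OneForms 𝓘(ℝ, E) M) : A Φ = 0 := by
  set e := trivializationAt E (TangentSpace 𝓘(ℝ, E) : M → Type _) x with he
  have hx : x ∈ e.baseSet := FiberBundle.mem_baseSet_trivializationAt' x
  let b := Module.finBasis ℝ E
  choose u hu using fun i => exists_function_eq_chart x (b.coord i).toContinuousLinearMap
  choose Y hY using fun i => exists_section_eventuallyEq
    (V := fun x : M => TangentSpace 𝓘(ℝ, E) x) e.open_baseSet hx
    (σ := fun y => e.symmL ℝ y (b i)) (fun y hy =>
      contMDiffWithinAt_symmL (I := 𝓘(ℝ, E)) (IX := 𝓘(ℝ, E)) (b := id) e contMDiffWithinAt_id hy _)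
  have hA0 : A 0 = 0 := by simpa using hadd 0 0
  have hsum : ∀ s : Finset (Fin (Module.finrank ℝ E)),
      A (∑ i ∈ s, smulSection (formPair Φ (Y i)) (formDiff (u i))) = 0 := by
    classical
    intro s
    induction s using Finset.induction_on with
    | empty => simpa using hA0
    | insert i s hi ih => rw [Finset.sum_insert hi, hadd, hsmul, hA, ih, mul_zero, add_zero]
  -- `Φ = ∑ ⟨Φ, Yᵢ⟩ duᵢ` near `x`, for coordinates `uᵢ` with coordinate fields `Yᵢ`; the functions
  -- and fields are cut off to be global.
  have hev : ∀ᶠ y in 𝓝 x, Φ y = (∑ i, smulSection (formPair Φ (Y i)) (formDiff (u i)) :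
      OneForms 𝓘(ℝ, E) M) y := by
    filter_upwards [eventually_all.2 fun i => (hu i).eventually_nhds, eventually_all.2 hY,
      (chartAt E x).open_source.mem_nhds (mem_chart_source E x)] with y h1 h2 h3
    have hy : y ∈ e.baseSet := h3
    ext v
    have h4 : (∑ i, smulSection (formPair Φ (Y i)) (formDiff (u i)) : OneForms 𝓘(ℝ, E) M) y v =
        ∑ i, Φ y (Y i y) * mvfderiv 𝓘(ℝ, E) (u i) y v := by
      let L : OneForms 𝓘(ℝ, E) M →+ ℝ :=
        { toFun := fun Θ => Θ y v, map_zero' := rfl, map_add' := fun _ _ => rfl }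
      exact map_sum L _ _
    have h5 : v = ∑ i, b.coord i (e.continuousLinearMapAt ℝ y v) • e.symmL ℝ y (b i) := by
      conv_lhs => rw [← e.symmL_continuousLinearMapAt (R := ℝ) hy v,
        ← b.sum_repr (e.continuousLinearMapAt ℝ y v), map_sum]
      exact Finset.sum_congr rfl fun i _ => map_smul _ _ _
    rw [h4]
    conv_lhs => rw [h5, map_sum]
    refine Finset.sum_congr rfl fun i _ => ?_
    rw [map_smul, h2 i, mvfderiv_congr (h1 i), mvfderiv_clm_extChartAt h3, smul_eq_mul, mul_comm]
    exact congrArg (fun w => Φ y (e.symmL ℝ y (b i)) * b.coord i w) (DFunLike.congr_fun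
      (TangentBundle.continuousLinearMapAt_trivializationAt (I := 𝓘(ℝ, E)) h3) v)
  obtain ⟨χ, h1, h2⟩ := exists_bump (E := E) hev
  have h3 : smulSection χ Φ =
      smulSection χ (∑ i, smulSection (formPair Φ (Y i)) (formDiff (u i))) := by
    ext1 y
    change χ y • Φ y = χ y • _
    by_cases hy : Φ y = (∑ i, smulSection (formPair Φ (Y i)) (formDiff (u i)) :
      OneForms 𝓘(ℝ, E) M) y
    · rw [hy]
    · rw [h2 y hy, zero_smul, zero_smul]
  have h4 := congrArg A h3
  rw [hsmul, hsmul, hsum, h1] at h4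
  linarith

end Calculus

/-! ### The bracket of 1-forms on a Poisson manifold -/

section FormBracket

variable {E : Type*} [NormedAddCommGroup E] [NormedSpace ℝ E] [FiniteDimensional ℝ E]
  {M : Type*} [TopologicalSpace M] [ChartedSpace E M] [IsManifold 𝓘(ℝ, E) ∞ M]
  [T2Space M] [SigmaCompactSpace M]

theorem formPair_sub_left (Φ Ψ : OneForms 𝓘(ℝ, E) M) (X : VectorFields 𝓘(ℝ, E) M) :
    formPair (Φ - Ψ) X = formPair Φ X - formPair Ψ X := by
  ext x; rfl

theorem formPair_neg_left (Φ : OneForms 𝓘(ℝ, E) M) (X : VectorFields 𝓘(ℝ, E) M) :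
    formPair (-Φ) X = -formPair Φ X := by
  ext x; rfl

theorem formDiff_add (f g : C^∞⟮𝓘(ℝ, E), M; 𝓘(ℝ), ℝ⟯) :
    formDiff (f + g) = formDiff f + formDiff g := by
  ext1 x; exact mvfderiv_add_apply f g x

theorem formDiff_zero : formDiff (0 : C^∞⟮𝓘(ℝ, E), M; 𝓘(ℝ), ℝ⟯) = 0 := by
  simpa using formDiff_add (0 : C^∞⟮𝓘(ℝ, E), M; 𝓘(ℝ), ℝ⟯) 0

theorem fieldDeriv_algebraMap (X : VectorFields 𝓘(ℝ, E) M) (c : ℝ) :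
    fieldDeriv X (algebraMap ℝ C^∞⟮𝓘(ℝ, E), M; 𝓘(ℝ), ℝ⟯ c) = 0 := by
  ext x
  have h := (hasMFDerivAt_const (I := 𝓘(ℝ, E)) (I' := 𝓘(ℝ)) c x).mfderiv
  exact DFunLike.congr_fun h (X x)

theorem mdifferentiableAt_formPair (ψ : OneForms 𝓘(ℝ, E) M) {x : M}
    {Y : ∀ x : M, TangentSpace 𝓘(ℝ, E) x} (hY : MDifferentiableAt 𝓘(ℝ, E) 𝓘(ℝ, E).tangent
      (fun y => (⟨y, Y y⟩ : TangentBundle 𝓘(ℝ, E) M)) x) :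
    MDifferentiableAt 𝓘(ℝ, E) 𝓘(ℝ) (fun y => ψ y (Y y)) x := by
  have h1 : MDifferentiableAt 𝓘(ℝ, E) (𝓘(ℝ, E).prod 𝓘(ℝ, E →L[ℝ] ℝ))
    (fun y => (⟨y, ψ y⟩ : CotangentBundle 𝓘(ℝ, E) M)) x := mdifferentiableAt_section ψ x
  have h := MDifferentiableAt.clm_bundle_apply (E₂ := Bundle.Trivial M ℝ) (F₂ := ℝ) h1 hY
  rw [mdifferentiableAt_totalSpace] at h
  exact h.2

/-- The property that defines `lieDerivOneForm` by choice can be satisfied, because `X⟨ψ, Y⟩ - ⟨ψ,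
[X, Y]⟩` is tensorial in `Y`. -/
theorem exists_lieDerivOneForm (X : VectorFields 𝓘(ℝ, E) M) (ψ : OneForms 𝓘(ℝ, E) M) (x : M) :
    ∃ θ : CotangentSpace 𝓘(ℝ, E) x, ∀ Y : VectorFields 𝓘(ℝ, E) M,
      θ (Y x) = mvfderiv 𝓘(ℝ, E) (fun y => ψ y (Y y)) x (X x) -
        ψ x (VectorField.mlieBracket 𝓘(ℝ, E) X Y x) := by
  have h2 := isManifold_two (E := E) (M := M)
  have : IsManifold 𝓘(ℝ, E) 1 M := IsManifold.of_le (n := ∞) (by simp)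
  have htens : TensorialAt 𝓘(ℝ, E) E (fun Y : ∀ x : M, TangentSpace 𝓘(ℝ, E) x =>
      mvfderiv 𝓘(ℝ, E) (fun y => ψ y (Y y)) x (X x) -
        ψ x (VectorField.mlieBracket 𝓘(ℝ, E) X Y x)) x := by
    constructor
    · intro f Y hf hY
      have h1 := (hf.hasMFDerivAt.mul (mdifferentiableAt_formPair ψ hY).hasMFDerivAt).mfderiv
      have h3 : (fun y => ψ y ((f • Y) y)) = fun y => f y * ψ y (Y y) := by
        funext y; exact map_smul (ψ y) (f y) (Y y)
      have h4 : mvfderiv 𝓘(ℝ, E) (fun y => f y * ψ y (Y y)) x (X x) =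
          f x * mvfderiv 𝓘(ℝ, E) (fun y => ψ y (Y y)) x (X x) +
            ψ x (Y x) * mvfderiv 𝓘(ℝ, E) f x (X x) := DFunLike.congr_fun h1 (X x)
      rw [h3, h4, VectorField.mlieBracket_smul_right hf hY, map_add, map_smul, map_smul]
      simp only [smul_eq_mul]
      ring
    · intro Y Z hY hZ
      have h1 := ((mdifferentiableAt_formPair ψ hY).hasMFDerivAt.add
        (mdifferentiableAt_formPair ψ hZ).hasMFDerivAt).mfderiv
      have h3 : (fun y => ψ y ((Y + Z) y)) = fun y => ψ y (Y y) + ψ y (Z y) := by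
        funext y; exact map_add (ψ y) (Y y) (Z y)
      have h4 : mvfderiv 𝓘(ℝ, E) (fun y => ψ y (Y y) + ψ y (Z y)) x (X x) =
          mvfderiv 𝓘(ℝ, E) (fun y => ψ y (Y y)) x (X x) +
          mvfderiv 𝓘(ℝ, E) (fun y => ψ y (Z y)) x (X x) := DFunLike.congr_fun h1 (X x)
      rw [h3, h4, VectorField.mlieBracket_add_right hY hZ, map_add]
      ring
  exact ⟨TensorialAt.mkHom _ x htens, fun Y =>
    TensorialAt.mkHom_apply htens (mdifferentiableAt_section Y x)⟩

theorem lieDerivOneForm_apply (X : VectorFields 𝓘(ℝ, E) M) (ψ : OneForms 𝓘(ℝ, E) M) (x : M)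
    (Y : VectorFields 𝓘(ℝ, E) M) :
    lieDerivOneForm (fun x => X x) (fun x => ψ x) x (Y x) =
      (fieldDeriv X (formPair ψ Y) - formPair ψ (fieldBracket X Y) :
        C^∞⟮𝓘(ℝ, E), M; 𝓘(ℝ), ℝ⟯) x :=
  Classical.epsilon_spec (exists_lieDerivOneForm X ψ x) Y

namespace PoissonStructure

variable (π : PoissonStructure 𝓘(ℝ, E) M)

/-- The vector field `π^# Φ`. -/
def sharpField (Φ : OneForms 𝓘(ℝ, E) M) : VectorFields 𝓘(ℝ, E) M :=
  ⟨fun x => π.sharp x (Φ x), π.contMDiff_anchor.comp Φ.contMDiff⟩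

theorem oneFormBracket_apply (Φ Ψ : OneForms 𝓘(ℝ, E) M) (Z : VectorFields 𝓘(ℝ, E) M) (x : M) :
    π.oneFormBracket (fun x => Φ x) (fun x => Ψ x) x (Z x) =
      (fieldDeriv (π.sharpField Φ) (formPair Ψ Z) - formPair Ψ (fieldBracket (π.sharpField Φ) Z) -
      (fieldDeriv (π.sharpField Ψ) (formPair Φ Z) - formPair Φ (fieldBracket (π.sharpField Ψ) Z)) -
      fieldDeriv Z (formPair Ψ (π.sharpField Φ)) : C^∞⟮𝓘(ℝ, E), M; 𝓘(ℝ), ℝ⟯) x := by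
  have h1 := lieDerivOneForm_apply (π.sharpField Φ) Ψ x Z
  have h2 := lieDerivOneForm_apply (π.sharpField Ψ) Φ x Z
  exact congrArg₂ (fun a b : ℝ => a - b - fieldDeriv Z (formPair Ψ (π.sharpField Φ)) x) h1 h2

/-- The bracket of 1-forms as a smooth 1-form. -/
def formBracket (Φ Ψ : OneForms 𝓘(ℝ, E) M) : OneForms 𝓘(ℝ, E) M :=
  ⟨fun x => π.oneFormBracket (fun x => Φ x) (fun x => Ψ x) x, contMDiff_dual_section fun Z =>
    (ContMDiffMap.contMDiff _).congr fun x => π.oneFormBracket_apply Φ Ψ Z x⟩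

variable (Φ Ψ Θ : OneForms 𝓘(ℝ, E) M) (X Z : VectorFields 𝓘(ℝ, E) M)
  (f g h : C^∞⟮𝓘(ℝ, E), M; 𝓘(ℝ), ℝ⟯)

theorem formPair_formBracket : formPair (π.formBracket Φ Ψ) Z =
    fieldDeriv (π.sharpField Φ) (formPair Ψ Z) - formPair Ψ (fieldBracket (π.sharpField Φ) Z) -
      (fieldDeriv (π.sharpField Ψ) (formPair Φ Z) - formPair Φ (fieldBracket (π.sharpField Ψ) Z)) -
      fieldDeriv Z (formPair Ψ (π.sharpField Φ)) := by
  ext x; exact π.oneFormBracket_apply Φ Ψ Z x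

theorem sharpField_add : π.sharpField (Φ + Ψ) = π.sharpField Φ + π.sharpField Ψ := by
  ext x; exact π.sharp_add (Φ x) (Ψ x)

theorem sharpField_smul : π.sharpField (smulSection f Φ) = smulSection f (π.sharpField Φ) := by
  ext x; exact π.sharp_smul (f x) (Φ x)

theorem formPair_sharpField_swap :
    formPair Φ (π.sharpField Ψ) = -formPair Ψ (π.sharpField Φ) := by
  ext x; exact π.apply_sharp_swap (Φ x) (Ψ x)

theorem formPair_sharpField_self : formPair Φ (π.sharpField Φ) = 0 := by
  ext x; exact π.apply_sharp_self (Φ x)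

theorem fieldDeriv_sharpField_formDiff :
    fieldDeriv (π.sharpField (formDiff f)) g = π.bracket f g := by
  ext x; exact π.mvfderiv_sharp f g x

theorem fieldDeriv_sharpField :
    fieldDeriv (π.sharpField Φ) f = -formPair Φ (π.sharpField (formDiff f)) := by
  rw [← formPair_formDiff, formPair_sharpField_swap]

theorem formBracket_formDiff :
    π.formBracket (formDiff f) (formDiff g) = formDiff (π.bracket f g) := by
  refine form_ext_of_formPair fun Z => ?_
  simp only [formPair_formBracket, formPair_formDiff, fieldDeriv_fieldBracket,
    fieldDeriv_sharpField_formDiff]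
  rw [π.bracket_swap g f, fieldDeriv_neg]
  ring

theorem formBracket_self : π.formBracket Φ Φ = 0 := by
  refine form_ext_of_formPair fun Z => ?_
  rw [formPair_formBracket, formPair_sharpField_self, sub_self, zero_sub, ← fieldDeriv_neg, neg_zero]
  ext x
  have := DFunLike.congr_fun (fieldDeriv_smul Z (0 : C^∞⟮𝓘(ℝ, E), M; 𝓘(ℝ), ℝ⟯) 0) x
  rw [zero_smul, zero_smul] at this
  exact this

theorem formBracket_add_left :
    π.formBracket (Φ + Ψ) Θ = π.formBracket Φ Θ + π.formBracket Ψ Θ := by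
  refine form_ext_of_formPair fun Z => ?_
  simp only [formPair_formBracket, formPair_add_left, sharpField_add, fieldDeriv_add_left,
    fieldBracket_add_left, formPair_add_right, fieldDeriv_add]
  ring

theorem formBracket_add_right :
    π.formBracket Φ (Ψ + Θ) = π.formBracket Φ Ψ + π.formBracket Φ Θ := by
  refine form_ext_of_formPair fun Z => ?_
  simp only [formPair_formBracket, formPair_add_left, sharpField_add, fieldDeriv_add_left,
    fieldBracket_add_left, formPair_add_right, fieldDeriv_add]
  ring

theorem formBracket_swap : π.formBracket Φ Ψ = -π.formBracket Ψ Φ := by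
  have h := π.formBracket_self (Φ + Ψ)
  rw [formBracket_add_left, formBracket_add_right, formBracket_add_right, formBracket_self,
    formBracket_self, zero_add, add_zero] at h
  exact eq_neg_of_add_eq_zero_left h

theorem formBracket_sub_right :
    π.formBracket Φ (Ψ - Θ) = π.formBracket Φ Ψ - π.formBracket Φ Θ := by
  rw [eq_sub_iff_add_eq, ← formBracket_add_right, sub_add_cancel]

theorem formBracket_smul_right : π.formBracket Φ (smulSection f Ψ) =
    smulSection f (π.formBracket Φ Ψ) + smulSection (fieldDeriv (π.sharpField Φ) f) Ψ := by
  refine form_ext_of_formPair fun Z => ?_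
  simp only [formPair_formBracket, formPair_add_left, sharpField_smul, formPair_smul_left,
    fieldDeriv_mul, fieldDeriv_smul_left, fieldBracket_smul_left, formPair_sub_right,
    formPair_smul_right]
  rw [π.formPair_sharpField_swap Φ Ψ]
  ring

theorem formBracket_smul_left : π.formBracket (smulSection f Φ) Ψ =
    smulSection f (π.formBracket Φ Ψ) - smulSection (fieldDeriv (π.sharpField Ψ) f) Φ := by
  rw [formBracket_swap, formBracket_smul_right, π.formBracket_swap Φ Ψ]
  ext1 x
  change -(f x • π.formBracket Ψ Φ x + fieldDeriv (π.sharpField Ψ) f x • Φ x) =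
    f x • -π.formBracket Ψ Φ x - fieldDeriv (π.sharpField Ψ) f x • Φ x
  module

/-- The Hamiltonian vector field `H = π^#(df)` preserves the Poisson tensor: the expression is
`-(𝔏_H π)(Φ, Ψ)`, which is tensorial and vanishes on exact forms by the Jacobi identity. -/
theorem lieDeriv_hamiltonian_eq_zero :
    formPair Ψ (fieldBracket (π.sharpField Φ) (π.sharpField (formDiff f))) -
      formPair Φ (fieldBracket (π.sharpField Ψ) (π.sharpField (formDiff f))) +
      fieldDeriv (π.sharpField (formDiff f)) (formPair Ψ (π.sharpField Φ)) = 0 := by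
  set H := π.sharpField (formDiff f) with hH
  let T : OneForms 𝓘(ℝ, E) M → OneForms 𝓘(ℝ, E) M → C^∞⟮𝓘(ℝ, E), M; 𝓘(ℝ), ℝ⟯ := fun Φ Ψ =>
    formPair Ψ (fieldBracket (π.sharpField Φ) H) - formPair Φ (fieldBracket (π.sharpField Ψ) H) +
      fieldDeriv H (formPair Ψ (π.sharpField Φ))
  have hswap : ∀ Φ Ψ, T Φ Ψ = -T Ψ Φ := by
    intro Φ Ψ
    simp only [T]
    rw [π.formPair_sharpField_swap Ψ Φ, fieldDeriv_neg]
    ring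
  have hadd : ∀ Φ Ψ Θ, T Φ (Ψ + Θ) = T Φ Ψ + T Φ Θ := by
    intro Φ Ψ Θ
    simp only [T, formPair_add_left, sharpField_add, fieldBracket_add_left, formPair_add_right,
      fieldDeriv_add]
    ring
  have hsmul : ∀ Φ f Ψ, T Φ (smulSection f Ψ) = f * T Φ Ψ := by
    intro Φ f Ψ
    simp only [T, formPair_smul_left, sharpField_smul, fieldBracket_smul_left, formPair_sub_right,
      formPair_smul_right, fieldDeriv_mul]
    rw [π.formPair_sharpField_swap Φ Ψ]
    ring
  have hexact : ∀ g h, T (formDiff g) (formDiff h) = 0 := by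
    intro g h
    simp only [T, hH, formPair_formDiff, fieldDeriv_fieldBracket, fieldDeriv_sharpField_formDiff]
    have := π.jacobi f g h
    rw [π.bracket_swap f h, π.bracket_swap h g, map_neg, map_neg]
    linear_combination -this
  have h1 : ∀ g Ψ, T (formDiff g) Ψ = 0 := fun g Ψ => by
    ext x
    exact eq_zero_of_formDiff (x := x) (A := fun Ψ => T (formDiff g) Ψ x)
      (fun Ψ Θ => by simp only [hadd]; rfl) (fun f Ψ => by simp only [hsmul]; rfl)
      (fun h => by simp only [hexact]; rfl) Ψ
  have h2 : T Φ Ψ = 0 := by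
    rw [hswap]
    ext x
    exact neg_eq_zero.2 (eq_zero_of_formDiff (x := x) (A := fun Φ => T Ψ Φ x)
      (fun Ψ Θ => by simp only [hadd]; rfl) (fun f Ψ => by simp only [hsmul]; rfl)
      (fun h => by simp only [hswap Ψ, h1, neg_zero]; rfl) Φ)
  exact h2

/-- `π^#` maps the bracket of 1-forms to the bracket of vector fields. Applied to a function `f`,
this is the invariance of the Poisson tensor under the Hamiltonian field of `f`. -/
theorem sharpField_formBracket :
    π.sharpField (π.formBracket Φ Ψ) = fieldBracket (π.sharpField Φ) (π.sharpField Ψ) := by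
  refine field_ext_of_fieldDeriv fun f => ?_
  have h := π.lieDeriv_hamiltonian_eq_zero Φ Ψ f
  rw [fieldDeriv_sharpField, formPair_formBracket, fieldDeriv_fieldBracket,
    π.fieldDeriv_sharpField Φ f, π.fieldDeriv_sharpField Ψ f, fieldDeriv_neg, fieldDeriv_neg]
  linear_combination h

/-- The Jacobi identity for 1-forms. Since `π^#` preserves brackets, the Jacobiator is linear over
functions in each argument, and on exact forms it is the differential of the Jacobiator of
functions. -/
theorem formBracket_jacobi : π.formBracket Φ (π.formBracket Ψ Θ) +
    π.formBracket Ψ (π.formBracket Θ Φ) + π.formBracket Θ (π.formBracket Φ Ψ) = 0 := by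
  let J : OneForms 𝓘(ℝ, E) M → OneForms 𝓘(ℝ, E) M → OneForms 𝓘(ℝ, E) M → OneForms 𝓘(ℝ, E) M :=
    fun Φ Ψ Θ => π.formBracket Φ (π.formBracket Ψ Θ) +
      π.formBracket Ψ (π.formBracket Θ Φ) + π.formBracket Θ (π.formBracket Φ Ψ)
  have hcyc : ∀ Φ Ψ Θ, J Φ Ψ Θ = J Ψ Θ Φ := by
    intro Φ Ψ Θ
    simp only [J]
    abel
  have hadd : ∀ Φ Ψ Θ Θ', J Φ Ψ (Θ + Θ') = J Φ Ψ Θ + J Φ Ψ Θ' := by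
    intro Φ Ψ Θ Θ'
    simp only [J, formBracket_add_left, formBracket_add_right]
    abel
  have hsmul : ∀ Φ Ψ f Θ, J Φ Ψ (smulSection f Θ) = smulSection f (J Φ Ψ Θ) := by
    intro Φ Ψ f Θ
    refine form_ext_of_formPair fun Z => ?_
    simp only [J, formBracket_smul_right, formBracket_smul_left, formBracket_add_right,
      formBracket_sub_right, formPair_add_left, formPair_sub_left, formPair_smul_left,
      sharpField_formBracket, fieldDeriv_fieldBracket]
    rw [π.formBracket_swap Φ Θ, formPair_neg_left]
    ring
  have hexact : ∀ f g h, J (formDiff f) (formDiff g) (formDiff h) = 0 := by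
    intro f g h
    simp only [J, formBracket_formDiff]
    rw [← formDiff_add, ← formDiff_add, π.jacobi, formDiff_zero]
  -- By cyclic symmetry, exact arguments can be replaced by arbitrary ones one at a time.
  have h0 : ∀ Φ Ψ, (∀ f, J Φ Ψ (formDiff f) = 0) → ∀ Θ, J Φ Ψ Θ = 0 := by
    intro Φ Ψ hf Θ
    refine form_ext_of_formPair fun Z => ?_
    ext x
    refine (eq_zero_of_formDiff (x := x) (A := fun Θ => J Φ Ψ Θ x (Z x))
      (fun Ψ Θ => by simp only [hadd]; rfl) (fun f Ψ => by simp only [hsmul]; rfl)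
      (fun h => by simp only [hf]; rfl) Θ).trans rfl
  have h1 : ∀ f g Θ, J (formDiff f) (formDiff g) Θ = 0 := fun f g => h0 _ _ (hexact f g)
  have h2 : ∀ f Ψ Θ, J Θ (formDiff f) Ψ = 0 := fun f Ψ Θ =>
    h0 _ _ (fun g => by rw [hcyc, h1]) Ψ
  exact h0 _ _ (fun f => by rw [hcyc, h2]) Θ

theorem formBracket_const_smul_right (c : ℝ) :
    π.formBracket Φ (c • Ψ) = c • π.formBracket Φ Ψ := by
  have h1 : ∀ Θ : OneForms 𝓘(ℝ, E) M, c • Θ = smulSection (algebraMap ℝ _ c) Θ := fun Θ => rfl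
  rw [h1, h1, formBracket_smul_right, fieldDeriv_algebraMap]
  ext1 x
  change _ + (0 : ℝ) • Ψ x = _
  rw [zero_smul, add_zero]

theorem formBracket_const_smul_left (c : ℝ) :
    π.formBracket (c • Φ) Ψ = c • π.formBracket Φ Ψ := by
  rw [formBracket_swap, formBracket_const_smul_right, π.formBracket_swap Φ]
  ext1 x
  exact (smul_neg c (π.formBracket Ψ Φ x)).symm

/-- The Lie algebroid structure of the cotangent bundle of a Poisson manifold. -/
def cotangentAlgebroid :
    LieAlgebroid 𝓘(ℝ, E) (E →L[ℝ] ℝ) (fun x : M => CotangentSpace 𝓘(ℝ, E) x) where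
  bracket := LinearMap.mk₂ ℝ π.formBracket π.formBracket_add_left
    (fun c Φ Ψ => π.formBracket_const_smul_left Φ Ψ c) π.formBracket_add_right
    (fun c Φ Ψ => π.formBracket_const_smul_right Φ Ψ c)
  anchor := π.sharpL
  contMDiff_anchor := π.contMDiff_anchor
  bracket_self := π.formBracket_self
  jacobi := π.formBracket_jacobi
  leibniz Φ Ψ f x := DFunLike.congr_fun (π.formBracket_smul_right Φ Ψ f) x
  anchor_bracket Φ Ψ x := DFunLike.congr_fun (π.sharpField_formBracket Φ Ψ) x

end PoissonStructure

end FormBracket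

/-! ### The tangent groupoid -/

section TangentGroupoid

variable {E : Type*} [NormedAddCommGroup E] [NormedSpace ℝ E] [FiniteDimensional ℝ E]
  {G : Type*} [TopologicalSpace G] [ChartedSpace E G] [IsManifold 𝓘(ℝ, E) ∞ G]
  {F : Type*} [NormedAddCommGroup F] [NormedSpace ℝ F] [FiniteDimensional ℝ F]
  {P : Type*} [TopologicalSpace P] [ChartedSpace F P] [IsManifold 𝓘(ℝ, F) ∞ P]

namespace LieGroupoid

variable (𝒢 : LieGroupoid 𝓘(ℝ, E) G 𝓘(ℝ, F) P)

/-- The structure maps of the tangent groupoid of `𝒢`. -/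
abbrev tan : GroupoidMaps (TangentBundle 𝓘(ℝ, E) G) (TangentBundle 𝓘(ℝ, F) P) :=
  𝒢.tangent 𝓘(ℝ, E) 𝓘(ℝ, F)

/-- The derivative of the multiplication at `(h, g)`, as an endomorphism of the model spaces. -/
def mulDeriv (h g : G) : E × E →L[ℝ] E :=
  mfderivWithin (𝓘(ℝ, E).prod 𝓘(ℝ, E)) 𝓘(ℝ, E) (fun p : G × G => 𝒢.mul p.1 p.2)
    𝒢.composable (h, g)

theorem tan_mul_eq (η ξ : TangentBundle 𝓘(ℝ, E) G) :
    𝒢.tan.mul η ξ = ⟨𝒢.mul η.1 ξ.1, 𝒢.mulDeriv η.1 ξ.1 (η.2, ξ.2)⟩ := rfl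

section Smoothness

variable {EX : Type*} [NormedAddCommGroup EX] [NormedSpace ℝ EX]
  {HX : Type*} [TopologicalSpace HX] {IX : ModelWithCorners ℝ EX HX}
  {X : Type*} [TopologicalSpace X] [ChartedSpace HX X]

theorem contMDiffAt_src (g : G) : ContMDiffAt 𝓘(ℝ, E) 𝓘(ℝ, F) ∞ 𝒢.src g :=
  𝒢.isLieGroupoid.contMDiff_src g

theorem contMDiffAt_tgt (g : G) : ContMDiffAt 𝓘(ℝ, E) 𝓘(ℝ, F) ∞ 𝒢.tgt g :=
  𝒢.isLieGroupoid.contMDiff_tgt g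

theorem contMDiffAt_one (m : P) : ContMDiffAt 𝓘(ℝ, F) 𝓘(ℝ, E) ∞ 𝒢.one m :=
  𝒢.isLieGroupoid.contMDiff_one m

theorem contMDiffAt_src_comp {g : X → G} {x₀ : X} (hg : ContMDiffAt IX 𝓘(ℝ, E) ∞ g x₀) :
    ContMDiffAt IX 𝓘(ℝ, F) ∞ (fun x => 𝒢.src (g x)) x₀ :=
  (𝒢.contMDiffAt_src _).comp x₀ hg

theorem contMDiffAt_tgt_comp {g : X → G} {x₀ : X} (hg : ContMDiffAt IX 𝓘(ℝ, E) ∞ g x₀) :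
    ContMDiffAt IX 𝓘(ℝ, F) ∞ (fun x => 𝒢.tgt (g x)) x₀ :=
  (𝒢.contMDiffAt_tgt _).comp x₀ hg

theorem contMDiffAt_one_comp {m : X → P} {x₀ : X} (hm : ContMDiffAt IX 𝓘(ℝ, F) ∞ m x₀) :
    ContMDiffAt IX 𝓘(ℝ, E) ∞ (fun x => 𝒢.one (m x)) x₀ :=
  (𝒢.contMDiffAt_one _).comp x₀ hm

theorem contMDiffWithinAt_mul {h g : X → G} {s : Set X} {x₀ : X}
    (hh : ContMDiffWithinAt IX 𝓘(ℝ, E) ∞ h s x₀) (hg : ContMDiffWithinAt IX 𝓘(ℝ, E) ∞ g s x₀)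
    (hc : ∀ x ∈ s, 𝒢.src (h x) = 𝒢.tgt (g x)) (hc₀ : 𝒢.src (h x₀) = 𝒢.tgt (g x₀)) :
    ContMDiffWithinAt IX 𝓘(ℝ, E) ∞ (fun x => 𝒢.mul (h x) (g x)) s x₀ :=
  (𝒢.isLieGroupoid.contMDiffOn_mul (h x₀, g x₀) hc₀).comp (t := 𝒢.composable) x₀
    (hh.prodMk hg) hc

theorem contMDiffAt_mul {h g : X → G} {x₀ : X}
    (hh : ContMDiffAt IX 𝓘(ℝ, E) ∞ h x₀) (hg : ContMDiffAt IX 𝓘(ℝ, E) ∞ g x₀)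
    (hc : ∀ᶠ x in 𝓝 x₀, 𝒢.src (h x) = 𝒢.tgt (g x)) :
    ContMDiffAt IX 𝓘(ℝ, E) ∞ (fun x => 𝒢.mul (h x) (g x)) x₀ :=
  (𝒢.contMDiffWithinAt_mul (s := {x | 𝒢.src (h x) = 𝒢.tgt (g x)}) hh.contMDiffWithinAt
    hg.contMDiffWithinAt (fun _ hx => hx) hc.self_of_nhds).contMDiffAt hc

end Smoothness

/-- Near a composable pair the multiplication extends smoothly to an open subset of `G × G`. -/
theorem exists_mul_extension {h₀ g₀ : G} (hc : 𝒢.src h₀ = 𝒢.tgt g₀) :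
    ∃ (O : Set (G × G)) (κ : G × G → G), IsOpen O ∧ (h₀, g₀) ∈ O ∧
      ContMDiffOn (𝓘(ℝ, E).prod 𝓘(ℝ, E)) 𝓘(ℝ, E) ∞ κ O ∧
      ∀ p ∈ O, p ∈ 𝒢.composable → κ p = 𝒢.mul p.1 p.2 := by
  obtain ⟨W, s, hW, hW₀, hs, hs1, hs2⟩ := exists_section_family 𝒢.isLieGroupoid.contMDiff_tgt g₀
    (𝒢.isLieGroupoid.tgt_submersion g₀)
  have hf : ContMDiff (𝓘(ℝ, E).prod 𝓘(ℝ, E)) (𝓘(ℝ, F).prod 𝓘(ℝ, E)) ∞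
      (fun p : G × G => (𝒢.src p.1, p.2)) :=
    (𝒢.isLieGroupoid.contMDiff_src.comp contMDiff_fst).prodMk contMDiff_snd
  -- `κ (h, g) = h s(αh, g)`, where `s(·, g)` is a section of the target through `g`.
  refine ⟨(fun p : G × G => (𝒢.src p.1, p.2)) ⁻¹' W, fun p => 𝒢.mul p.1 (s (𝒢.src p.1, p.2)),
    hW.preimage hf.continuous, by simpa [hc] using hW₀, fun p hp => ?_, fun p hp hp' => ?_⟩
  · exact 𝒢.contMDiffWithinAt_mul contMDiffWithinAt_fst
      ((hs.comp hf.contMDiffOn (fun _ h => h)) p hp) (fun q hq => (hs1 _ hq).symm) (hs1 _ hp).symm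
  · have h1 : 𝒢.src p.1 = 𝒢.tgt p.2 := hp'
    change (𝒢.src p.1, p.2) ∈ W at hp
    change 𝒢.mul p.1 (s (𝒢.src p.1, p.2)) = _
    rw [h1] at hp ⊢
    rw [hs2 _ hp]

/-- A curve `h` and a tangent vector composable with its velocity: the vector is the velocity of a
curve composable with `h`. -/
theorem exists_composable_curve {h : ℝ → G} (hh : ContMDiffAt 𝓘(ℝ) 𝓘(ℝ, E) ∞ h 0)
    {ξ : TangentBundle 𝓘(ℝ, E) G} (hc : 𝒢.tan.src (velocity 𝓘(ℝ, E) h) = 𝒢.tan.tgt ξ) :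
    ∃ g : ℝ → G, ContMDiffAt 𝓘(ℝ) 𝓘(ℝ, E) ∞ g 0 ∧ velocity 𝓘(ℝ, E) g = ξ ∧
      ∀ᶠ t in 𝓝 0, 𝒢.src (h t) = 𝒢.tgt (g t) := by
  obtain ⟨g, hg, rfl⟩ := exists_velocity_eq ξ
  obtain ⟨W, s, hW, hW₀, hs, hs1, hs2⟩ := exists_section_family 𝒢.isLieGroupoid.contMDiff_tgt (g 0)
    (𝒢.isLieGroupoid.tgt_submersion (g 0))
  have h0 : 𝒢.src (h 0) = 𝒢.tgt (g 0) := congrArg TotalSpace.proj hc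
  have hsat : ContMDiffAt (𝓘(ℝ, F).prod 𝓘(ℝ, E)) 𝓘(ℝ, E) ∞ s (𝒢.tgt (g 0), g 0) :=
    hs.contMDiffAt (hW.mem_nhds hW₀)
  have h1 : ContMDiffAt 𝓘(ℝ) (𝓘(ℝ, F).prod 𝓘(ℝ, E)) ∞ (fun t => (𝒢.src (h t), g t)) 0 :=
    (𝒢.contMDiffAt_src_comp hh).prodMk hg
  have h2 : ContMDiffAt 𝓘(ℝ) (𝓘(ℝ, F).prod 𝓘(ℝ, E)) ∞ (fun t => (𝒢.tgt (g t), g t)) 0 :=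
    (𝒢.contMDiffAt_tgt_comp hg).prodMk hg
  have hsat' : ContMDiffAt (𝓘(ℝ, F).prod 𝓘(ℝ, E)) 𝓘(ℝ, E) ∞ s (𝒢.src (h 0), g 0) := by
    rw [h0]; exact hsat
  -- The curve `g` is corrected by the sections of the target through its points; this does not
  -- change its velocity, since `T(α)` of the velocity of `h` is `T(β)` of that of `g`.
  refine ⟨fun t => s (𝒢.src (h t), g t), ContMDiffAt.comp 0 hsat' h1, ?_, ?_⟩
  · have e1 : velocity 𝓘(ℝ, E) (fun t => s (𝒢.src (h t), g t)) =
        tangentMap (𝓘(ℝ, F).prod 𝓘(ℝ, E)) 𝓘(ℝ, E) s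
          (tangentPair (𝒢.tan.src (velocity 𝓘(ℝ, E) h)) (velocity 𝓘(ℝ, E) g)) := by
      rw [velocity_comp (f := s) (γ := fun t => (𝒢.src (h t), g t))
        (hsat'.mdifferentiableAt (by simp)) (h1.mdifferentiableAt (by simp)),
        velocity_prodMk ((𝒢.contMDiffAt_src_comp hh).mdifferentiableAt (by simp))
          (hg.mdifferentiableAt (by simp))]
      congr 2
      exact velocity_comp ((𝒢.contMDiffAt_src _).mdifferentiableAt (by simp))
        (hh.mdifferentiableAt (by simp))
    have e2 : velocity 𝓘(ℝ, E) (fun t => s (𝒢.tgt (g t), g t)) =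
        tangentMap (𝓘(ℝ, F).prod 𝓘(ℝ, E)) 𝓘(ℝ, E) s
          (tangentPair (𝒢.tan.tgt (velocity 𝓘(ℝ, E) g)) (velocity 𝓘(ℝ, E) g)) := by
      rw [velocity_comp (f := s) (γ := fun t => (𝒢.tgt (g t), g t))
        (hsat.mdifferentiableAt (by simp)) (h2.mdifferentiableAt (by simp)),
        velocity_prodMk ((𝒢.contMDiffAt_tgt_comp hg).mdifferentiableAt (by simp))
          (hg.mdifferentiableAt (by simp))]
      congr 2
      exact velocity_comp ((𝒢.contMDiffAt_tgt _).mdifferentiableAt (by simp))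
        (hg.mdifferentiableAt (by simp))
    rw [e1, hc, ← e2]
    refine velocity_congr ?_
    filter_upwards [h2.continuousAt.eventually (hW.mem_nhds hW₀)] with t ht
    exact hs2 _ ht
  · filter_upwards [h1.continuousAt.eventually (hW.mem_nhds (by
      change (𝒢.src (h 0), g 0) ∈ W
      rw [h0]; exact hW₀))] with t ht
    exact (hs1 _ ht).symm

theorem exists_composable_curves {η ξ : TangentBundle 𝓘(ℝ, E) G}
    (hc : 𝒢.tan.src η = 𝒢.tan.tgt ξ) :
    ∃ h g : ℝ → G, ContMDiffAt 𝓘(ℝ) 𝓘(ℝ, E) ∞ h 0 ∧ ContMDiffAt 𝓘(ℝ) 𝓘(ℝ, E) ∞ g 0 ∧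
      velocity 𝓘(ℝ, E) h = η ∧ velocity 𝓘(ℝ, E) g = ξ ∧
      ∀ᶠ t in 𝓝 0, 𝒢.src (h t) = 𝒢.tgt (g t) := by
  obtain ⟨h, hh, rfl⟩ := exists_velocity_eq η
  obtain ⟨g, hg, rfl, h1⟩ := 𝒢.exists_composable_curve hh hc
  exact ⟨h, g, hh, hg, rfl, rfl, h1⟩

section Velocity

variable {h g : ℝ → G}

theorem velocity_src (hg : ContMDiffAt 𝓘(ℝ) 𝓘(ℝ, E) ∞ g 0) :
    velocity 𝓘(ℝ, F) (fun t => 𝒢.src (g t)) = 𝒢.tan.src (velocity 𝓘(ℝ, E) g) :=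
  velocity_comp ((𝒢.contMDiffAt_src _).mdifferentiableAt (by simp)) (hg.mdifferentiableAt (by simp))

theorem velocity_tgt (hg : ContMDiffAt 𝓘(ℝ) 𝓘(ℝ, E) ∞ g 0) :
    velocity 𝓘(ℝ, F) (fun t => 𝒢.tgt (g t)) = 𝒢.tan.tgt (velocity 𝓘(ℝ, E) g) :=
  velocity_comp ((𝒢.contMDiffAt_tgt _).mdifferentiableAt (by simp)) (hg.mdifferentiableAt (by simp))

theorem velocity_one {m : ℝ → P} (hm : ContMDiffAt 𝓘(ℝ) 𝓘(ℝ, F) ∞ m 0) :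
    velocity 𝓘(ℝ, E) (fun t => 𝒢.one (m t)) = 𝒢.tan.one (velocity 𝓘(ℝ, F) m) :=
  velocity_comp ((𝒢.contMDiffAt_one _).mdifferentiableAt (by simp)) (hm.mdifferentiableAt (by simp))

/-- The product of two curves of composable elements has velocity the product of the velocities in
the tangent groupoid. -/
theorem velocity_mul (hh : ContMDiffAt 𝓘(ℝ) 𝓘(ℝ, E) ∞ h 0) (hg : ContMDiffAt 𝓘(ℝ) 𝓘(ℝ, E) ∞ g 0)
    (hc : ∀ᶠ t in 𝓝 0, 𝒢.src (h t) = 𝒢.tgt (g t)) :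
    velocity 𝓘(ℝ, E) (fun t => 𝒢.mul (h t) (g t)) =
      𝒢.tan.mul (velocity 𝓘(ℝ, E) h) (velocity 𝓘(ℝ, E) g) := by
  have h1 := ((𝒢.isLieGroupoid.contMDiffOn_mul (h 0, g 0) hc.self_of_nhds).mdifferentiableWithinAt
    (by simp)).hasMFDerivWithinAt
  have h2 := (hh.mdifferentiableAt (by simp)).hasMFDerivAt.prodMk
    (hg.mdifferentiableAt (by simp)).hasMFDerivAt
  have h3 := h1.comp (u := 𝒢.composable)
    (s := {t | 𝒢.src (h t) = 𝒢.tgt (g t)}) (0 : ℝ) h2.hasMFDerivWithinAt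
    (fun _ ht => ht)
  exact velocity_of_hasMFDerivAt (h3.hasMFDerivAt hc)

end Velocity

variable {η ξ ζ : TangentBundle 𝓘(ℝ, E) G}

theorem tan_src_mul (hc : 𝒢.tan.src η = 𝒢.tan.tgt ξ) :
    𝒢.tan.src (𝒢.tan.mul η ξ) = 𝒢.tan.src ξ := by
  obtain ⟨h, g, hh, hg, rfl, rfl, hc'⟩ := 𝒢.exists_composable_curves hc
  rw [← 𝒢.velocity_mul hh hg hc', ← 𝒢.velocity_src (𝒢.contMDiffAt_mul hh hg hc'),
    ← 𝒢.velocity_src hg]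
  exact velocity_congr (hc'.mono fun t ht => 𝒢.isLieGroupoid.src_mul _ _ ht)

theorem tan_tgt_mul (hc : 𝒢.tan.src η = 𝒢.tan.tgt ξ) :
    𝒢.tan.tgt (𝒢.tan.mul η ξ) = 𝒢.tan.tgt η := by
  obtain ⟨h, g, hh, hg, rfl, rfl, hc'⟩ := 𝒢.exists_composable_curves hc
  rw [← 𝒢.velocity_mul hh hg hc', ← 𝒢.velocity_tgt (𝒢.contMDiffAt_mul hh hg hc'),
    ← 𝒢.velocity_tgt hh]
  exact velocity_congr (hc'.mono fun t ht => 𝒢.isLieGroupoid.tgt_mul _ _ ht)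

theorem tan_mul_assoc (h1 : 𝒢.tan.src η = 𝒢.tan.tgt ξ) (h2 : 𝒢.tan.src ξ = 𝒢.tan.tgt ζ) :
    𝒢.tan.mul η (𝒢.tan.mul ξ ζ) = 𝒢.tan.mul (𝒢.tan.mul η ξ) ζ := by
  obtain ⟨h, g, hh, hg, rfl, rfl, hc⟩ := 𝒢.exists_composable_curves h1
  obtain ⟨f, hf, rfl, hc'⟩ := 𝒢.exists_composable_curve hg h2
  have e1 : ∀ᶠ t in 𝓝 0, 𝒢.src (h t) = 𝒢.tgt (𝒢.mul (g t) (f t)) := by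
    filter_upwards [hc, hc'] with t h1 h2
    rw [𝒢.isLieGroupoid.tgt_mul _ _ h2, h1]
  have e2 : ∀ᶠ t in 𝓝 0, 𝒢.src (𝒢.mul (h t) (g t)) = 𝒢.tgt (f t) := by
    filter_upwards [hc, hc'] with t h1 h2
    rw [𝒢.isLieGroupoid.src_mul _ _ h1, h2]
  rw [← 𝒢.velocity_mul hg hf hc', ← 𝒢.velocity_mul hh (𝒢.contMDiffAt_mul hg hf hc') e1,
    ← 𝒢.velocity_mul hh hg hc, ← 𝒢.velocity_mul (𝒢.contMDiffAt_mul hh hg hc) hf e2]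
  refine velocity_congr ?_
  filter_upwards [hc, hc'] with t h1 h2
  exact 𝒢.isLieGroupoid.mul_assoc _ _ _ h1 h2

theorem tan_src_one (v : TangentBundle 𝓘(ℝ, F) P) : 𝒢.tan.src (𝒢.tan.one v) = v := by
  obtain ⟨m, hm, rfl⟩ := exists_velocity_eq v
  rw [← 𝒢.velocity_one hm, ← 𝒢.velocity_src (𝒢.contMDiffAt_one_comp hm)]
  simp only [𝒢.isLieGroupoid.src_one]

theorem tan_tgt_one (v : TangentBundle 𝓘(ℝ, F) P) : 𝒢.tan.tgt (𝒢.tan.one v) = v := by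
  obtain ⟨m, hm, rfl⟩ := exists_velocity_eq v
  rw [← 𝒢.velocity_one hm, ← 𝒢.velocity_tgt (𝒢.contMDiffAt_one_comp hm)]
  simp only [𝒢.isLieGroupoid.tgt_one]

theorem tan_one_mul (ξ : TangentBundle 𝓘(ℝ, E) G) :
    𝒢.tan.mul (𝒢.tan.one (𝒢.tan.tgt ξ)) ξ = ξ := by
  obtain ⟨g, hg, rfl⟩ := exists_velocity_eq ξ
  have h1 := 𝒢.contMDiffAt_tgt_comp hg
  rw [← 𝒢.velocity_tgt hg, ← 𝒢.velocity_one h1,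
    ← 𝒢.velocity_mul (𝒢.contMDiffAt_one_comp h1) hg
      (Eventually.of_forall fun t => 𝒢.isLieGroupoid.src_one _)]
  simp only [𝒢.isLieGroupoid.one_mul]

theorem tan_mul_one (ξ : TangentBundle 𝓘(ℝ, E) G) :
    𝒢.tan.mul ξ (𝒢.tan.one (𝒢.tan.src ξ)) = ξ := by
  obtain ⟨g, hg, rfl⟩ := exists_velocity_eq ξ
  have h1 := 𝒢.contMDiffAt_src_comp hg
  rw [← 𝒢.velocity_src hg, ← 𝒢.velocity_one h1,
    ← 𝒢.velocity_mul hg (𝒢.contMDiffAt_one_comp h1)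
      (Eventually.of_forall fun t => (𝒢.isLieGroupoid.tgt_one _).symm)]
  simp only [𝒢.isLieGroupoid.mul_one]

theorem isManifold_one_of_infty {E : Type*} [NormedAddCommGroup E] [NormedSpace ℝ E]
    {M : Type*} [TopologicalSpace M] [ChartedSpace E M] [IsManifold 𝓘(ℝ, E) ∞ M] :
    IsManifold 𝓘(ℝ, E) 1 M := IsManifold.of_le (n := ∞) (by simp)

/-- On composable pairs the multiplication of `TG` agrees with the tangent map of a smooth extension
of the multiplication to an open subset of `G × G`. -/
theorem contMDiffOn_tan_mul :
    ContMDiffOn (𝓘(ℝ, E).tangent.prod 𝓘(ℝ, E).tangent) 𝓘(ℝ, E).tangent ∞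
      (fun p : TangentBundle 𝓘(ℝ, E) G × TangentBundle 𝓘(ℝ, E) G => 𝒢.tan.mul p.1 p.2)
      𝒢.tan.composable := by
  rintro ⟨η₀, ξ₀⟩ hc₀
  obtain ⟨O, κ, hO, hmem, hκ, hκ'⟩ := 𝒢.exists_mul_extension (h₀ := η₀.1) (g₀ := ξ₀.1)
    (congrArg TotalSpace.proj hc₀)
  have hcont : Continuous fun p : TangentBundle 𝓘(ℝ, E) G × TangentBundle 𝓘(ℝ, E) G =>
      (p.1.1, p.2.1) := by
    have h := FiberBundle.continuous_proj E (TangentSpace 𝓘(ℝ, E) : G → Type _)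
    exact (h.comp continuous_fst).prodMk (h.comp continuous_snd)
  have key : ∀ η ξ : TangentBundle 𝓘(ℝ, E) G, (η.1, ξ.1) ∈ O → 𝒢.tan.src η = 𝒢.tan.tgt ξ →
      𝒢.tan.mul η ξ = tangentMap (𝓘(ℝ, E).prod 𝓘(ℝ, E)) 𝓘(ℝ, E) κ (tangentPair η ξ) := by
    intro η ξ hηξ hc
    obtain ⟨h, g, hh, hg, rfl, rfl, hc'⟩ := 𝒢.exists_composable_curves hc
    have h1 : ContMDiffAt 𝓘(ℝ) (𝓘(ℝ, E).prod 𝓘(ℝ, E)) ∞ (fun t => (h t, g t)) 0 := hh.prodMk hg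
    have h2 : ContMDiffAt (𝓘(ℝ, E).prod 𝓘(ℝ, E)) 𝓘(ℝ, E) ∞ κ (h 0, g 0) :=
      hκ.contMDiffAt (hO.mem_nhds hηξ)
    rw [← 𝒢.velocity_mul hh hg hc', ← velocity_prodMk (hh.mdifferentiableAt (by simp))
      (hg.mdifferentiableAt (by simp)), ← velocity_comp (f := κ) (γ := fun t => (h t, g t))
        (h2.mdifferentiableAt (by simp)) (h1.mdifferentiableAt (by simp))]
    refine velocity_congr ?_
    filter_upwards [hc', h1.continuousAt.eventually (hO.mem_nhds hηξ)] with t ht1 ht2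
    exact (hκ' _ ht2 ht1).symm
  have hT : ContMDiffAt (𝓘(ℝ, E).tangent.prod 𝓘(ℝ, E).tangent) 𝓘(ℝ, E).tangent ∞
      (fun p : TangentBundle 𝓘(ℝ, E) G × TangentBundle 𝓘(ℝ, E) G =>
        tangentMap (𝓘(ℝ, E).prod 𝓘(ℝ, E)) 𝓘(ℝ, E) κ (tangentPair p.1 p.2)) (η₀, ξ₀) := by
    have := isManifold_one_of_infty (E := E) (M := G)
    have h1 := contMDiffOn_tangentMap hO hκ
    have h2 : IsOpen (TotalSpace.proj ⁻¹' O :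
        Set (TangentBundle (𝓘(ℝ, E).prod 𝓘(ℝ, E)) (G × G))) :=
      hO.preimage (FiberBundle.continuous_proj (E × E) _)
    exact (h1.contMDiffAt (h2.mem_nhds hmem)).comp (η₀, ξ₀)
      (contMDiff_tangentPair.contMDiffAt (x := (η₀, ξ₀)))
  refine hT.contMDiffWithinAt.congr_of_eventuallyEq ?_ (key _ _ hmem hc₀)
  filter_upwards [self_mem_nhdsWithin,
    mem_nhdsWithin_of_mem_nhds ((hO.preimage hcont).mem_nhds hmem)] with p hp1 hp2
  exact key _ _ hp2 hp1

end LieGroupoid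

end TangentGroupoid

/-! ### Smoothness of the inversion, and the tangent Lie groupoid -/

section TangentLieGroupoid

variable {E : Type*} [NormedAddCommGroup E] [NormedSpace ℝ E] [FiniteDimensional ℝ E]
  {G : Type*} [TopologicalSpace G] [ChartedSpace E G] [IsManifold 𝓘(ℝ, E) ∞ G]
  {F : Type*} [NormedAddCommGroup F] [NormedSpace ℝ F] [FiniteDimensional ℝ F]
  {P : Type*} [TopologicalSpace P] [ChartedSpace F P] [IsManifold 𝓘(ℝ, F) ∞ P]

namespace LieGroupoid

variable (𝒢 : LieGroupoid 𝓘(ℝ, E) G 𝓘(ℝ, F) P)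

theorem tan_src_zero (g : G) : 𝒢.tan.src ⟨g, 0⟩ = ⟨𝒢.src g, 0⟩ :=
  tangent_ext rfl (map_zero (mfderiv 𝓘(ℝ, E) 𝓘(ℝ, F) 𝒢.src g))

theorem tan_tgt_zero (g : G) : 𝒢.tan.tgt ⟨g, 0⟩ = ⟨𝒢.tgt g, 0⟩ :=
  tangent_ext rfl (map_zero (mfderiv 𝓘(ℝ, E) 𝓘(ℝ, F) 𝒢.tgt g))

theorem tan_one_zero (m : P) : 𝒢.tan.one ⟨m, 0⟩ = ⟨𝒢.one m, 0⟩ :=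
  tangent_ext rfl (map_zero (mfderiv 𝓘(ℝ, F) 𝓘(ℝ, E) 𝒢.one m))

theorem tan_mul_zero_zero (h g : G) : 𝒢.tan.mul ⟨h, 0⟩ ⟨g, 0⟩ = ⟨𝒢.mul h g, 0⟩ :=
  tangent_ext rfl (map_zero (𝒢.mulDeriv h g))

/-- Right translation by `0_g` is undone by right translation by `0` at the inverse of `g`. -/
theorem tan_mul_zero_cancel_right {η : TangentBundle 𝓘(ℝ, E) G} {g : G}
    (h : 𝒢.tan.src η = ⟨𝒢.tgt g, 0⟩) :
    𝒢.tan.mul (𝒢.tan.mul η ⟨g, 0⟩) ⟨𝒢.inv g, 0⟩ = η := by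
  rw [← 𝒢.tan_mul_assoc (by rw [h, tan_tgt_zero])
    (by rw [tan_src_zero, tan_tgt_zero, 𝒢.isLieGroupoid.tgt_inv]), tan_mul_zero_zero,
    𝒢.isLieGroupoid.mul_inv, ← tan_one_zero, ← h, tan_mul_one]

theorem tan_mul_zero_cancel_left {ξ : TangentBundle 𝓘(ℝ, E) G} {h : G}
    (hc : ⟨𝒢.src h, 0⟩ = 𝒢.tan.tgt ξ) :
    𝒢.tan.mul ⟨𝒢.inv h, 0⟩ (𝒢.tan.mul ⟨h, 0⟩ ξ) = ξ := by
  rw [𝒢.tan_mul_assoc (by rw [tan_src_zero, tan_tgt_zero, 𝒢.isLieGroupoid.src_inv])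
    (by rw [tan_src_zero, hc]), tan_mul_zero_zero,
    𝒢.isLieGroupoid.inv_mul, ← tan_one_zero, hc, tan_one_mul]

theorem eq_inv_of_mul_eq_one {h g : G} (hc : 𝒢.src h = 𝒢.tgt g)
    (h1 : 𝒢.mul h g = 𝒢.one (𝒢.src g)) : h = 𝒢.inv g := by
  have hg := 𝒢.isLieGroupoid
  rw [← hg.mul_one h, hc, ← hg.mul_inv g, hg.mul_assoc _ _ _ hc (hg.tgt_inv g).symm, h1,
    ← hg.tgt_inv g, hg.one_mul]

/-- Near `(g₀⁻¹, g₀)` the map `W (h, g) = (αh, b(hg), g)` is a local diffeomorphism, with `b` a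
coordinate complementary to the source near `1_{αg₀}` and the product extended to noncomposable
pairs. As `g⁻¹` is the `h` with `W (h, g) = (βg, b(1_{αg}), g)`, a local inverse of `W` expresses it
smoothly. -/
theorem contMDiff_inv : ContMDiff 𝓘(ℝ, E) 𝓘(ℝ, E) ∞ 𝒢.inv := by
  intro g₀
  have hG := 𝒢.isLieGroupoid
  set h₀ := 𝒢.inv g₀ with hh₀
  have hc₀ : 𝒢.src h₀ = 𝒢.tgt g₀ := hG.src_inv g₀
  obtain ⟨K, b, θ, U, V, hfin, hU, hU₀, hV, hb, hθ, hUV, hfθ, -, hbinj⟩ :=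
    exists_complementary_coordinate hG.contMDiff_src (𝒢.mul h₀ g₀) (hG.src_submersion _)
  obtain ⟨S, s, hS, hS₀, hs, hs1, hs2⟩ := exists_section_family hG.contMDiff_src h₀
    (hG.src_submersion h₀)
  -- `c (h, g) = s(βg, h) g` extends the multiplication to noncomposable pairs.
  set c : G × G → G := fun p => 𝒢.mul (s (𝒢.tgt p.2, p.1)) p.2 with hc
  set O₁ : Set (G × G) := (fun p : G × G => (𝒢.tgt p.2, p.1)) ⁻¹' S with hO₁
  have hmap : ContMDiff (𝓘(ℝ, E).prod 𝓘(ℝ, E)) (𝓘(ℝ, F).prod 𝓘(ℝ, E)) ∞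
      (fun p : G × G => (𝒢.tgt p.2, p.1)) :=
    (hG.contMDiff_tgt.comp contMDiff_snd).prodMk contMDiff_fst
  have hO₁o : IsOpen O₁ := hS.preimage hmap.continuous
  have hcs : ContMDiffOn (𝓘(ℝ, E).prod 𝓘(ℝ, E)) 𝓘(ℝ, E) ∞ c O₁ := fun p hp =>
    𝒢.contMDiffWithinAt_mul ((hs.comp hmap.contMDiffOn (fun _ h => h)) p hp)
      contMDiffWithinAt_snd (fun q hq => hs1 _ hq) (hs1 _ hp)
  set O : Set (G × G) := O₁ ∩ c ⁻¹' U with hO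
  have hOo : IsOpen O := hcs.continuousOn.isOpen_inter_preimage hO₁o hU
  have hcval : ∀ p ∈ O₁, 𝒢.src p.1 = 𝒢.tgt p.2 → c p = 𝒢.mul p.1 p.2 := by
    intro p hp h1
    change 𝒢.mul (s (𝒢.tgt p.2, p.1)) p.2 = _
    change (𝒢.tgt p.2, p.1) ∈ S at hp
    rw [← h1] at hp ⊢
    rw [hs2 _ hp]
  have hO₁₀ : (h₀, g₀) ∈ O₁ := by
    change (𝒢.tgt g₀, h₀) ∈ S
    rwa [← hc₀]
  have hO₀ : (h₀, g₀) ∈ O := ⟨hO₁₀, by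
    change c (h₀, g₀) ∈ U
    rw [hcval _ hO₁₀ hc₀]
    exact hU₀⟩
  set W : G × G → P × (K × G) := fun p => (𝒢.src p.1, (b (c p), p.2)) with hW
  have hWs : ContMDiffOn (𝓘(ℝ, E).prod 𝓘(ℝ, E)) (𝓘(ℝ, F).prod (𝓘(ℝ, K).prod 𝓘(ℝ, E))) ∞ W O := by
    refine (hG.contMDiff_src.comp contMDiff_fst).contMDiffOn.prodMk (ContMDiffOn.prodMk ?_ ?_)
    · exact hb.comp (hcs.mono inter_subset_left) (fun p hp => hp.2)
    · exact contMDiffOn_snd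
  have hWat : MDifferentiableAt (𝓘(ℝ, E).prod 𝓘(ℝ, E)) (𝓘(ℝ, F).prod (𝓘(ℝ, K).prod 𝓘(ℝ, E))) W
      (h₀, g₀) := (hWs.contMDiffAt (hOo.mem_nhds hO₀)).mdifferentiableAt (by simp)
  -- A vector `(u, v)` in the kernel of `T(W)` has `v = 0` and `T(α) u = 0`; then `u • 0` has zero
  -- source and zero `T(b)`, so it vanishes, and so does `u`.
  have hinj : Function.Injective (mfderiv (𝓘(ℝ, E).prod 𝓘(ℝ, E))
      (𝓘(ℝ, F).prod (𝓘(ℝ, K).prod 𝓘(ℝ, E))) W (h₀, g₀)) := by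
    rw [injective_iff_map_eq_zero]
    rintro ⟨u, v⟩ hW₀
    have hv : v = 0 := by
      have h1 := (contMDiff_snd.comp contMDiff_snd : ContMDiff
        (𝓘(ℝ, F).prod (𝓘(ℝ, K).prod 𝓘(ℝ, E))) 𝓘(ℝ, E) ∞
        ((Prod.snd : K × G → G) ∘ (Prod.snd : P × (K × G) → K × G))).mdifferentiableAt
          (x := W (h₀, g₀)) (by simp)
      have h2 := mfderiv_comp_apply (h₀, g₀) h1 hWat (u, v)
      rw [hW₀, map_zero] at h2
      have h3 : HasMFDerivAt (𝓘(ℝ, E).prod 𝓘(ℝ, E)) 𝓘(ℝ, E) (Prod.snd : G × G → G) (h₀, g₀) _ :=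
        hasMFDerivAt_snd (h₀, g₀)
      exact (DFunLike.congr_fun h3.mfderiv (u, v)).symm.trans h2
    have hu : mfderiv 𝓘(ℝ, E) 𝓘(ℝ, F) 𝒢.src h₀ u = 0 := by
      have h1 := (contMDiff_fst : ContMDiff (𝓘(ℝ, F).prod (𝓘(ℝ, K).prod 𝓘(ℝ, E))) 𝓘(ℝ, F) ∞
        (Prod.fst : P × (K × G) → P)).mdifferentiableAt (x := W (h₀, g₀)) (by simp)
      have h2 := mfderiv_comp_apply (h₀, g₀) h1 hWat (u, v)
      rw [hW₀, map_zero] at h2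
      have h3 := ((𝒢.contMDiffAt_src h₀).mdifferentiableAt (by simp)).hasMFDerivAt.comp
        (h₀, g₀) (hasMFDerivAt_fst (I := 𝓘(ℝ, E)) (I' := 𝓘(ℝ, E)) (h₀, g₀))
      exact (DFunLike.congr_fun h3.mfderiv (u, v)).symm.trans h2
    subst hv
    have hcomp : 𝒢.tan.src ⟨h₀, u⟩ = 𝒢.tan.tgt ⟨g₀, 0⟩ := by
      rw [tan_tgt_zero]
      exact tangent_ext hc₀ hu
    obtain ⟨h, g, hh, hg, hvh, hvg, hcc⟩ := 𝒢.exists_composable_curves hcomp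
    have hh0 : h 0 = h₀ := congrArg TotalSpace.proj hvh
    have hg0 : g 0 = g₀ := congrArg TotalSpace.proj hvg
    have hγ : ContMDiffAt 𝓘(ℝ) (𝓘(ℝ, E).prod 𝓘(ℝ, E)) ∞ (fun t => (h t, g t)) 0 := hh.prodMk hg
    have hγ0 : (h 0, g 0) = (h₀, g₀) := by rw [hh0, hg0]
    have hvW : velocity (𝓘(ℝ, F).prod (𝓘(ℝ, K).prod 𝓘(ℝ, E))) (fun t => W (h t, g t)) =
        ⟨W (h₀, g₀), 0⟩ := by
      rw [velocity_comp (f := W) (γ := fun t => (h t, g t)) (by rw [hγ0]; exact hWat)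
        (hγ.mdifferentiableAt (by simp)), velocity_prodMk (hh.mdifferentiableAt (by simp))
        (hg.mdifferentiableAt (by simp)), hvh, hvg]
      exact tangent_ext rfl hW₀
    have hWγ : ContMDiffAt 𝓘(ℝ) (𝓘(ℝ, F).prod (𝓘(ℝ, K).prod 𝓘(ℝ, E))) ∞
        (fun t => W (h t, g t)) 0 :=
      ContMDiffAt.comp 0 (hWs.contMDiffAt (hOo.mem_nhds (by rw [hγ0]; exact hO₀))) hγ
    have hprod : ContMDiffAt 𝓘(ℝ) 𝓘(ℝ, E) ∞ (fun t => 𝒢.mul (h t) (g t)) 0 :=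
      𝒢.contMDiffAt_mul hh hg hcc
    have hvb : velocity 𝓘(ℝ, K) (fun t => b (𝒢.mul (h t) (g t))) =
        tangentMap 𝓘(ℝ, E) 𝓘(ℝ, K) b (𝒢.tan.mul ⟨h₀, u⟩ ⟨g₀, 0⟩) := by
      rw [velocity_comp (f := b) (γ := fun t => 𝒢.mul (h t) (g t))
        ((hb.contMDiffAt (hU.mem_nhds (by rw [hh0, hg0]; exact hU₀))).mdifferentiableAt (by simp))
        (hprod.mdifferentiableAt (by simp)), 𝒢.velocity_mul hh hg hcc, hvh, hvg]
    have hvb' : velocity 𝓘(ℝ, K) (fun t => b (𝒢.mul (h t) (g t))) = ⟨b (c (h₀, g₀)), 0⟩ := by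
      have h1 := (contMDiff_fst.comp contMDiff_snd : ContMDiff
        (𝓘(ℝ, F).prod (𝓘(ℝ, K).prod 𝓘(ℝ, E))) 𝓘(ℝ, K) ∞
        ((Prod.fst : K × G → K) ∘ (Prod.snd : P × (K × G) → K × G)))
      have h2 := velocity_comp (γ := fun t => W (h t, g t)) (h1.mdifferentiableAt (by simp))
        (hWγ.mdifferentiableAt (by simp))
      rw [hvW] at h2
      have h3 : velocity 𝓘(ℝ, K) (fun t => b (𝒢.mul (h t) (g t))) = velocity 𝓘(ℝ, K)
          (fun t => ((Prod.fst : K × G → K) ∘ (Prod.snd : P × (K × G) → K × G)) (W (h t, g t))) := by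
        refine velocity_congr ?_
        filter_upwards [hcc, hγ.continuousAt.eventually (hO₁o.mem_nhds (by
          change (h 0, g 0) ∈ O₁
          rw [hγ0]; exact hO₁₀))] with t ht1 ht2
        exact congrArg b (hcval (h t, g t) ht2 ht1).symm
      rw [h3, h2]
      exact tangent_ext rfl (map_zero _)
    have hzero : (𝒢.tan.mul ⟨h₀, u⟩ ⟨g₀, 0⟩).2 = 0 := by
      refine hbinj _ ?_ ?_
      · have h1 := 𝒢.tan_src_mul hcomp
        rw [tan_src_zero] at h1
        have h2 : ∀ X Y : TangentBundle 𝓘(ℝ, F) P, X = Y → (X.2 : F) = Y.2 := by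
          rintro X _ rfl; rfl
        exact h2 _ _ h1
      · have h2 : ∀ X Y : TangentBundle 𝓘(ℝ, K) K, X = Y → (X.2 : K) = Y.2 := by
          rintro X _ rfl; rfl
        exact h2 _ _ (hvb.symm.trans hvb')
    have hcancel := 𝒢.tan_mul_zero_cancel_right (η := ⟨h₀, u⟩) (g := g₀)
      (by rw [hcomp, tan_tgt_zero])
    have h4 : 𝒢.tan.mul ⟨h₀, u⟩ ⟨g₀, 0⟩ = ⟨𝒢.mul h₀ g₀, 0⟩ := tangent_ext rfl hzero
    rw [h4, tan_mul_zero_zero] at hcancel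
    have h2 : ∀ X Y : TangentBundle 𝓘(ℝ, E) G, X = Y → (X.2 : E) = Y.2 := by
      rintro X _ rfl; rfl
    have h5 : u = 0 := (h2 _ _ hcancel).symm
    rw [h5]
    rfl
  have hbij : Function.Bijective (mfderiv (𝓘(ℝ, E).prod 𝓘(ℝ, E))
      (𝓘(ℝ, F).prod (𝓘(ℝ, K).prod 𝓘(ℝ, E))) W (h₀, g₀)) := by
    refine ⟨hinj, ?_⟩
    have hdim : Module.finrank ℝ (E × E) = Module.finrank ℝ (F × (K × E)) := by
      simp only [Module.finrank_prod]
      omega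
    exact (LinearMap.injective_iff_surjective_of_finrank_eq_finrank (V := E × E)
      (V₂ := F × (K × E)) hdim).1 hinj
  obtain ⟨V', r, hV', hV'₀, hr, -, hr2, -⟩ := exists_local_inverse hOo hWs hO₀ hbij
  -- `q g` is the value of `W` at `(g⁻¹, g)`.
  set q : G → P × (K × G) := fun g => (𝒢.tgt g, (b (𝒢.one (𝒢.src g)), g)) with hq
  have hone : 𝒢.mul h₀ g₀ = 𝒢.one (𝒢.src g₀) := hG.inv_mul g₀
  have hosrc : ContMDiff 𝓘(ℝ, E) 𝓘(ℝ, E) ∞ (fun g => 𝒢.one (𝒢.src g)) :=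
    hG.contMDiff_one.comp hG.contMDiff_src
  have hUev : ∀ᶠ g in 𝓝 g₀, 𝒢.one (𝒢.src g) ∈ U :=
    hosrc.continuous.continuousAt.eventually (hU.mem_nhds (by
      change 𝒢.one (𝒢.src g₀) ∈ U
      rwa [← hone]))
  have hqs : ContMDiffAt 𝓘(ℝ, E) (𝓘(ℝ, F).prod (𝓘(ℝ, K).prod 𝓘(ℝ, E))) ∞ q g₀ := by
    refine (𝒢.contMDiffAt_tgt g₀).prodMk (ContMDiffAt.prodMk ?_ contMDiffAt_id)
    exact ContMDiffAt.comp g₀ (hb.contMDiffAt (hU.mem_nhds hUev.self_of_nhds)) (hosrc g₀)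
  have hq₀ : q g₀ = W (h₀, g₀) := by
    simp only [hq, hW, hcval _ hO₁₀ hc₀, hone, hc₀]
  have hres : ContMDiffAt 𝓘(ℝ, E) 𝓘(ℝ, E) ∞ (fun g => (r (q g)).1) g₀ :=
    contMDiffAt_fst.comp g₀ (ContMDiffAt.comp g₀
      (hr.contMDiffAt (hV'.mem_nhds (by rw [hq₀]; exact hV'₀))) hqs)
  refine hres.congr_of_eventuallyEq ?_
  filter_upwards [hUev, hqs.continuousAt.eventually
    (hV'.mem_nhds (by rw [hq₀]; exact hV'₀))] with g hgU hgV
  obtain ⟨hrO, hrW⟩ := hr2 _ hgV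
  have e1 : 𝒢.src (r (q g)).1 = 𝒢.tgt g := congrArg Prod.fst hrW
  have e2 : b (c (r (q g))) = b (𝒢.one (𝒢.src g)) := congrArg (fun p => p.2.1) hrW
  have e3 : (r (q g)).2 = g := congrArg (fun p => p.2.2) hrW
  have e4 : c (r (q g)) = 𝒢.mul (r (q g)).1 g := by
    rw [hcval _ hrO.1 (by rw [e1, e3]), e3]
  -- The product has source `αg` and `b`-coordinate that of `1_{αg}`, so it is `1_{αg}`.
  refine (𝒢.eq_inv_of_mul_eq_one e1 ?_).symm
  have e5 := (hUV _ hrO.2).2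
  have e6 := (hUV _ hgU).2
  rw [e4] at e5 e2
  rw [hG.src_mul _ _ e1, e2] at e5
  rw [hG.src_one] at e6
  rw [← e5, e6]

section Inverse

variable {𝒢} in
theorem contMDiffAt_inv_comp {EX : Type*} [NormedAddCommGroup EX] [NormedSpace ℝ EX]
    {HX : Type*} [TopologicalSpace HX] {IX : ModelWithCorners ℝ EX HX}
    {X : Type*} [TopologicalSpace X] [ChartedSpace HX X] {g : X → G} {x₀ : X}
    (hg : ContMDiffAt IX 𝓘(ℝ, E) ∞ g x₀) :
    ContMDiffAt IX 𝓘(ℝ, E) ∞ (fun x => 𝒢.inv (g x)) x₀ :=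
  (𝒢.contMDiff_inv _).comp x₀ hg

theorem velocity_inv {g : ℝ → G} (hg : ContMDiffAt 𝓘(ℝ) 𝓘(ℝ, E) ∞ g 0) :
    velocity 𝓘(ℝ, E) (fun t => 𝒢.inv (g t)) = 𝒢.tan.inv (velocity 𝓘(ℝ, E) g) :=
  velocity_comp ((𝒢.contMDiff_inv _).mdifferentiableAt (by simp)) (hg.mdifferentiableAt (by simp))

theorem tan_src_inv (ξ : TangentBundle 𝓘(ℝ, E) G) : 𝒢.tan.src (𝒢.tan.inv ξ) = 𝒢.tan.tgt ξ := by
  obtain ⟨g, hg, rfl⟩ := exists_velocity_eq ξ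
  rw [← 𝒢.velocity_inv hg, ← 𝒢.velocity_src (contMDiffAt_inv_comp hg), ← 𝒢.velocity_tgt hg]
  simp only [𝒢.isLieGroupoid.src_inv]

theorem tan_tgt_inv (ξ : TangentBundle 𝓘(ℝ, E) G) : 𝒢.tan.tgt (𝒢.tan.inv ξ) = 𝒢.tan.src ξ := by
  obtain ⟨g, hg, rfl⟩ := exists_velocity_eq ξ
  rw [← 𝒢.velocity_inv hg, ← 𝒢.velocity_tgt (contMDiffAt_inv_comp hg), ← 𝒢.velocity_src hg]
  simp only [𝒢.isLieGroupoid.tgt_inv]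

theorem tan_inv_mul (ξ : TangentBundle 𝓘(ℝ, E) G) :
    𝒢.tan.mul (𝒢.tan.inv ξ) ξ = 𝒢.tan.one (𝒢.tan.src ξ) := by
  obtain ⟨g, hg, rfl⟩ := exists_velocity_eq ξ
  rw [← 𝒢.velocity_inv hg, ← 𝒢.velocity_mul (contMDiffAt_inv_comp hg) hg
    (Eventually.of_forall fun t => 𝒢.isLieGroupoid.src_inv _), ← 𝒢.velocity_src hg,
    ← 𝒢.velocity_one (𝒢.contMDiffAt_src_comp hg)]
  simp only [𝒢.isLieGroupoid.inv_mul]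

theorem tan_mul_inv (ξ : TangentBundle 𝓘(ℝ, E) G) :
    𝒢.tan.mul ξ (𝒢.tan.inv ξ) = 𝒢.tan.one (𝒢.tan.tgt ξ) := by
  obtain ⟨g, hg, rfl⟩ := exists_velocity_eq ξ
  rw [← 𝒢.velocity_inv hg, ← 𝒢.velocity_mul hg (contMDiffAt_inv_comp hg)
    (Eventually.of_forall fun t => (𝒢.isLieGroupoid.tgt_inv _).symm), ← 𝒢.velocity_tgt hg,
    ← 𝒢.velocity_one (𝒢.contMDiffAt_tgt_comp hg)]
  simp only [𝒢.isLieGroupoid.mul_inv]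

theorem inv_inv (g : G) : 𝒢.inv (𝒢.inv g) = g :=
  (𝒢.eq_inv_of_mul_eq_one (𝒢.isLieGroupoid.tgt_inv g).symm (by
    rw [𝒢.isLieGroupoid.mul_inv, 𝒢.isLieGroupoid.src_inv])).symm

theorem tan_inv_inv (ξ : TangentBundle 𝓘(ℝ, E) G) : 𝒢.tan.inv (𝒢.tan.inv ξ) = ξ := by
  obtain ⟨g, hg, rfl⟩ := exists_velocity_eq ξ
  rw [← 𝒢.velocity_inv hg, ← 𝒢.velocity_inv (contMDiffAt_inv_comp hg)]
  simp only [inv_inv]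

end Inverse

theorem mfderiv_injective_of_leftInverse {E : Type*} [NormedAddCommGroup E] [NormedSpace ℝ E]
    {H : Type*} [TopologicalSpace H] {I : ModelWithCorners ℝ E H}
    {M : Type*} [TopologicalSpace M] [ChartedSpace H M]
    {E' : Type*} [NormedAddCommGroup E'] [NormedSpace ℝ E']
    {H' : Type*} [TopologicalSpace H'] {I' : ModelWithCorners ℝ E' H'}
    {M' : Type*} [TopologicalSpace M'] [ChartedSpace H' M'] {f : M → M'} {g : M' → M} {x : M}
    (hf : MDifferentiableAt I I' f x) (hg : MDifferentiableAt I' I g (f x))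
    (h : ∀ x, g (f x) = x) : Function.Injective (mfderiv I I' f x) := by
  have h1 := hg.hasMFDerivAt.comp x hf.hasMFDerivAt
  have h2 : g ∘ f = id := funext h
  rw [h2] at h1
  have h3 := hasMFDerivAt_unique h1 (hasMFDerivAt_id x)
  intro v w hvw
  have h4 : ∀ v, mfderiv I' I g (f x) (mfderiv I I' f x v) = v := fun v => DFunLike.congr_fun h3 v
  exact (h4 v).symm.trans ((congrArg (mfderiv I' I g (f x)) hvw).trans (h4 w))

/-- The tangent groupoid is a Lie groupoid. -/
theorem isLieGroupoid_tan :
    IsLieGroupoid 𝓘(ℝ, E).tangent 𝓘(ℝ, F).tangent (𝒢.tan) := by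
  have hG := 𝒢.isLieGroupoid
  have hE := isManifold_one_of_infty (E := E) (M := G)
  have hF := isManifold_one_of_infty (E := F) (M := P)
  have hs : ContMDiff 𝓘(ℝ, E).tangent 𝓘(ℝ, F).tangent ∞ 𝒢.tan.src :=
    hG.contMDiff_src.contMDiff_tangentMap (by simp)
  have ht : ContMDiff 𝓘(ℝ, E).tangent 𝓘(ℝ, F).tangent ∞ 𝒢.tan.tgt :=
    hG.contMDiff_tgt.contMDiff_tangentMap (by simp)
  have ho : ContMDiff 𝓘(ℝ, F).tangent 𝓘(ℝ, E).tangent ∞ 𝒢.tan.one :=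
    hG.contMDiff_one.contMDiff_tangentMap (by simp)
  refine ⟨hs, ht, fun v => ⟨_, 𝒢.tan_src_one v⟩, fun v => ⟨_, 𝒢.tan_tgt_one v⟩, fun ξ => ?_,
    fun ξ => ?_, ho, Function.LeftInverse.injective 𝒢.tan_src_one, fun v => ?_,
    𝒢.contMDiffOn_tan_mul, 𝒢.tan_src_one, 𝒢.tan_tgt_one, fun η ξ h => 𝒢.tan_src_mul h,
    fun η ξ h => 𝒢.tan_tgt_mul h, fun η ξ ζ h1 h2 => 𝒢.tan_mul_assoc h1 h2, 𝒢.tan_one_mul,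
    𝒢.tan_mul_one, 𝒢.tan_src_inv, 𝒢.tan_tgt_inv, 𝒢.tan_inv_mul, 𝒢.tan_mul_inv⟩
  · exact mfderiv_bundleMap_surjective (V := fun g : G => TangentSpace 𝓘(ℝ, E) g)
      (V' := fun m : P => TangentSpace 𝓘(ℝ, F) m) (f := 𝒢.src) (fun _ => rfl) ξ.1 ξ.2
      (hs.mdifferentiableAt (by simp)) ((𝒢.contMDiffAt_src ξ.1).mdifferentiableAt (by simp))
      (hG.src_submersion ξ.1) (mfderiv 𝓘(ℝ, E) 𝓘(ℝ, F) 𝒢.src ξ.1) (fun _ => rfl)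
      (hG.src_submersion ξ.1)
  · exact mfderiv_bundleMap_surjective (V := fun g : G => TangentSpace 𝓘(ℝ, E) g)
      (V' := fun m : P => TangentSpace 𝓘(ℝ, F) m) (f := 𝒢.tgt) (fun _ => rfl) ξ.1 ξ.2
      (ht.mdifferentiableAt (by simp)) ((𝒢.contMDiffAt_tgt ξ.1).mdifferentiableAt (by simp))
      (hG.tgt_submersion ξ.1) (mfderiv 𝓘(ℝ, E) 𝓘(ℝ, F) 𝒢.tgt ξ.1) (fun _ => rfl)
      (hG.tgt_submersion ξ.1)
  · exact mfderiv_injective_of_leftInverse (ho.mdifferentiableAt (by simp))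
      (hs.mdifferentiableAt (by simp)) 𝒢.tan_src_one

end LieGroupoid

end TangentLieGroupoid

/-! ### Covectors paired with products of tangent vectors -/

section CotangentGroupoid

theorem tangent_snd_eq {E : Type*} [NormedAddCommGroup E] [NormedSpace ℝ E]
    {H : Type*} [TopologicalSpace H] {I : ModelWithCorners ℝ E H}
    {M : Type*} [TopologicalSpace M] [ChartedSpace H M] {V W : TangentBundle I M} (h : V = W) :
    (V.2 : E) = W.2 := by
  subst h; rfl

theorem pair_of_add {E : Type*} [NormedAddCommGroup E] [NormedSpace ℝ E]
    {H : Type*} [TopologicalSpace H] {I : ModelWithCorners ℝ E H}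
    {M : Type*} [TopologicalSpace M] [ChartedSpace H M] (Φ : CotangentBundle I M)
    {U V W : TangentBundle I M} (h : (U.2 : E) = (show E from V.2) + (show E from W.2)) :
    pair Φ U = pair Φ V + pair Φ W := by
  unfold pair
  exact (congrArg (show E →L[ℝ] ℝ from Φ.2) h).trans (map_add (show E →L[ℝ] ℝ from Φ.2) _ _)

theorem pair_zero {E : Type*} [NormedAddCommGroup E] [NormedSpace ℝ E]
    {H : Type*} [TopologicalSpace H] {I : ModelWithCorners ℝ E H}
    {M : Type*} [TopologicalSpace M] [ChartedSpace H M] (Φ : CotangentBundle I M) (x : M) :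
    pair Φ (⟨x, 0⟩ : TangentBundle I M) = 0 :=
  map_zero (show E →L[ℝ] ℝ from Φ.2)

variable {E : Type*} [NormedAddCommGroup E] [NormedSpace ℝ E] [FiniteDimensional ℝ E]
  {G : Type*} [TopologicalSpace G] [ChartedSpace E G] [IsManifold 𝓘(ℝ, E) ∞ G]
  {F : Type*} [NormedAddCommGroup F] [NormedSpace ℝ F] [FiniteDimensional ℝ F]
  {P : Type*} [TopologicalSpace P] [ChartedSpace F P] [IsManifold 𝓘(ℝ, F) ∞ P]

namespace LieGroupoid

variable (𝒢 : LieGroupoid 𝓘(ℝ, E) G 𝓘(ℝ, F) P)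

/-- The mirror image of `exists_composable_curve`, obtained by inverting curves. -/
theorem exists_composable_curve_left {g : ℝ → G} (hg : ContMDiffAt 𝓘(ℝ) 𝓘(ℝ, E) ∞ g 0)
    {η : TangentBundle 𝓘(ℝ, E) G} (hc : 𝒢.tan.src η = 𝒢.tan.tgt (velocity 𝓘(ℝ, E) g)) :
    ∃ h : ℝ → G, ContMDiffAt 𝓘(ℝ) 𝓘(ℝ, E) ∞ h 0 ∧ velocity 𝓘(ℝ, E) h = η ∧
      ∀ᶠ t in 𝓝 0, 𝒢.src (h t) = 𝒢.tgt (g t) := by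
  obtain ⟨k, hk, hkv, hkc⟩ := 𝒢.exists_composable_curve (contMDiffAt_inv_comp hg)
    (ξ := 𝒢.tan.inv η) (by rw [𝒢.velocity_inv hg, tan_src_inv, tan_tgt_inv, hc])
  refine ⟨fun t => 𝒢.inv (k t), contMDiffAt_inv_comp hk, ?_, hkc.mono fun t ht => ?_⟩
  · rw [𝒢.velocity_inv hk, hkv, tan_inv_inv]
  · rw [𝒢.isLieGroupoid.src_inv, ← ht, 𝒢.isLieGroupoid.src_inv]

/-- The derivative of right translation within the fibre of the source is right multiplication by
a zero vector in the tangent groupoid. -/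
theorem mfderivWithin_mul_right {η : TangentBundle 𝓘(ℝ, E) G} {g : G}
    (hc : 𝒢.tan.src η = ⟨𝒢.tgt g, 0⟩) :
    (mfderivWithin 𝓘(ℝ, E) 𝓘(ℝ, E) (fun h => 𝒢.mul h g) {h | 𝒢.src h = 𝒢.tgt g} η.1 η.2 : E) =
      (𝒢.tan.mul η ⟨g, 0⟩).2 := by
  have hcv : 𝒢.tan.src η = 𝒢.tan.tgt (velocity 𝓘(ℝ, E) fun _ => g) := by
    rw [hc, velocity_const, tan_tgt_zero]
  obtain ⟨h, hh, rfl, hhc⟩ := 𝒢.exists_composable_curve_left contMDiffAt_const hcv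
  have h1 := ((𝒢.contMDiffWithinAt_mul (X := G) (s := {h | 𝒢.src h = 𝒢.tgt g}) (x₀ := h 0)
    (h := id) (g := fun _ => g) contMDiffWithinAt_id contMDiffWithinAt_const (fun _ hx => hx)
    hhc.self_of_nhds).mdifferentiableWithinAt (by simp)).hasMFDerivWithinAt
  have h2 := h1.comp (u := {h | 𝒢.src h = 𝒢.tgt g}) (s := {t | 𝒢.src (h t) = 𝒢.tgt g}) (0 : ℝ)
    (hh.mdifferentiableAt (by simp)).hasMFDerivAt.hasMFDerivWithinAt (fun _ ht => ht)
  have h3 := 𝒢.velocity_mul hh contMDiffAt_const hhc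
  rw [velocity_const] at h3
  rw [← h3]
  exact DFunLike.congr_fun (h2.hasMFDerivAt hhc).mfderiv.symm (1 : ℝ)

/-- The derivative of left translation within the fibre of the target is left multiplication by a
zero vector in the tangent groupoid. -/
theorem mfderivWithin_mul_left {ξ : TangentBundle 𝓘(ℝ, E) G} {h : G}
    (hc : 𝒢.tan.tgt ξ = ⟨𝒢.src h, 0⟩) :
    (mfderivWithin 𝓘(ℝ, E) 𝓘(ℝ, E) (fun g => 𝒢.mul h g) {g | 𝒢.tgt g = 𝒢.src h} ξ.1 ξ.2 : E) =
      (𝒢.tan.mul ⟨h, 0⟩ ξ).2 := by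
  have hcv : 𝒢.tan.src (velocity 𝓘(ℝ, E) fun _ => h) = 𝒢.tan.tgt ξ := by
    rw [hc, velocity_const, tan_src_zero]
  obtain ⟨g, hg, rfl, hgc⟩ := 𝒢.exists_composable_curve contMDiffAt_const hcv
  have hgc' : ∀ᶠ t in 𝓝 (0 : ℝ), 𝒢.tgt (g t) = 𝒢.src h := hgc.mono fun t ht => ht.symm
  have h1 := ((𝒢.contMDiffWithinAt_mul (X := G) (s := {g | 𝒢.tgt g = 𝒢.src h}) (x₀ := g 0)
    (h := fun _ => h) (g := id) contMDiffWithinAt_const contMDiffWithinAt_id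
    (fun _ hx => Eq.symm hx) hgc.self_of_nhds).mdifferentiableWithinAt
    (by simp)).hasMFDerivWithinAt
  have h2 := h1.comp (u := {g | 𝒢.tgt g = 𝒢.src h}) (s := {t | 𝒢.tgt (g t) = 𝒢.src h}) (0 : ℝ)
    (hg.mdifferentiableAt (by simp)).hasMFDerivAt.hasMFDerivWithinAt (fun _ ht => ht)
  have h3 := 𝒢.velocity_mul contMDiffAt_const hg hgc
  rw [velocity_const] at h3
  rw [← h3]
  exact DFunLike.congr_fun (h2.hasMFDerivAt hgc').mfderiv.symm (1 : ℝ)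

/-- `V` lies in the fibre `A_m G`, seen as a subspace of `T_{1_m} G`. -/
def IsAlg (m : P) (V : TangentBundle 𝓘(ℝ, E) G) : Prop :=
  V.1 = 𝒢.one m ∧ 𝒢.tan.src V = ⟨m, 0⟩

theorem isAlg_incl (m : P) (X : 𝒢.AlgFiber m) : 𝒢.IsAlg m ⟨𝒢.one m, 𝒢.incl m X⟩ := by
  have hX : mfderiv 𝓘(ℝ, E) 𝓘(ℝ, F) 𝒢.src (𝒢.one m) (𝒢.incl m X) = 0 := X.2
  exact ⟨rfl, tangent_ext (𝒢.isLieGroupoid.src_one m) hX⟩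

theorem IsAlg.exists_incl {m : P} {V : TangentBundle 𝓘(ℝ, E) G} (h : 𝒢.IsAlg m V) :
    ∃ X : 𝒢.AlgFiber m, V = ⟨𝒢.one m, 𝒢.incl m X⟩ := by
  obtain ⟨g, v⟩ := V
  obtain ⟨h1, h2⟩ := h
  obtain rfl : g = 𝒢.one m := h1
  have h3 : mfderiv 𝓘(ℝ, E) 𝓘(ℝ, F) 𝒢.src (𝒢.one m) v = 0 := tangent_snd_eq h2
  exact ⟨⟨v, h3⟩, rfl⟩

theorem tan_inv_zero (g : G) : 𝒢.tan.inv ⟨g, 0⟩ = ⟨𝒢.inv g, 0⟩ :=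
  tangent_ext rfl (map_zero (mfderiv 𝓘(ℝ, E) 𝓘(ℝ, E) 𝒢.inv g))

theorem inv_one (m : P) : 𝒢.inv (𝒢.one m) = 𝒢.one m := by
  have hG := 𝒢.isLieGroupoid
  refine (𝒢.eq_inv_of_mul_eq_one (by rw [hG.src_one, hG.tgt_one]) ?_).symm
  have := hG.mul_one (𝒢.one m)
  rw [hG.src_one] at this ⊢
  exact this

/-- `(η • ξ)⁻¹ = ξ⁻¹ • η⁻¹`. -/
theorem tan_inv_mul_rev {η ξ : TangentBundle 𝓘(ℝ, E) G} (hc : 𝒢.tan.src η = 𝒢.tan.tgt ξ) :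
    𝒢.tan.inv (𝒢.tan.mul η ξ) = 𝒢.tan.mul (𝒢.tan.inv ξ) (𝒢.tan.inv η) := by
  have h1 : 𝒢.tan.src (𝒢.tan.inv ξ) = 𝒢.tan.tgt (𝒢.tan.inv η) := by
    rw [tan_src_inv, tan_tgt_inv, hc]
  have h2 := 𝒢.tan_mul_assoc (η := 𝒢.tan.mul (𝒢.tan.inv ξ) (𝒢.tan.inv η)) (ξ := 𝒢.tan.mul η ξ)
    (ζ := 𝒢.tan.inv (𝒢.tan.mul η ξ))
    (by rw [𝒢.tan_src_mul h1, tan_src_inv, 𝒢.tan_tgt_mul hc]) (by rw [tan_tgt_inv])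
  rw [tan_mul_inv, 𝒢.tan_tgt_mul hc] at h2
  have h3 : 𝒢.tan.mul (𝒢.tan.mul (𝒢.tan.inv ξ) (𝒢.tan.inv η)) (𝒢.tan.mul η ξ) =
      𝒢.tan.one (𝒢.tan.src ξ) := by
    rw [← 𝒢.tan_mul_assoc h1 (by rw [tan_src_inv, 𝒢.tan_tgt_mul hc]),
      𝒢.tan_mul_assoc (𝒢.tan_src_inv η) hc, tan_inv_mul, hc, tan_one_mul, tan_inv_mul]
  rw [h3, ← 𝒢.tan_src_mul hc] at h2
  have h4 := 𝒢.tan_one_mul (𝒢.tan.inv (𝒢.tan.mul η ξ))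
  rw [tan_tgt_inv] at h4
  rw [h4] at h2
  have h5 := 𝒢.tan_mul_one (𝒢.tan.mul (𝒢.tan.inv ξ) (𝒢.tan.inv η))
  rw [𝒢.tan_src_mul h1, tan_src_inv] at h5
  rw [← h2, h5]

variable {𝒢} in
theorem IsAlg.mul_zero_one {m : P} {V : TangentBundle 𝓘(ℝ, E) G} (h : 𝒢.IsAlg m V) :
    𝒢.tan.mul V ⟨𝒢.one m, 0⟩ = V := by
  have := 𝒢.tan_mul_one V
  rwa [h.2, tan_one_zero] at this

variable {𝒢} in
theorem IsAlg.zero_one_mul {m : P} {V : TangentBundle 𝓘(ℝ, E) G} (h : 𝒢.IsAlg m V) :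
    𝒢.tan.mul ⟨𝒢.one m, 0⟩ (𝒢.tan.inv V) = 𝒢.tan.inv V := by
  have := 𝒢.tan_one_mul (𝒢.tan.inv V)
  rwa [tan_tgt_inv, h.2, tan_one_zero] at this

/-- `X + X⁻¹ = T(1)(aX)` for `X ∈ A_m G`, by the additivity of `•` on `T_{1_m} G`. -/
theorem IsAlg.add_inv {m : P} {V : TangentBundle 𝓘(ℝ, E) G} (h : 𝒢.IsAlg m V) :
    (show E from V.2) + (show E from (𝒢.tan.inv V).2) = (𝒢.tan.one (𝒢.tan.tgt V)).2 := by
  have hb : V.1 = 𝒢.one m := h.1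
  have hb' : (𝒢.tan.inv V).1 = 𝒢.one m := by
    change 𝒢.inv V.1 = _
    rw [hb, inv_one]
  have h1 := tangent_snd_eq h.mul_zero_one
  have h2 := tangent_snd_eq h.zero_one_mul
  have h3 := tangent_snd_eq (𝒢.tan_mul_inv V)
  rw [tan_mul_eq] at h1 h2 h3
  rw [hb] at h1
  rw [hb'] at h2
  rw [hb, hb'] at h3
  rw [← h3]
  refine (congrArg₂ (· + ·) h1.symm h2.symm).trans ?_
  refine (map_add (𝒢.mulDeriv (𝒢.one m) (𝒢.one m)) _ _).symm.trans ?_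
  refine congrArg (𝒢.mulDeriv (𝒢.one m) (𝒢.one m)) ?_
  exact Prod.ext (add_zero (show E from V.2)) (zero_add (show E from (𝒢.tan.inv V).2))

section Pairings

theorem pair_one_incl (φ : 𝒢.DualAlg) (X : 𝒢.AlgFiber φ.1) :
    pair (𝒢.cotangent.one φ) ⟨𝒢.one φ.1, 𝒢.incl φ.1 X⟩ = φ.2 X :=
  congrArg φ.2 (𝒢.algProj_incl φ.1 X)

theorem algProj_one (m : P) (x : TangentSpace 𝓘(ℝ, F) m) :
    𝒢.algProj m (mfderiv 𝓘(ℝ, F) 𝓘(ℝ, E) 𝒢.one m x) = 0 := by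
  refine Subtype.ext ?_
  change 𝒢.incl m (𝒢.algProj m (mfderiv 𝓘(ℝ, F) 𝓘(ℝ, E) 𝒢.one m x)) = 0
  rw [incl_algProj, sub_eq_zero]
  exact (congrArg (mfderiv 𝓘(ℝ, F) 𝓘(ℝ, E) 𝒢.one m) (𝒢.mfderiv_src_one m x)).symm

theorem pair_one_one {φ : 𝒢.DualAlg} {x : TangentBundle 𝓘(ℝ, F) P} (h : x.1 = φ.1) :
    pair (𝒢.cotangent.one φ) (𝒢.tan.one x) = 0 := by
  obtain ⟨m, x⟩ := x
  obtain rfl : m = φ.1 := h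
  exact (congrArg φ.2 (𝒢.algProj_one φ.1 x)).trans (map_zero φ.2)

/-- Elements of `A^*G` are compared by pairing their identity covectors with `AG`. -/
theorem dualAlg_ext {φ ψ : 𝒢.DualAlg} (h : φ.1 = ψ.1)
    (h' : ∀ V, 𝒢.IsAlg φ.1 V → pair (𝒢.cotangent.one φ) V = pair (𝒢.cotangent.one ψ) V) :
    φ = ψ := by
  obtain ⟨m, φ⟩ := φ
  obtain ⟨n, ψ⟩ := ψ
  obtain rfl : m = n := h
  refine congrArg (TotalSpace.mk m) (ContinuousLinearMap.ext fun X => ?_)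
  have := h' _ (𝒢.isAlg_incl m X)
  rwa [pair_one_incl 𝒢 ⟨m, φ⟩, pair_one_incl 𝒢 ⟨m, ψ⟩] at this

/-- The target of a covector in terms of the tangent groupoid: `⟨\tilde β(Φ), Y⟩ = ⟨Φ, Y • 0_g⟩`. -/
theorem cotangent_tgt_apply (Φ : CotangentBundle 𝓘(ℝ, E) G) (Y : 𝒢.AlgFiber (𝒢.tgt Φ.1)) :
    (𝒢.cotangent.tgt Φ).2 Y =
      pair Φ (𝒢.tan.mul ⟨𝒢.one (𝒢.tgt Φ.1), 𝒢.incl _ Y⟩ ⟨Φ.1, 0⟩) := by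
  have h := 𝒢.mfderivWithin_mul_right (𝒢.isAlg_incl _ Y).2
  unfold pair
  rw [← h]
  exact congrArg Φ.2 (tcast_eq (𝒢.isLieGroupoid.one_mul Φ.1) _)

theorem pair_one_tgt {Φ : CotangentBundle 𝓘(ℝ, E) G} {V : TangentBundle 𝓘(ℝ, E) G}
    (hV : 𝒢.IsAlg (𝒢.tgt Φ.1) V) :
    pair (𝒢.cotangent.one (𝒢.cotangent.tgt Φ)) V = pair Φ (𝒢.tan.mul V ⟨Φ.1, 0⟩) := by
  obtain ⟨Y, rfl⟩ := IsAlg.exists_incl 𝒢 hV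
  exact (𝒢.pair_one_incl (𝒢.cotangent.tgt Φ) Y).trans (𝒢.cotangent_tgt_apply Φ Y)

/-- `X⁻¹ = -(X - T(1)(aX))` for `X ∈ A_m G`. -/
theorem tan_inv_incl (m : P) (X : 𝒢.AlgFiber m) :
    𝒢.tan.inv ⟨𝒢.one m, 𝒢.incl m X⟩ = ⟨𝒢.one m, -(𝒢.incl m X -
      mfderiv 𝓘(ℝ, F) 𝓘(ℝ, E) 𝒢.one m (tcast (𝒢.isLieGroupoid.tgt_one m)
        (mfderiv 𝓘(ℝ, E) 𝓘(ℝ, F) 𝒢.tgt (𝒢.one m) (𝒢.incl m X))))⟩ := by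
  refine tangent_ext (𝒢.inv_one m) ?_
  have h := IsAlg.add_inv 𝒢 (𝒢.isAlg_incl m X)
  have h1 : 𝒢.tan.tgt ⟨𝒢.one m, 𝒢.incl m X⟩ = ⟨m, tcast (𝒢.isLieGroupoid.tgt_one m)
        (mfderiv 𝓘(ℝ, E) 𝓘(ℝ, F) 𝒢.tgt (𝒢.one m) (𝒢.incl m X))⟩ :=
    tangent_ext (𝒢.isLieGroupoid.tgt_one m) (tcast_eq _ _).symm
  rw [h1] at h
  refine (eq_sub_of_add_eq' h).trans ?_
  exact (neg_sub (show E from 𝒢.incl m X) _).symm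

/-- The source of a covector in terms of the tangent groupoid: `⟨\tilde α(Φ), X⟩ = -⟨Φ, 0_g • X⁻¹⟩`.
-/
theorem cotangent_src_apply (Φ : CotangentBundle 𝓘(ℝ, E) G) (X : 𝒢.AlgFiber (𝒢.src Φ.1)) :
    (𝒢.cotangent.src Φ).2 X =
      -pair Φ (𝒢.tan.mul ⟨Φ.1, 0⟩ (𝒢.tan.inv ⟨𝒢.one (𝒢.src Φ.1), 𝒢.incl _ X⟩)) := by
  have h := 𝒢.mfderivWithin_mul_left (h := Φ.1)
    (ξ := 𝒢.tan.inv ⟨𝒢.one (𝒢.src Φ.1), 𝒢.incl _ X⟩)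
    (by rw [tan_tgt_inv, (𝒢.isAlg_incl _ X).2])
  unfold pair
  rw [← h, tan_inv_incl]
  refine Eq.trans ?_ (map_neg Φ.2 _)
  refine congrArg Φ.2 ?_
  refine (tcast_eq (𝒢.isLieGroupoid.mul_one Φ.1) _).trans ?_
  set A := mfderivWithin 𝓘(ℝ, E) 𝓘(ℝ, E) (fun h => 𝒢.mul Φ.1 h) {h | 𝒢.tgt h = 𝒢.src Φ.1}
      (𝒢.one (𝒢.src Φ.1))
  set w := 𝒢.incl (𝒢.src Φ.1) X - mfderiv 𝓘(ℝ, F) 𝓘(ℝ, E) 𝒢.one (𝒢.src Φ.1)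
    (tcast (𝒢.isLieGroupoid.tgt_one (𝒢.src Φ.1))
      (mfderiv 𝓘(ℝ, E) 𝓘(ℝ, F) 𝒢.tgt (𝒢.one (𝒢.src Φ.1)) (𝒢.incl (𝒢.src Φ.1) X)))
  change A w = -A (-w)
  rw [map_neg, neg_neg]

theorem pair_one_src {Φ : CotangentBundle 𝓘(ℝ, E) G} {V : TangentBundle 𝓘(ℝ, E) G}
    (hV : 𝒢.IsAlg (𝒢.src Φ.1) V) :
    pair (𝒢.cotangent.one (𝒢.cotangent.src Φ)) V =
      -pair Φ (𝒢.tan.mul ⟨Φ.1, 0⟩ (𝒢.tan.inv V)) := by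
  obtain ⟨Y, rfl⟩ := IsAlg.exists_incl 𝒢 hV
  exact (𝒢.pair_one_incl (𝒢.cotangent.src Φ) Y).trans (𝒢.cotangent_src_apply Φ Y)

end Pairings

/-- Every vector at `hg` is a product of vectors at `h` and `g`. -/
theorem exists_tan_mul_eq {h g : G} (hc : 𝒢.src h = 𝒢.tgt g) {ζ : TangentBundle 𝓘(ℝ, E) G}
    (hζ : ζ.1 = 𝒢.mul h g) : ∃ η ξ : TangentBundle 𝓘(ℝ, E) G, η.1 = h ∧ ξ.1 = g ∧
      𝒢.tan.src η = 𝒢.tan.tgt ξ ∧ 𝒢.tan.mul η ξ = ζ := by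
  have hG := 𝒢.isLieGroupoid
  have hb : 𝒢.tgt h = 𝒢.tgt ζ.1 := by rw [hζ, hG.tgt_mul _ _ hc]
  obtain ⟨u, hu⟩ := hG.tgt_submersion h (show F from (𝒢.tan.tgt ζ).2)
  have hη : 𝒢.tan.tgt ⟨h, u⟩ = 𝒢.tan.tgt ζ := tangent_ext hb hu
  have h1 : 𝒢.tan.src (𝒢.tan.inv ⟨h, u⟩) = 𝒢.tan.tgt ζ := by rw [tan_src_inv, hη]
  refine ⟨⟨h, u⟩, 𝒢.tan.mul (𝒢.tan.inv ⟨h, u⟩) ζ, rfl, ?_, ?_, ?_⟩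
  · change 𝒢.mul (𝒢.inv h) ζ.1 = g
    rw [hζ, hG.mul_assoc _ _ _ (hG.src_inv h) hc, hG.inv_mul, hc, hG.one_mul]
  · rw [𝒢.tan_tgt_mul h1, tan_tgt_inv]
  · rw [𝒢.tan_mul_assoc (𝒢.tan_tgt_inv _).symm h1, tan_mul_inv, hη, tan_one_mul]

theorem tan_src_snd_of_mul_zero {η ξ : TangentBundle 𝓘(ℝ, E) G} {k : G}
    (hc : 𝒢.tan.src η = 𝒢.tan.tgt ξ) (h : 𝒢.tan.mul η ξ = ⟨k, 0⟩) :
    𝒢.tan.src ξ = ⟨𝒢.src ξ.1, 0⟩ := by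
  have h1 := 𝒢.tan_src_mul hc
  rw [h, tan_src_zero] at h1
  exact tangent_ext rfl (tangent_snd_eq h1).symm

/-- The composability of covectors says that their sum vanishes on the kernel of the multiplication
of tangent vectors: if `η • ξ = 0` then `ξ = Y • 0_g` and `η = 0_h • Y⁻¹` with `Y = ξ • 0_{g⁻¹}`. -/
theorem pair_add_pair_eq_zero {Ψ Φ : CotangentBundle 𝓘(ℝ, E) G}
    (hc : 𝒢.cotangent.src Ψ = 𝒢.cotangent.tgt Φ) {η ξ : TangentBundle 𝓘(ℝ, E) G}
    (hη : η.1 = Ψ.1) (hξ : ξ.1 = Φ.1) (h : 𝒢.tan.src η = 𝒢.tan.tgt ξ)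
    (h0 : ((𝒢.tan.mul η ξ).2 : E) = 0) : pair Ψ η + pair Φ ξ = 0 := by
  have hG := 𝒢.isLieGroupoid
  have hb : 𝒢.src Ψ.1 = 𝒢.tgt Φ.1 := congrArg TotalSpace.proj hc
  have hm : 𝒢.tan.mul η ξ = ⟨𝒢.mul Ψ.1 Φ.1, 0⟩ :=
    tangent_ext (by rw [← hη, ← hξ]; rfl) h0
  have hsξ : 𝒢.tan.src ξ = ⟨𝒢.src Φ.1, 0⟩ := by
    rw [𝒢.tan_src_snd_of_mul_zero h hm, hξ]
  have hcz : 𝒢.tan.src ξ = 𝒢.tan.tgt ⟨𝒢.inv Φ.1, 0⟩ := by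
    rw [hsξ, tan_tgt_zero, hG.tgt_inv]
  set Y := 𝒢.tan.mul ξ ⟨𝒢.inv Φ.1, 0⟩ with hY
  have hYb : Y.1 = 𝒢.one (𝒢.tgt Φ.1) := by
    change 𝒢.mul ξ.1 (𝒢.inv Φ.1) = _
    rw [hξ, hG.mul_inv]
  have hYs : 𝒢.tan.src Y = ⟨𝒢.tgt Φ.1, 0⟩ := by
    rw [hY, 𝒢.tan_src_mul hcz, tan_src_zero, hG.src_inv]
  have hYalg : 𝒢.IsAlg (𝒢.tgt Φ.1) Y := ⟨hYb, hYs⟩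
  have hinvΦ : 𝒢.inv (𝒢.inv Φ.1) = Φ.1 := 𝒢.inv_inv _
  have e1 : 𝒢.tan.mul Y ⟨Φ.1, 0⟩ = ξ := by
    have := 𝒢.tan_mul_zero_cancel_right (η := ξ) (g := 𝒢.inv Φ.1) (by rw [hcz, tan_tgt_zero])
    rwa [hinvΦ] at this
  have hηY : 𝒢.tan.src η = 𝒢.tan.tgt Y := by rw [hY, 𝒢.tan_tgt_mul hcz, h]
  have e2 : 𝒢.tan.mul η Y = ⟨Ψ.1, 0⟩ := by
    rw [hY, 𝒢.tan_mul_assoc h hcz, hm, tan_mul_zero_zero,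
      ← hG.mul_assoc _ _ _ hb (hG.tgt_inv _).symm, hG.mul_inv, ← hb, hG.mul_one]
  have e3 : 𝒢.tan.mul ⟨Ψ.1, 0⟩ (𝒢.tan.inv Y) = η := by
    rw [← e2, ← 𝒢.tan_mul_assoc hηY (𝒢.tan_tgt_inv Y).symm, tan_mul_inv, ← hηY, tan_mul_one]
  have h1 := 𝒢.pair_one_tgt hYalg
  have h2 := 𝒢.pair_one_src (Φ := Ψ) (V := Y) (by rw [hb]; exact hYalg)
  rw [hc, h1, e1, e3] at h2
  rw [h2]
  ring

/-- The property that defines the product of covectors by choice can be satisfied: `(η, ξ) ↦ ⟨Ψ, η⟩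
+ ⟨Φ, ξ⟩` vanishes on the kernel of the multiplication of composable vectors, so it factors through
that map. -/
theorem exists_cotangent_mul {Ψ Φ : CotangentBundle 𝓘(ℝ, E) G}
    (hc : 𝒢.cotangent.src Ψ = 𝒢.cotangent.tgt Φ) :
    ∃ Θ : CotangentSpace 𝓘(ℝ, E) (𝒢.mul Ψ.1 Φ.1),
      ∀ (η : TangentSpace 𝓘(ℝ, E) Ψ.1) (ξ : TangentSpace 𝓘(ℝ, E) Φ.1),
        𝒢.tan.src ⟨Ψ.1, η⟩ = 𝒢.tan.tgt ⟨Φ.1, ξ⟩ →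
        Θ (𝒢.tan.mul ⟨Ψ.1, η⟩ ⟨Φ.1, ξ⟩).2 = Ψ.2 η + Φ.2 ξ := by
  have hb : 𝒢.src Ψ.1 = 𝒢.tgt Φ.1 := congrArg TotalSpace.proj hc
  let Tα : E →L[ℝ] F := mfderiv 𝓘(ℝ, E) 𝓘(ℝ, F) 𝒢.src Ψ.1
  let Tβ : E →L[ℝ] F := mfderiv 𝓘(ℝ, E) 𝓘(ℝ, F) 𝒢.tgt Φ.1
  -- The space of composable pairs of vectors at `(h, g)`.
  let D : Submodule ℝ (E × E) := LinearMap.ker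
    (Tα.comp (ContinuousLinearMap.fst ℝ E E) - Tβ.comp (ContinuousLinearMap.snd ℝ E E)).toLinearMap
  have hD : ∀ p : E × E, p ∈ D ↔ 𝒢.tan.src ⟨Ψ.1, p.1⟩ = 𝒢.tan.tgt ⟨Φ.1, p.2⟩ := by
    intro p
    have h1 : p ∈ D ↔ Tα p.1 - Tβ p.2 = 0 := Iff.rfl
    rw [h1, sub_eq_zero]
    exact ⟨fun h => tangent_ext hb h, fun h => tangent_snd_eq h⟩
  let μ : D →ₗ[ℝ] E := (𝒢.mulDeriv Ψ.1 Φ.1).toLinearMap.domRestrict D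
  let ψ : E →L[ℝ] ℝ := Ψ.2
  let φ : E →L[ℝ] ℝ := Φ.2
  let L : D →ₗ[ℝ] ℝ := (ψ.comp (ContinuousLinearMap.fst ℝ E E) +
    φ.comp (ContinuousLinearMap.snd ℝ E E)).toLinearMap.domRestrict D
  have hL : L ∈ LinearMap.range μ.dualMap := by
    rw [LinearMap.range_dualMap_eq_dualAnnihilator_ker, Submodule.mem_dualAnnihilator]
    intro p hp
    exact 𝒢.pair_add_pair_eq_zero hc (η := ⟨Ψ.1, p.1.1⟩) (ξ := ⟨Φ.1, p.1.2⟩) rfl rfl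
      ((hD p.1).1 p.2) hp
  obtain ⟨θ, hθ⟩ := hL
  let θ' : E →L[ℝ] ℝ := LinearMap.toContinuousLinearMap θ
  refine ⟨θ', fun η ξ h => ?_⟩
  exact LinearMap.congr_fun hθ (⟨(η, ξ), (hD (η, ξ)).2 h⟩ : D)

theorem pair_cotangent_mul {Ψ Φ : CotangentBundle 𝓘(ℝ, E) G}
    (hc : 𝒢.cotangent.src Ψ = 𝒢.cotangent.tgt Φ) {η ξ : TangentBundle 𝓘(ℝ, E) G}
    (hη : η.1 = Ψ.1) (hξ : ξ.1 = Φ.1) (h : 𝒢.tan.src η = 𝒢.tan.tgt ξ) :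
    pair (𝒢.cotangent.mul Ψ Φ) (𝒢.tan.mul η ξ) = pair Ψ η + pair Φ ξ := by
  obtain ⟨y, η⟩ := η
  obtain ⟨x, ξ⟩ := ξ
  obtain rfl : y = Ψ.1 := hη
  obtain rfl : x = Φ.1 := hξ
  exact Classical.epsilon_spec (𝒢.exists_cotangent_mul hc) η ξ h

theorem pair_cotangent_inv {Φ : CotangentBundle 𝓘(ℝ, E) G} {ξ : TangentBundle 𝓘(ℝ, E) G}
    (h : ξ.1 = Φ.1) : pair (𝒢.cotangent.inv Φ) (𝒢.tan.inv ξ) = -pair Φ ξ := by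
  obtain ⟨x, ξ⟩ := ξ
  obtain rfl : x = Φ.1 := h
  have hex : ∃ Θ : CotangentSpace 𝓘(ℝ, E) (𝒢.inv Φ.1), ∀ ξ : TangentSpace 𝓘(ℝ, E) Φ.1,
      Θ (mfderiv 𝓘(ℝ, E) 𝓘(ℝ, E) 𝒢.inv Φ.1 ξ) = -Φ.2 ξ := by
    let φ : E →L[ℝ] ℝ := Φ.2
    let A : E →L[ℝ] E := mfderiv 𝓘(ℝ, E) 𝓘(ℝ, E) 𝒢.inv (𝒢.inv Φ.1)
    refine ⟨-(φ.comp A), fun ξ => ?_⟩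
    have h1 := tangent_snd_eq (𝒢.tan_inv_inv ⟨Φ.1, ξ⟩)
    exact congrArg (fun v => -φ v) h1
  exact Classical.epsilon_spec hex ξ

end LieGroupoid

end CotangentGroupoid

/-! ### The groupoid axioms of the cotangent groupoid -/

section CotangentAxioms

variable {E : Type*} [NormedAddCommGroup E] [NormedSpace ℝ E] [FiniteDimensional ℝ E]
  {G : Type*} [TopologicalSpace G] [ChartedSpace E G] [IsManifold 𝓘(ℝ, E) ∞ G]
  {F : Type*} [NormedAddCommGroup F] [NormedSpace ℝ F] [FiniteDimensional ℝ F]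
  {P : Type*} [TopologicalSpace P] [ChartedSpace F P] [IsManifold 𝓘(ℝ, F) ∞ P]

namespace LieGroupoid

variable (𝒢 : LieGroupoid 𝓘(ℝ, E) G 𝓘(ℝ, F) P)

variable {Ψ Φ Θ : CotangentBundle 𝓘(ℝ, E) G}

theorem cotangent_composable_base (hc : 𝒢.cotangent.src Ψ = 𝒢.cotangent.tgt Φ) :
    𝒢.src Ψ.1 = 𝒢.tgt Φ.1 :=
  congrArg TotalSpace.proj hc

theorem cotangent_src_mul (hc : 𝒢.cotangent.src Ψ = 𝒢.cotangent.tgt Φ) :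
    𝒢.cotangent.src (𝒢.cotangent.mul Ψ Φ) = 𝒢.cotangent.src Φ := by
  have hG := 𝒢.isLieGroupoid
  have hb := 𝒢.cotangent_composable_base hc
  refine 𝒢.dualAlg_ext (hG.src_mul _ _ hb) fun V hV => ?_
  have hV' : 𝒢.IsAlg (𝒢.src Φ.1) V := by rw [← hG.src_mul _ _ hb]; exact hV
  rw [𝒢.pair_one_src (Φ := 𝒢.cotangent.mul Ψ Φ) hV, 𝒢.pair_one_src hV']
  have h1 : 𝒢.tan.src ⟨Φ.1, 0⟩ = 𝒢.tan.tgt (𝒢.tan.inv V) := by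
    rw [tan_src_zero, tan_tgt_inv, hV'.2]
  have h2 : 𝒢.tan.src ⟨Ψ.1, 0⟩ = 𝒢.tan.tgt ⟨Φ.1, 0⟩ := by rw [tan_src_zero, tan_tgt_zero, hb]
  have e : 𝒢.tan.mul ⟨(𝒢.cotangent.mul Ψ Φ).1, 0⟩ (𝒢.tan.inv V) =
      𝒢.tan.mul ⟨Ψ.1, 0⟩ (𝒢.tan.mul ⟨Φ.1, 0⟩ (𝒢.tan.inv V)) := by
    rw [𝒢.tan_mul_assoc h2 h1, tan_mul_zero_zero]
    rfl
  have hbase : (𝒢.tan.mul ⟨Φ.1, 0⟩ (𝒢.tan.inv V)).1 = Φ.1 := by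
    change 𝒢.mul Φ.1 (𝒢.inv V.1) = _
    rw [hV'.1, inv_one, hG.mul_one]
  rw [e, 𝒢.pair_cotangent_mul hc rfl hbase (by rw [h2, 𝒢.tan_tgt_mul h1]), pair_zero, zero_add]

theorem cotangent_tgt_mul (hc : 𝒢.cotangent.src Ψ = 𝒢.cotangent.tgt Φ) :
    𝒢.cotangent.tgt (𝒢.cotangent.mul Ψ Φ) = 𝒢.cotangent.tgt Ψ := by
  have hG := 𝒢.isLieGroupoid
  have hb := 𝒢.cotangent_composable_base hc
  refine 𝒢.dualAlg_ext (hG.tgt_mul _ _ hb) fun V hV => ?_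
  have hV' : 𝒢.IsAlg (𝒢.tgt Ψ.1) V := by rw [← hG.tgt_mul _ _ hb]; exact hV
  rw [𝒢.pair_one_tgt (Φ := 𝒢.cotangent.mul Ψ Φ) hV, 𝒢.pair_one_tgt hV']
  have h1 : 𝒢.tan.src V = 𝒢.tan.tgt ⟨Ψ.1, 0⟩ := by rw [hV'.2, tan_tgt_zero]
  have h2 : 𝒢.tan.src ⟨Ψ.1, 0⟩ = 𝒢.tan.tgt ⟨Φ.1, 0⟩ := by rw [tan_src_zero, tan_tgt_zero, hb]
  have e : 𝒢.tan.mul V ⟨(𝒢.cotangent.mul Ψ Φ).1, 0⟩ =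
      𝒢.tan.mul (𝒢.tan.mul V ⟨Ψ.1, 0⟩) ⟨Φ.1, 0⟩ := by
    rw [← 𝒢.tan_mul_assoc h1 h2, tan_mul_zero_zero]
    rfl
  have hbase : (𝒢.tan.mul V ⟨Ψ.1, 0⟩).1 = Ψ.1 := by
    change 𝒢.mul V.1 Ψ.1 = _
    rw [hV'.1, hG.one_mul]
  rw [e, 𝒢.pair_cotangent_mul hc hbase rfl (by rw [← h2, 𝒢.tan_src_mul h1]), pair_zero, add_zero]

theorem cotangent_mul_assoc (h1 : 𝒢.cotangent.src Ψ = 𝒢.cotangent.tgt Φ)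
    (h2 : 𝒢.cotangent.src Φ = 𝒢.cotangent.tgt Θ) :
    𝒢.cotangent.mul Ψ (𝒢.cotangent.mul Φ Θ) = 𝒢.cotangent.mul (𝒢.cotangent.mul Ψ Φ) Θ := by
  have hG := 𝒢.isLieGroupoid
  have hb1 := 𝒢.cotangent_composable_base h1
  have hb2 := 𝒢.cotangent_composable_base h2
  refine cotangent_ext (hG.mul_assoc _ _ _ hb1 hb2) fun ζ hζ => ?_
  obtain ⟨η, ρ, hη, hρ, hηρ, rfl⟩ := 𝒢.exists_tan_mul_eq (h := Ψ.1) (g := 𝒢.mul Φ.1 Θ.1)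
    (by rw [hG.tgt_mul _ _ hb2, hb1]) hζ
  obtain ⟨ξ, χ, hξ, hχ, hξχ, rfl⟩ := 𝒢.exists_tan_mul_eq hb2 hρ
  have hηξ : 𝒢.tan.src η = 𝒢.tan.tgt ξ := by rw [hηρ, 𝒢.tan_tgt_mul hξχ]
  rw [𝒢.pair_cotangent_mul (by rw [𝒢.cotangent_tgt_mul h2, h1]) hη hρ hηρ,
    𝒢.pair_cotangent_mul h2 hξ hχ hξχ, 𝒢.tan_mul_assoc hηξ hξχ,
    𝒢.pair_cotangent_mul (by rw [𝒢.cotangent_src_mul h1, h2])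
      (by change 𝒢.mul η.1 ξ.1 = _; rw [hη, hξ]; rfl) hχ (by rw [𝒢.tan_src_mul hηξ, hξχ]),
    𝒢.pair_cotangent_mul h1 hη hξ hηξ, add_assoc]

theorem cotangent_src_one (φ : 𝒢.DualAlg) : 𝒢.cotangent.src (𝒢.cotangent.one φ) = φ := by
  have hG := 𝒢.isLieGroupoid
  refine 𝒢.dualAlg_ext (hG.src_one φ.1) fun V hV => ?_
  have hV' : 𝒢.IsAlg φ.1 V := by rw [← hG.src_one φ.1]; exact hV
  rw [𝒢.pair_one_src (Φ := 𝒢.cotangent.one φ) hV]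
  have e : 𝒢.tan.mul ⟨(𝒢.cotangent.one φ).1, 0⟩ (𝒢.tan.inv V) = 𝒢.tan.inv V := hV'.zero_one_mul
  have h1 := pair_of_add (𝒢.cotangent.one φ) (hV'.add_inv).symm
  rw [𝒢.pair_one_one (by
    change 𝒢.tgt V.1 = _
    rw [hV'.1, hG.tgt_one])] at h1
  rw [e]
  linarith

theorem cotangent_tgt_one (φ : 𝒢.DualAlg) : 𝒢.cotangent.tgt (𝒢.cotangent.one φ) = φ := by
  have hG := 𝒢.isLieGroupoid
  refine 𝒢.dualAlg_ext (hG.tgt_one φ.1) fun V hV => ?_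
  have hV' : 𝒢.IsAlg φ.1 V := by rw [← hG.tgt_one φ.1]; exact hV
  rw [𝒢.pair_one_tgt (Φ := 𝒢.cotangent.one φ) hV]
  exact congrArg (pair (𝒢.cotangent.one φ)) hV'.mul_zero_one

theorem cotangent_one_mul (Φ : CotangentBundle 𝓘(ℝ, E) G) :
    𝒢.cotangent.mul (𝒢.cotangent.one (𝒢.cotangent.tgt Φ)) Φ = Φ := by
  have hG := 𝒢.isLieGroupoid
  refine cotangent_ext (hG.one_mul Φ.1) fun ζ hζ => ?_
  have hζ' : ζ.1 = Φ.1 := hζ.trans (hG.one_mul Φ.1)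
  have hb : 𝒢.tgt ζ.1 = 𝒢.tgt Φ.1 := by rw [hζ']
  conv_lhs => rw [← 𝒢.tan_one_mul ζ]
  rw [𝒢.pair_cotangent_mul (𝒢.cotangent_src_one _) (congrArg 𝒢.one hb) hζ' (𝒢.tan_src_one _),
    𝒢.pair_one_one hb, zero_add]

theorem cotangent_mul_one (Φ : CotangentBundle 𝓘(ℝ, E) G) :
    𝒢.cotangent.mul Φ (𝒢.cotangent.one (𝒢.cotangent.src Φ)) = Φ := by
  have hG := 𝒢.isLieGroupoid
  refine cotangent_ext (hG.mul_one Φ.1) fun ζ hζ => ?_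
  have hζ' : ζ.1 = Φ.1 := hζ.trans (hG.mul_one Φ.1)
  have hb : 𝒢.src ζ.1 = 𝒢.src Φ.1 := by rw [hζ']
  conv_lhs => rw [← 𝒢.tan_mul_one ζ]
  rw [𝒢.pair_cotangent_mul (𝒢.cotangent_tgt_one _).symm hζ' (congrArg 𝒢.one hb)
    (𝒢.tan_tgt_one _).symm, 𝒢.pair_one_one hb, add_zero]

theorem cotangent_src_inv (Φ : CotangentBundle 𝓘(ℝ, E) G) :
    𝒢.cotangent.src (𝒢.cotangent.inv Φ) = 𝒢.cotangent.tgt Φ := by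
  have hG := 𝒢.isLieGroupoid
  refine 𝒢.dualAlg_ext (hG.src_inv Φ.1) fun V hV => ?_
  have hV' : 𝒢.IsAlg (𝒢.tgt Φ.1) V := by rw [← hG.src_inv Φ.1]; exact hV
  rw [𝒢.pair_one_src (Φ := 𝒢.cotangent.inv Φ) hV, 𝒢.pair_one_tgt hV']
  have e : 𝒢.tan.mul ⟨(𝒢.cotangent.inv Φ).1, 0⟩ (𝒢.tan.inv V) =
      𝒢.tan.inv (𝒢.tan.mul V ⟨Φ.1, 0⟩) := by
    rw [𝒢.tan_inv_mul_rev (by rw [hV'.2, tan_tgt_zero]), tan_inv_zero]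
    rfl
  rw [e, 𝒢.pair_cotangent_inv (by
    change 𝒢.mul V.1 Φ.1 = _
    rw [hV'.1, hG.one_mul]), neg_neg]

theorem cotangent_inv_inv (Φ : CotangentBundle 𝓘(ℝ, E) G) :
    𝒢.cotangent.inv (𝒢.cotangent.inv Φ) = Φ := by
  refine cotangent_ext (𝒢.inv_inv Φ.1) fun ζ hζ => ?_
  have hζ' : ζ.1 = Φ.1 := hζ.trans (𝒢.inv_inv Φ.1)
  have hζi : (𝒢.tan.inv ζ).1 = 𝒢.inv Φ.1 := congrArg 𝒢.inv hζ'
  conv_lhs => rw [← 𝒢.tan_inv_inv ζ]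
  rw [𝒢.pair_cotangent_inv (Φ := 𝒢.cotangent.inv Φ) hζi, 𝒢.pair_cotangent_inv hζ', neg_neg]

theorem cotangent_tgt_inv (Φ : CotangentBundle 𝓘(ℝ, E) G) :
    𝒢.cotangent.tgt (𝒢.cotangent.inv Φ) = 𝒢.cotangent.src Φ := by
  rw [← cotangent_src_inv, cotangent_inv_inv]

theorem tan_one_src_snd (m : P) (v : TangentSpace 𝓘(ℝ, E) (𝒢.one m)) :
    ((𝒢.tan.one (𝒢.tan.src ⟨𝒢.one m, v⟩)).2 : E) = 𝒢.oneSrc m v := by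
  have h : 𝒢.tan.src ⟨𝒢.one m, v⟩ = ⟨m, tcast (𝒢.isLieGroupoid.src_one m)
      (mfderiv 𝓘(ℝ, E) 𝓘(ℝ, F) 𝒢.src (𝒢.one m) v)⟩ :=
    tangent_ext (𝒢.isLieGroupoid.src_one m) (tcast_eq _ _).symm
  rw [h]
  rfl

/-- The decomposition `T_{1_m} G = T(1)(T_m P) ⊕ A_m G`. -/
theorem exists_isAlg_add {m : P} {ζ : TangentBundle 𝓘(ℝ, E) G} (h : ζ.1 = 𝒢.one m) :
    ∃ V, 𝒢.IsAlg m V ∧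
      (ζ.2 : E) = (show E from (𝒢.tan.one (𝒢.tan.src ζ)).2) + (show E from V.2) := by
  obtain ⟨g, v⟩ := ζ
  obtain rfl : g = 𝒢.one m := h
  refine ⟨_, 𝒢.isAlg_incl m (𝒢.algProj m v), ?_⟩
  refine Eq.trans ?_ (congrArg (· + (show E from 𝒢.incl m (𝒢.algProj m v)))
    (𝒢.tan_one_src_snd m v).symm)
  exact (add_sub_cancel (show E from 𝒢.oneSrc m v) (show E from v)).symm

/-- Both sides are evaluated on `T(1)(x) + V` with `V ∈ AG`: on `T(1)(x) = ξ⁻¹ • ξ` both vanish, and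
`V = (V • 0) • 0`. -/
theorem cotangent_inv_mul (Φ : CotangentBundle 𝓘(ℝ, E) G) :
    𝒢.cotangent.mul (𝒢.cotangent.inv Φ) Φ = 𝒢.cotangent.one (𝒢.cotangent.src Φ) := by
  have hG := 𝒢.isLieGroupoid
  refine cotangent_ext (hG.inv_mul Φ.1) fun ζ hζ => ?_
  have hζ' : ζ.1 = 𝒢.one (𝒢.src Φ.1) := hζ.trans (hG.inv_mul Φ.1)
  obtain ⟨V, hV, hζV⟩ := 𝒢.exists_isAlg_add hζ'
  have hsb : 𝒢.src ζ.1 = 𝒢.src Φ.1 := by rw [hζ', hG.src_one]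
  rw [pair_of_add _ hζV, pair_of_add _ hζV, 𝒢.pair_one_one hsb]
  obtain ⟨u, hu⟩ := hG.src_submersion Φ.1 (show F from (𝒢.tan.src ζ).2)
  have hξ : 𝒢.tan.src ⟨Φ.1, u⟩ = 𝒢.tan.src ζ := tangent_ext hsb.symm hu
  rw [← hξ, ← tan_inv_mul, 𝒢.pair_cotangent_mul (𝒢.cotangent_src_inv Φ) rfl rfl (𝒢.tan_src_inv _),
    𝒢.pair_cotangent_inv rfl, neg_add_cancel]
  congr 1
  have hVi : 𝒢.IsAlg (𝒢.tgt (𝒢.inv Φ.1)) V := by rw [hG.tgt_inv]; exact hV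
  have h1 : 𝒢.tan.src V = 𝒢.tan.tgt ⟨𝒢.inv Φ.1, 0⟩ := by rw [hVi.2, tan_tgt_zero]
  have e : 𝒢.tan.mul (𝒢.tan.mul V ⟨𝒢.inv Φ.1, 0⟩) ⟨Φ.1, 0⟩ = V := by
    have := 𝒢.tan_mul_zero_cancel_right (η := V) (g := 𝒢.inv Φ.1) hVi.2
    rwa [inv_inv] at this
  have hb : (𝒢.tan.mul V ⟨𝒢.inv Φ.1, 0⟩).1 = 𝒢.inv Φ.1 := by
    change 𝒢.mul V.1 (𝒢.inv Φ.1) = _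
    rw [hVi.1, hG.one_mul]
  conv_lhs => rw [← e]
  rw [𝒢.pair_cotangent_mul (𝒢.cotangent_src_inv Φ) hb rfl (by
      rw [𝒢.tan_src_mul h1, tan_src_zero, tan_tgt_zero, hG.src_inv]),
    pair_zero, add_zero, ← cotangent_tgt_inv,
    𝒢.pair_one_tgt (Φ := 𝒢.cotangent.inv Φ) hVi]
  rfl

theorem cotangent_mul_inv (Φ : CotangentBundle 𝓘(ℝ, E) G) :
    𝒢.cotangent.mul Φ (𝒢.cotangent.inv Φ) = 𝒢.cotangent.one (𝒢.cotangent.tgt Φ) := by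
  have h := 𝒢.cotangent_inv_mul (𝒢.cotangent.inv Φ)
  rwa [cotangent_inv_inv, cotangent_src_inv] at h

end LieGroupoid

end CotangentAxioms

/-! ### Smoothness of the cotangent groupoid -/

section LiftAlgebra

variable {E : Type*} [NormedAddCommGroup E] [NormedSpace ℝ E]
  {H : Type*} [TopologicalSpace H] {I : ModelWithCorners ℝ E H}
  {M : Type*} [TopologicalSpace M] [ChartedSpace H M] [IsManifold I ∞ M]
  {K : Type*} [NormedAddCommGroup K] [NormedSpace ℝ K]
  {V : M → Type*} [TopologicalSpace (TotalSpace K V)] [∀ x, TopologicalSpace (V x)]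
  [∀ x, AddCommGroup (V x)] [∀ x, Module ℝ (V x)] [FiberBundle K V] [VectorBundle ℝ K V]
  [ContMDiffVectorBundle ∞ K V I]
  {EX : Type*} [NormedAddCommGroup EX] [NormedSpace ℝ EX]
  {HX : Type*} [TopologicalSpace HX] {IX : ModelWithCorners ℝ EX HX}
  {X : Type*} [TopologicalSpace X] [ChartedSpace HX X]

theorem contMDiffWithinAt_lift_sub {b : X → M} {v w : ∀ x, V (b x)} {s : Set X} {x₀ : X}
    (hv : ContMDiffWithinAt IX (I.prod 𝓘(ℝ, K)) ∞ (fun x => (⟨b x, v x⟩ : TotalSpace K V)) s x₀)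
    (hw : ContMDiffWithinAt IX (I.prod 𝓘(ℝ, K)) ∞ (fun x => (⟨b x, w x⟩ : TotalSpace K V)) s x₀) :
    ContMDiffWithinAt IX (I.prod 𝓘(ℝ, K)) ∞
      (fun x => (⟨b x, v x - w x⟩ : TotalSpace K V)) s x₀ := by
  rw [Bundle.contMDiffWithinAt_totalSpace] at hv hw ⊢
  refine ⟨hv.1, (hv.2.sub hw.2).congr_of_eventuallyEq ?_ ?_⟩
  · filter_upwards [hv.1.continuousWithinAt ((trivializationAt K V (b x₀)).open_baseSet.mem_nhds
      (FiberBundle.mem_baseSet_trivializationAt' _))] with x hx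
    exact ((trivializationAt K V (b x₀)).linear ℝ hx).map_sub _ _
  · exact ((trivializationAt K V (b x₀)).linear ℝ
      (FiberBundle.mem_baseSet_trivializationAt' _)).map_sub _ _

theorem contMDiffWithinAt_pair_of_eventually {F : X → CotangentBundle I M}
    {v : X → TangentBundle I M} {s : Set X} {x₀ : X}
    (hF : ContMDiffWithinAt IX (I.prod 𝓘(ℝ, E →L[ℝ] ℝ)) ∞ F s x₀)
    (hv : ContMDiffWithinAt IX I.tangent ∞ v s x₀) (h : ∀ᶠ x in 𝓝[s] x₀, (v x).1 = (F x).1)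
    (h₀ : (v x₀).1 = (F x₀).1) :
    ContMDiffWithinAt IX 𝓘(ℝ) ∞ (fun x => pair (F x) (v x)) s x₀ := by
  have hv' : ContMDiffWithinAt IX I.tangent ∞
      (fun x => (⟨(F x).1, (show E from (v x).2)⟩ : TangentBundle I M)) s x₀ :=
    hv.congr_of_eventuallyEq (h.mono fun x hx => tangent_ext hx.symm rfl) (tangent_ext h₀.symm rfl)
  exact contMDiffWithinAt_dual_apply hF hv'

end LiftAlgebra

section CotangentSmooth

variable {E : Type*} [NormedAddCommGroup E] [NormedSpace ℝ E] [FiniteDimensional ℝ E]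
  {G : Type*} [TopologicalSpace G] [ChartedSpace E G] [IsManifold 𝓘(ℝ, E) ∞ G]
  {F : Type*} [NormedAddCommGroup F] [NormedSpace ℝ F] [FiniteDimensional ℝ F]
  {P : Type*} [TopologicalSpace P] [ChartedSpace F P] [IsManifold 𝓘(ℝ, F) ∞ P]

namespace LieGroupoid

variable (𝒢 : LieGroupoid 𝓘(ℝ, E) G 𝓘(ℝ, F) P)

section Lifts

variable {EX : Type*} [NormedAddCommGroup EX] [NormedSpace ℝ EX]
  {HX : Type*} [TopologicalSpace HX] {IX : ModelWithCorners ℝ EX HX}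
  {X : Type*} [TopologicalSpace X] [ChartedSpace HX X]

theorem tTriv_snd {i m : P} (h : 𝒢.one m ∈ (𝒢.tTriv i).baseSet)
    (v : TangentSpace 𝓘(ℝ, E) (𝒢.one m)) :
    (𝒢.tTriv i ⟨𝒢.one m, v⟩).2 = 𝒢.toCoord i m v := by
  unfold toCoord
  rw [Bundle.Trivialization.continuousLinearMapAt_apply,
    Bundle.Trivialization.coe_linearMapAt_of_mem _ h]

theorem eventually_one_mem_baseSet {m : X → P} {s : Set X} {x₀ : X}
    (hm : ContMDiffWithinAt IX 𝓘(ℝ, F) ∞ m s x₀) :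
    ∀ᶠ x in 𝓝[s] x₀, 𝒢.one (m x) ∈ (𝒢.tTriv (m x₀)).baseSet :=
  hm.continuousWithinAt ((((𝒢.tTriv (m x₀)).open_baseSet).preimage
    𝒢.isLieGroupoid.contMDiff_one.continuous).mem_nhds (𝒢.one_mem_baseSet (m x₀)))

/-- A map into `AG` is smooth if it is smooth as a map into `TG`. -/
theorem contMDiffWithinAt_alg {v : X → TotalSpace (AlgModel E F) 𝒢.AlgFiber} {s : Set X} {x₀ : X}
    (hb : ContMDiffWithinAt IX 𝓘(ℝ, F) ∞ (fun x => (v x).1) s x₀)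
    (h : ContMDiffWithinAt IX 𝓘(ℝ, E).tangent ∞
      (fun x => (⟨𝒢.one (v x).1, 𝒢.incl _ (v x).2⟩ : TangentBundle 𝓘(ℝ, E) G)) s x₀) :
    ContMDiffWithinAt IX (𝓘(ℝ, F).prod 𝓘(ℝ, AlgModel E F)) ∞ v s x₀ := by
  rw [Bundle.contMDiffWithinAt_totalSpace] at h ⊢
  refine ⟨hb, ?_⟩
  have h1 : ContMDiffWithinAt IX 𝓘(ℝ, AlgModel E F) ∞ (fun x => 𝒢.modelProj (v x₀).1
      (𝒢.tTriv (v x₀).1 ⟨𝒢.one (v x).1, 𝒢.incl _ (v x).2⟩).2) s x₀ :=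
    (𝒢.modelProj (v x₀).1).contDiff.contMDiff.contMDiffAt.comp_contMDiffWithinAt x₀ h.2
  refine h1.congr_of_eventuallyEq ?_ ?_
  · filter_upwards [𝒢.eventually_one_mem_baseSet hb] with x hx
    rw [tTriv_snd _ hx]; rfl
  · rw [tTriv_snd _ (𝒢.one_mem_baseSet _)]; rfl

theorem toCoord_incl_algCoordInv {i m : P} (h : 𝒢.one m ∈ (𝒢.tTriv i).baseSet)
    (w : AlgModel E F) :
    𝒢.toCoord i m (𝒢.incl m (𝒢.algCoordInv i m w)) =
      (ContinuousLinearMap.id ℝ E - 𝒢.oneSrcCoord i m)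
        (𝒢.modelIncl i ((𝒢.algTrans i m).inverse w)) := by
  change 𝒢.toCoord i m (𝒢.ofCoord i m (𝒢.modelIncl i _) -
    𝒢.oneSrc m (𝒢.ofCoord i m (𝒢.modelIncl i _))) = 𝒢.modelIncl i _ -
      𝒢.toCoord i m (𝒢.oneSrc m (𝒢.ofCoord i m (𝒢.modelIncl i _)))
  rw [map_sub (𝒢.toCoord i m), toCoord_ofCoord _ h]
  rfl

/-- A smooth map into `AG` is smooth as a map into `TG`: in the trivialization of `TG`, the
inclusion is `id - T(1 ∘ α)` applied to the inverse of the smooth family `algTrans`. -/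
theorem contMDiffWithinAt_incl {v : X → TotalSpace (AlgModel E F) 𝒢.AlgFiber} {s : Set X} {x₀ : X}
    (h : ContMDiffWithinAt IX (𝓘(ℝ, F).prod 𝓘(ℝ, AlgModel E F)) ∞ v s x₀) :
    ContMDiffWithinAt IX 𝓘(ℝ, E).tangent ∞
      (fun x => (⟨𝒢.one (v x).1, 𝒢.incl _ (v x).2⟩ : TangentBundle 𝓘(ℝ, E) G)) s x₀ := by
  rw [Bundle.contMDiffWithinAt_totalSpace] at h
  have hb := h.1
  have h2 : ContMDiffWithinAt IX 𝓘(ℝ, AlgModel E F) ∞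
      (fun x => 𝒢.algCoord (v x₀).1 (v x).1 (v x).2) s x₀ := h.2
  have hmem := 𝒢.mem_algBase (v x₀).1
  have hinv : ContMDiffAt 𝓘(ℝ, F) 𝓘(ℝ, AlgModel E F →L[ℝ] AlgModel E F) ∞
      (fun m' => (𝒢.algTrans (v x₀).1 m').inverse) (v x₀).1 :=
    ContMDiffAt.comp (I' := 𝓘(ℝ, AlgModel E F →L[ℝ] AlgModel E F)) (v x₀).1
      (hmem.2.contDiffAt_map_inverse).contMDiffAt (𝒢.contMDiffAt_algTrans hmem.1)
  have h3 : ContMDiffWithinAt IX 𝓘(ℝ, E) ∞ (fun x => 𝒢.modelIncl (v x₀).1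
      ((𝒢.algTrans (v x₀).1 (v x).1).inverse (𝒢.algCoord (v x₀).1 (v x).1 (v x).2))) s x₀ :=
    contMDiffWithinAt_const.clm_apply ((hinv.comp_contMDiffWithinAt x₀ hb).clm_apply h2)
  have h4 : ContMDiffWithinAt IX 𝓘(ℝ, E →L[ℝ] E) ∞ (fun x => ContinuousLinearMap.id ℝ E -
      𝒢.oneSrcCoord (v x₀).1 (v x).1) s x₀ :=
    contMDiffWithinAt_const.sub
      ((𝒢.contMDiffAt_oneSrcCoord hmem.1).comp_contMDiffWithinAt x₀ hb)
  have key : ∀ x, (v x).1 ∈ 𝒢.algBase (v x₀).1 →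
      (𝒢.tTriv (v x₀).1 ⟨𝒢.one (v x).1, 𝒢.incl _ (v x).2⟩).2 =
      (ContinuousLinearMap.id ℝ E - 𝒢.oneSrcCoord (v x₀).1 (v x).1) (𝒢.modelIncl (v x₀).1
        ((𝒢.algTrans (v x₀).1 (v x).1).inverse (𝒢.algCoord (v x₀).1 (v x).1 (v x).2))) := by
    intro x hx
    rw [tTriv_snd _ hx.1, ← 𝒢.toCoord_incl_algCoordInv hx.1, algCoordInv_algCoord _ hx]
  have h5 : ContMDiffWithinAt IX 𝓘(ℝ, E) ∞
      (fun x => (𝒢.tTriv (v x₀).1 ⟨𝒢.one (v x).1, 𝒢.incl _ (v x).2⟩).2) s x₀ := by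
    refine (h4.clm_apply h3).congr_of_eventuallyEq ?_ (key x₀ hmem)
    filter_upwards [hb.continuousWithinAt ((𝒢.isOpen_algBase (v x₀).1).mem_nhds hmem)] with x hx
    exact key x hx
  rw [Bundle.contMDiffWithinAt_totalSpace]
  exact ⟨(𝒢.contMDiffAt_one _).comp_contMDiffWithinAt x₀ hb, h5⟩

theorem contMDiffWithinAt_tan_mul {η ξ : X → TangentBundle 𝓘(ℝ, E) G} {s : Set X} {x₀ : X}
    (hη : ContMDiffWithinAt IX 𝓘(ℝ, E).tangent ∞ η s x₀)
    (hξ : ContMDiffWithinAt IX 𝓘(ℝ, E).tangent ∞ ξ s x₀)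
    (hc : ∀ᶠ x in 𝓝[s] x₀, 𝒢.tan.src (η x) = 𝒢.tan.tgt (ξ x))
    (hc₀ : 𝒢.tan.src (η x₀) = 𝒢.tan.tgt (ξ x₀)) :
    ContMDiffWithinAt IX 𝓘(ℝ, E).tangent ∞ (fun x => 𝒢.tan.mul (η x) (ξ x)) s x₀ := by
  have h := (𝒢.contMDiffOn_tan_mul (η x₀, ξ x₀) hc₀).comp (t := 𝒢.tan.composable)
    (s := s ∩ {x | 𝒢.tan.src (η x) = 𝒢.tan.tgt (ξ x)}) x₀
    ((hη.prodMk hξ).mono inter_subset_left) (fun x hx => hx.2)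
  exact h.mono_of_mem_nhdsWithin (inter_mem self_mem_nhdsWithin hc)

end Lifts

theorem contMDiff_tan_src : ContMDiff 𝓘(ℝ, E).tangent 𝓘(ℝ, F).tangent ∞ 𝒢.tan.src :=
  𝒢.isLieGroupoid_tan.contMDiff_src

theorem contMDiff_tan_tgt : ContMDiff 𝓘(ℝ, E).tangent 𝓘(ℝ, F).tangent ∞ 𝒢.tan.tgt :=
  𝒢.isLieGroupoid_tan.contMDiff_tgt

theorem contMDiff_tan_one : ContMDiff 𝓘(ℝ, F).tangent 𝓘(ℝ, E).tangent ∞ 𝒢.tan.one :=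
  𝒢.isLieGroupoid_tan.contMDiff_one

theorem contMDiff_tan_inv : ContMDiff 𝓘(ℝ, E).tangent 𝓘(ℝ, E).tangent ∞ 𝒢.tan.inv := by
  have := isManifold_one_of_infty (E := E) (M := G)
  exact 𝒢.contMDiff_inv.contMDiff_tangentMap (by simp)

theorem contMDiff_cotangent_proj : ContMDiff (𝓘(ℝ, E).prod 𝓘(ℝ, E →L[ℝ] ℝ)) 𝓘(ℝ, E) ∞
    (fun Φ : CotangentBundle 𝓘(ℝ, E) G => Φ.1) :=
  Bundle.contMDiff_proj _

theorem contMDiff_cotangent_zero : ContMDiff (𝓘(ℝ, E).prod 𝓘(ℝ, E →L[ℝ] ℝ)) 𝓘(ℝ, E).tangent ∞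
    (fun Φ : CotangentBundle 𝓘(ℝ, E) G => (⟨Φ.1, 0⟩ : TangentBundle 𝓘(ℝ, E) G)) :=
  (Bundle.contMDiff_zeroSection ℝ (TangentSpace 𝓘(ℝ, E) : G → Type _)).comp
    contMDiff_cotangent_proj

theorem contMDiff_cotangent_one : ContMDiff (𝓘(ℝ, F).prod 𝓘(ℝ, AlgModel E F →L[ℝ] ℝ))
    (𝓘(ℝ, E).prod 𝓘(ℝ, E →L[ℝ] ℝ)) ∞ 𝒢.cotangent.one := by
  intro φ₀
  have hp : ContMDiffWithinAt (𝓘(ℝ, F).prod 𝓘(ℝ, AlgModel E F →L[ℝ] ℝ)) 𝓘(ℝ, F) ∞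
    (fun φ : 𝒢.DualAlg => φ.1) univ φ₀ := Bundle.contMDiff_proj _ φ₀
  refine contMDiffWithinAt_dual (F := 𝒢.cotangent.one)
    ((𝒢.contMDiffAt_one _).comp_contMDiffWithinAt φ₀ hp) fun v hv => ?_
  have h1 : ContMDiffWithinAt (𝓘(ℝ, F).prod 𝓘(ℝ, AlgModel E F →L[ℝ] ℝ)) 𝓘(ℝ, E).tangent ∞
      (fun φ : 𝒢.DualAlg => (⟨𝒢.one φ.1, 𝒢.oneSrc φ.1 (v φ)⟩ : TangentBundle 𝓘(ℝ, E) G))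
      univ φ₀ := by
    refine ((𝒢.contMDiff_tan_one _).comp_contMDiffWithinAt φ₀
      ((𝒢.contMDiff_tan_src _).comp_contMDiffWithinAt φ₀ hv)).congr (fun φ _ => ?_) ?_
    · exact tangent_ext (congrArg 𝒢.one (𝒢.isLieGroupoid.src_one φ.1)).symm
        (𝒢.tan_one_src_snd φ.1 (v φ)).symm
    · exact tangent_ext (congrArg 𝒢.one (𝒢.isLieGroupoid.src_one φ₀.1)).symm
        (𝒢.tan_one_src_snd φ₀.1 (v φ₀)).symm
  refine contMDiffWithinAt_dual_apply (F := fun φ : 𝒢.DualAlg => φ)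
    (v := fun φ => 𝒢.algProj φ.1 (v φ)) contMDiffWithinAt_id (𝒢.contMDiffWithinAt_alg hp ?_)
  exact contMDiffWithinAt_lift_sub (V := (TangentSpace 𝓘(ℝ, E) : G → Type _)) hv h1

theorem contMDiff_cotangent_src : ContMDiff (𝓘(ℝ, E).prod 𝓘(ℝ, E →L[ℝ] ℝ))
    (𝓘(ℝ, F).prod 𝓘(ℝ, AlgModel E F →L[ℝ] ℝ)) ∞ 𝒢.cotangent.src := by
  intro Φ₀
  have hG := 𝒢.isLieGroupoid
  refine contMDiffWithinAt_dual (F := 𝒢.cotangent.src)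
    ((𝒢.contMDiffAt_src _).comp_contMDiffWithinAt Φ₀ (contMDiff_cotangent_proj Φ₀))
    fun v hv => ?_
  have h1 := 𝒢.contMDiffWithinAt_incl hv
  have hc : ∀ Φ : CotangentBundle 𝓘(ℝ, E) G, 𝒢.tan.src ⟨Φ.1, 0⟩ =
      𝒢.tan.tgt (𝒢.tan.inv ⟨𝒢.one (𝒢.src Φ.1), 𝒢.incl _ (v Φ)⟩) := fun Φ =>
    (𝒢.tan_src_zero _).trans ((𝒢.tan_tgt_inv _).trans (𝒢.isAlg_incl _ (v Φ)).2).symm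
  have h2 := 𝒢.contMDiffWithinAt_tan_mul (contMDiff_cotangent_zero Φ₀)
    ((𝒢.contMDiff_tan_inv _).comp_contMDiffWithinAt Φ₀ h1) (Eventually.of_forall hc) (hc Φ₀)
  refine ((contMDiffWithinAt_pair (contMDiffWithinAt_id (x := Φ₀)) h2 fun Φ => ?_).neg).congr
    (fun Φ _ => 𝒢.cotangent_src_apply Φ (v Φ)) (𝒢.cotangent_src_apply Φ₀ (v Φ₀))
  change Φ.1 = 𝒢.mul Φ.1 (𝒢.inv (𝒢.one (𝒢.src Φ.1)))
  rw [inv_one, hG.mul_one]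

theorem contMDiff_cotangent_tgt : ContMDiff (𝓘(ℝ, E).prod 𝓘(ℝ, E →L[ℝ] ℝ))
    (𝓘(ℝ, F).prod 𝓘(ℝ, AlgModel E F →L[ℝ] ℝ)) ∞ 𝒢.cotangent.tgt := by
  intro Φ₀
  have hG := 𝒢.isLieGroupoid
  refine contMDiffWithinAt_dual (F := 𝒢.cotangent.tgt)
    ((𝒢.contMDiffAt_tgt _).comp_contMDiffWithinAt Φ₀ (contMDiff_cotangent_proj Φ₀))
    fun v hv => ?_
  have h1 := 𝒢.contMDiffWithinAt_incl hv
  have hc : ∀ Φ : CotangentBundle 𝓘(ℝ, E) G,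
      𝒢.tan.src ⟨𝒢.one (𝒢.tgt Φ.1), 𝒢.incl _ (v Φ)⟩ = 𝒢.tan.tgt ⟨Φ.1, 0⟩ := fun Φ =>
    (𝒢.isAlg_incl _ (v Φ)).2.trans (𝒢.tan_tgt_zero _).symm
  have h2 := 𝒢.contMDiffWithinAt_tan_mul h1 (contMDiff_cotangent_zero Φ₀)
    (Eventually.of_forall hc) (hc Φ₀)
  refine (contMDiffWithinAt_pair (contMDiffWithinAt_id (x := Φ₀)) h2 fun Φ => ?_).congr
    (fun Φ _ => 𝒢.cotangent_tgt_apply Φ (v Φ)) (𝒢.cotangent_tgt_apply Φ₀ (v Φ₀))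
  exact (hG.one_mul Φ.1).symm

/-- Near `h₀`, a tangent vector to `P` lifts through `T(β)` to a tangent vector to `G`, with
prescribed base point and smoothly in the data. -/
theorem exists_tan_tgt_lift (h₀ : G) :
    ∃ (W : Set (P × G)) (L : TangentBundle 𝓘(ℝ, F) P × G → TangentBundle 𝓘(ℝ, E) G),
      IsOpen W ∧ (𝒢.tgt h₀, h₀) ∈ W ∧
      ContMDiffOn (𝓘(ℝ, F).tangent.prod 𝓘(ℝ, E)) 𝓘(ℝ, E).tangent ∞ L {p | (p.1.1, p.2) ∈ W} ∧
      ∀ p : TangentBundle 𝓘(ℝ, F) P × G, (p.1.1, p.2) ∈ W →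
        𝒢.tan.tgt (L p) = p.1 ∧ (𝒢.tgt p.2 = p.1.1 → (L p).1 = p.2) := by
  have := isManifold_one_of_infty (E := E) (M := G)
  have := isManifold_one_of_infty (E := F) (M := P)
  obtain ⟨W, s, hW, hW₀, hs, hs1, hs2⟩ := exists_section_family 𝒢.isLieGroupoid.contMDiff_tgt h₀
    (𝒢.isLieGroupoid.tgt_submersion h₀)
  refine ⟨W, fun p => tangentMap (𝓘(ℝ, F).prod 𝓘(ℝ, E)) 𝓘(ℝ, E) s (tangentPair p.1 ⟨p.2, 0⟩),
    hW, hW₀, ?_, fun p hp => ⟨?_, fun h => ?_⟩⟩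
  · have h1 : ContMDiff (𝓘(ℝ, F).tangent.prod 𝓘(ℝ, E)) (𝓘(ℝ, F).tangent.prod 𝓘(ℝ, E).tangent) ∞
        (fun p : TangentBundle 𝓘(ℝ, F) P × G =>
          (p.1, (⟨p.2, 0⟩ : TangentBundle 𝓘(ℝ, E) G))) :=
      contMDiff_fst.prodMk
        ((Bundle.contMDiff_zeroSection ℝ (TangentSpace 𝓘(ℝ, E) : G → Type _)).comp contMDiff_snd)
    exact (contMDiffOn_tangentMap hW hs).comp
      (contMDiff_tangentPair.comp h1).contMDiffOn (fun p hp => hp)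
  · obtain ⟨x, g⟩ := p
    obtain ⟨m, hm, rfl⟩ := exists_velocity_eq x
    have h1 : ContMDiffAt 𝓘(ℝ) (𝓘(ℝ, F).prod 𝓘(ℝ, E)) ∞ (fun t => (m t, g)) 0 :=
      hm.prodMk contMDiffAt_const
    have h2 : ContMDiffAt (𝓘(ℝ, F).prod 𝓘(ℝ, E)) 𝓘(ℝ, E) ∞ s (m 0, g) :=
      hs.contMDiffAt (hW.mem_nhds hp)
    have h3 : ContMDiffAt 𝓘(ℝ) 𝓘(ℝ, E) ∞ (fun t => s (m t, g)) 0 := ContMDiffAt.comp 0 h2 h1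
    change 𝒢.tan.tgt (tangentMap _ _ s (tangentPair (velocity 𝓘(ℝ, F) m) ⟨g, 0⟩)) = _
    rw [← velocity_const, ← velocity_prodMk (hm.mdifferentiableAt (by simp))
      mdifferentiableAt_const, ← velocity_comp (f := s) (γ := fun t => (m t, g))
        (h2.mdifferentiableAt (by simp)) (h1.mdifferentiableAt (by simp)), ← 𝒢.velocity_tgt h3]
    refine velocity_congr ?_
    filter_upwards [h1.continuousAt.eventually (hW.mem_nhds hp)] with t ht
    exact hs1 _ ht
  · change s (p.1.1, p.2) = p.2
    rw [← h] at hp ⊢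
    exact hs2 _ hp

/-- To pair `Ψ • Φ` with a smooth family `ζ` of vectors, factor it smoothly as `ζ = η • ξ`: lift
`T(β)(ζ)` to a vector `η` at the base point of `Ψ`, and put `ξ = η⁻¹ • ζ`. -/
theorem contMDiffOn_cotangent_mul :
    ContMDiffOn ((𝓘(ℝ, E).prod 𝓘(ℝ, E →L[ℝ] ℝ)).prod (𝓘(ℝ, E).prod 𝓘(ℝ, E →L[ℝ] ℝ)))
      (𝓘(ℝ, E).prod 𝓘(ℝ, E →L[ℝ] ℝ)) ∞
      (fun p : CotangentBundle 𝓘(ℝ, E) G × CotangentBundle 𝓘(ℝ, E) G =>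
        𝒢.cotangent.mul p.1 p.2) 𝒢.cotangent.composable := by
  intro p₀ hc₀
  have hG := 𝒢.isLieGroupoid
  have hb : ∀ p ∈ 𝒢.cotangent.composable, 𝒢.src p.1.1 = 𝒢.tgt p.2.1 :=
    fun p hp => 𝒢.cotangent_composable_base hp
  set S := 𝒢.cotangent.composable with hS
  have hp1 : ContMDiffWithinAt ((𝓘(ℝ, E).prod 𝓘(ℝ, E →L[ℝ] ℝ)).prod
      (𝓘(ℝ, E).prod 𝓘(ℝ, E →L[ℝ] ℝ))) (𝓘(ℝ, E).prod 𝓘(ℝ, E →L[ℝ] ℝ)) ∞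
      (fun p : CotangentBundle 𝓘(ℝ, E) G × CotangentBundle 𝓘(ℝ, E) G => p.1) S p₀ :=
    contMDiffWithinAt_fst
  have hp2 : ContMDiffWithinAt ((𝓘(ℝ, E).prod 𝓘(ℝ, E →L[ℝ] ℝ)).prod
      (𝓘(ℝ, E).prod 𝓘(ℝ, E →L[ℝ] ℝ))) (𝓘(ℝ, E).prod 𝓘(ℝ, E →L[ℝ] ℝ)) ∞
      (fun p : CotangentBundle 𝓘(ℝ, E) G × CotangentBundle 𝓘(ℝ, E) G => p.2) S p₀ :=
    contMDiffWithinAt_snd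
  have hb1 := (contMDiff_cotangent_proj _).comp_contMDiffWithinAt p₀ hp1
  have hb2 := (contMDiff_cotangent_proj _).comp_contMDiffWithinAt p₀ hp2
  refine contMDiffWithinAt_dual (F := fun p : CotangentBundle 𝓘(ℝ, E) G ×
    CotangentBundle 𝓘(ℝ, E) G => 𝒢.cotangent.mul p.1 p.2)
    (𝒢.contMDiffWithinAt_mul hb1 hb2 hb (hb p₀ hc₀)) fun v hv => ?_
  set ζ : CotangentBundle 𝓘(ℝ, E) G × CotangentBundle 𝓘(ℝ, E) G → TangentBundle 𝓘(ℝ, E) G :=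
    fun p => ⟨𝒢.mul p.1.1 p.2.1, v p⟩ with hζ
  replace hv : ContMDiffWithinAt _ 𝓘(ℝ, E).tangent ∞ ζ S p₀ := hv
  obtain ⟨W, L, hW, hW₀, hL, hL'⟩ := 𝒢.exists_tan_tgt_lift p₀.1.1
  have hq : ContMDiffWithinAt _ (𝓘(ℝ, F).tangent.prod 𝓘(ℝ, E)) ∞
      (fun p => (𝒢.tan.tgt (ζ p), p.1.1)) S p₀ :=
    ((𝒢.contMDiff_tan_tgt _).comp_contMDiffWithinAt p₀ hv).prodMk hb1
  have htgt : ∀ p ∈ S, (𝒢.tan.tgt (ζ p)).1 = 𝒢.tgt p.1.1 := fun p hp => hG.tgt_mul _ _ (hb p hp)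
  have hW' : IsOpen {p : TangentBundle 𝓘(ℝ, F) P × G | (p.1.1, p.2) ∈ W} := by
    have h := FiberBundle.continuous_proj F (TangentSpace 𝓘(ℝ, F) : P → Type _)
    exact hW.preimage ((h.comp continuous_fst).prodMk continuous_snd)
  have hq₀ : (𝒢.tan.tgt (ζ p₀), p₀.1.1) ∈ {p : TangentBundle 𝓘(ℝ, F) P × G | (p.1.1, p.2) ∈ W} := by
    change ((𝒢.tan.tgt (ζ p₀)).1, p₀.1.1) ∈ W
    rw [htgt p₀ hc₀]; exact hW₀
  set η := fun p => L (𝒢.tan.tgt (ζ p), p.1.1) with hη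
  have hηs : ContMDiffWithinAt _ 𝓘(ℝ, E).tangent ∞ η S p₀ :=
    (hL.contMDiffAt (hW'.mem_nhds hq₀)).comp_contMDiffWithinAt p₀ hq
  have hev : ∀ᶠ p in 𝓝[S] p₀, p ∈ S ∧ ((𝒢.tan.tgt (ζ p)).1, p.1.1) ∈ W :=
    eventually_mem_nhdsWithin.and (hq.continuousWithinAt (hW'.mem_nhds hq₀))
  have hη1 : ∀ p ∈ S, ((𝒢.tan.tgt (ζ p)).1, p.1.1) ∈ W →
      𝒢.tan.tgt (η p) = 𝒢.tan.tgt (ζ p) ∧ (η p).1 = p.1.1 := fun p hp hpW =>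
    ⟨(hL' _ hpW).1, (hL' _ hpW).2 (htgt p hp).symm⟩
  have hcomp : ∀ p ∈ S, ((𝒢.tan.tgt (ζ p)).1, p.1.1) ∈ W →
      𝒢.tan.src (𝒢.tan.inv (η p)) = 𝒢.tan.tgt (ζ p) := fun p hp hpW => by
    rw [tan_src_inv, (hη1 p hp hpW).1]
  set ξ := fun p => 𝒢.tan.mul (𝒢.tan.inv (η p)) (ζ p) with hξ
  have hξs : ContMDiffWithinAt _ 𝓘(ℝ, E).tangent ∞ ξ S p₀ :=
    𝒢.contMDiffWithinAt_tan_mul ((𝒢.contMDiff_tan_inv _).comp_contMDiffWithinAt p₀ hηs) hv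
      (hev.mono fun p hp => hcomp p hp.1 hp.2) (hcomp p₀ hc₀ hq₀)
  have hξb : ∀ p ∈ S, ((𝒢.tan.tgt (ζ p)).1, p.1.1) ∈ W → (ξ p).1 = p.2.1 := fun p hp hpW => by
    change 𝒢.mul (𝒢.inv (η p).1) (𝒢.mul p.1.1 p.2.1) = _
    rw [(hη1 p hp hpW).2, hG.mul_assoc _ _ _ (hG.src_inv _) (hb p hp), hG.inv_mul, hb p hp,
      hG.one_mul]
  have key : ∀ p ∈ S, ((𝒢.tan.tgt (ζ p)).1, p.1.1) ∈ W →
      (𝒢.cotangent.mul p.1 p.2).2 (v p) = pair p.1 (η p) + pair p.2 (ξ p) := fun p hp hpW => by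
    have h1 := hcomp p hp hpW
    rw [← 𝒢.pair_cotangent_mul hp (hη1 p hp hpW).2 (hξb p hp hpW) (by
      rw [hξ, 𝒢.tan_tgt_mul h1, tan_tgt_inv])]
    have e : 𝒢.tan.mul (η p) (ξ p) = ζ p := by
      change 𝒢.tan.mul (η p) (𝒢.tan.mul (𝒢.tan.inv (η p)) (ζ p)) = ζ p
      rw [𝒢.tan_mul_assoc (𝒢.tan_tgt_inv _).symm h1, tan_mul_inv, (hη1 p hp hpW).1, tan_one_mul]
    rw [e]
    rfl
  refine ContMDiffWithinAt.congr_of_eventuallyEq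
    ((contMDiffWithinAt_pair_of_eventually hp1 hηs
      (hev.mono fun p hp => (hη1 p hp.1 hp.2).2) (hη1 p₀ hc₀ hq₀).2).add
    (contMDiffWithinAt_pair_of_eventually hp2 hξs
      (hev.mono fun p hp => hξb p hp.1 hp.2) (hξb p₀ hc₀ hq₀)))
    (hev.mono fun p hp => key p hp.1 hp.2) (key p₀ hc₀ hq₀)

end LieGroupoid

end CotangentSmooth

/-! ### The cotangent Lie groupoid -/

section CotangentLie

variable {E : Type*} [NormedAddCommGroup E] [NormedSpace ℝ E] [FiniteDimensional ℝ E]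
  {G : Type*} [TopologicalSpace G] [ChartedSpace E G] [IsManifold 𝓘(ℝ, E) ∞ G]
  {F : Type*} [NormedAddCommGroup F] [NormedSpace ℝ F] [FiniteDimensional ℝ F]
  {P : Type*} [TopologicalSpace P] [ChartedSpace F P] [IsManifold 𝓘(ℝ, F) ∞ P]

theorem tangent_snd_eq_zero_of_pair {M : Type*} [TopologicalSpace M] [ChartedSpace E M]
    (V : TangentBundle 𝓘(ℝ, E) M) {x : M}
    (h : ∀ φ : CotangentSpace 𝓘(ℝ, E) x, pair ⟨x, φ⟩ V = 0) : (V.2 : E) = 0 := by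
  by_contra hV
  have hsep : ∃ φ : E →L[ℝ] ℝ, φ (show E from V.2) ≠ 0 := SeparatingDual.exists_ne_zero hV
  obtain ⟨φ, hφ⟩ := hsep
  exact hφ (h φ)

/-- The transpose of an injective linear map is onto. -/
theorem exists_precomp_eq {V : Type*} [AddCommGroup V] [Module ℝ V] [TopologicalSpace V]
    {L : V →L[ℝ] E} (hL : Function.Injective L) (θ : V →L[ℝ] ℝ) :
    ∃ φ : E →L[ℝ] ℝ, φ ∘L L = θ := by
  obtain ⟨g, hg⟩ := LinearMap.exists_leftInverse_of_injective L.toLinearMap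
    (LinearMap.ker_eq_bot.2 hL)
  refine ⟨LinearMap.toContinuousLinearMap (θ.toLinearMap ∘ₗ g), ?_⟩
  ext x
  exact congrArg θ (LinearMap.congr_fun hg x)

namespace LieGroupoid

variable (𝒢 : LieGroupoid 𝓘(ℝ, E) G 𝓘(ℝ, F) P)

/-- The map `A_{αg} G → T_g G` whose transpose is the source of the cotangent groupoid at `g`. -/
def srcMap (g : G) : 𝒢.AlgFiber (𝒢.src g) →L[ℝ] TangentSpace 𝓘(ℝ, E) g :=
  tcast (𝒢.isLieGroupoid.mul_one g) ∘L
    mfderivWithin 𝓘(ℝ, E) 𝓘(ℝ, E) (fun h => 𝒢.mul g h) {h | 𝒢.tgt h = 𝒢.src g}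
      (𝒢.one (𝒢.src g)) ∘L
    (ContinuousLinearMap.id ℝ _ - mfderiv 𝓘(ℝ, F) 𝓘(ℝ, E) 𝒢.one (𝒢.src g) ∘L
      tcast (𝒢.isLieGroupoid.tgt_one (𝒢.src g)) ∘L
      mfderiv 𝓘(ℝ, E) 𝓘(ℝ, F) 𝒢.tgt (𝒢.one (𝒢.src g))) ∘L
    𝒢.incl (𝒢.src g)

/-- The map `A_{βg} G → T_g G` whose transpose is the target of the cotangent groupoid at `g`. -/
def tgtMap (g : G) : 𝒢.AlgFiber (𝒢.tgt g) →L[ℝ] TangentSpace 𝓘(ℝ, E) g :=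
  tcast (𝒢.isLieGroupoid.one_mul g) ∘L
    mfderivWithin 𝓘(ℝ, E) 𝓘(ℝ, E) (fun h => 𝒢.mul h g) {h | 𝒢.src h = 𝒢.tgt g}
      (𝒢.one (𝒢.tgt g)) ∘L
    𝒢.incl (𝒢.tgt g)

/-- `0_g • X⁻¹ = 0` forces `X = 0`, by cancelling `0_g`. -/
theorem srcMap_injective (g : G) : Function.Injective (𝒢.srcMap g) := by
  refine (injective_iff_map_eq_zero (𝒢.srcMap g)).2 fun X hX => ?_
  have hG := 𝒢.isLieGroupoid
  have hc : (⟨𝒢.src g, 0⟩ : TangentBundle 𝓘(ℝ, F) P) =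
      𝒢.tan.tgt (𝒢.tan.inv ⟨𝒢.one (𝒢.src g), 𝒢.incl _ X⟩) := by
    rw [tan_tgt_inv, (𝒢.isAlg_incl _ X).2]
  have h0 : ((𝒢.tan.mul ⟨g, 0⟩ (𝒢.tan.inv ⟨𝒢.one (𝒢.src g), 𝒢.incl _ X⟩)).2 : E) = 0 := by
    refine tangent_snd_eq_zero_of_pair _ (x := g) fun φ => ?_
    have h1 := 𝒢.cotangent_src_apply ⟨g, φ⟩ X
    have h2 : (𝒢.cotangent.src ⟨g, φ⟩).2 X = 0 := (congrArg φ hX).trans (map_zero φ)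
    exact neg_eq_zero.1 (h1.symm.trans h2)
  have h1 : 𝒢.tan.mul ⟨g, 0⟩ (𝒢.tan.inv ⟨𝒢.one (𝒢.src g), 𝒢.incl _ X⟩) = ⟨g, 0⟩ := by
    refine tangent_ext ?_ h0
    change 𝒢.mul g (𝒢.inv (𝒢.one (𝒢.src g))) = g
    rw [inv_one, hG.mul_one]
  have h2 := 𝒢.tan_mul_zero_cancel_left hc
  rw [h1, tan_mul_zero_zero, hG.inv_mul] at h2
  have h3 := 𝒢.tan_inv_inv ⟨𝒢.one (𝒢.src g), 𝒢.incl _ X⟩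
  rw [← h2, tan_inv_zero] at h3
  exact Subtype.ext (tangent_snd_eq h3).symm

/-- `Y • 0_g = 0` forces `Y = 0`, by cancelling `0_g`. -/
theorem tgtMap_injective (g : G) : Function.Injective (𝒢.tgtMap g) := by
  refine (injective_iff_map_eq_zero (𝒢.tgtMap g)).2 fun X hX => ?_
  have hG := 𝒢.isLieGroupoid
  have h0 : ((𝒢.tan.mul ⟨𝒢.one (𝒢.tgt g), 𝒢.incl _ X⟩ ⟨g, 0⟩).2 : E) = 0 := by
    refine tangent_snd_eq_zero_of_pair _ (x := g) fun φ => ?_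
    have h1 := 𝒢.cotangent_tgt_apply ⟨g, φ⟩ X
    have h2 : (𝒢.cotangent.tgt ⟨g, φ⟩).2 X = 0 := (congrArg φ hX).trans (map_zero φ)
    exact h1.symm.trans h2
  have h1 : 𝒢.tan.mul ⟨𝒢.one (𝒢.tgt g), 𝒢.incl _ X⟩ ⟨g, 0⟩ = ⟨g, 0⟩ :=
    tangent_ext (hG.one_mul g) h0
  have h2 := 𝒢.tan_mul_zero_cancel_right (𝒢.isAlg_incl _ X).2
  rw [h1, tan_mul_zero_zero, hG.mul_inv] at h2
  exact Subtype.ext (tangent_snd_eq h2).symm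

/-- The cotangent groupoid is a Lie groupoid. Its source and target are submersions because they are
bundle maps over submersions, onto on each fibre as transposes of injective maps. -/
theorem isLieGroupoid_cotangent :
    IsLieGroupoid (𝓘(ℝ, E).prod 𝓘(ℝ, E →L[ℝ] ℝ)) (𝓘(ℝ, F).prod 𝓘(ℝ, AlgModel E F →L[ℝ] ℝ))
      𝒢.cotangent where
  contMDiff_src := 𝒢.contMDiff_cotangent_src
  contMDiff_tgt := 𝒢.contMDiff_cotangent_tgt
  src_surjective φ := ⟨_, 𝒢.cotangent_src_one φ⟩
  tgt_surjective φ := ⟨_, 𝒢.cotangent_tgt_one φ⟩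
  src_submersion := by
    rintro ⟨g, φ⟩
    exact mfderiv_bundleMap_surjective (I := 𝓘(ℝ, E)) (I' := 𝓘(ℝ, F))
      (V := fun g : G => CotangentSpace 𝓘(ℝ, E) g)
      (V' := 𝒢.DualAlgFiber) (f := 𝒢.src) (T := 𝒢.cotangent.src) (fun _ => rfl) g φ
      ((𝒢.contMDiff_cotangent_src _).mdifferentiableAt (by simp))
      ((𝒢.contMDiffAt_src _).mdifferentiableAt (by simp)) (𝒢.isLieGroupoid.src_submersion g)
      (ContinuousLinearMap.precomp ℝ (𝒢.srcMap g)) (fun _ => rfl)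
      (exists_precomp_eq (E := E) (L := 𝒢.srcMap g) (𝒢.srcMap_injective g))
  tgt_submersion := by
    rintro ⟨g, φ⟩
    exact mfderiv_bundleMap_surjective (I := 𝓘(ℝ, E)) (I' := 𝓘(ℝ, F))
      (V := fun g : G => CotangentSpace 𝓘(ℝ, E) g)
      (V' := 𝒢.DualAlgFiber) (f := 𝒢.tgt) (T := 𝒢.cotangent.tgt) (fun _ => rfl) g φ
      ((𝒢.contMDiff_cotangent_tgt _).mdifferentiableAt (by simp))
      ((𝒢.contMDiffAt_tgt _).mdifferentiableAt (by simp)) (𝒢.isLieGroupoid.tgt_submersion g)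
      (ContinuousLinearMap.precomp ℝ (𝒢.tgtMap g)) (fun _ => rfl)
      (exists_precomp_eq (E := E) (L := 𝒢.tgtMap g) (𝒢.tgtMap_injective g))
  contMDiff_one := 𝒢.contMDiff_cotangent_one
  one_injective := Function.LeftInverse.injective 𝒢.cotangent_src_one
  one_immersion φ := mfderiv_injective_of_leftInverse
    ((𝒢.contMDiff_cotangent_one _).mdifferentiableAt (by simp))
    ((𝒢.contMDiff_cotangent_src _).mdifferentiableAt (by simp)) 𝒢.cotangent_src_one
  contMDiffOn_mul := 𝒢.contMDiffOn_cotangent_mul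
  src_one := 𝒢.cotangent_src_one
  tgt_one := 𝒢.cotangent_tgt_one
  src_mul _ _ h := 𝒢.cotangent_src_mul h
  tgt_mul _ _ h := 𝒢.cotangent_tgt_mul h
  mul_assoc _ _ _ h h' := 𝒢.cotangent_mul_assoc h h'
  one_mul := 𝒢.cotangent_one_mul
  mul_one := 𝒢.cotangent_mul_one
  src_inv := 𝒢.cotangent_src_inv
  tgt_inv := 𝒢.cotangent_tgt_inv
  inv_mul := 𝒢.cotangent_inv_mul
  mul_inv := 𝒢.cotangent_mul_inv

end LieGroupoid

end CotangentLie

/-! ### The Poisson anchor as a morphism of groupoids -/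

section AnchorMorphism

theorem tangentPair_injective {E : Type*} [NormedAddCommGroup E] [NormedSpace ℝ E]
    {H : Type*} [TopologicalSpace H] {I : ModelWithCorners ℝ E H}
    {M : Type*} [TopologicalSpace M] [ChartedSpace H M]
    {E' : Type*} [NormedAddCommGroup E'] [NormedSpace ℝ E']
    {H' : Type*} [TopologicalSpace H'] {I' : ModelWithCorners ℝ E' H'}
    {M' : Type*} [TopologicalSpace M'] [ChartedSpace H' M'] {V V' : TangentBundle I M}
    {W W' : TangentBundle I' M'} (h : tangentPair V W = tangentPair V' W') : V = V' ∧ W = W' :=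
  Prod.mk.inj ((equivTangentBundleProd I M I' M').symm.injective h)

variable {E : Type*} [NormedAddCommGroup E] [NormedSpace ℝ E] [FiniteDimensional ℝ E]
  {G : Type*} [TopologicalSpace G] [ChartedSpace E G] [IsManifold 𝓘(ℝ, E) ∞ G]
  {F : Type*} [NormedAddCommGroup F] [NormedSpace ℝ F] [FiniteDimensional ℝ F]
  {P : Type*} [TopologicalSpace P] [ChartedSpace F P] [IsManifold 𝓘(ℝ, F) ∞ P]

theorem PoissonStructure.sharp_neg [T2Space G] [SigmaCompactSpace G]
    (π : PoissonStructure 𝓘(ℝ, E) G) {x : G} (φ : CotangentSpace 𝓘(ℝ, E) x) :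
    π.sharp x (-φ) = -π.sharp x φ := by
  exact map_neg (π.sharpL x) φ

namespace LieGroupoid

variable (𝒢 : LieGroupoid 𝓘(ℝ, E) G 𝓘(ℝ, F) P)

/-- The vectors tangent to the graph of the multiplication are the `(η • ξ, η, ξ)`. -/
theorem exists_of_mem_tangentSet_graph
    {V : TangentBundle (𝓘(ℝ, E).prod (𝓘(ℝ, E).prod 𝓘(ℝ, E))) (G × (G × G))}
    (hV : V ∈ tangentSet (𝓘(ℝ, E).prod (𝓘(ℝ, E).prod 𝓘(ℝ, E))) 𝒢.graph) :
    ∃ η ξ : TangentBundle 𝓘(ℝ, E) G, 𝒢.tan.src η = 𝒢.tan.tgt ξ ∧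
      V = tangentPair (𝒢.tan.mul η ξ) (tangentPair η ξ) := by
  obtain ⟨γ, hγ, hγC, rfl⟩ := hV
  have hk : ContMDiffAt 𝓘(ℝ) 𝓘(ℝ, E) ∞ (fun t => (γ t).1) 0 := contMDiffAt_fst.comp (0 : ℝ) hγ
  have hγ2 : ContMDiffAt 𝓘(ℝ) (𝓘(ℝ, E).prod 𝓘(ℝ, E)) ∞ (fun t => (γ t).2) 0 :=
    contMDiffAt_snd.comp (0 : ℝ) hγ
  have hh : ContMDiffAt 𝓘(ℝ) 𝓘(ℝ, E) ∞ (fun t => (γ t).2.1) 0 := contMDiffAt_fst.comp (0 : ℝ) hγ2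
  have hg : ContMDiffAt 𝓘(ℝ) 𝓘(ℝ, E) ∞ (fun t => (γ t).2.2) 0 := contMDiffAt_snd.comp (0 : ℝ) hγ2
  have hc : ∀ᶠ t in 𝓝 0, 𝒢.src (γ t).2.1 = 𝒢.tgt (γ t).2.2 := hγC.mono fun t ht => ht.1
  refine ⟨velocity 𝓘(ℝ, E) fun t => (γ t).2.1, velocity 𝓘(ℝ, E) fun t => (γ t).2.2, ?_, ?_⟩
  · rw [← 𝒢.velocity_src hh, ← 𝒢.velocity_tgt hg]
    exact velocity_congr hc
  · rw [← 𝒢.velocity_mul hh hg hc, ← velocity_prodMk (hh.mdifferentiableAt (by simp))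
      (hg.mdifferentiableAt (by simp)), ← velocity_prodMk
      ((𝒢.contMDiffAt_mul hh hg hc).mdifferentiableAt (by simp))
      (hγ2.mdifferentiableAt (by simp))]
    refine velocity_congr (hγC.mono fun t ht => ?_)
    exact Prod.ext ht.2 rfl

variable {𝒢} {π : PoissonStructure 𝓘(ℝ, E) G} [T2Space G] [SigmaCompactSpace G]

/-- The covector `(-Ψ • Φ, Ψ, Φ)` annihilates the graph of the multiplication; since the graph is
coisotropic, `(π^#(Ψ • Φ), π^# Ψ, π^# Φ)` is tangent to it. -/
theorem IsPoissonGroupoid.anchor_composable_and_mul (hπ : 𝒢.IsPoissonGroupoid π)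
    {Ψ Φ : CotangentBundle 𝓘(ℝ, E) G} (hc : 𝒢.cotangent.src Ψ = 𝒢.cotangent.tgt Φ) :
    𝒢.tan.src (π.anchor Ψ) = 𝒢.tan.tgt (π.anchor Φ) ∧
      π.anchor (𝒢.cotangent.mul Ψ Φ) = 𝒢.tan.mul (π.anchor Ψ) (π.anchor Φ) := by
  set χ : E →L[ℝ] ℝ := (𝒢.cotangent.mul Ψ Φ).2 with hχ
  set ψ : E →L[ℝ] ℝ := Ψ.2 with hψ
  set φ : E →L[ℝ] ℝ := Φ.2 with hφ
  let L : E × (E × E) →L[ℝ] ℝ := -(χ.comp (ContinuousLinearMap.fst ℝ E (E × E))) +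
    (ψ.comp (ContinuousLinearMap.fst ℝ E E) + φ.comp (ContinuousLinearMap.snd ℝ E E)).comp
      (ContinuousLinearMap.snd ℝ E (E × E))
  let Θ : CotangentBundle (𝓘(ℝ, E).prod (𝓘(ℝ, E).prod 𝓘(ℝ, E))) (G × (G × G)) :=
    ⟨(𝒢.mul Ψ.1 Φ.1, (Ψ.1, Φ.1)), L⟩
  have hΘ : Θ ∈ annihilator (𝓘(ℝ, E).prod (𝓘(ℝ, E).prod 𝓘(ℝ, E))) 𝒢.graph := by
    refine ⟨⟨𝒢.cotangent_composable_base hc, rfl⟩, fun v hv => ?_⟩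
    obtain ⟨η, ξ, hηξ, hV⟩ := 𝒢.exists_of_mem_tangentSet_graph hv
    have hb : (𝒢.mul Ψ.1 Φ.1, (Ψ.1, Φ.1)) = (𝒢.mul η.1 ξ.1, (η.1, ξ.1)) :=
      congrArg TotalSpace.proj hV
    have hη : η.1 = Ψ.1 := (congrArg (fun p => p.2.1) hb).symm
    have hξ : ξ.1 = Φ.1 := (congrArg (fun p => p.2.2) hb).symm
    have hv' : (show E × (E × E) from v) = ((𝒢.tan.mul η ξ).2, (η.2, ξ.2)) := tangent_snd_eq hV
    have h := 𝒢.pair_cotangent_mul hc hη hξ hηξ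
    refine (congrArg L hv').trans ?_
    change -(pair (𝒢.cotangent.mul Ψ Φ) (𝒢.tan.mul η ξ)) + (pair Ψ η + pair Φ ξ) = 0
    rw [h, neg_add_cancel]
  obtain ⟨η, ξ, hηξ, hV⟩ := 𝒢.exists_of_mem_tangentSet_graph (hπ.2 Θ hΘ)
  have hL1 : L.comp (ContinuousLinearMap.inl ℝ E (E × E)) = -χ := by ext v; simp [L]
  have hL2 : (L.comp (ContinuousLinearMap.inr ℝ E (E × E))).comp
      (ContinuousLinearMap.inl ℝ E E) = ψ := by ext v; simp [L]
  have hL3 : (L.comp (ContinuousLinearMap.inr ℝ E (E × E))).comp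
      (ContinuousLinearMap.inr ℝ E E) = φ := by ext v; simp [L]
  have e1 : (show E from -π.sharp (𝒢.mul Ψ.1 Φ.1) (L.comp (ContinuousLinearMap.inl ℝ E (E × E)))) =
      π.sharp (𝒢.mul Ψ.1 Φ.1) χ := by
    refine (congrArg (fun c : E →L[ℝ] ℝ => (show E from -π.sharp (𝒢.mul Ψ.1 Φ.1) c)) hL1).trans ?_
    exact (congrArg Neg.neg (π.sharp_neg (x := 𝒢.mul Ψ.1 Φ.1) χ)).trans (neg_neg _)
  have hV' : (⟨Θ.1, prodAnchor (fun x φ => -π.sharp x φ) (prodAnchor π.sharp π.sharp) Θ.1 Θ.2⟩ :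
      TangentBundle (𝓘(ℝ, E).prod (𝓘(ℝ, E).prod 𝓘(ℝ, E))) (G × (G × G))) =
      tangentPair (π.anchor (𝒢.cotangent.mul Ψ Φ)) (tangentPair (π.anchor Ψ) (π.anchor Φ)) :=
    tangent_ext rfl (Prod.ext e1 (Prod.ext (congrArg (π.sharp Ψ.1) hL2)
      (congrArg (π.sharp Φ.1) hL3)))
  rw [hV'] at hV
  obtain ⟨h1, h2⟩ := tangentPair_injective hV
  obtain ⟨h3, h4⟩ := tangentPair_injective h2
  rw [h1, h3, h4]
  exact ⟨hηξ, rfl⟩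

variable (𝒢 π) in
/-- The base map `a_* : A^*G → TP` of the Poisson anchor, `φ ↦ T(β)(π^#(\tilde 1_φ))`. -/
def dualAnchor (φ : 𝒢.DualAlg) : TangentBundle 𝓘(ℝ, F) P :=
  𝒢.tan.tgt (π.anchor (𝒢.cotangent.one φ))

/-- The image of an identity covector under `π^#` is idempotent, and an idempotent of the tangent
groupoid is an identity. -/
theorem IsPoissonGroupoid.anchor_one (hπ : 𝒢.IsPoissonGroupoid π) (φ : 𝒢.DualAlg) :
    π.anchor (𝒢.cotangent.one φ) = 𝒢.tan.one (𝒢.dualAnchor π φ) := by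
  have hc : 𝒢.cotangent.src (𝒢.cotangent.one φ) = 𝒢.cotangent.tgt (𝒢.cotangent.one φ) := by
    rw [cotangent_src_one, cotangent_tgt_one]
  obtain ⟨h1, h2⟩ := hπ.anchor_composable_and_mul hc
  have h3 := 𝒢.cotangent_one_mul (𝒢.cotangent.one φ)
  rw [cotangent_tgt_one] at h3
  rw [h3] at h2
  set χ := π.anchor (𝒢.cotangent.one φ)
  change χ = 𝒢.tan.one (𝒢.tan.tgt χ)
  have h4 := 𝒢.tan_mul_assoc (η := 𝒢.tan.inv χ) (𝒢.tan_src_inv χ) h1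
  rw [← h2, tan_inv_mul, h1, tan_one_mul] at h4
  exact h4.symm

theorem IsPoissonGroupoid.tan_src_anchor (hπ : 𝒢.IsPoissonGroupoid π)
    (Φ : CotangentBundle 𝓘(ℝ, E) G) :
    𝒢.tan.src (π.anchor Φ) = 𝒢.dualAnchor π (𝒢.cotangent.src Φ) :=
  (hπ.anchor_composable_and_mul (𝒢.cotangent_tgt_one (𝒢.cotangent.src Φ)).symm).1

theorem IsPoissonGroupoid.tan_tgt_anchor (hπ : 𝒢.IsPoissonGroupoid π)
    (Φ : CotangentBundle 𝓘(ℝ, E) G) :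
    𝒢.tan.tgt (π.anchor Φ) = 𝒢.dualAnchor π (𝒢.cotangent.tgt Φ) := by
  rw [← (hπ.anchor_composable_and_mul (𝒢.cotangent_src_one (𝒢.cotangent.tgt Φ))).1,
    hπ.anchor_one, tan_src_one]

theorem contMDiff_dualAnchor : ContMDiff (𝓘(ℝ, F).prod 𝓘(ℝ, AlgModel E F →L[ℝ] ℝ))
    𝓘(ℝ, F).tangent ∞ (𝒢.dualAnchor π) :=
  𝒢.contMDiff_tan_tgt.comp (π.contMDiff_anchor.comp 𝒢.contMDiff_cotangent_one)

/-- The Poisson anchor is a morphism from the cotangent to the tangent groupoid. -/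
theorem IsPoissonGroupoid.isLieGroupoidMorphism_anchor (hπ : 𝒢.IsPoissonGroupoid π) :
    IsLieGroupoidMorphism (𝓘(ℝ, E).prod 𝓘(ℝ, E →L[ℝ] ℝ))
      (𝓘(ℝ, F).prod 𝓘(ℝ, AlgModel E F →L[ℝ] ℝ)) 𝓘(ℝ, E).tangent 𝓘(ℝ, F).tangent
      𝒢.cotangent 𝒢.tan π.anchor (𝒢.dualAnchor π) where
  dom := 𝒢.isLieGroupoid_cotangent
  cod := 𝒢.isLieGroupoid_tan
  contMDiff := π.contMDiff_anchor
  contMDiff_base := contMDiff_dualAnchor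
  map_src := hπ.tan_src_anchor
  map_tgt := hπ.tan_tgt_anchor
  map_one := hπ.anchor_one
  map_mul _ _ hc := (hπ.anchor_composable_and_mul hc).2

/-- `π^#` preserves inverses, as every morphism of groupoids does. -/
theorem IsPoissonGroupoid.anchor_inv (hπ : 𝒢.IsPoissonGroupoid π)
    (Φ : CotangentBundle 𝓘(ℝ, E) G) :
    π.anchor (𝒢.cotangent.inv Φ) = 𝒢.tan.inv (π.anchor Φ) := by
  obtain ⟨h1, h2⟩ := hπ.anchor_composable_and_mul (𝒢.cotangent_src_inv Φ)
  rw [cotangent_inv_mul, hπ.anchor_one, ← hπ.tan_src_anchor] at h2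
  have h3 := 𝒢.tan_mul_assoc h1 (𝒢.tan_tgt_inv (π.anchor Φ)).symm
  rw [← h2, tan_mul_inv, ← h1, tan_mul_one, ← tan_tgt_inv, tan_one_mul] at h3
  exact h3

/-- The transpose of the derivative of inversion takes `df` to `-(df)⁻¹`, and `π^#` preserves
inverses. -/
theorem IsPoissonGroupoid.isAntiPoissonMap_inv (hπ : 𝒢.IsPoissonGroupoid π) :
    IsAntiPoissonMap π π 𝒢.inv := by
  refine ⟨𝒢.contMDiff_inv, fun f₁ f₂ => ?_⟩
  ext g
  set ι : C^∞⟮𝓘(ℝ, E), G; 𝓘(ℝ, E), G⟯ := ⟨𝒢.inv, 𝒢.contMDiff_inv⟩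
  have hd : ∀ (f : C^∞⟮𝓘(ℝ, E), G; 𝓘(ℝ), ℝ⟯) (V : TangentBundle 𝓘(ℝ, E) G), V.1 = g →
      pair (⟨g, mvfderiv 𝓘(ℝ, E) (f.comp ι) g⟩ : CotangentBundle 𝓘(ℝ, E) G) V =
        pair ⟨𝒢.inv g, mvfderiv 𝓘(ℝ, E) f (𝒢.inv g)⟩ (𝒢.tan.inv V) := by
    rintro f ⟨x, v⟩ hx
    obtain rfl : x = g := hx
    exact mfderiv_comp_apply x (f.contMDiff.mdifferentiableAt (by simp))
      (𝒢.contMDiff_inv.mdifferentiableAt (by simp)) v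
  have hinv : (⟨g, -mvfderiv 𝓘(ℝ, E) (f₁.comp ι) g⟩ : CotangentBundle 𝓘(ℝ, E) G) =
      𝒢.cotangent.inv ⟨𝒢.inv g, mvfderiv 𝓘(ℝ, E) f₁ (𝒢.inv g)⟩ := by
    refine cotangent_ext (𝒢.inv_inv g).symm fun V hV => ?_
    have h1 := 𝒢.pair_cotangent_inv (Φ := ⟨𝒢.inv g, mvfderiv 𝓘(ℝ, E) f₁ (𝒢.inv g)⟩)
      (ξ := 𝒢.tan.inv V) (congrArg 𝒢.inv hV)
    rw [tan_inv_inv] at h1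
    rw [h1, ← hd f₁ V hV]
    rfl
  have h2 := hπ.anchor_inv ⟨𝒢.inv g, mvfderiv 𝓘(ℝ, E) f₁ (𝒢.inv g)⟩
  rw [← hinv] at h2
  have h3 : π.anchor ⟨g, -mvfderiv 𝓘(ℝ, E) (f₁.comp ι) g⟩ =
      ⟨g, -π.sharp g (mvfderiv 𝓘(ℝ, E) (f₁.comp ι) g)⟩ := tangent_ext rfl (π.sharp_neg _)
  rw [h3] at h2
  have h4 := hd f₂ _ (congrArg TotalSpace.proj h2).symm
  rw [tan_inv_inv, ← h2] at h4
  have h5 : mvfderiv 𝓘(ℝ, E) (f₂.comp ι) g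
      (-π.sharp g (mvfderiv 𝓘(ℝ, E) (f₁.comp ι) g)) = π.bracket f₁ f₂ (𝒢.inv g) :=
    h4.trans (π.mvfderiv_sharp f₁ f₂ (𝒢.inv g))
  rw [map_neg, π.mvfderiv_sharp] at h5
  change π.bracket (f₁.comp ι) (f₂.comp ι) g = -π.bracket f₁ f₂ (𝒢.inv g)
  rw [← h5, neg_neg]

/-! ### The Poisson structure on the base -/

section Base

/-- The target map as a bundled smooth map. -/
def tgtMapBundled (𝒢 : LieGroupoid 𝓘(ℝ, E) G 𝓘(ℝ, F) P) : C^∞⟮𝓘(ℝ, E), G; 𝓘(ℝ, F), P⟯ :=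
  ⟨𝒢.tgt, 𝒢.isLieGroupoid.contMDiff_tgt⟩

/-- The identities as a bundled smooth map. -/
def oneMapBundled (𝒢 : LieGroupoid 𝓘(ℝ, E) G 𝓘(ℝ, F) P) : C^∞⟮𝓘(ℝ, F), P; 𝓘(ℝ, E), G⟯ :=
  ⟨𝒢.one, 𝒢.isLieGroupoid.contMDiff_one⟩

theorem pair_mvfderiv_comp_tgt (f : C^∞⟮𝓘(ℝ, F), P; 𝓘(ℝ), ℝ⟯) {g : G}
    {V : TangentBundle 𝓘(ℝ, E) G} (hV : V.1 = g) :
    pair (⟨g, mvfderiv 𝓘(ℝ, E) (f.comp 𝒢.tgtMapBundled) g⟩ : CotangentBundle 𝓘(ℝ, E) G) V =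
      pair ⟨𝒢.tgt g, mvfderiv 𝓘(ℝ, F) f (𝒢.tgt g)⟩ (𝒢.tan.tgt V) := by
  obtain ⟨x, v⟩ := V
  obtain rfl : x = g := hV
  exact mfderiv_comp_apply x (f.contMDiff.mdifferentiableAt (by simp))
    (𝒢.isLieGroupoid.contMDiff_tgt.mdifferentiableAt (by simp)) v

/-- The target of `d(f ∘ β)_g` depends only on `βg`: it is `Y ↦ ⟨df, aY⟩`. -/
theorem cotangent_tgt_mvfderiv (f : C^∞⟮𝓘(ℝ, F), P; 𝓘(ℝ), ℝ⟯) (g : G) :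
    𝒢.cotangent.tgt ⟨g, mvfderiv 𝓘(ℝ, E) (f.comp 𝒢.tgtMapBundled) g⟩ =
      𝒢.cotangent.tgt ⟨𝒢.one (𝒢.tgt g), mvfderiv 𝓘(ℝ, E) (f.comp 𝒢.tgtMapBundled)
        (𝒢.one (𝒢.tgt g))⟩ := by
  have hG := 𝒢.isLieGroupoid
  have key : ∀ (g : G) (V : TangentBundle 𝓘(ℝ, E) G), 𝒢.IsAlg (𝒢.tgt g) V →
      pair (𝒢.cotangent.one (𝒢.cotangent.tgt
        ⟨g, mvfderiv 𝓘(ℝ, E) (f.comp 𝒢.tgtMapBundled) g⟩)) V =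
      pair ⟨𝒢.tgt g, mvfderiv 𝓘(ℝ, F) f (𝒢.tgt g)⟩ (𝒢.tan.tgt V) := fun g V hV => by
    rw [𝒢.pair_one_tgt (Φ := ⟨g, _⟩) hV, pair_mvfderiv_comp_tgt, 𝒢.tan_tgt_mul
      (by rw [hV.2, tan_tgt_zero])]
    change 𝒢.mul V.1 g = g
    rw [hV.1, hG.one_mul]
  refine 𝒢.dualAlg_ext (hG.tgt_one _).symm fun V hV => ?_
  have hV' : 𝒢.IsAlg (𝒢.tgt (𝒢.one (𝒢.tgt g))) V := by rw [hG.tgt_one]; exact hV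
  rw [key g V hV, key _ V hV', hG.tgt_one]

/-- The bracket of two functions pulled back along the target is constant on the fibres of the
target: `{f₁ ∘ β, f₂ ∘ β}(g) = ⟨df₂, a_*(\tilde β(d(f₁ ∘ β)_g))⟩`. -/
theorem IsPoissonGroupoid.bracket_comp_tgt (hπ : 𝒢.IsPoissonGroupoid π)
    (f₁ f₂ : C^∞⟮𝓘(ℝ, F), P; 𝓘(ℝ), ℝ⟯) (g : G) :
    π.bracket (f₁.comp 𝒢.tgtMapBundled) (f₂.comp 𝒢.tgtMapBundled) g =
      π.bracket (f₁.comp 𝒢.tgtMapBundled) (f₂.comp 𝒢.tgtMapBundled) (𝒢.one (𝒢.tgt g)) := by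
  have key : ∀ g : G, π.bracket (f₁.comp 𝒢.tgtMapBundled) (f₂.comp 𝒢.tgtMapBundled) g =
      pair ⟨𝒢.tgt g, mvfderiv 𝓘(ℝ, F) f₂ (𝒢.tgt g)⟩ (𝒢.dualAnchor π (𝒢.cotangent.tgt
        ⟨g, mvfderiv 𝓘(ℝ, E) (f₁.comp 𝒢.tgtMapBundled) g⟩)) := fun g => by
    rw [← hπ.tan_tgt_anchor, ← π.mvfderiv_sharp]
    exact pair_mvfderiv_comp_tgt (V := π.anchor
      ⟨g, mvfderiv 𝓘(ℝ, E) (f₁.comp 𝒢.tgtMapBundled) g⟩) f₂ rfl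
  rw [key g, key (𝒢.one (𝒢.tgt g)), 𝒢.isLieGroupoid.tgt_one, cotangent_tgt_mvfderiv]

/-- The Poisson structure induced on the base of a Poisson groupoid: pull functions back along the
target, take their bracket, and restrict it to the identities. -/
def IsPoissonGroupoid.base (hπ : 𝒢.IsPoissonGroupoid π) : PoissonStructure 𝓘(ℝ, F) P :=
  have hcomp : ∀ f₁ f₂ : C^∞⟮𝓘(ℝ, F), P; 𝓘(ℝ), ℝ⟯,
      ((π.bracket (f₁.comp 𝒢.tgtMapBundled) (f₂.comp 𝒢.tgtMapBundled)).comp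
        𝒢.oneMapBundled).comp 𝒢.tgtMapBundled =
      π.bracket (f₁.comp 𝒢.tgtMapBundled) (f₂.comp 𝒢.tgtMapBundled) := fun f₁ f₂ => by
    ext g; exact (hπ.bracket_comp_tgt f₁ f₂ g).symm
  have hone : ∀ f : C^∞⟮𝓘(ℝ, F), P; 𝓘(ℝ), ℝ⟯, (f.comp 𝒢.tgtMapBundled).comp 𝒢.oneMapBundled = f :=
    fun f => by ext m; exact congrArg f (𝒢.isLieGroupoid.tgt_one m)
  { bracket := LinearMap.mk₂ ℝ (fun f₁ f₂ => (π.bracket (f₁.comp 𝒢.tgtMapBundled)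
        (f₂.comp 𝒢.tgtMapBundled)).comp 𝒢.oneMapBundled)
      (fun f g h => by
        have : (f + g).comp 𝒢.tgtMapBundled = f.comp 𝒢.tgtMapBundled + g.comp 𝒢.tgtMapBundled := rfl
        rw [this, map_add, LinearMap.add_apply]; rfl)
      (fun c f g => by
        have : (c • f).comp 𝒢.tgtMapBundled = c • f.comp 𝒢.tgtMapBundled := rfl
        rw [this, map_smul, LinearMap.smul_apply]; rfl)
      (fun f g h => by
        have : (g + h).comp 𝒢.tgtMapBundled = g.comp 𝒢.tgtMapBundled + h.comp 𝒢.tgtMapBundled := rfl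
        rw [this, map_add]; rfl)
      (fun c f g => by
        have : (c • g).comp 𝒢.tgtMapBundled = c • g.comp 𝒢.tgtMapBundled := rfl
        rw [this, map_smul]; rfl)
    bracket_self := fun f => by
      rw [LinearMap.mk₂_apply, π.bracket_self]; rfl
    jacobi := fun f g h => by
      simp only [LinearMap.mk₂_apply, hcomp]
      exact congrArg (fun k : C^∞⟮𝓘(ℝ, E), G; 𝓘(ℝ), ℝ⟯ => k.comp 𝒢.oneMapBundled)
        (π.jacobi _ _ _)
    leibniz := fun f g h => by
      simp only [LinearMap.mk₂_apply]
      have h1 : (g * h).comp 𝒢.tgtMapBundled =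
        g.comp 𝒢.tgtMapBundled * h.comp 𝒢.tgtMapBundled := rfl
      rw [h1, π.leibniz]
      exact congrArg₂ (fun a b : C^∞⟮𝓘(ℝ, F), P; 𝓘(ℝ), ℝ⟯ =>
        a * ((π.bracket (f.comp 𝒢.tgtMapBundled) (h.comp 𝒢.tgtMapBundled)).comp 𝒢.oneMapBundled) +
        ((π.bracket (f.comp 𝒢.tgtMapBundled) (g.comp 𝒢.tgtMapBundled)).comp 𝒢.oneMapBundled) * b)
        (hone g) (hone h) }

theorem IsPoissonGroupoid.existsUnique_base (hπ : 𝒢.IsPoissonGroupoid π) :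
    ∃! πP : PoissonStructure 𝓘(ℝ, F) P, IsPoissonMap π πP 𝒢.tgt := by
  refine ⟨hπ.base, ⟨𝒢.isLieGroupoid.contMDiff_tgt, fun f₁ f₂ => ?_⟩, fun ρ hρ => ?_⟩
  · ext g; exact hπ.bracket_comp_tgt f₁ f₂ g
  -- Uniqueness holds because the target is onto.
  · obtain ⟨h, hρ⟩ := hρ
    ext f₁ f₂ m
    have h1 := DFunLike.congr_fun (hρ f₁ f₂) (𝒢.one m)
    have h2 : ρ.bracket f₁ f₂ (𝒢.tgt (𝒢.one m)) = ρ.bracket f₁ f₂ m := by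
      rw [𝒢.isLieGroupoid.tgt_one]
    exact h2.symm.trans h1.symm

end Base

end LieGroupoid

end AnchorMorphism

/-! ### The submanifold of identities -/

section Identities

variable {E : Type*} [NormedAddCommGroup E] [NormedSpace ℝ E] [FiniteDimensional ℝ E]
  {G : Type*} [TopologicalSpace G] [ChartedSpace E G] [IsManifold 𝓘(ℝ, E) ∞ G]
  {F : Type*} [NormedAddCommGroup F] [NormedSpace ℝ F] [FiniteDimensional ℝ F]
  {P : Type*} [TopologicalSpace P] [ChartedSpace F P] [IsManifold 𝓘(ℝ, F) ∞ P]

namespace LieGroupoid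

variable (𝒢 : LieGroupoid 𝓘(ℝ, E) G 𝓘(ℝ, F) P)

theorem mem_range_one_iff {g : G} : g ∈ range 𝒢.one ↔ 𝒢.one (𝒢.src g) = g := by
  refine ⟨?_, fun h => ⟨_, h⟩⟩
  rintro ⟨m, rfl⟩
  rw [𝒢.isLieGroupoid.src_one]

theorem isClosed_range_one [T2Space G] : IsClosed (range 𝒢.one) := by
  have h : range 𝒢.one = {g | 𝒢.one (𝒢.src g) = g} := ext fun _ => 𝒢.mem_range_one_iff
  rw [h]
  exact isClosed_eq (𝒢.isLieGroupoid.contMDiff_one.continuous.comp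
    𝒢.isLieGroupoid.contMDiff_src.continuous) continuous_id

/-- A projection `E → ℝ^r` which on `T_{1_m} G`, identified with `E` by the chart at `1_m`, is the
projection onto `A_m G`. -/
def algChartProj (m : P) : E →L[ℝ] AlgModel E F :=
  let L : E →ₗ[ℝ] AlgModel E F := (𝒢.fiberEquiv m).toLinearMap ∘ₗ (𝒢.algProj m).toLinearMap
  L.toContinuousLinearMap

/-- A function near `1_m` with values in `ℝ^r` whose zero set is that of the identities: the
difference in a chart of `g` and `1_{αg}`, projected along `T(1)(T_m P)`. -/
def oneDefect (m : P) (g : G) : AlgModel E F :=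
  𝒢.algChartProj m (extChartAt 𝓘(ℝ, E) (𝒢.one m) g -
    extChartAt 𝓘(ℝ, E) (𝒢.one m) (𝒢.one (𝒢.src g)))

/-- The domain of `oneDefect`. -/
def oneDefectDomain (m : P) : Set G :=
  (chartAt E (𝒢.one m)).source ∩ (fun g => 𝒢.one (𝒢.src g)) ⁻¹' (chartAt E (𝒢.one m)).source

theorem contMDiff_one_src : ContMDiff 𝓘(ℝ, E) 𝓘(ℝ, E) ∞ (fun g => 𝒢.one (𝒢.src g)) :=
  𝒢.isLieGroupoid.contMDiff_one.comp 𝒢.isLieGroupoid.contMDiff_src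

theorem isOpen_oneDefectDomain (m : P) : IsOpen (𝒢.oneDefectDomain m) :=
  (chartAt E (𝒢.one m)).open_source.inter
    ((chartAt E (𝒢.one m)).open_source.preimage 𝒢.contMDiff_one_src.continuous)

theorem one_mem_oneDefectDomain (m : P) : 𝒢.one m ∈ 𝒢.oneDefectDomain m := by
  refine ⟨mem_chart_source E _, ?_⟩
  change 𝒢.one (𝒢.src (𝒢.one m)) ∈ (chartAt E (𝒢.one m)).source
  rw [𝒢.isLieGroupoid.src_one]
  exact mem_chart_source E _

theorem contMDiffOn_oneDefect (m : P) :
    ContMDiffOn 𝓘(ℝ, E) 𝓘(ℝ, AlgModel E F) ∞ (𝒢.oneDefect m) (𝒢.oneDefectDomain m) := by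
  have h1 : ContMDiffOn 𝓘(ℝ, E) 𝓘(ℝ, E) ∞ (fun g => extChartAt 𝓘(ℝ, E) (𝒢.one m) g -
      extChartAt 𝓘(ℝ, E) (𝒢.one m) (𝒢.one (𝒢.src g))) (𝒢.oneDefectDomain m) := by
    have h2 : ContMDiffOn 𝓘(ℝ, E) 𝓘(ℝ, E) ∞ (extChartAt 𝓘(ℝ, E) (𝒢.one m))
      (chartAt E (𝒢.one m)).source := contMDiffOn_extChartAt
    exact (h2.mono inter_subset_left).sub
      (h2.comp (𝒢.contMDiff_one_src.contMDiffOn) inter_subset_right)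
  exact (𝒢.algChartProj m).contDiff.contMDiff.comp_contMDiffOn h1

theorem mfderiv_oneDefect (m : P) (v : TangentSpace 𝓘(ℝ, E) (𝒢.one m)) :
    (mfderiv 𝓘(ℝ, E) 𝓘(ℝ, AlgModel E F) (𝒢.oneDefect m) (𝒢.one m) v : AlgModel E F) =
      𝒢.fiberEquiv m (𝒢.algProj m v) := by
  have h1 : HasMFDerivAt 𝓘(ℝ, E) 𝓘(ℝ, E) (extChartAt 𝓘(ℝ, E) (𝒢.one m)) (𝒢.one m)
      (ContinuousLinearMap.id ℝ E) := by
    have h := (mdifferentiableAt_extChartAt (I := 𝓘(ℝ, E)) (mem_chart_source E (𝒢.one m))).hasMFDerivAt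
    rwa [mfderiv_extChartAt_self] at h
  have h2 : HasMFDerivAt 𝓘(ℝ, E) 𝓘(ℝ, E) (extChartAt 𝓘(ℝ, E) (𝒢.one m)) (𝒢.one (𝒢.src (𝒢.one m)))
      (ContinuousLinearMap.id ℝ E) := by
    rw [𝒢.isLieGroupoid.src_one]; exact h1
  have h3 := h2.comp (𝒢.one m) (𝒢.contMDiff_one_src.mdifferentiableAt
    (x := 𝒢.one m) (by simp)).hasMFDerivAt
  have h4 : HasMFDerivAt 𝓘(ℝ, E) 𝓘(ℝ, AlgModel E F) (𝒢.algChartProj m)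
      (extChartAt 𝓘(ℝ, E) (𝒢.one m) (𝒢.one m) -
        extChartAt 𝓘(ℝ, E) (𝒢.one m) (𝒢.one (𝒢.src (𝒢.one m)))) (𝒢.algChartProj m) :=
    (𝒢.algChartProj m).hasFDerivAt.hasMFDerivAt
  have h5 := h4.comp (𝒢.one m) (h1.sub h3)
  refine (DFunLike.congr_fun h5.mfderiv v).trans ?_
  have h6 : (mfderiv 𝓘(ℝ, E) 𝓘(ℝ, E) (fun g => 𝒢.one (𝒢.src g)) (𝒢.one m) v : E) =
    𝒢.oneSrc m v := 𝒢.mfderiv_one_src m v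
  refine (congrArg (fun w : E => 𝒢.algChartProj m ((show E from v) - w)) h6).trans ?_
  exact congrArg (𝒢.fiberEquiv m) (𝒢.algProj_incl m (𝒢.algProj m v))

/-- Near `1_m` the identities are the zero set of `oneDefect`: the map `g ↦ (αg, oneDefect g)` is
injective near `1_m`, and `oneDefect` vanishes at `1_{αg}`. -/
theorem exists_range_one_eq_zeroSet (m : P) : ∃ U : Set G, IsOpen U ∧ 𝒢.one m ∈ U ∧
    U ⊆ 𝒢.oneDefectDomain m ∧ range 𝒢.one ∩ U = {g ∈ U | 𝒢.oneDefect m g = 0} := by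
  have hG := 𝒢.isLieGroupoid
  have hs : ContMDiffOn 𝓘(ℝ, E) (𝓘(ℝ, F).prod 𝓘(ℝ, AlgModel E F)) ∞
      (fun g => (𝒢.src g, 𝒢.oneDefect m g)) (𝒢.oneDefectDomain m) :=
    hG.contMDiff_src.contMDiffOn.prodMk (𝒢.contMDiffOn_oneDefect m)
  have hd := ((𝒢.contMDiffOn_oneDefect m).contMDiffAt ((𝒢.isOpen_oneDefectDomain m).mem_nhds
    (𝒢.one_mem_oneDefectDomain m))).mdifferentiableAt (by simp)
  have hbij : Function.Bijective (mfderiv 𝓘(ℝ, E) (𝓘(ℝ, F).prod 𝓘(ℝ, AlgModel E F))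
      (fun g => (𝒢.src g, 𝒢.oneDefect m g)) (𝒢.one m)) := by
    have h1 := ((𝒢.contMDiffAt_src (𝒢.one m)).mdifferentiableAt
      (by simp)).hasMFDerivAt.prodMk hd.hasMFDerivAt
    rw [h1.mfderiv]
    have h2 : ∀ v, (mfderiv 𝓘(ℝ, E) 𝓘(ℝ, F) 𝒢.src (𝒢.one m)).prod
        (mfderiv 𝓘(ℝ, E) 𝓘(ℝ, AlgModel E F) (𝒢.oneDefect m) (𝒢.one m)) v =
        (mfderiv 𝓘(ℝ, E) 𝓘(ℝ, F) 𝒢.src (𝒢.one m) v, 𝒢.fiberEquiv m (𝒢.algProj m v)) := fun v =>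
      Prod.ext rfl (𝒢.mfderiv_oneDefect m v)
    constructor
    · refine (injective_iff_map_eq_zero _).2 fun v hv => ?_
      have hv' := (h2 v).symm.trans hv
      have hv1 : mfderiv 𝓘(ℝ, E) 𝓘(ℝ, F) 𝒢.src (𝒢.one m) v = 0 := congrArg Prod.fst hv'
      have hv2 : 𝒢.fiberEquiv m (𝒢.algProj m v) = 0 := congrArg Prod.snd hv'
      rw [LinearEquiv.map_eq_zero_iff] at hv2
      have h3 := 𝒢.algProj_incl m ⟨v, hv1⟩
      have h4 : 𝒢.algProj m v = ⟨v, hv1⟩ := h3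
      rw [hv2] at h4
      exact (congrArg (𝒢.incl m) h4).symm.trans (map_zero _)
    · rintro ⟨x, w⟩
      let x' : TangentSpace 𝓘(ℝ, F) m := (show F from x)
      let v := mfderiv 𝓘(ℝ, F) 𝓘(ℝ, E) 𝒢.one m x' + 𝒢.incl m ((𝒢.fiberEquiv m).symm w)
      refine ⟨v, (h2 v).trans (Prod.ext ?_ ?_)⟩
      · have h5 := tangent_snd_eq (𝒢.tan_src_one ⟨m, x'⟩)
        have h6 : mfderiv 𝓘(ℝ, E) 𝓘(ℝ, F) 𝒢.src (𝒢.one m)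
          (𝒢.incl m ((𝒢.fiberEquiv m).symm w)) = 0 := ((𝒢.fiberEquiv m).symm w).2
        refine (map_add (mfderiv 𝓘(ℝ, E) 𝓘(ℝ, F) 𝒢.src (𝒢.one m)) _ _).trans ?_
        rw [h6, add_zero]
        exact h5
      · change 𝒢.fiberEquiv m (𝒢.algProj m v) = w
        rw [map_add, algProj_one, algProj_incl, zero_add, LinearEquiv.apply_symm_apply]
  obtain ⟨V, k, hV, hV₀, hk, -, -, W, hW, hW₀, hWU, hWk⟩ := exists_local_inverse
    (𝒢.isOpen_oneDefectDomain m) hs (𝒢.one_mem_oneDefectDomain m) hbij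
  have hzero : ∀ n, 𝒢.oneDefect m (𝒢.one n) = 0 := fun n => by
    change 𝒢.algChartProj m (_ - extChartAt 𝓘(ℝ, E) (𝒢.one m) (𝒢.one (𝒢.src (𝒢.one n)))) = 0
    rw [hG.src_one, sub_self, map_zero]
  refine ⟨W ∩ (fun g => 𝒢.one (𝒢.src g)) ⁻¹' W,
    hW.inter (hW.preimage 𝒢.contMDiff_one_src.continuous), ⟨hW₀, ?_⟩,
    inter_subset_left.trans hWU, ?_⟩
  · change 𝒢.one (𝒢.src (𝒢.one m)) ∈ W
    rw [hG.src_one]; exact hW₀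
  · ext g
    constructor
    · rintro ⟨⟨n, rfl⟩, hn⟩
      exact ⟨hn, hzero n⟩
    · rintro ⟨hgU, hg⟩
      refine ⟨𝒢.mem_range_one_iff.2 ?_, hgU⟩
      have h1 := (hWk g hgU.1).2
      have h2 := (hWk (𝒢.one (𝒢.src g)) hgU.2).2
      rw [← h2, hzero, hG.src_one, ← hg, h1]

theorem isClosedSubmanifold_range_one [T2Space G] :
    IsClosedSubmanifold 𝓘(ℝ, E) (range 𝒢.one) := by
  refine ⟨𝒢.isClosed_range_one, ?_⟩
  rintro _ ⟨m, rfl⟩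
  obtain ⟨U, hU, hmU, hUD, hUz⟩ := 𝒢.exists_range_one_eq_zeroSet m
  refine ⟨_, U, 𝒢.oneDefect m, hU, hmU, (𝒢.contMDiffOn_oneDefect m).mono hUD, fun w => ?_, hUz⟩
  refine ⟨𝒢.incl m ((𝒢.fiberEquiv m).symm w), (𝒢.mfderiv_oneDefect m _).trans ?_⟩
  rw [algProj_incl, LinearEquiv.apply_symm_apply]

theorem tan_one_mem_tangentSet (x : TangentBundle 𝓘(ℝ, F) P) :
    𝒢.tan.one x ∈ tangentSet 𝓘(ℝ, E) (range 𝒢.one) := by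
  obtain ⟨m, hm, rfl⟩ := exists_velocity_eq x
  exact ⟨fun t => 𝒢.one (m t), 𝒢.contMDiffAt_one_comp hm, Eventually.of_forall fun t => ⟨_, rfl⟩,
    (𝒢.velocity_one hm).symm⟩

/-- A covector at `1_m` vanishing on the vectors tangent to the identities is conormal. -/
theorem eq_cotangent_one {Φ : CotangentBundle 𝓘(ℝ, E) G} {m : P} (hb : Φ.1 = 𝒢.one m)
    (h : ∀ x : TangentBundle 𝓘(ℝ, F) P, x.1 = m → pair Φ (𝒢.tan.one x) = 0) :
    ∃ φ : 𝒢.DualAlg, φ.1 = m ∧ Φ = 𝒢.cotangent.one φ := by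
  obtain ⟨g, Φ⟩ := Φ
  obtain rfl : g = 𝒢.one m := hb
  refine ⟨⟨m, Φ ∘L 𝒢.incl m⟩, rfl, cotangent_ext rfl fun V hV => ?_⟩
  obtain ⟨W, hW, hVW⟩ := 𝒢.exists_isAlg_add (ζ := V) (m := m) hV
  have hV' : V.1 = 𝒢.one m := hV
  have hbase : (𝒢.tan.src V).1 = m := by
    change 𝒢.src V.1 = m
    rw [hV', 𝒢.isLieGroupoid.src_one]
  rw [pair_of_add _ hVW, pair_of_add _ hVW, h _ hbase, 𝒢.pair_one_one hbase]
  obtain ⟨X, rfl⟩ := IsAlg.exists_incl 𝒢 hW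
  rw [𝒢.pair_one_incl ⟨m, _⟩ X]
  rfl

theorem IsPoissonGroupoid.isCoisotropic_range_one {𝒢 : LieGroupoid 𝓘(ℝ, E) G 𝓘(ℝ, F) P}
    {π : PoissonStructure 𝓘(ℝ, E) G} [T2Space G] [SigmaCompactSpace G]
    (hπ : 𝒢.IsPoissonGroupoid π) : IsCoisotropic 𝓘(ℝ, E) π.sharp (range 𝒢.one) := by
  refine ⟨𝒢.isClosedSubmanifold_range_one, fun Φ hΦ => ?_⟩
  obtain ⟨⟨m, hm⟩, hΦ⟩ := hΦ
  obtain ⟨φ, -, rfl⟩ := 𝒢.eq_cotangent_one hm.symm (fun x hx => by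
    have hb : (𝒢.tan.one x).1 = Φ.1 := (congrArg 𝒢.one hx).trans hm
    have h1 : (⟨Φ.1, (show E from (𝒢.tan.one x).2)⟩ : TangentBundle 𝓘(ℝ, E) G) = 𝒢.tan.one x :=
      tangent_ext hb.symm rfl
    have h2 := 𝒢.tan_one_mem_tangentSet x
    rw [← h1] at h2
    exact hΦ _ h2)
  change π.anchor (𝒢.cotangent.one φ) ∈ _
  rw [hπ.anchor_one]
  exact 𝒢.tan_one_mem_tangentSet _

end LieGroupoid

end Identities

/-! ### Vector fields related along the identities -/

section Related

variable {E : Type*} [NormedAddCommGroup E] [NormedSpace ℝ E] [FiniteDimensional ℝ E]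
  {G : Type*} [TopologicalSpace G] [ChartedSpace E G] [IsManifold 𝓘(ℝ, E) ∞ G]
  [T2Space G] [SigmaCompactSpace G]
  {F : Type*} [NormedAddCommGroup F] [NormedSpace ℝ F] [FiniteDimensional ℝ F]
  {P : Type*} [TopologicalSpace P] [ChartedSpace F P] [IsManifold 𝓘(ℝ, F) ∞ P]

namespace LieGroupoid

variable (𝒢 : LieGroupoid 𝓘(ℝ, E) G 𝓘(ℝ, F) P)

/-- A smooth section of a vector bundle along the identities extends to `G`. Near `1_m` it extends
by being constant, in a trivialization, along the fibres of the source. -/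
theorem exists_section_extending {K : Type*} [NormedAddCommGroup K] [NormedSpace ℝ K]
    (V : G → Type*) [TopologicalSpace (TotalSpace K V)] [∀ x, TopologicalSpace (V x)]
    [∀ x, AddCommGroup (V x)] [∀ x, Module ℝ (V x)] [FiberBundle K V] [VectorBundle ℝ K V]
    [ContMDiffVectorBundle ∞ K V 𝓘(ℝ, E)] {σ : ∀ m, V (𝒢.one m)}
    (hσ : ContMDiff 𝓘(ℝ, F) (𝓘(ℝ, E).prod 𝓘(ℝ, K)) ∞
      fun m => (⟨𝒢.one m, σ m⟩ : TotalSpace K V)) :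
    ∃ s : Cₛ^∞⟮𝓘(ℝ, E); K, V⟯, ∀ m, s (𝒢.one m) = σ m := by
  have hG := 𝒢.isLieGroupoid
  obtain ⟨s, hs⟩ := exists_contMDiffSection_forall_mem_convex_of_local (I := 𝓘(ℝ, E)) (n := (⊤ : ℕ∞))
    (F_fiber := K) V
    (fun g => {v | ∀ m, 𝒢.one m = g → (⟨g, v⟩ : TotalSpace K V) = ⟨𝒢.one m, σ m⟩})
    (fun g => by
      by_cases hg : g ∈ range 𝒢.one
      · obtain ⟨m, rfl⟩ := hg
        refine Set.Subsingleton.convex fun v hv w hw => ?_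
        exact eq_of_heq (TotalSpace.mk.inj ((hv m rfl).trans (hw m rfl).symm)).2
      · have h : {v : V g | ∀ m, 𝒢.one m = g → (⟨g, v⟩ : TotalSpace K V) = ⟨𝒢.one m, σ m⟩} =
            univ := eq_univ_of_forall fun v m hm => absurd ⟨m, hm⟩ hg
        rw [h]
        exact convex_univ) (fun g => by
      by_cases hg : g ∈ range 𝒢.one
      · obtain ⟨m, rfl⟩ := hg
        let e := trivializationAt K V (𝒢.one m)
        let c : P → K := fun n => (e ⟨𝒢.one n, σ n⟩).2
        have hm : 𝒢.one m ∈ e.baseSet := FiberBundle.mem_baseSet_trivializationAt' _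
        have hU : IsOpen (e.baseSet ∩ (fun g => 𝒢.one (𝒢.src g)) ⁻¹' e.baseSet) :=
          e.open_baseSet.inter (e.open_baseSet.preimage 𝒢.contMDiff_one_src.continuous)
        refine ⟨_, hU.mem_nhds ⟨hm, ?_⟩, fun g => e.symmL ℝ g (c (𝒢.src g)), ?_, ?_⟩
        · change 𝒢.one (𝒢.src (𝒢.one m)) ∈ e.baseSet
          rwa [hG.src_one]
        · have h1 : ContMDiffOn 𝓘(ℝ, E) (𝓘(ℝ, E).prod 𝓘(ℝ, K)) ∞
              (fun g => e ⟨𝒢.one (𝒢.src g), σ (𝒢.src g)⟩)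
              (e.baseSet ∩ (fun g => 𝒢.one (𝒢.src g)) ⁻¹' e.baseSet) :=
            (e.contMDiffOn (IB := 𝓘(ℝ, E)) (n := ∞)).comp (hσ.comp hG.contMDiff_src).contMDiffOn
              fun g hg => e.mem_source.2 hg.2
          have h2 : ContMDiffOn 𝓘(ℝ, E) (𝓘(ℝ, E).prod 𝓘(ℝ, K)) ∞ (fun g => (g, c (𝒢.src g)))
              (e.baseSet ∩ (fun g => 𝒢.one (𝒢.src g)) ⁻¹' e.baseSet) :=
            contMDiffOn_id.prodMk (contMDiff_snd.comp_contMDiffOn h1)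
          refine ((e.contMDiffOn_symm (IB := 𝓘(ℝ, E)) (n := ∞)).comp h2
            fun g hg => e.mem_target.2 hg.1).congr fun g hg => ?_
          refine (congrArg (TotalSpace.mk g) (e.symmL_apply hg.1 _)).trans ?_
          exact e.mk_symm hg.1 _
        · rintro _ hg n rfl
          have h : c (𝒢.src (𝒢.one n)) = e.continuousLinearMapAt ℝ (𝒢.one n) (σ n) := by
            rw [hG.src_one, e.continuousLinearMapAt_apply (R := ℝ), e.coe_linearMapAt_of_mem (R := ℝ) hg.1]
          exact congrArg (TotalSpace.mk (𝒢.one n)) ((congrArg (e.symmL ℝ (𝒢.one n)) h).trans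
            (e.symmL_continuousLinearMapAt hg.1 (σ n)))
      · exact ⟨(range 𝒢.one)ᶜ, 𝒢.isClosed_range_one.isOpen_compl.mem_nhds hg, fun _ => 0,
          (Bundle.contMDiff_zeroSection ℝ V).contMDiffOn, fun z hz m hm => absurd ⟨m, hm⟩ hz⟩)
  exact ⟨s, fun m => eq_of_heq (TotalSpace.mk.inj (hs (𝒢.one m) m rfl)).2⟩

/-- The vector fields `x` on `P` and `X` on `G` are related by `1 : P → G`; in particular `X` is
tangent to the identities. -/
def OneRelated (x : VectorFields 𝓘(ℝ, F) P) (X : VectorFields 𝓘(ℝ, E) G) : Prop :=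
  ∀ m, X (𝒢.one m) = mfderiv 𝓘(ℝ, F) 𝓘(ℝ, E) 𝒢.one m (x m)

theorem exists_oneRelated (x : VectorFields 𝓘(ℝ, F) P) :
    ∃ X : VectorFields 𝓘(ℝ, E) G, 𝒢.OneRelated x X :=
  𝒢.exists_section_extending (fun g : G => TangentSpace 𝓘(ℝ, E) g)
    (σ := fun m => mfderiv 𝓘(ℝ, F) 𝓘(ℝ, E) 𝒢.one m (x m))
    (𝒢.contMDiff_tan_one.comp x.contMDiff)

variable {𝒢}

theorem OneRelated.fieldDeriv_comp {x : VectorFields 𝓘(ℝ, F) P} {X : VectorFields 𝓘(ℝ, E) G}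
    (h : 𝒢.OneRelated x X) (f : C^∞⟮𝓘(ℝ, E), G; 𝓘(ℝ), ℝ⟯) :
    (fieldDeriv X f).comp 𝒢.oneMapBundled = fieldDeriv x (f.comp 𝒢.oneMapBundled) := by
  ext m
  have h1 := mfderiv_comp_apply (I := 𝓘(ℝ, F)) (I' := 𝓘(ℝ, E)) (I'' := 𝓘(ℝ)) m
    (f.contMDiff.mdifferentiableAt (x := 𝒢.one m) (by simp))
    (𝒢.isLieGroupoid.contMDiff_one.mdifferentiableAt (x := m) (by simp)) (x m)
  exact (congrArg (mvfderiv 𝓘(ℝ, E) f (𝒢.one m)) (h m)).trans h1.symm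

/-- A vector field tangent to the identities kills, along them, the functions that vanish on them.
-/
theorem OneRelated.fieldDeriv_eq_zero {x : VectorFields 𝓘(ℝ, F) P} {X : VectorFields 𝓘(ℝ, E) G}
    (h : 𝒢.OneRelated x X) {f : C^∞⟮𝓘(ℝ, E), G; 𝓘(ℝ), ℝ⟯} (hf : f.comp 𝒢.oneMapBundled = 0)
    (m : P) : fieldDeriv X f (𝒢.one m) = 0 := by
  have h1 := DFunLike.congr_fun (h.fieldDeriv_comp f) m
  rw [hf] at h1
  refine h1.trans ?_
  exact DFunLike.congr_fun (hasMFDerivAt_const (I := 𝓘(ℝ, F)) (I' := 𝓘(ℝ)) (0 : ℝ) m).mfderiv (x m)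

/-- The bracket of fields tangent to the identities is tangent to them. -/
theorem OneRelated.fieldBracket {x y : VectorFields 𝓘(ℝ, F) P} {X Y : VectorFields 𝓘(ℝ, E) G}
    (hX : 𝒢.OneRelated x X) (hY : 𝒢.OneRelated y Y) [T2Space P] [SigmaCompactSpace P] :
    𝒢.OneRelated (fieldBracket x y) (fieldBracket X Y) := fun m =>
  tangent_eq_of_forall_mvfderiv fun f => by
    have h1 : ∀ (z : VectorFields 𝓘(ℝ, F) P), mvfderiv 𝓘(ℝ, E) f (𝒢.one m)
        (mfderiv 𝓘(ℝ, F) 𝓘(ℝ, E) 𝒢.one m (z m)) = fieldDeriv z (f.comp 𝒢.oneMapBundled) m :=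
      fun z => (mfderiv_comp_apply (I := 𝓘(ℝ, F)) (I' := 𝓘(ℝ, E)) (I'' := 𝓘(ℝ)) m
        (f.contMDiff.mdifferentiableAt (x := 𝒢.one m) (by simp))
        (𝒢.isLieGroupoid.contMDiff_one.mdifferentiableAt (x := m) (by simp)) (z m)).symm
    have h2 := DFunLike.congr_fun (fieldDeriv_fieldBracket X Y f) (𝒢.one m)
    have h3 := DFunLike.congr_fun (fieldDeriv_fieldBracket x y (f.comp 𝒢.oneMapBundled)) m
    have h4 := DFunLike.congr_fun (hX.fieldDeriv_comp (fieldDeriv Y f)) m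
    have h5 := DFunLike.congr_fun (hY.fieldDeriv_comp (fieldDeriv X f)) m
    rw [hY.fieldDeriv_comp] at h4
    rw [hX.fieldDeriv_comp] at h5
    refine (h2.trans ?_).trans (h1 _).symm
    refine Eq.trans ?_ h3.symm
    exact congrArg₂ (· - ·) h4 h5

end LieGroupoid

end Related

/-! ### Conormal 1-forms and their brackets -/

section DualAlgebroid

variable {E : Type*} [NormedAddCommGroup E] [NormedSpace ℝ E] [FiniteDimensional ℝ E]
  {G : Type*} [TopologicalSpace G] [ChartedSpace E G] [IsManifold 𝓘(ℝ, E) ∞ G]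
  [T2Space G] [SigmaCompactSpace G]
  {F : Type*} [NormedAddCommGroup F] [NormedSpace ℝ F] [FiniteDimensional ℝ F]
  {P : Type*} [TopologicalSpace P] [ChartedSpace F P] [IsManifold 𝓘(ℝ, F) ∞ P]

namespace LieGroupoid

section Anchor

variable (𝒢 : LieGroupoid 𝓘(ℝ, E) G 𝓘(ℝ, F) P) (π : PoissonStructure 𝓘(ℝ, E) G)

/-- The map `a_* : A^*_m G → T_m P` as a linear map; `tcast` moves the result from the tangent space
at `β(1_m)` to that at `m`. -/
def dualAnchorL (m : P) : 𝒢.DualAlgFiber m →L[ℝ] TangentSpace 𝓘(ℝ, F) m :=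
  tcast (𝒢.isLieGroupoid.tgt_one m) ∘L mfderiv 𝓘(ℝ, E) 𝓘(ℝ, F) 𝒢.tgt (𝒢.one m) ∘L
    π.sharpL (𝒢.one m) ∘L ContinuousLinearMap.precomp ℝ (𝒢.algProj m)

theorem mk_dualAnchorL (φ : 𝒢.DualAlg) :
    (⟨φ.1, 𝒢.dualAnchorL π φ.1 φ.2⟩ : TangentBundle 𝓘(ℝ, F) P) = 𝒢.dualAnchor π φ :=
  tangent_ext (𝒢.isLieGroupoid.tgt_one φ.1).symm (tcast_eq (𝒢.isLieGroupoid.tgt_one φ.1) _)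

/-- The vector field `a_*φ` on `P`. -/
def dualAnchorField (φ : 𝒢.DualAlgSections) : VectorFields 𝓘(ℝ, F) P :=
  ⟨fun m => 𝒢.dualAnchorL π m (φ m),
    ((contMDiff_dualAnchor (π := π)).comp φ.contMDiff).congr fun m =>
      𝒢.mk_dualAnchorL π ⟨m, φ m⟩⟩

/-- The 1-form `Φ` is conormal to the identities, with values `Φ(1_m) = \tilde 1_{φ(m)}`. -/
def IsConormal (Φ : OneForms 𝓘(ℝ, E) G) (φ : 𝒢.DualAlgSections) : Prop :=
  ∀ m, Φ (𝒢.one m) = 𝒢.conormal m (φ m)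

theorem exists_isConormal (φ : 𝒢.DualAlgSections) :
    ∃ Φ : OneForms 𝓘(ℝ, E) G, 𝒢.IsConormal Φ φ :=
  𝒢.exists_section_extending (fun g : G => CotangentSpace 𝓘(ℝ, E) g)
    (σ := fun m => 𝒢.conormal m (φ m)) (𝒢.contMDiff_cotangent_one.comp φ.contMDiff)

theorem conormal_incl (m : P) (φ : 𝒢.DualAlgFiber m) : 𝒢.conormal m φ ∘L 𝒢.incl m = φ :=
  ContinuousLinearMap.ext fun X => congrArg φ (𝒢.algProj_incl m X)

theorem conormal_one (m : P) (φ : 𝒢.DualAlgFiber m) (x : TangentSpace 𝓘(ℝ, F) m) :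
    𝒢.conormal m φ (mfderiv 𝓘(ℝ, F) 𝓘(ℝ, E) 𝒢.one m x) = 0 :=
  (congrArg φ (𝒢.algProj_one m x)).trans (map_zero φ)

/-- A covector at `1_m` which vanishes on the vectors tangent to the identities is conormal. -/
theorem eq_conormal {m : P} {θ : CotangentSpace 𝓘(ℝ, E) (𝒢.one m)}
    (h : ∀ x, θ (mfderiv 𝓘(ℝ, F) 𝓘(ℝ, E) 𝒢.one m x) = 0) :
    θ = 𝒢.conormal m (θ ∘L 𝒢.incl m) :=
  ContinuousLinearMap.ext fun v => by
    change θ v = θ (𝒢.incl m (𝒢.algProj m v))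
    rw [incl_algProj, map_sub]
    exact ((congrArg (fun c => θ v - c) (h _)).trans (sub_zero _)).symm

/-- The restriction to `AG` of the values of a 1-form at the identities. -/
def restrictForm [T2Space P] [SigmaCompactSpace P] (Θ : OneForms 𝓘(ℝ, E) G) : 𝒢.DualAlgSections :=
  ⟨fun m => Θ (𝒢.one m) ∘L 𝒢.incl m, contMDiff_dual_section fun X m => by
    have h := 𝒢.contMDiffWithinAt_incl (X.contMDiff.contMDiffAt (x := m))
    exact contMDiffWithinAt_pair (F := fun m => (⟨𝒢.one m, Θ (𝒢.one m)⟩ : CotangentBundle 𝓘(ℝ, E) G))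
      ((Θ.contMDiff.comp 𝒢.isLieGroupoid.contMDiff_one) m) h fun _ => rfl⟩

variable [T2Space P] [SigmaCompactSpace P]

variable {𝒢} in
theorem IsConormal.restrictForm_eq {Φ : OneForms 𝓘(ℝ, E) G} {φ : 𝒢.DualAlgSections}
    (h : 𝒢.IsConormal Φ φ) : 𝒢.restrictForm Φ = φ := by
  ext1 m
  exact (congrArg (fun θ : CotangentSpace 𝓘(ℝ, E) (𝒢.one m) => θ ∘L 𝒢.incl m) (h m)).trans
    (𝒢.conormal_incl m (φ m))

variable {𝒢} in
theorem IsConormal.formPair_comp {Φ : OneForms 𝓘(ℝ, E) G} {φ : 𝒢.DualAlgSections}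
    (h : 𝒢.IsConormal Φ φ) {x : VectorFields 𝓘(ℝ, F) P} {X : VectorFields 𝓘(ℝ, E) G}
    (hX : 𝒢.OneRelated x X) : (formPair Φ X).comp 𝒢.oneMapBundled = 0 := by
  ext m
  change Φ (𝒢.one m) (X (𝒢.one m)) = 0
  rw [h m, hX m]
  exact 𝒢.conormal_one m (φ m) (x m)

end Anchor

section Bracket

variable {𝒢 : LieGroupoid 𝓘(ℝ, E) G 𝓘(ℝ, F) P} {π : PoissonStructure 𝓘(ℝ, E) G}

/-- Since `π^#` maps conormal covectors into `T(1)(TP)`, it maps conormal 1-forms to vector fields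
tangent to the identities. -/
theorem IsPoissonGroupoid.oneRelated_sharpField (hπ : 𝒢.IsPoissonGroupoid π)
    {Φ : OneForms 𝓘(ℝ, E) G} {φ : 𝒢.DualAlgSections} (h : 𝒢.IsConormal Φ φ) :
    𝒢.OneRelated (𝒢.dualAnchorField π φ) (π.sharpField Φ) := fun m => by
  have h1 := hπ.anchor_one ⟨m, φ m⟩
  rw [← mk_dualAnchorL] at h1
  exact (congrArg (π.sharp (𝒢.one m)) (h m)).trans (tangent_snd_eq h1)

variable [T2Space P] [SigmaCompactSpace P]

/-- The bracket of conormal 1-forms is conormal: evaluated on a field `Z` tangent to the identities,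
each of the five terms of the bracket is a pairing of a conormal form with a field tangent to the
identities, or a derivative of such a pairing along a field of this kind, and so vanishes along the
identities. -/
theorem IsPoissonGroupoid.isConormal_formBracket (hπ : 𝒢.IsPoissonGroupoid π)
    {Φ Ψ : OneForms 𝓘(ℝ, E) G} {φ ψ : 𝒢.DualAlgSections} (hΦ : 𝒢.IsConormal Φ φ)
    (hΨ : 𝒢.IsConormal Ψ ψ) :
    𝒢.IsConormal (π.formBracket Φ Ψ) (𝒢.restrictForm (π.formBracket Φ Ψ)) := fun m =>
  𝒢.eq_conormal fun x => by
    obtain ⟨z, rfl⟩ := exists_section_eq (E := F) (K := F)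
      (V := fun m : P => TangentSpace 𝓘(ℝ, F) m) m x
    obtain ⟨Z, hZ⟩ := 𝒢.exists_oneRelated z
    have hX := hπ.oneRelated_sharpField hΦ
    have hY := hπ.oneRelated_sharpField hΨ
    rw [← hZ m]
    refine (DFunLike.congr_fun (π.formPair_formBracket Φ Ψ Z) (𝒢.one m)).trans ?_
    change fieldDeriv (π.sharpField Φ) (formPair Ψ Z) (𝒢.one m) -
      formPair Ψ (fieldBracket (π.sharpField Φ) Z) (𝒢.one m) -
      (fieldDeriv (π.sharpField Ψ) (formPair Φ Z) (𝒢.one m) -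
        formPair Φ (fieldBracket (π.sharpField Ψ) Z) (𝒢.one m)) -
      fieldDeriv Z (formPair Ψ (π.sharpField Φ)) (𝒢.one m) = 0
    have h1 := DFunLike.congr_fun (hΨ.formPair_comp (hX.fieldBracket hZ)) m
    have h2 := DFunLike.congr_fun (hΦ.formPair_comp (hY.fieldBracket hZ)) m
    rw [hX.fieldDeriv_eq_zero (hΨ.formPair_comp hZ), hY.fieldDeriv_eq_zero (hΦ.formPair_comp hZ),
      hZ.fieldDeriv_eq_zero (hΨ.formPair_comp hX)]
    have h1' : formPair Ψ (fieldBracket (π.sharpField Φ) Z) (𝒢.one m) = 0 := h1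
    have h2' : formPair Φ (fieldBracket (π.sharpField Ψ) Z) (𝒢.one m) = 0 := h2
    rw [h1', h2']
    norm_num

/-- The bracket along the identities of conormal 1-forms depends only on their values there: if `Φ`
vanishes along the identities, then so do `⟨Φ, Y⟩` for every field `Y`, and `π^#Φ`; as `π^#Ψ` is
tangent to the identities, `[Φ, Ψ]` vanishes along them. -/
theorem IsPoissonGroupoid.formBracket_eq_zero (hπ : 𝒢.IsPoissonGroupoid π)
    {Φ Ψ : OneForms 𝓘(ℝ, E) G} {ψ : 𝒢.DualAlgSections} (hΦ : ∀ m, Φ (𝒢.one m) = 0)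
    (hΨ : 𝒢.IsConormal Ψ ψ) (m : P) : π.formBracket Φ Ψ (𝒢.one m) = 0 := by
  ext v
  obtain ⟨Z, rfl⟩ := exists_section_eq (E := E) (K := E)
    (V := fun g : G => TangentSpace 𝓘(ℝ, E) g) (𝒢.one m) v
  have hY := hπ.oneRelated_sharpField hΨ
  have hp : ∀ X : VectorFields 𝓘(ℝ, E) G, (formPair Φ X).comp 𝒢.oneMapBundled = 0 := fun X => by
    ext n
    exact DFunLike.congr_fun (hΦ n) (X (𝒢.one n))
  have hs : π.sharpField Φ (𝒢.one m) = 0 :=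
    (congrArg (π.sharp (𝒢.one m)) (hΦ m)).trans (map_zero (π.sharpL (𝒢.one m)))
  -- `Z⟨Ψ, X⟩ - ⟨Ψ, [Z, X]⟩ = ⟨L_Z Ψ, X⟩` is tensorial in `X = π^#Φ`, so it vanishes where `X` does.
  have h1 := lieDerivOneForm_apply Z Ψ (𝒢.one m) (π.sharpField Φ)
  have h2 : (fieldDeriv Z (formPair Ψ (π.sharpField Φ)) -
      formPair Ψ (fieldBracket Z (π.sharpField Φ)) : C^∞⟮𝓘(ℝ, E), G; 𝓘(ℝ), ℝ⟯) (𝒢.one m) = 0 := by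
    rw [← h1, hs]
    exact map_zero _
  have h3 : fieldDeriv (π.sharpField Φ) (formPair Ψ Z) (𝒢.one m) = 0 :=
    (congrArg (mvfderiv 𝓘(ℝ, E) (formPair Ψ Z) (𝒢.one m)) hs).trans (map_zero _)
  have h4 := hY.fieldDeriv_eq_zero (hp Z) m
  have h5 : formPair Φ (fieldBracket (π.sharpField Ψ) Z) (𝒢.one m) = 0 :=
    DFunLike.congr_fun (hp _) m
  have h6 : formPair Ψ (fieldBracket (π.sharpField Φ) Z) (𝒢.one m) =
      -formPair Ψ (fieldBracket Z (π.sharpField Φ)) (𝒢.one m) := by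
    rw [fieldBracket_swap]
    exact map_neg (Ψ (𝒢.one m)) _
  have h7 : fieldDeriv Z (formPair Ψ (π.sharpField Φ)) (𝒢.one m) -
      formPair Ψ (fieldBracket Z (π.sharpField Φ)) (𝒢.one m) = 0 := h2
  refine (DFunLike.congr_fun (π.formPair_formBracket Φ Ψ Z) (𝒢.one m)).trans ?_
  change fieldDeriv (π.sharpField Φ) (formPair Ψ Z) (𝒢.one m) -
    formPair Ψ (fieldBracket (π.sharpField Φ) Z) (𝒢.one m) -
    (fieldDeriv (π.sharpField Ψ) (formPair Φ Z) (𝒢.one m) -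
      formPair Φ (fieldBracket (π.sharpField Ψ) Z) (𝒢.one m)) -
    fieldDeriv Z (formPair Ψ (π.sharpField Φ)) (𝒢.one m) = (0 : ℝ)
  rw [h3, h4, h5, h6]
  linear_combination -h7

end Bracket

end LieGroupoid

end DualAlgebroid

/-! ### The Lie algebroid structure on the dual bundle -/

section InducedAlgebroid

variable {E : Type*} [NormedAddCommGroup E] [NormedSpace ℝ E] [FiniteDimensional ℝ E]
  {G : Type*} [TopologicalSpace G] [ChartedSpace E G] [IsManifold 𝓘(ℝ, E) ∞ G]
  [T2Space G] [SigmaCompactSpace G]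
  {F : Type*} [NormedAddCommGroup F] [NormedSpace ℝ F] [FiniteDimensional ℝ F]
  {P : Type*} [TopologicalSpace P] [ChartedSpace F P] [IsManifold 𝓘(ℝ, F) ∞ P]
  [T2Space P] [SigmaCompactSpace P]

namespace LieGroupoid

variable {𝒢 : LieGroupoid 𝓘(ℝ, E) G 𝓘(ℝ, F) P} {π : PoissonStructure 𝓘(ℝ, E) G}

theorem OneRelated.unique {x y : VectorFields 𝓘(ℝ, F) P} {X : VectorFields 𝓘(ℝ, E) G}
    (hx : 𝒢.OneRelated x X) (hy : 𝒢.OneRelated y X) : x = y := by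
  ext1 m
  exact 𝒢.isLieGroupoid.one_immersion m ((hx m).symm.trans (hy m))

variable {Φ Φ' Ψ Ψ' : OneForms 𝓘(ℝ, E) G} {φ φ' ψ χ : 𝒢.DualAlgSections}

theorem IsConormal.unique (h : 𝒢.IsConormal Φ φ) (h' : 𝒢.IsConormal Φ φ') : φ = φ' :=
  h.restrictForm_eq.symm.trans h'.restrictForm_eq

theorem IsConormal.add (hΦ : 𝒢.IsConormal Φ φ) (hΨ : 𝒢.IsConormal Ψ ψ) :
    𝒢.IsConormal (Φ + Ψ) (φ + ψ) := fun m => congrArg₂ (· + ·) (hΦ m) (hΨ m)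

theorem IsConormal.const_smul (c : ℝ) (hΦ : 𝒢.IsConormal Φ φ) :
    𝒢.IsConormal (c • Φ) (c • φ) := fun m => congrArg (c • ·) (hΦ m)

theorem IsConormal.smul (f : C^∞⟮𝓘(ℝ, E), G; 𝓘(ℝ), ℝ⟯) (hΦ : 𝒢.IsConormal Φ φ) :
    𝒢.IsConormal (smulSection f Φ) (smulSection (f.comp 𝒢.oneMapBundled) φ) := fun m =>
  congrArg (f (𝒢.one m) • ·) (hΦ m)

/-- A conormal 1-form extending `φ`. -/
def conormalExtension (φ : 𝒢.DualAlgSections) : OneForms 𝓘(ℝ, E) G :=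
  Classical.choose (𝒢.exists_isConormal φ)

theorem isConormal_conormalExtension (φ : 𝒢.DualAlgSections) :
    𝒢.IsConormal (conormalExtension φ) φ :=
  Classical.choose_spec (𝒢.exists_isConormal φ)

variable (π) in
/-- The bracket of sections of `A^*G`: extend them to conormal 1-forms, and restrict the bracket of
these to the identities. -/
def dualBracket (φ ψ : 𝒢.DualAlgSections) : 𝒢.DualAlgSections :=
  𝒢.restrictForm (π.formBracket (conormalExtension φ) (conormalExtension ψ))

namespace IsPoissonGroupoid

/-- The bracket of sections of `A^*G` may be computed with any conormal extensions. -/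
theorem isConormal_dualBracket (hπ : 𝒢.IsPoissonGroupoid π) (hΦ : 𝒢.IsConormal Φ φ)
    (hΨ : 𝒢.IsConormal Ψ ψ) : 𝒢.IsConormal (π.formBracket Φ Ψ) (dualBracket π φ ψ) := fun m => by
  have hΦ' := isConormal_conormalExtension φ
  have hΨ' := isConormal_conormalExtension ψ
  have h0 : ∀ {Θ Θ' : OneForms 𝓘(ℝ, E) G} {θ : 𝒢.DualAlgSections}, 𝒢.IsConormal Θ θ →
      𝒢.IsConormal Θ' θ → ∀ n, (Θ - Θ') (𝒢.one n) = 0 := fun h h' n =>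
    sub_eq_zero.2 ((h n).trans (h' n).symm)
  have h1 := hπ.formBracket_eq_zero (h0 hΦ hΦ') hΨ m
  have h2 := hπ.formBracket_eq_zero (h0 hΨ hΨ') hΦ' m
  have h3 : π.formBracket Φ Ψ = π.formBracket (conormalExtension φ) (conormalExtension ψ) +
      π.formBracket (Φ - conormalExtension φ) Ψ -
      π.formBracket (Ψ - conormalExtension ψ) (conormalExtension φ) := by
    rw [π.formBracket_swap (Φ - _) Ψ, π.formBracket_swap (Ψ - _), π.formBracket_sub_right,
      π.formBracket_sub_right, π.formBracket_swap Ψ Φ, π.formBracket_swap Ψ]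
    abel
  rw [h3]
  refine Eq.trans ?_ (hπ.isConormal_formBracket hΦ' hΨ' m)
  refine (congrArg₂ (fun a b => π.formBracket (conormalExtension φ) (conormalExtension ψ) (𝒢.one m)
    + a - b) h1 h2).trans ?_
  rw [add_zero, sub_zero]

theorem dualBracket_eq (hπ : 𝒢.IsPoissonGroupoid π) (hΦ : 𝒢.IsConormal Φ φ)
    (hΨ : 𝒢.IsConormal Ψ ψ) (h : 𝒢.IsConormal (π.formBracket Φ Ψ) χ) : dualBracket π φ ψ = χ :=
  (hπ.isConormal_dualBracket hΦ hΨ).unique h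

theorem dualBracket_self (hπ : 𝒢.IsPoissonGroupoid π) (φ : 𝒢.DualAlgSections) :
    dualBracket π φ φ = 0 := by
  have h := isConormal_conormalExtension φ
  refine hπ.dualBracket_eq h h fun m => ?_
  rw [π.formBracket_self]
  rfl

theorem dualBracket_add_right (hπ : 𝒢.IsPoissonGroupoid π) (φ ψ χ : 𝒢.DualAlgSections) :
    dualBracket π φ (ψ + χ) = dualBracket π φ ψ + dualBracket π φ χ := by
  have hφ := isConormal_conormalExtension φ
  have hψ := isConormal_conormalExtension ψ
  have hχ := isConormal_conormalExtension χ
  refine hπ.dualBracket_eq hφ (hψ.add hχ) ?_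
  rw [π.formBracket_add_right]
  exact (hπ.isConormal_dualBracket hφ hψ).add (hπ.isConormal_dualBracket hφ hχ)

theorem dualBracket_add_left (hπ : 𝒢.IsPoissonGroupoid π) (φ ψ χ : 𝒢.DualAlgSections) :
    dualBracket π (φ + ψ) χ = dualBracket π φ χ + dualBracket π ψ χ := by
  have hφ := isConormal_conormalExtension φ
  have hψ := isConormal_conormalExtension ψ
  have hχ := isConormal_conormalExtension χ
  refine hπ.dualBracket_eq (hφ.add hψ) hχ ?_
  rw [π.formBracket_add_left]
  exact (hπ.isConormal_dualBracket hφ hχ).add (hπ.isConormal_dualBracket hψ hχ)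

theorem dualBracket_const_smul_right (hπ : 𝒢.IsPoissonGroupoid π) (c : ℝ)
    (φ ψ : 𝒢.DualAlgSections) : dualBracket π φ (c • ψ) = c • dualBracket π φ ψ := by
  have hφ := isConormal_conormalExtension φ
  have hψ := isConormal_conormalExtension ψ
  refine hπ.dualBracket_eq hφ (hψ.const_smul c) ?_
  rw [π.formBracket_const_smul_right]
  exact (hπ.isConormal_dualBracket hφ hψ).const_smul c

theorem dualBracket_const_smul_left (hπ : 𝒢.IsPoissonGroupoid π) (c : ℝ)
    (φ ψ : 𝒢.DualAlgSections) : dualBracket π (c • φ) ψ = c • dualBracket π φ ψ := by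
  have hφ := isConormal_conormalExtension φ
  have hψ := isConormal_conormalExtension ψ
  refine hπ.dualBracket_eq (hφ.const_smul c) hψ ?_
  rw [π.formBracket_const_smul_left]
  exact (hπ.isConormal_dualBracket hφ hψ).const_smul c

theorem dualBracket_jacobi (hπ : 𝒢.IsPoissonGroupoid π) (φ ψ χ : 𝒢.DualAlgSections) :
    dualBracket π φ (dualBracket π ψ χ) + dualBracket π ψ (dualBracket π χ φ) +
      dualBracket π χ (dualBracket π φ ψ) = 0 := by
  have hφ := isConormal_conormalExtension φ
  have hψ := isConormal_conormalExtension ψ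
  have hχ := isConormal_conormalExtension χ
  have h := ((hπ.isConormal_dualBracket hφ (hπ.isConormal_dualBracket hψ hχ)).add
    (hπ.isConormal_dualBracket hψ (hπ.isConormal_dualBracket hχ hφ))).add
    (hπ.isConormal_dualBracket hχ (hπ.isConormal_dualBracket hφ hψ))
  rw [π.formBracket_jacobi] at h
  exact h.unique fun m => rfl

/-- A function on `P` extends to `G` as its composite with the source. -/
theorem dualBracket_smul_right (hπ : 𝒢.IsPoissonGroupoid π) (φ ψ : 𝒢.DualAlgSections)
    (f : C^∞⟮𝓘(ℝ, F), P; 𝓘(ℝ), ℝ⟯) : dualBracket π φ (smulSection f ψ) =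
      smulSection f (dualBracket π φ ψ) + smulSection (fieldDeriv (𝒢.dualAnchorField π φ) f) ψ := by
  have hφ := isConormal_conormalExtension φ
  have hψ := isConormal_conormalExtension ψ
  let g : C^∞⟮𝓘(ℝ, E), G; 𝓘(ℝ), ℝ⟯ := f.comp ⟨𝒢.src, 𝒢.isLieGroupoid.contMDiff_src⟩
  have hg : g.comp 𝒢.oneMapBundled = f := by
    ext m
    exact congrArg f (𝒢.isLieGroupoid.src_one m)
  have h1 := hψ.smul g
  have h2 := ((hπ.isConormal_dualBracket hφ hψ).smul g).add
    (hψ.smul (fieldDeriv (π.sharpField (conormalExtension φ)) g))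
  rw [(hπ.oneRelated_sharpField hφ).fieldDeriv_comp, hg, ← π.formBracket_smul_right] at h2
  rw [hg] at h1
  exact hπ.dualBracket_eq hφ h1 h2

theorem dualAnchorField_dualBracket (hπ : 𝒢.IsPoissonGroupoid π) (φ ψ : 𝒢.DualAlgSections) :
    𝒢.dualAnchorField π (dualBracket π φ ψ) =
      fieldBracket (𝒢.dualAnchorField π φ) (𝒢.dualAnchorField π ψ) := by
  have hφ := isConormal_conormalExtension φ
  have hψ := isConormal_conormalExtension ψ
  have h1 := hπ.oneRelated_sharpField (hπ.isConormal_dualBracket hφ hψ)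
  rw [π.sharpField_formBracket] at h1
  exact h1.unique ((hπ.oneRelated_sharpField hφ).fieldBracket (hπ.oneRelated_sharpField hψ))

/-- The Lie algebroid structure of `A^*G`. -/
def dualAlgebroid (hπ : 𝒢.IsPoissonGroupoid π) :
    LieAlgebroid 𝓘(ℝ, F) (AlgModel E F →L[ℝ] ℝ) 𝒢.DualAlgFiber where
  bracket := LinearMap.mk₂ ℝ (dualBracket π) hπ.dualBracket_add_left hπ.dualBracket_const_smul_left
    hπ.dualBracket_add_right hπ.dualBracket_const_smul_right
  anchor := 𝒢.dualAnchorL π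
  contMDiff_anchor := (contMDiff_dualAnchor (π := π)).congr (𝒢.mk_dualAnchorL π)
  bracket_self := hπ.dualBracket_self
  jacobi := hπ.dualBracket_jacobi
  leibniz φ ψ f m := DFunLike.congr_fun (hπ.dualBracket_smul_right φ ψ f) m
  anchor_bracket φ ψ m := DFunLike.congr_fun (hπ.dualAnchorField_dualBracket φ ψ) m

/-- A Lie algebroid structure on `A^*G` is determined by its brackets, which conormal extensions
compute, and its anchor. -/
theorem existsUnique_dualAlgebroid (hπ : 𝒢.IsPoissonGroupoid π) :
    ∃! L : LieAlgebroid 𝓘(ℝ, F) (AlgModel E F →L[ℝ] ℝ) 𝒢.DualAlgFiber,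
      (∀ φ : 𝒢.DualAlg, (⟨φ.1, L.anchor φ.1 φ.2⟩ : TangentBundle 𝓘(ℝ, F) P) =
        𝒢.dualAnchor π φ) ∧
      ∀ (φ ψ : 𝒢.DualAlgSections) (Φ Ψ : OneForms 𝓘(ℝ, E) G),
        (∀ m, Φ (𝒢.one m) = 𝒢.conormal m (φ m)) → (∀ m, Ψ (𝒢.one m) = 𝒢.conormal m (ψ m)) →
        ∀ m, π.cotangentAlgebroid.bracket Φ Ψ (𝒢.one m) = 𝒢.conormal m (L.bracket φ ψ m) := by
  refine ⟨hπ.dualAlgebroid, ⟨𝒢.mk_dualAnchorL π, fun φ ψ Φ Ψ hΦ hΨ =>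
    hπ.isConormal_dualBracket hΦ hΨ⟩, fun L hL => ?_⟩
  refine LieAlgebroid.ext ?_ ?_
  · refine LinearMap.ext fun φ => LinearMap.ext fun ψ => ?_
    have hφ := isConormal_conormalExtension φ
    have hψ := isConormal_conormalExtension ψ
    exact (hπ.dualBracket_eq hφ hψ (hL.2 φ ψ _ _ hφ hψ)).symm
  · funext m
    refine ContinuousLinearMap.ext fun φ => ?_
    exact tangent_snd_eq ((hL.1 ⟨m, φ⟩).trans (𝒢.mk_dualAnchorL π ⟨m, φ⟩).symm)

end IsPoissonGroupoid

end LieGroupoid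

end InducedAlgebroid

end PoissonGeometry

end

theorem theorem4p2
    {E : Type*} [NormedAddCommGroup E] [NormedSpace ℝ E] [FiniteDimensional ℝ E]
    {G : Type*} [TopologicalSpace G] [ChartedSpace E G] [IsManifold 𝓘(ℝ, E) ∞ G]
    [T2Space G] [SigmaCompactSpace G]
    {F : Type*} [NormedAddCommGroup F] [NormedSpace ℝ F] [FiniteDimensional ℝ F]
    {P : Type*} [TopologicalSpace P] [ChartedSpace F P] [IsManifold 𝓘(ℝ, F) ∞ P]
    [T2Space P] [SigmaCompactSpace P]
    (𝒢 : LieGroupoid 𝓘(ℝ, E) G 𝓘(ℝ, F) P) (π : PoissonStructure 𝓘(ℝ, E) G)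
    (hπ : 𝒢.IsPoissonGroupoid π) :
    (∃ aStar : 𝒢.DualAlg → TangentBundle 𝓘(ℝ, F) P,
      -- the Poisson anchor is a morphism of Lie groupoids from `T^*G ⇉ A^*G` to `TG ⇉ TP`
      IsLieGroupoidMorphism (𝓘(ℝ, E).prod 𝓘(ℝ, E →L[ℝ] ℝ))
        (𝓘(ℝ, F).prod 𝓘(ℝ, LieGroupoid.AlgModel E F →L[ℝ] ℝ)) 𝓘(ℝ, E).tangent 𝓘(ℝ, F).tangent
        𝒢.cotangent (𝒢.tangent 𝓘(ℝ, E) 𝓘(ℝ, F)) π.anchor aStar ∧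
      -- the cotangent Lie algebroid of `G` induces a Lie algebroid structure on `A^*G`,
      -- with anchor `aStar`
      ∃ K : LieAlgebroid 𝓘(ℝ, E) (E →L[ℝ] ℝ) (fun g : G => CotangentSpace 𝓘(ℝ, E) g),
        (∀ (g : G) (φ : CotangentSpace 𝓘(ℝ, E) g), K.anchor g φ = π.sharp g φ) ∧
        (∀ (Φ Ψ : OneForms 𝓘(ℝ, E) G) (g : G),
          K.bracket Φ Ψ g = π.oneFormBracket (fun x => Φ x) (fun x => Ψ x) g) ∧
        ∃! L : LieAlgebroid 𝓘(ℝ, F) (LieGroupoid.AlgModel E F →L[ℝ] ℝ) 𝒢.DualAlgFiber,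
          (∀ φ : 𝒢.DualAlg, (⟨φ.1, L.anchor φ.1 φ.2⟩ : TangentBundle 𝓘(ℝ, F) P) = aStar φ) ∧
          ∀ (φ ψ : 𝒢.DualAlgSections) (Φ Ψ : OneForms 𝓘(ℝ, E) G),
            (∀ m, Φ (𝒢.one m) = 𝒢.conormal m (φ m)) →
            (∀ m, Ψ (𝒢.one m) = 𝒢.conormal m (ψ m)) →
            ∀ m, K.bracket Φ Ψ (𝒢.one m) = 𝒢.conormal m (L.bracket φ ψ m)) ∧
    -- the submanifold of identities is coisotropic
    IsCoisotropic 𝓘(ℝ, E) π.sharp (range 𝒢.one) ∧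
    -- inversion is anti-Poisson
    IsAntiPoissonMap π π 𝒢.inv ∧
    -- the induced Poisson structure on the base
    ∃! πP : PoissonStructure 𝓘(ℝ, F) P, IsPoissonMap π πP 𝒢.tgt :=
  ⟨⟨𝒢.dualAnchor π, hπ.isLieGroupoidMorphism_anchor, π.cotangentAlgebroid, fun _ _ => rfl,
    fun _ _ _ => rfl, hπ.existsUnique_dualAlgebroid⟩,
    hπ.isCoisotropic_range_one, hπ.isAntiPoissonMap_inv, hπ.existsUnique_base⟩
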